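/- Let $n\ge 2$, let $\Sigma$ be a compact smooth manifold of dimension $n-1$, and let $(M,g)=(\mathbb R\times\Sigma,\,g)$ be a standard stationary spacetime, $$g=-N^2\,dt^2+h_{ij}(dx^i+\beta^i dt)(dx^j+\beta^j dt),$$ where $h$ is a smooth Riemannian metric, $N>0$ a smooth function and $\beta$ a smooth vector field on $\Sigma$ with $|\beta|_h^2<N^2$, so that the Killing field $Z=\partial_t$ is timelike. For $m>0$ let $\mathcal N_m$ be the space of mass $m$ geodesics, i.e. the quotient of the hyperboloid bundle $\{(x,\xi)\in T^*M: g^{-1}(\xi,\xi)=-m^2\}$ by the geodesic flow (the Hamiltonian flow of $\tfrac12 g^{-1}(\xi,\xi)$). It is a symplectic manifold of dimension $2(n-1)$, with the reduced symplectic form $\omega$ and the symplectic volume form $\Omega=\omega^{n-1}/(n-1)!$. The function $p_Z(x,\xi)=\langle\xi,Z\rangle=\tau$ descends to $\mathcal N_m$. Let $\nu>0$ be a regular value of $p_Z$ on $\mathcal N_1$, put $\mathcal N_m(\nu)=\{p_Z=\nu m\}\subset\mathcal N_m$ (the level set $\tau-\nu\sigma=0$, $\sigma=m$), and let $\mu_{\mathcal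 N_m(\nu)}=\Omega/dp_Z$ be the Liouville (Leray) measure on this hypersurface. Then $$\mu_{\mathcal N_m(\nu)}(\mathcal N_m(\nu))=m^{n-2}\,\mu_{\mathcal N_1(\nu)}(\mathcal N_1(\nu)),$$ $$\mu_{\mathcal N_1(\nu)}(\mathcal N_1(\nu))=\mathrm{Vol}(S^{n-2})\int_{\{x\in\Sigma:\ \nu^2>N^2-|\beta|_h^2\}}\frac{N\nu}{(N^2-|\beta|_h^2)^{n/2}}\bigl(\nu^2-(N^2-|\beta|_h^2)\bigr)^{\frac{n-3}{2}}\,d\mathrm{Vol}_h,$$ where $\mathrm{Vol}(S^{n-2})$ is the area of the unit sphere in $\mathbb R^{n-1}$. The integral converges; in particular both measures are finite. -/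

import Mathlib

open Set MeasureTheory
open scoped Manifold ContDiff ENNReal Bundle

noncomputable section

namespace StationaryLadder

/-! ### Cotangent bundles, Hamiltonian flows and spaces of geodesics -/

section Cotangent

variable {E : Type*} [NormedAddCommGroup E] [NormedSpace ℝ E]
  {H : Type*} [TopologicalSpace H] (I : ModelWithCorners ℝ E H)
  (X : Type*) [TopologicalSpace X] [ChartedSpace H X] [IsManifold I ∞ X]

/-- The cotangent bundle `T*X`, with the topology and the smooth structure that Mathlib puts on
bundles of continuous linear maps.  A point `ζ` is a pair of a base point `ζ.proj : X` and a
covector `ζ.snd` at this point. -/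
abbrev CotangentBundle : Type _ :=
  Bundle.TotalSpace (E →L[ℝ] ℝ) (fun x : X => TangentSpace I x →L[ℝ] Bundle.Trivial X ℝ x)

variable {X}

/-- The covector part of a point of `T*X`, as a linear form on the tangent space. -/
def covector (ζ : CotangentBundle I X) : TangentSpace I ζ.proj →L[ℝ] ℝ := ζ.snd

variable {I}

/-- The model of `T*X`. -/
abbrev cotModel (I : ModelWithCorners ℝ E H) :
    ModelWithCorners ℝ (E × (E →L[ℝ] ℝ)) (ModelProd H (E →L[ℝ] ℝ)) :=
  I.prod 𝓘(ℝ, E →L[ℝ] ℝ)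

/-- The canonical symplectic form `∑ dqⁱ ∧ dpᵢ` on `E × E*`:
`ω((q, p), (q', p')) = p'(q) - p(q')`. -/
def symplecticModel (E : Type*) [NormedAddCommGroup E] [NormedSpace ℝ E] :
    (E × (E →L[ℝ] ℝ)) →L[ℝ] (E × (E →L[ℝ] ℝ)) →L[ℝ] ℝ :=
  (ContinuousLinearMap.id ℝ (E →L[ℝ] ℝ)).flip.bilinearComp
      (ContinuousLinearMap.fst ℝ E (E →L[ℝ] ℝ)) (ContinuousLinearMap.snd ℝ E (E →L[ℝ] ℝ))
    - (ContinuousLinearMap.id ℝ (E →L[ℝ] ℝ)).bilinearComp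
      (ContinuousLinearMap.snd ℝ E (E →L[ℝ] ℝ)) (ContinuousLinearMap.fst ℝ E (E →L[ℝ] ℝ))

theorem symplecticModel_apply (u v : E × (E →L[ℝ] ℝ)) :
    symplecticModel E u v = v.2 u.1 - u.2 v.1 := rfl

/-- The canonical symplectic form of `T*X` at `ζ`.  Mathlib's chart of `T*X` at `ζ` is the one by
the canonical coordinates `(q, p)` induced by the chart of `X` at the base point of `ζ`, and it is
by this chart that tangent vectors of `T*X` at `ζ` are pairs `(q̇, ṗ)` in `E × E*`. -/
def symplecticForm (ζ : CotangentBundle I X) :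
    TangentSpace (cotModel I) ζ →L[ℝ] TangentSpace (cotModel I) ζ →L[ℝ] ℝ :=
  symplecticModel E

/-- The differential of a real function on `T*X`. -/
def differential (f : CotangentBundle I X → ℝ) (ζ : CotangentBundle I X) :
    TangentSpace (cotModel I) ζ →L[ℝ] ℝ :=
  mfderiv (cotModel I) 𝓘(ℝ, ℝ) f ζ

/-- The Hamilton vector field `X_f` of `f`, determined by `ω(X_f, ·) = df`. -/
def hamiltonField (f : CotangentBundle I X → ℝ) (ζ : CotangentBundle I X) :
    TangentSpace (cotModel I) ζ :=
  (symplecticForm ζ).inverse (differential f ζ)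

/-- The norm square `g⁻¹(ξ, ξ)` of a covector `(x, ξ)` for the cometric of a pseudo-Riemannian
metric `g`: it is `ξ(ξ^♯)`, where the vector `ξ^♯` is determined by `g(ξ^♯, ·) = ξ`. -/
def cometric (g : ∀ x : X, TangentSpace I x →L[ℝ] TangentSpace I x →L[ℝ] ℝ)
    (ζ : CotangentBundle I X) : ℝ :=
  covector I ζ ((g ζ.proj).inverse (covector I ζ))

/-- The Hamiltonian `½ g⁻¹(ξ, ξ)` of the geodesic flow on `T*X`. -/
def geodesicHamiltonian (g : ∀ x : X, TangentSpace I x →L[ℝ] TangentSpace I x →L[ℝ] ℝ)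
    (ζ : CotangentBundle I X) : ℝ :=
  cometric g ζ / 2

/-- The mass `m` hyperboloid bundle `{g⁻¹(ξ, ξ) = -m²}` in `T*X`. -/
def massHyperboloid (g : ∀ x : X, TangentSpace I x →L[ℝ] TangentSpace I x →L[ℝ] ℝ) (m : ℝ) :
    Set (CotangentBundle I X) :=
  {ζ | cometric g ζ = -m ^ 2}

/-- The geodesic flow moves `ζ` to `ζ'` in some time `b - a ≥ 0`. -/
def FlowsTo (g : ∀ x : X, TangentSpace I x →L[ℝ] TangentSpace I x →L[ℝ] ℝ)
    (ζ ζ' : CotangentBundle I X) : Prop :=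
  ∃ (γ : ℝ → CotangentBundle I X) (a b : ℝ), a ≤ b ∧ γ a = ζ ∧ γ b = ζ' ∧
    IsMIntegralCurveOn (I := cotModel I) γ (hamiltonField (geodesicHamiltonian g)) (Icc a b)

/-- The space `𝒩_m` of mass `m` geodesics: the quotient of the mass `m` hyperboloid bundle by the
geodesic flow (by the equivalence relation generated by `FlowsTo`), with the quotient topology. -/
def MassiveGeodesics (g : ∀ x : X, TangentSpace I x →L[ℝ] TangentSpace I x →L[ℝ] ℝ) (m : ℝ) :
    Type _ :=
  Quot (fun ζ ζ' : massHyperboloid g m => FlowsTo g ζ.1 ζ'.1)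

instance (g : ∀ x : X, TangentSpace I x →L[ℝ] TangentSpace I x →L[ℝ] ℝ) (m : ℝ) :
    TopologicalSpace (MassiveGeodesics g m) :=
  inferInstanceAs (TopologicalSpace (Quot _))

instance (g : ∀ x : X, TangentSpace I x →L[ℝ] TangentSpace I x →L[ℝ] ℝ) (m : ℝ) :
    MeasurableSpace (MassiveGeodesics g m) :=
  borel _

/-- The geodesic through a point of the hyperboloid bundle. -/
def MassiveGeodesics.mk {g : ∀ x : X, TangentSpace I x →L[ℝ] TangentSpace I x →L[ℝ] ℝ} {m : ℝ}
    (ζ : massHyperboloid g m) : MassiveGeodesics g m :=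
  Quot.mk _ ζ

/-! ### The Liouville measure on a level set in the space of geodesics -/

/-- A function `f` on `T*X`, thought of as a function on `𝒩_m` (it is meant to be constant along
the geodesic flow), has `c` as a regular value on `𝒩_m`: at every point of the level set, `df` does
not vanish on the tangent space `ker d(½ g⁻¹)` of the hyperboloid bundle. -/
def IsRegularValueOn (g : ∀ x : X, TangentSpace I x →L[ℝ] TangentSpace I x →L[ℝ] ℝ) (m : ℝ)
    (f : CotangentBundle I X → ℝ) (c : ℝ) : Prop :=
  ∀ ζ ∈ massHyperboloid g m, f ζ = c →
    ∃ w : TangentSpace (cotModel I) ζ,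
      differential (geodesicHamiltonian g) ζ w = 0 ∧ differential f ζ w ≠ 0

/-- The level set `{f = c}` in `𝒩_m`. -/
def levelSet (g : ∀ x : X, TangentSpace I x →L[ℝ] TangentSpace I x →L[ℝ] ℝ) (m : ℝ)
    (f : CotangentBundle I X → ℝ) (c : ℝ) : Set (MassiveGeodesics g m) :=
  {z | ∃ ζ : massHyperboloid g m, MassiveGeodesics.mk ζ = z ∧ f ζ.1 = c}

/-- A smooth parametrization, injective into `𝒩_m`, of a part of `𝒩_m` by an open set of `ℝ^(k+1)`
in which the function `f` is the coordinate `y 0`; it is given by a lift to the hyperboloid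
bundle. -/
structure AdaptedPatch (g : ∀ x : X, TangentSpace I x →L[ℝ] TangentSpace I x →L[ℝ] ℝ) (m : ℝ)
    (f : CotangentBundle I X → ℝ) (k : ℕ) where
  domain : Set (Fin (k + 1) → ℝ)
  isOpen_domain : IsOpen domain
  toFun : (Fin (k + 1) → ℝ) → CotangentBundle I X
  smooth : ContMDiffOn 𝓘(ℝ, Fin (k + 1) → ℝ) (cotModel I) ∞ toFun domain
  mem_hyperboloid : ∀ y ∈ domain, toFun y ∈ massHyperboloid g m
  coordinate_zero : ∀ y ∈ domain, f (toFun y) = y 0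
  injective : Function.Injective
    (fun y : domain => MassiveGeodesics.mk ⟨toFun y.1, mem_hyperboloid y.1 y.2⟩)

namespace AdaptedPatch

variable {g : ∀ x : X, TangentSpace I x →L[ℝ] TangentSpace I x →L[ℝ] ℝ} {m : ℝ}
  {f : CotangentBundle I X → ℝ} {k : ℕ} (S : AdaptedPatch g m f k)

/-- The density in the coordinates `y` of the symplectic volume form of `𝒩_m`.  The symplectic form
of the quotient pulls back to the restriction of `ω` to the hyperboloid bundle, so its matrix in
these coordinates is `A i j = ω(∂ᵢS, ∂ⱼS)`, and the density of `ω^r / r!` (with `k + 1 = 2 r`) is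
the absolute value of the Pfaffian of `A`, which is `√(det A)`. -/
def symplecticDensity (y : Fin (k + 1) → ℝ) : ℝ :=
  √(Matrix.det (Matrix.of fun i j : Fin (k + 1) =>
    symplecticForm (S.toFun y)
      (mfderiv 𝓘(ℝ, Fin (k + 1) → ℝ) (cotModel I) S.toFun y (Pi.single i (1 : ℝ)))
      (mfderiv 𝓘(ℝ, Fin (k + 1) → ℝ) (cotModel I) S.toFun y (Pi.single j (1 : ℝ)))))

/-- The part of the level set `{f = c}` seen in the coordinates `y = (c, y')`. -/
def slice (c : ℝ) : Set (Fin k → ℝ) := {y' | (Fin.cons c y' : Fin (k + 1) → ℝ) ∈ S.domain}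

/-- The parametrization of a part of the level set `{f = c}` in `𝒩_m` by `y'`. -/
def sliceMap (c : ℝ) (y' : S.slice c) : MassiveGeodesics g m :=
  MassiveGeodesics.mk ⟨S.toFun (Fin.cons c y'.1), S.mem_hyperboloid _ y'.2⟩

/-- In the coordinates `y = (f, y')`, if the symplectic volume form `Ω` is `ρ df ∧ dy'`, then
`Ω / df` is `ρ dy'`.  This is the resulting measure on the part of the level set `{f = c}` that the
patch covers. -/
def lerayMeasure (c : ℝ) : Measure (MassiveGeodesics g m) :=
  (((volume : Measure (Fin k → ℝ)).comap (Subtype.val : S.slice c → Fin k → ℝ)).withDensity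
    (fun y' => ENNReal.ofReal (S.symplecticDensity (Fin.cons c y'.1)))).map (S.sliceMap c)

end AdaptedPatch

/-- The Liouville (Leray) measure `Ω / df` of the level set `{f = c}` in the symplectic manifold
`𝒩_m` of dimension `k + 1`, as a measure on `𝒩_m` carried by this level set.  On the part of a
regular level set that an adapted patch covers it is the measure `Ω / df` in this patch, and so it
is the least measure which is at least as large as all of these. -/
def liouvilleMeasure (g : ∀ x : X, TangentSpace I x →L[ℝ] TangentSpace I x →L[ℝ] ℝ) (m : ℝ)
    (f : CotangentBundle I X → ℝ) (k : ℕ) (c : ℝ) : Measure (MassiveGeodesics g m) :=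
  ⨆ S : AdaptedPatch g m f k, S.lerayMeasure c

end Cotangent

/-! ### Standard stationary spacetimes -/

section Stationary

variable (r : ℕ) (Sig : Type*) [TopologicalSpace Sig]
  [ChartedSpace (EuclideanSpace ℝ (Fin r)) Sig] [IsManifold (𝓡 r) ∞ Sig]

/-- The data `(h, N, β)` of a standard stationary spacetime `ℝ × Σ` over an `r`-dimensional
manifold `Σ`: a Riemannian metric `h`, a positive lapse function `N` and a shift vector field `β`,
all smooth on `Σ`, such that `∂_t` is timelike. -/
structure StationaryData where
  h : Bundle.ContMDiffRiemannianMetric (𝓡 r) ∞ (EuclideanSpace ℝ (Fin r))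
    (fun x : Sig => TangentSpace (𝓡 r) x)
  N : Sig → ℝ
  β : ∀ x : Sig, TangentSpace (𝓡 r) x
  smooth_N : ContMDiff (𝓡 r) 𝓘(ℝ, ℝ) ∞ N
  smooth_β : ContMDiff (𝓡 r) (𝓡 r).tangent ∞
    (fun x => (⟨x, β x⟩ : TangentBundle (𝓡 r) Sig))
  N_pos : ∀ x, 0 < N x
  timelike : ∀ x, h.inner x (β x) (β x) < N x ^ 2

variable {r} {Sig}

namespace StationaryData

variable (D : StationaryData r Sig)

/-- The model of the spacetime `ℝ × Σ`. -/
abbrev stModel (r : ℕ) : ModelWithCorners ℝ (ℝ × EuclideanSpace ℝ (Fin r))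
    (ModelProd ℝ (EuclideanSpace ℝ (Fin r))) :=
  𝓘(ℝ, ℝ).prod (𝓡 r)

/-- The function `N² - |β|²_h` on `Σ`, that is, `-g(Z, Z)`. -/
def normSq (x : Sig) : ℝ := D.N x ^ 2 - D.h.inner x (D.β x) (D.β x)

/-- The linear map `dx + β dt : ℝ × T_xΣ → T_xΣ`. -/
def shiftMap (x : Sig) : (ℝ × EuclideanSpace ℝ (Fin r)) →L[ℝ] EuclideanSpace ℝ (Fin r) :=
  let b : EuclideanSpace ℝ (Fin r) := D.β x
  ContinuousLinearMap.snd ℝ ℝ (EuclideanSpace ℝ (Fin r)) +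
    (ContinuousLinearMap.fst ℝ ℝ (EuclideanSpace ℝ (Fin r))).smulRight b

/-- The metric `g = -N² dt² + h(dx + β dt, dx + β dt)` on `ℝ × Σ`. -/
def metric (p : ℝ × Sig) :
    TangentSpace (stModel r) p →L[ℝ] TangentSpace (stModel r) p →L[ℝ] ℝ :=
  ((ContinuousLinearMap.mul ℝ ℝ).bilinearComp
      (ContinuousLinearMap.fst ℝ ℝ (EuclideanSpace ℝ (Fin r)))
      ((-(D.N p.2 ^ 2)) • ContinuousLinearMap.fst ℝ ℝ (EuclideanSpace ℝ (Fin r))) +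
    ContinuousLinearMap.bilinearComp
      (E := EuclideanSpace ℝ (Fin r)) (F := EuclideanSpace ℝ (Fin r))
      (D.h.inner p.2) (D.shiftMap p.2) (D.shiftMap p.2) :
    (ℝ × EuclideanSpace ℝ (Fin r)) →L[ℝ] (ℝ × EuclideanSpace ℝ (Fin r)) →L[ℝ] ℝ)

theorem metric_apply (p : ℝ × Sig) (a b : ℝ) (v w : TangentSpace (𝓡 r) p.2) :
    D.metric p ((a, v) : ℝ × EuclideanSpace ℝ (Fin r)) ((b, w) : ℝ × EuclideanSpace ℝ (Fin r)) =
      -(D.N p.2 ^ 2) * (a * b) + D.h.inner p.2 (v + a • D.β p.2) (w + b • D.β p.2) := by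
  have e : D.metric p ((a, v) : ℝ × EuclideanSpace ℝ (Fin r))
      ((b, w) : ℝ × EuclideanSpace ℝ (Fin r)) = a * (-(D.N p.2 ^ 2) * b) +
        D.h.inner p.2 (v + a • D.β p.2) (w + b • D.β p.2) := rfl
  rw [e]
  ring

theorem metric_killing (p : ℝ × Sig) :
    D.metric p ((1, 0) : ℝ × EuclideanSpace ℝ (Fin r)) ((1, 0) : ℝ × EuclideanSpace ℝ (Fin r)) =
      -D.normSq p.2 := by
  have e := D.metric_apply p 1 1 0 0
  simp only [zero_add, one_smul] at e
  exact e.trans (by rw [normSq]; ring)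

/-- The Killing vector field `Z = ∂_t`. -/
def killing (p : ℝ × Sig) : TangentSpace (stModel r) p :=
  ((1, 0) : ℝ × EuclideanSpace ℝ (Fin r))

/-- The energy `p_Z(x, ξ) = ⟨ξ, Z⟩` on `T*(ℝ × Σ)`. -/
def energy (ζ : CotangentBundle (stModel r) (ℝ × Sig)) : ℝ :=
  covector (stModel r) ζ (killing ζ.proj)

/-- The density of the Riemannian volume measure of `h` in a chart of `Σ`: the square root of the
determinant of the matrix of `h` in the chart. -/
def chartDensity (e : OpenPartialHomeomorph Sig (EuclideanSpace ℝ (Fin r)))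
    (y : EuclideanSpace ℝ (Fin r)) : ℝ :=
  √(Matrix.det (Matrix.of fun i j : Fin r =>
    D.h.inner (e.symm y)
      (mfderiv (𝓡 r) (𝓡 r) e.symm y (EuclideanSpace.single i (1 : ℝ)))
      (mfderiv (𝓡 r) (𝓡 r) e.symm y (EuclideanSpace.single j (1 : ℝ)))))

/-- The Riemannian volume measure of `(Σ, h)`: the least measure on `Σ` which is, on the domain of
every chart of the atlas, at least as large as the measure with density `√(det h_ij)` there. -/
def riemannianVolume [MeasurableSpace Sig] : Measure Sig :=
  ⨆ e ∈ atlas (EuclideanSpace ℝ (Fin r)) Sig,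
    (((volume : Measure (EuclideanSpace ℝ (Fin r))).restrict e.target).withDensity
      (fun y => ENNReal.ofReal (D.chartDensity e y))).map e.symm

end StationaryData

end Stationary

/-- The area of the unit sphere in `ℝ^r`. -/
def sphereArea (r : ℕ) : ℝ :=
  ((volume : Measure (EuclideanSpace ℝ (Fin r))).toSphere univ).toReal

end StationaryLadder

end

open StationaryLadder

/-!
The idea is to replace the space of geodesics by the phase space `T*Σ` of a particle in space, where
the function `p_Z` is an explicit Hamiltonian, and to compute the volume of its level sets by
integrating over the momenta first.

*Reduction to phase space.* In a chart of `Σ` a covector has an energy `τ` and a spatial momentum `η`,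
and the mass shell is `(τ - η(β))² = N² (m² + |η|²)`. As `∂_t` is timelike, the sheet of positive
energy is the graph `τ = H`, where `H(x, η) = η(β) + N √(m² + |η|²)` (`energyOf`, `eq_energyOf`), and
the geodesic Hamiltonian has the factor `τ - H` up to a constant (`LocalData.K_eq`). So the time `t` is
strictly monotone along the flow (`StationaryData.strictAntiOn_time`). A geodesic cannot leave all
compact sets before it reaches `t = 0`, since its energy is conserved, `Σ` is compact and `H` is proper
in the momenta (`LocalData.isCompact_sublevel`, `exists_hamFlow_eq_zero`,
`StationaryData.exists_time_eq_zero`). Hence a geodesic of positive energy is determined by its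
position and spatial momentum at time zero. The motion to time zero is differentiable, because local
flows depend differentiably on the starting point (`exists_isLocalFlow`), and is symplectic
transversally to the flow (`exists_return_of_sameOrbit`): the flow itself preserves the symplectic
form, and the projection along the Hamilton vector field preserves it on the tangent space of the mass
shell. So every patch of the space of geodesics is related to the canonical coordinates of `T*Σ` by a
map whose Jacobian is the density of the symplectic volume
(`StationaryData.exists_hasFDerivAt_phase`). If the coordinates are changed such that the first one is
`H`, they form an adapted patch themselves, on which the supremum defining the Liouville measure is
attained (`StationaryData.lerayMeasure_le_patch`, `StationaryData.lintegral_patchSet`).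

*Layers.* The Liouville measure of `{H = c}` is the limit of `ε⁻¹` times the Lebesgue measure of the
layers `c - ε < H ≤ c` (`Straightening.tendsto_layer`, `StationaryData.tendsto_lintegral_layer`); this
needs that `c = ν m` is a regular value, which scaling reduces to mass one
(`StationaryData.fderiv_chartEnergy_ne_zero`). Over a point of `Σ`, the momenta with `H ≤ e` form an
ellipsoid, with volume
`N √(det h) F^(-(r+1)/2) (e² - m² F)^(r/2)` times that of the unit ball, where `F = N² - |β|²` and `r`
is the dimension of `Σ` (`volume_energyOf_le`). So the density on `Σ` is the limit of difference
quotients of `(e² - m² F)^(r/2)`.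

*Convergence.* For `r = 1` this density is unbounded near `{c² = m² F}`, and its integrability is
part of the claim. The difference quotients are bounded by twice their limit
(`quotient_sqrt_pow_le`). Their integrals converge to the Liouville measure, which is finite on the
compact level set, since this is regular; so Fatou's lemma shows that the limit is integrable, and then
the bound allows dominated convergence (`lintegral_eq_of_tendsto_of_le_mul`). The charts are put
together by a partition of unity (`StationaryData.riemannianVolume_restrict`,
`StationaryData.lintegral_levelSet`, `StationaryData.liouvilleMeasure_levelSet`).
-/

noncomputable section

open scoped Topology NNReal

set_option synthInstance.maxHeartbeats 200000
set_option linter.unusedSectionVars false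

namespace StationaryLadder

/-! ### Canonical coordinates of the cotangent bundle -/

section CotangentCharts

variable {E : Type*} [NormedAddCommGroup E] [NormedSpace ℝ E]

theorem symplecticModel_swap (u v : E × (E →L[ℝ] ℝ)) :
    symplecticModel E u v = -symplecticModel E v u := by
  simp only [symplecticModel_apply]; ring

theorem symplecticModel_self (u : E × (E →L[ℝ] ℝ)) : symplecticModel E u u = 0 := by
  simp only [symplecticModel_apply]; ring

/-- A change of canonical coordinates `(q, p) ↦ (φ q, p ∘ (Dφ)⁻¹)` is differentiable and preserves
the canonical symplectic form, by the symmetry of the second derivative of the inverse `ψ` of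
`φ`. -/
theorem symplecticModel_cotangentLift {φ ψ : E → E} {q : E} {p : E →L[ℝ] ℝ}
    (hφ : DifferentiableAt ℝ φ q) (hψ : ContDiffAt ℝ 2 ψ (φ q))
    (hψφ : ∀ᶠ x in 𝓝 q, ψ (φ x) = x) :
    ∃ L : (E × (E →L[ℝ] ℝ)) →L[ℝ] (E × (E →L[ℝ] ℝ)),
      HasFDerivAt (fun z : E × (E →L[ℝ] ℝ) => (φ z.1, z.2.comp (fderiv ℝ ψ (φ z.1)))) L (q, p) ∧
      ∀ u v, symplecticModel E (L u) (L v) = symplecticModel E u v := by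
  have hd2 : DifferentiableAt ℝ (fderiv ℝ ψ) (φ q) :=
    (hψ.fderiv_right (m := 1) (by norm_num)).differentiableAt one_ne_zero
  have h1 : HasFDerivAt (fun z : E × (E →L[ℝ] ℝ) => φ z.1)
      ((fderiv ℝ φ q).comp (ContinuousLinearMap.fst ℝ E (E →L[ℝ] ℝ))) (q, p) :=
    HasFDerivAt.comp (q, p) (g := φ) hφ.hasFDerivAt hasFDerivAt_fst
  have h2 : HasFDerivAt (fun z : E × (E →L[ℝ] ℝ) => fderiv ℝ ψ (φ z.1))
      ((fderiv ℝ (fderiv ℝ ψ) (φ q)).comp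
        ((fderiv ℝ φ q).comp (ContinuousLinearMap.fst ℝ E (E →L[ℝ] ℝ)))) (q, p) :=
    HasFDerivAt.comp (q, p) (g := fderiv ℝ ψ) hd2.hasFDerivAt h1
  have h3 : HasFDerivAt (fun z : E × (E →L[ℝ] ℝ) => z.2)
      (ContinuousLinearMap.snd ℝ E (E →L[ℝ] ℝ)) (q, p) := hasFDerivAt_snd
  refine ⟨_, h1.prodMk (h3.clm_comp h2), ?_⟩
  have hid : (fderiv ℝ ψ (φ q)).comp (fderiv ℝ φ q) = ContinuousLinearMap.id ℝ E := by
    have a1 : HasFDerivAt (ψ ∘ φ) ((fderiv ℝ ψ (φ q)).comp (fderiv ℝ φ q)) q :=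
      HasFDerivAt.comp q (hψ.differentiableAt two_ne_zero).hasFDerivAt hφ.hasFDerivAt
    have a2 : HasFDerivAt (ψ ∘ φ) (ContinuousLinearMap.id ℝ E) q :=
      (hasFDerivAt_id q).congr_of_eventuallyEq hψφ
    exact a1.unique a2
  have hid' : ∀ v, fderiv ℝ ψ (φ q) (fderiv ℝ φ q v) = v := fun v => by
    simpa using DFunLike.congr_fun hid v
  have hsym : IsSymmSndFDerivAt ℝ ψ (φ q) := hψ.isSymmSndFDerivAt (by simp)
  intro u v
  simp only [symplecticModel_apply]
  have := hsym (fderiv ℝ φ q u.1) (fderiv ℝ φ q v.1)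
  simp [hid', this]

variable {H : Type*} [TopologicalSpace H] {I : ModelWithCorners ℝ E H}
  {X : Type*} [TopologicalSpace X] [ChartedSpace H X] [IsManifold I ∞ X]

/-- The covector part of a point of `T*X`, as a linear form on the model space. -/
def covectorModel (ζ : CotangentBundle I X) : E →L[ℝ] ℝ := ζ.snd

theorem extChartAt_cot_source (ζ₀ : CotangentBundle I X) :
    (extChartAt (cotModel I) ζ₀).source = {ζ | ζ.proj ∈ (chartAt H ζ₀.proj).source} := by
  rw [FiberBundle.extChartAt]
  ext ζ
  simp only [PartialEquiv.trans_source, PartialEquiv.prod_source, PartialEquiv.refl_source,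
    mem_inter_iff, mem_preimage, mem_prod, mem_univ, and_true, mem_ofPred_eq, extChartAt_source]
  have h1 : ((trivializationAt (E →L[ℝ] ℝ)
      (fun x : X => TangentSpace I x →L[ℝ] Bundle.Trivial X ℝ x) ζ₀.proj).toPartialEquiv ζ).1
        = ζ.proj := rfl
  rw [h1, and_iff_right_iff_imp]
  intro h
  have := (Bundle.Trivialization.mem_source (trivializationAt (E →L[ℝ] ℝ)
      (fun x : X => TangentSpace I x →L[ℝ] Bundle.Trivial X ℝ x) ζ₀.proj) (x := ζ)).2
  apply this
  rw [hom_trivializationAt_baseSet]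
  exact ⟨h, mem_univ _⟩

theorem extChartAt_cot_apply {ζ₀ ζ : CotangentBundle I X}
    (h : ζ.proj ∈ (chartAt H ζ₀.proj).source) :
    extChartAt (cotModel I) ζ₀ ζ = (extChartAt I ζ₀.proj ζ.proj,
      (covectorModel ζ).comp (tangentCoordChange I ζ₀.proj ζ.proj ζ.proj)) := by
  have h0 : extChartAt (cotModel I) ζ₀ ζ = cotModel I (chartAt _ ζ₀ ζ) := rfl
  rw [h0, hom_chart]
  refine Prod.ext rfl ?_
  change ContinuousLinearMap.inCoordinates _ _ _ _ _ _ _ _ _ = _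
  rw [ContinuousLinearMap.inCoordinates]
  rw [TangentBundle.symmL_trivializationAt_eq_core h]
  ext v
  simp
  rfl

variable [I.Boundaryless]

/-- Mathlib's charts of `T*X` are canonical coordinates for the symplectic form. -/
theorem exists_hasMFDerivAt_extChartAt_cot {ζ₀ ζ : CotangentBundle I X}
    (h : ζ.proj ∈ (chartAt H ζ₀.proj).source) :
    ∃ L : TangentSpace (cotModel I) ζ →L[ℝ] (E × (E →L[ℝ] ℝ)),
      HasMFDerivAt (cotModel I) 𝓘(ℝ, E × (E →L[ℝ] ℝ)) (extChartAt (cotModel I) ζ₀) ζ L ∧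
      ∀ u v, symplecticModel E (L u) (L v) = symplecticForm ζ u v := by
  set x₀ := ζ₀.proj
  set x₁ := ζ.proj with hx₁
  set φ : E → E := extChartAt I x₀ ∘ (extChartAt I x₁).symm with hφdef
  set ψ : E → E := extChartAt I x₁ ∘ (extChartAt I x₀).symm with hψdef
  set q := extChartAt I x₁ x₁ with hq
  have hs0 : x₁ ∈ (extChartAt I x₀).source := by rwa [extChartAt_source]
  have hs1 : x₁ ∈ (extChartAt I x₁).source := mem_extChartAt_source x₁
  have hφq : φ q = extChartAt I x₀ x₁ := by
    simp [hφdef, hq]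
  have hφ : ContDiffAt ℝ ∞ φ q := by
    have := contDiffWithinAt_ext_coord_change (I := I) (n := ∞) x₀ x₁ (y := q) (by
      rw [PartialEquiv.trans_source, PartialEquiv.symm_source]
      exact ⟨mem_extChartAt_target x₁, by rw [mem_preimage, hq, extChartAt_to_inv]; exact hs0⟩)
    rwa [I.range_eq_univ, contDiffWithinAt_univ] at this
  have hψ : ContDiffAt ℝ ∞ ψ (φ q) := by
    have := contDiffWithinAt_ext_coord_change (I := I) (n := ∞) x₁ x₀ (y := φ q) (by
      rw [PartialEquiv.trans_source, PartialEquiv.symm_source, hφq]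
      exact ⟨(extChartAt I x₀).map_source hs0, by
        rw [mem_preimage, (extChartAt I x₀).left_inv hs0]; exact hs1⟩)
    rwa [I.range_eq_univ, contDiffWithinAt_univ] at this
  have hψφ : ∀ᶠ x in 𝓝 q, ψ (φ x) = x := by
    have h1 : ∀ᶠ x in 𝓝 q, x ∈ (extChartAt I x₁).target := extChartAt_target_mem_nhds x₁
    have h2 : ∀ᶠ x in 𝓝 q, (extChartAt I x₁).symm x ∈ (extChartAt I x₀).source := by
      apply (continuousAt_extChartAt_symm x₁).eventually
      rw [extChartAt_to_inv]
      exact (isOpen_extChartAt_source x₀).mem_nhds hs0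
    filter_upwards [h1, h2] with x hx1 hx2
    simp only [hφdef, hψdef, Function.comp_apply]
    rw [(extChartAt I x₀).left_inv hx2, (extChartAt I x₁).right_inv hx1]
  -- the transition map of the charts of `T*X` is the cotangent lift of the one of `X`
  obtain ⟨L, hL, hLs⟩ := symplecticModel_cotangentLift (p := (extChartAt (cotModel I) ζ ζ).2)
    (hφ.differentiableAt (by simp)) (hψ.of_le (by norm_cast)) hψφ
  refine ⟨L, ⟨?_, ?_⟩, hLs⟩
  · apply continuousAt_extChartAt'
    rw [extChartAt_cot_source]; exact h
  · have hz : (q, (extChartAt (cotModel I) ζ ζ).2) = extChartAt (cotModel I) ζ ζ := by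
      rw [extChartAt_cot_apply (mem_chart_source H ζ.proj)]
    rw [hz] at hL
    refine (hL.congr_of_eventuallyEq ?_).hasFDerivWithinAt
    have e1 : ∀ᶠ z in 𝓝 (extChartAt (cotModel I) ζ ζ), z ∈ (extChartAt (cotModel I) ζ).target :=
      extChartAt_target_mem_nhds ζ
    have e2 : ∀ᶠ z in 𝓝 (extChartAt (cotModel I) ζ ζ),
        (extChartAt (cotModel I) ζ).symm z ∈ (extChartAt (cotModel I) ζ₀).source := by
      apply (continuousAt_extChartAt_symm ζ).eventually
      rw [extChartAt_to_inv]
      exact (isOpen_extChartAt_source ζ₀).mem_nhds (by rw [extChartAt_cot_source]; exact h)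
    filter_upwards [e1, e2] with z hz1 hz2
    set ζ' := (extChartAt (cotModel I) ζ).symm z with hζ'
    have hz3 : ζ' ∈ (extChartAt (cotModel I) ζ).source := (extChartAt (cotModel I) ζ).map_target hz1
    have hz4 : z = extChartAt (cotModel I) ζ ζ' := ((extChartAt (cotModel I) ζ).right_inv hz1).symm
    rw [extChartAt_cot_source] at hz2 hz3
    have hw : writtenInExtChartAt (cotModel I) 𝓘(ℝ, E × (E →L[ℝ] ℝ)) ζ
      (extChartAt (cotModel I) ζ₀) z = extChartAt (cotModel I) ζ₀ ζ' := rfl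
    rw [hw, hz4, extChartAt_cot_apply hz2, extChartAt_cot_apply hz3]
    have hs3 : ζ'.proj ∈ (extChartAt I x₁).source := by rw [extChartAt_source]; exact hz3
    have hs2 : ζ'.proj ∈ (extChartAt I x₀).source := by rw [extChartAt_source]; exact hz2
    have hφ' : φ (extChartAt I x₁ ζ'.proj) = extChartAt I x₀ ζ'.proj := by
      simp only [hφdef, Function.comp_apply]
      rw [(extChartAt I x₁).left_inv hs3]
    refine Prod.ext hφ'.symm ?_
    ext v
    change covectorModel ζ' _ = covectorModel ζ' (tangentCoordChange I x₁ ζ'.proj ζ'.proj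
      (fderiv ℝ ψ (φ (extChartAt I x₁ ζ'.proj)) v))
    have hf : fderiv ℝ ψ (φ (extChartAt I x₁ ζ'.proj)) = tangentCoordChange I x₀ x₁ ζ'.proj := by
      rw [tangentCoordChange_def, I.range_eq_univ, fderivWithin_univ, hφ']
    rw [hf, tangentCoordChange_comp ⟨⟨hs2, hs3⟩, mem_extChartAt_source _⟩]
    rfl

section FiniteDimensional

variable [FiniteDimensional ℝ E]

theorem symplecticModel_nondegenerate {u : E × (E →L[ℝ] ℝ)}
    (h : ∀ v, symplecticModel E u v = 0) : u = 0 := by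
  have h2 : u.2 = 0 := by
    ext x
    have := h (x, 0)
    simpa [symplecticModel_apply] using this
  have h1 : u.1 = 0 := by
    by_contra hne
    obtain ⟨f, hf⟩ := SeparatingDual.exists_ne_zero (R := ℝ) hne
    have := h (0, f)
    simp [symplecticModel_apply, h2] at this
    exact hf this
  exact Prod.ext h1 h2

/-- A nondegenerate bilinear form on a finite-dimensional space, as a map to the dual space, is
invertible. -/
theorem isInvertible_of_nondegenerate {V : Type*} [NormedAddCommGroup V] [NormedSpace ℝ V]
    [FiniteDimensional ℝ V] (B : V →L[ℝ] V →L[ℝ] ℝ) (hB : ∀ u, (∀ v, B u v = 0) → u = 0) :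
    B.IsInvertible := by
  have hinj : Function.Injective (B : V →ₗ[ℝ] (V →L[ℝ] ℝ)) := by
    refine (injective_iff_map_eq_zero (B : V →ₗ[ℝ] (V →L[ℝ] ℝ))).2 fun u hu => hB u fun v => ?_
    exact DFunLike.congr_fun hu v
  have hdim : Module.finrank ℝ V = Module.finrank ℝ (V →L[ℝ] ℝ) := by
    rw [← (LinearMap.toContinuousLinearMap (𝕜 := ℝ) (E := V) (F' := ℝ)).finrank_eq]
    exact Subspace.dual_finrank_eq.symm
  exact ⟨(LinearEquiv.ofInjectiveOfFinrankEq _ hinj hdim).toContinuousLinearEquiv, by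
    ext u v; rfl⟩

theorem symplecticModel_isInvertible : (symplecticModel E).IsInvertible :=
  isInvertible_of_nondegenerate _ fun _ => symplecticModel_nondegenerate

/-- The vector `X` with `ω(X, ·) = k`. -/
def sharp (E : Type*) [NormedAddCommGroup E] [NormedSpace ℝ E] :
    ((E × (E →L[ℝ] ℝ)) →L[ℝ] ℝ) →L[ℝ] (E × (E →L[ℝ] ℝ)) :=
  (symplecticModel E).inverse

theorem symplecticModel_sharp (k : (E × (E →L[ℝ] ℝ)) →L[ℝ] ℝ) (v : E × (E →L[ℝ] ℝ)) :
    symplecticModel E (sharp E k) v = k v := by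
  rw [sharp, symplecticModel_isInvertible.self_apply_inverse]

theorem eq_sharp {u : E × (E →L[ℝ] ℝ)} {k : (E × (E →L[ℝ] ℝ)) →L[ℝ] ℝ}
    (h : ∀ v, symplecticModel E u v = k v) : u = sharp E k := by
  rw [← sub_eq_zero]
  apply symplecticModel_nondegenerate
  intro v
  rw [map_sub, _root_.sub_apply, h, symplecticModel_sharp, sub_self]

theorem sharp_fst_snd (k : (E × (E →L[ℝ] ℝ)) →L[ℝ] ℝ) :
    (∀ f, f (sharp E k).1 = k (0, f)) ∧ ∀ x, (sharp E k).2 x = -k (x, 0) := by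
  constructor
  · intro f
    have := symplecticModel_sharp k (0, f)
    simpa [symplecticModel_apply] using this
  · intro x
    have := symplecticModel_sharp k (x, 0)
    simp only [symplecticModel_apply, _root_.zero_apply, zero_sub] at this
    linarith

/-- The Hamilton vector field satisfies `ω(X_f, ·) = df`. -/
theorem hamiltonField_spec (f : CotangentBundle I X → ℝ) (ζ : CotangentBundle I X)
    (v : TangentSpace (cotModel I) ζ) :
    symplecticForm ζ (hamiltonField f ζ) v = differential f ζ v :=
  symplecticModel_sharp (E := E) (differential f ζ) v

theorem hamiltonField_neg (f : CotangentBundle I X → ℝ) (ζ : CotangentBundle I X) :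
    hamiltonField (-f) ζ = -hamiltonField f ζ := by
  have : differential (-f) ζ = -differential f ζ := mfderiv_neg
  rw [hamiltonField, this, map_neg, hamiltonField]

/-- The representation of a function on `T*X` in the canonical coordinates at `ζ₀`. -/
def inChart (ζ₀ : CotangentBundle I X) (f : CotangentBundle I X → ℝ) :
    E × (E →L[ℝ] ℝ) → ℝ :=
  f ∘ (extChartAt (cotModel I) ζ₀).symm

/-- The chart of `T*X` at `ζ₀` at another point `ζ`: its differential is a symplectic isomorphism
which maps the Hamilton vector field of `f` to the one of `f` in the chart. -/
theorem exists_chart_symplectic {ζ₀ ζ : CotangentBundle I X}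
    (h : ζ.proj ∈ (chartAt H ζ₀.proj).source) :
    ∃ L : TangentSpace (cotModel I) ζ ≃L[ℝ] (E × (E →L[ℝ] ℝ)),
      HasMFDerivAt (cotModel I) 𝓘(ℝ, E × (E →L[ℝ] ℝ)) (extChartAt (cotModel I) ζ₀) ζ
        (L : TangentSpace (cotModel I) ζ →L[ℝ] (E × (E →L[ℝ] ℝ))) ∧
      HasMFDerivAt 𝓘(ℝ, E × (E →L[ℝ] ℝ)) (cotModel I) (extChartAt (cotModel I) ζ₀).symm
        (extChartAt (cotModel I) ζ₀ ζ)
        (L.symm : (E × (E →L[ℝ] ℝ)) →L[ℝ] TangentSpace (cotModel I) ζ) ∧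
      (∀ u v, symplecticModel E (L u) (L v) = symplecticForm ζ u v) ∧
      ∀ f : CotangentBundle I X → ℝ,
        DifferentiableAt ℝ (inChart ζ₀ f) (extChartAt (cotModel I) ζ₀ ζ) →
        (∀ u, differential f ζ u =
          fderiv ℝ (inChart ζ₀ f) (extChartAt (cotModel I) ζ₀ ζ) (L u)) ∧
        L (hamiltonField f ζ) =
          sharp E (fderiv ℝ (inChart ζ₀ f) (extChartAt (cotModel I) ζ₀ ζ)) := by
  obtain ⟨L, hL, hLs⟩ := exists_hasMFDerivAt_extChartAt_cot h
  have hsrc : ζ ∈ (extChartAt (cotModel I) ζ₀).source := by rw [extChartAt_cot_source]; exact h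
  let L' : (E × (E →L[ℝ] ℝ)) →L[ℝ] (E × (E →L[ℝ] ℝ)) := L
  have hinj : Function.Injective (L' : (E × (E →L[ℝ] ℝ)) →ₗ[ℝ] (E × (E →L[ℝ] ℝ))) := by
    rw [← LinearMap.ker_eq_bot, LinearMap.ker_eq_bot']
    intro u hu
    have hu' : L u = 0 := hu
    refine symplecticModel_nondegenerate fun v => ?_
    have := hLs u v
    rw [hu', map_zero] at this
    exact this.symm
  let e' : (E × (E →L[ℝ] ℝ)) ≃L[ℝ] (E × (E →L[ℝ] ℝ)) :=
    (LinearEquiv.ofInjectiveEndo _ hinj).toContinuousLinearEquiv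
  let e : TangentSpace (cotModel I) ζ ≃L[ℝ] (E × (E →L[ℝ] ℝ)) := e'
  have he : ∀ u, e u = L u := fun u => rfl
  have heL : (e : TangentSpace (cotModel I) ζ →L[ℝ] (E × (E →L[ℝ] ℝ))) = L := by ext1 u; rfl
  have hz : (extChartAt (cotModel I) ζ₀).symm (extChartAt (cotModel I) ζ₀ ζ) = ζ :=
    (extChartAt (cotModel I) ζ₀).left_inv hsrc
  have hmem : extChartAt (cotModel I) ζ₀ ζ ∈ (extChartAt (cotModel I) ζ₀).target :=
    (extChartAt (cotModel I) ζ₀).map_source hsrc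
  obtain ⟨D, hD⟩ : ∃ D : (E × (E →L[ℝ] ℝ)) →L[ℝ] TangentSpace (cotModel I) ζ,
      HasMFDerivAt 𝓘(ℝ, E × (E →L[ℝ] ℝ)) (cotModel I)
      (extChartAt (cotModel I) ζ₀).symm (extChartAt (cotModel I) ζ₀ ζ) D := by
    have := (contMDiffOn_extChartAt_symm (I := cotModel I) (n := 1) ζ₀).contMDiffAt
      ((isOpen_extChartAt_target ζ₀).mem_nhds hmem)
    exact ⟨_, (this.mdifferentiableAt one_ne_zero).hasMFDerivAt⟩
  have hLD : ∀ u, L (D u) = u := by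
    have h1 : HasMFDerivAt 𝓘(ℝ, E × (E →L[ℝ] ℝ)) 𝓘(ℝ, E × (E →L[ℝ] ℝ))
        (extChartAt (cotModel I) ζ₀ ∘ (extChartAt (cotModel I) ζ₀).symm)
        (extChartAt (cotModel I) ζ₀ ζ) (L.comp D) := by
      refine HasMFDerivAt.comp (extChartAt (cotModel I) ζ₀ ζ) ?_ hD
      rw [hz]; exact hL
    have h2 : HasMFDerivAt 𝓘(ℝ, E × (E →L[ℝ] ℝ)) 𝓘(ℝ, E × (E →L[ℝ] ℝ))
        (extChartAt (cotModel I) ζ₀ ∘ (extChartAt (cotModel I) ζ₀).symm)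
        (extChartAt (cotModel I) ζ₀ ζ) (ContinuousLinearMap.id ℝ _) := by
      refine (hasMFDerivAt_id _).congr_of_eventuallyEq ?_
      filter_upwards [(isOpen_extChartAt_target ζ₀).mem_nhds hmem] with z hz'
      exact (extChartAt (cotModel I) ζ₀).right_inv hz'
    intro u
    exact DFunLike.congr_fun (hasMFDerivAt_unique h1 h2) u
  have hDe : (e.symm : (E × (E →L[ℝ] ℝ)) →L[ℝ] TangentSpace (cotModel I) ζ) = D := by
    refine ContinuousLinearMap.coe_injective (LinearMap.ext fun u => e.injective ?_)
    change e (e.symm u) = e (D u)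
    rw [e.apply_symm_apply, he, hLD]
  have hdf : ∀ f : CotangentBundle I X → ℝ,
      DifferentiableAt ℝ (inChart ζ₀ f) (extChartAt (cotModel I) ζ₀ ζ) →
      ∀ u, differential f ζ u =
          fderiv ℝ (inChart ζ₀ f) (extChartAt (cotModel I) ζ₀ ζ) (e u) := by
    intro f hf u
    have h1 : HasMFDerivAt (cotModel I) 𝓘(ℝ, ℝ) (inChart ζ₀ f ∘ extChartAt (cotModel I) ζ₀) ζ
        ((fderiv ℝ (inChart ζ₀ f) (extChartAt (cotModel I) ζ₀ ζ)).comp L) :=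
      HasMFDerivAt.comp ζ hf.hasFDerivAt.hasMFDerivAt hL
    have h2 : HasMFDerivAt (cotModel I) 𝓘(ℝ, ℝ) f ζ
        ((fderiv ℝ (inChart ζ₀ f) (extChartAt (cotModel I) ζ₀ ζ)).comp L) := by
      refine h1.congr_of_eventuallyEq ?_
      filter_upwards [(isOpen_extChartAt_source ζ₀).mem_nhds hsrc] with ζ' hζ'
      simp only [inChart, Function.comp_apply]
      rw [(extChartAt (cotModel I) ζ₀).left_inv hζ']
    rw [differential, h2.mfderiv]
    rfl
  refine ⟨e, heL ▸ hL, hDe ▸ hD, fun u v => hLs u v, fun f hf => ⟨hdf f hf, ?_⟩⟩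
  refine eq_sharp fun v => ?_
  have h1 := hLs (hamiltonField f ζ) (e.symm v)
  rw [hamiltonField_spec, hdf f hf, ← he, ← he, e.apply_symm_apply] at h1
  exact h1

end FiniteDimensional

end CotangentCharts

/-! ### Differentiable dependence of local flows on the initial point -/

section LocalFlow

variable {V : Type*} [NormedAddCommGroup V] [NormedSpace ℝ V]

/-- Gronwall's inequality for the linearization error of a flow: `y - x - A h` solves the
linearized equation along `x` up to an error quadratic in `h`. -/
theorem norm_sub_sub_variation_le {v : V → V} {D : V → V →L[ℝ] V} {B : Set V} {K K₀ C T : ℝ}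
    (hK : 0 ≤ K)
    (hv : ∀ a ∈ B, ∀ b ∈ B, ‖v b - v a - D a (b - a)‖ ≤ K * ‖b - a‖ ^ 2)
    (hD : ∀ a ∈ B, ‖D a‖ ≤ K₀) {x y : ℝ → V} {A : ℝ → V →L[ℝ] V} {h : V}
    (hx : ∀ t ∈ Icc 0 T, HasDerivWithinAt x (v (x t)) (Icc 0 T) t)
    (hy : ∀ t ∈ Icc 0 T, HasDerivWithinAt y (v (y t)) (Icc 0 T) t)
    (hA : ∀ t ∈ Icc 0 T, HasDerivWithinAt A ((D (x t)).comp (A t)) (Icc 0 T) t)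
    (hxB : ∀ t ∈ Icc 0 T, x t ∈ B) (hyB : ∀ t ∈ Icc 0 T, y t ∈ B)
    (hA0 : A 0 = ContinuousLinearMap.id ℝ V) (hh : y 0 - x 0 = h)
    (hC : ∀ t ∈ Icc 0 T, ‖y t - x t‖ ≤ C * ‖h‖) :
    ∀ t ∈ Icc 0 T, ‖y t - x t - A t h‖ ≤ gronwallBound 0 K₀ (K * (C * ‖h‖) ^ 2) t := by
  have hu : ∀ t ∈ Icc 0 T, HasDerivWithinAt (fun t => y t - x t - A t h)
      (v (y t) - v (x t) - (D (x t)) (A t h)) (Icc 0 T) t := by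
    intro t ht
    have h1 := ((hA t ht).clm_apply (hasDerivWithinAt_const t (Icc 0 T) h))
    have h2 := ((hy t ht).sub (hx t ht)).sub h1
    simpa only [map_zero, add_zero] using! h2
  have := norm_le_gronwallBound_of_norm_deriv_right_le (f := fun t => y t - x t - A t h)
    (f' := fun t => v (y t) - v (x t) - (D (x t)) (A t h)) (δ := 0) (K := K₀)
    (ε := K * (C * ‖h‖) ^ 2) (a := 0) (b := T)
    (fun t ht => (hu t ht).continuousWithinAt)
    (fun t ht => ((hu t (Ico_subset_Icc_self ht)).mono_of_mem_nhdsWithin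
      (Icc_mem_nhdsGE_of_mem ht)))
    (by simp [hA0, hh]) ?_
  · intro t ht
    simpa using this t ht
  · intro t ht
    have ht' := Ico_subset_Icc_self ht
    have e : v (y t) - v (x t) - (D (x t)) (A t h) =
        D (x t) (y t - x t - A t h) + (v (y t) - v (x t) - D (x t) (y t - x t)) := by
      rw [map_sub (D (x t)) (y t - x t) (A t h)]; abel
    rw [e]
    refine (norm_add_le _ _).trans (add_le_add ?_ ?_)
    · exact ((D (x t)).le_opNorm _).trans (by gcongr; exact hD _ (hxB t ht'))
    · refine (hv _ (hxB t ht') _ (hyB t ht')).trans ?_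
      have := hC t ht'
      gcongr

/-- A local flow `Φ` of the vector field `v`, defined for starting points in `O` and times in
`[-δ, δ]`, which stays in `U`, together with its derivative `J` in the starting point. -/
structure IsLocalFlow (v : V → V) (U O : Set V) (δ : ℝ) (Φ : V → ℝ → V)
    (J : V → ℝ → V →L[ℝ] V) : Prop where
  isOpen : IsOpen O
  subset : O ⊆ U
  pos : 0 < δ
  zero : ∀ z ∈ O, Φ z 0 = z
  mem : ∀ z ∈ O, ∀ t ∈ Icc (-δ) δ, Φ z t ∈ U
  deriv : ∀ z ∈ O, ∀ t ∈ Icc (-δ) δ, HasDerivWithinAt (Φ z) (v (Φ z t)) (Icc (-δ) δ) t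
  jacobian_zero : ∀ z ∈ O, J z 0 = ContinuousLinearMap.id ℝ V
  jacobian_deriv : ∀ z ∈ O, ∀ t ∈ Icc (-δ) δ,
    HasDerivWithinAt (J z) ((fderiv ℝ v (Φ z t)).comp (J z t)) (Icc (-δ) δ) t
  hasFDerivAt : ∀ z ∈ O, ∀ t ∈ Icc (-δ) δ, HasFDerivAt (fun z => Φ z t) (J z t) z
  speed : ∃ M, 0 ≤ M ∧ ∀ z ∈ O, ∀ t ∈ Icc (-δ) δ, ‖Φ z t - z‖ ≤ M * |t|

/-- A vector field of class `C²` has a local flow which is differentiable in the starting point. The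
flow and its candidate derivative are obtained together from the Picard–Lindelöf theorem for the
variational system `z' = v(z)`, `J' = Dv(z) J`, and Gronwall's inequality shows that `J` is the
derivative. -/
theorem exists_isLocalFlow [CompleteSpace V] {v : V → V} {z₀ : V} (hv : ContDiffAt ℝ 2 v z₀)
    {U : Set V} (hU : U ∈ 𝓝 z₀) :
    ∃ (O : Set V) (δ : ℝ) (Φ : V → ℝ → V) (J : V → ℝ → V →L[ℝ] V),
      z₀ ∈ O ∧ IsLocalFlow v U O δ Φ J := by
  -- a ball on which `v` and its derivative are Lipschitz
  have hD1 : ContDiffAt ℝ 1 (fderiv ℝ v) z₀ := hv.fderiv_right (by norm_num)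
  obtain ⟨K, s, hs, hKs⟩ := hD1.exists_lipschitzOnWith
  have hdiff : ∀ᶠ z in 𝓝 z₀, DifferentiableAt ℝ v z :=
    (hv.eventually (by simp)).mono fun z hz => hz.differentiableAt two_ne_zero
  have hbdd : ∀ᶠ z in 𝓝 z₀, ‖v z‖ < ‖v z₀‖ + 1 :=
    hv.continuousAt.norm.eventually_lt_const (by linarith)
  obtain ⟨ρ, hρ, hball⟩ := Metric.mem_nhds_iff.1
    (Filter.inter_mem (Filter.inter_mem hs hU) (hdiff.and hbdd))
  set B := Metric.ball z₀ ρ with hB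
  have hz₀B : z₀ ∈ B := Metric.mem_ball_self hρ
  set K₀ : ℝ := ‖fderiv ℝ v z₀‖ + K * ρ with hK₀
  have hDB : ∀ a ∈ B, ‖fderiv ℝ v a‖ ≤ K₀ := by
    intro a ha
    have h1 := hKs.dist_le_mul a (hball ha).1.1 z₀ (hball hz₀B).1.1
    rw [dist_eq_norm] at h1
    have h2 : dist a z₀ ≤ ρ := (Metric.mem_ball.1 ha).le
    calc ‖fderiv ℝ v a‖ = ‖fderiv ℝ v z₀ + (fderiv ℝ v a - fderiv ℝ v z₀)‖ := by abel_nf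
      _ ≤ ‖fderiv ℝ v z₀‖ + ‖fderiv ℝ v a - fderiv ℝ v z₀‖ := norm_add_le _ _
      _ ≤ ‖fderiv ℝ v z₀‖ + K * ρ := by
        gcongr; exact h1.trans (by gcongr)
  have hvB : ∀ a ∈ B, ∀ b ∈ B, ‖v b - v a - fderiv ℝ v a (b - a)‖ ≤ K * ‖b - a‖ ^ 2 := by
    intro a ha b hb
    have hseg : segment ℝ a b ⊆ B := (convex_ball z₀ ρ).segment_subset ha hb
    have := (convex_segment a b).norm_image_sub_le_of_norm_hasFDerivWithin_le' (f := v)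
      (f' := fderiv ℝ v) (φ := fderiv ℝ v a) (C := K * ‖b - a‖)
      (fun x hx => (hball (hseg hx)).2.1.hasFDerivAt.hasFDerivWithinAt)
      (fun x hx => by
        have h1 := hKs.dist_le_mul x (hball (hseg hx)).1.1 a (hball ha).1.1
        rw [dist_eq_norm, dist_eq_norm] at h1
        refine h1.trans ?_
        gcongr
        exact norm_sub_le_of_mem_segment hx)
      (left_mem_segment ℝ a b) (right_mem_segment ℝ a b)
    calc _ ≤ K * ‖b - a‖ * ‖b - a‖ := this
      _ = _ := by ring
  -- the flow of the variational system
  let w : V × (V →L[ℝ] V) → V × (V →L[ℝ] V) := fun p => (v p.1, (fderiv ℝ v p.1).comp p.2)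
  have hw : ContDiffAt ℝ 1 w (z₀, ContinuousLinearMap.id ℝ V) := by
    have h1 : ContDiffAt ℝ 1 (fun p : V × (V →L[ℝ] V) => v p.1)
        (z₀, ContinuousLinearMap.id ℝ V) :=
      ContDiffAt.comp (g := v) (z₀, ContinuousLinearMap.id ℝ V) (hv.of_le (by norm_num))
        contDiffAt_fst
    have h2 : ContDiffAt ℝ 1 (fun p : V × (V →L[ℝ] V) => fderiv ℝ v p.1)
        (z₀, ContinuousLinearMap.id ℝ V) :=
      ContDiffAt.comp (g := fderiv ℝ v) (z₀, ContinuousLinearMap.id ℝ V) hD1 contDiffAt_fst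
    exact h1.prodMk (h2.clm_comp contDiffAt_snd)
  set p₀ : V × (V →L[ℝ] V) := (z₀, ContinuousLinearMap.id ℝ V) with hp₀
  obtain ⟨ε, hε, a, r, L, K', hr, hpl'⟩ := IsPicardLindelof.of_contDiffAt_one hw
  obtain ⟨α, hα, L', hL'⟩ :=
    (hpl' 0).exists_forall_mem_closedBall_eq_hasDerivWithinAt_lipschitzOnWith
  simp only [zero_sub, zero_add] at hα hL'
  have hp₀r : p₀ ∈ Metric.closedBall p₀ (r : ℝ) := Metric.mem_closedBall_self r.2
  have h0ε : (0 : ℝ) ∈ Icc (-ε) ε := ⟨by linarith, hε.le⟩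
  obtain ⟨δ, hδ, hδε, hδρ⟩ : ∃ δ > 0, δ ≤ ε ∧ ∀ t ∈ Icc (-δ) δ, dist (α p₀ t) p₀ < ρ / 2 := by
    have hc : ContinuousWithinAt (α p₀) (Icc (-ε) ε) 0 :=
      ((hα p₀ hp₀r).2 0 h0ε).continuousWithinAt
    have hc' : ContinuousAt (α p₀) 0 := hc.continuousAt (Icc_mem_nhds (by linarith) hε)
    have h1 := Metric.continuousAt_iff.1 hc' (ρ / 2) (by positivity)
    rw [(hα p₀ hp₀r).1] at h1
    obtain ⟨δ, hδ, h1⟩ := h1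
    refine ⟨min (δ / 2) ε, by positivity, min_le_right _ _, fun t ht => h1 ?_⟩
    rw [Real.dist_eq, sub_zero, abs_lt]
    have := min_le_left (δ / 2) ε
    constructor <;> linarith [ht.1, ht.2]
  have hsub : Icc (-δ) δ ⊆ Icc (-ε) ε := Icc_subset_Icc (by linarith) hδε
  -- starting points so close to `z₀` that the flow stays in the ball `B` up to the time `δ`
  set η : ℝ := min r (ρ / (2 * (L' + 1))) with hη
  have hηpos : 0 < η := by positivity
  have hηr : η ≤ r := min_le_left _ _
  have hηρ : (L' + 1) * η ≤ ρ / 2 := by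
    have : η ≤ ρ / (2 * (L' + 1)) := min_le_right _ _
    rw [le_div_iff₀ (by positivity)] at this
    linarith
  set O : Set V := Metric.ball z₀ η with hO
  have hdist : ∀ z z' : V, dist (z, ContinuousLinearMap.id ℝ V) (z', ContinuousLinearMap.id ℝ V) =
      dist z z' := fun z z' => by rw [Prod.dist_eq]; simp
  have hOr : ∀ z ∈ O, (z, ContinuousLinearMap.id ℝ V) ∈ Metric.closedBall p₀ (r : ℝ) := by
    intro z hz
    rw [Metric.mem_closedBall, hp₀, hdist]
    exact (Metric.mem_ball.1 hz).le.trans hηr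
  set Φ : V → ℝ → V := fun z t => (α (z, ContinuousLinearMap.id ℝ V) t).1 with hΦ
  set J : V → ℝ → V →L[ℝ] V := fun z t => (α (z, ContinuousLinearMap.id ℝ V) t).2 with hJ
  have hLip : ∀ z ∈ O, ∀ z' ∈ O, ∀ t ∈ Icc (-δ) δ, ‖Φ z t - Φ z' t‖ ≤ L' * ‖z - z'‖ := by
    intro z hz z' hz' t ht
    have h1 := (hL' t (hsub ht)).dist_le_mul _ (hOr z hz) _ (hOr z' hz')
    rw [hdist] at h1
    rw [← dist_eq_norm, ← dist_eq_norm]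
    refine le_trans ?_ h1
    rw [Prod.dist_eq]
    exact le_max_left _ _
  have hz₀O : z₀ ∈ O := Metric.mem_ball_self hηpos
  have hmem : ∀ z ∈ O, ∀ t ∈ Icc (-δ) δ, Φ z t ∈ B := by
    intro z hz t ht
    have h1 := hLip z hz z₀ hz₀O t ht
    have h2 : dist (Φ z₀ t) z₀ < ρ / 2 := by
      refine lt_of_le_of_lt ?_ (hδρ t ht)
      rw [Prod.dist_eq]
      exact le_max_left _ _
    rw [← dist_eq_norm, ← dist_eq_norm] at h1
    have h3 : dist z z₀ < η := Metric.mem_ball.1 hz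
    have h4 : (L' : ℝ) * dist z z₀ ≤ (L' + 1) * η := by
      gcongr
      · linarith
    rw [Metric.mem_ball]
    calc dist (Φ z t) z₀ ≤ dist (Φ z t) (Φ z₀ t) + dist (Φ z₀ t) z₀ := dist_triangle _ _ _
      _ < ρ / 2 + ρ / 2 := by linarith
      _ = ρ := by ring
  have hzero : ∀ z ∈ O, Φ z 0 = z := fun z hz => by simp only [hΦ]; rw [(hα _ (hOr z hz)).1]
  have hJzero : ∀ z ∈ O, J z 0 = ContinuousLinearMap.id ℝ V := fun z hz => by
    simp only [hJ]; rw [(hα _ (hOr z hz)).1]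
  have hderiv : ∀ z ∈ O, ∀ t ∈ Icc (-δ) δ,
      HasDerivWithinAt (Φ z) (v (Φ z t)) (Icc (-δ) δ) t := by
    intro z hz t ht
    have h1 := ((hα _ (hOr z hz)).2 t (hsub ht)).mono hsub
    exact (hasFDerivAt_fst.comp_hasDerivWithinAt t h1)
  have hJderiv : ∀ z ∈ O, ∀ t ∈ Icc (-δ) δ,
      HasDerivWithinAt (J z) ((fderiv ℝ v (Φ z t)).comp (J z t)) (Icc (-δ) δ) t := by
    intro z hz t ht
    have h1 := ((hα _ (hOr z hz)).2 t (hsub ht)).mono hsub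
    exact (hasFDerivAt_snd.comp_hasDerivWithinAt t h1)
  refine ⟨O, δ, Φ, J, hz₀O, Metric.isOpen_ball, ?_, hδ, hzero, ?_, hderiv, hJzero, hJderiv, ?_,
    ‖v z₀‖ + 1, by positivity, ?_⟩
  · intro z hz
    have := hmem z hz 0 ⟨by linarith, hδ.le⟩
    rw [hzero z hz] at this
    exact (hball this).1.2
  · exact fun z hz t ht => (hball (hmem z hz t ht)).1.2
  · intro z hz t ht
    -- the linearization error, for positive and for negative times
    have hquad : ∀ z' ∈ O, ‖Φ z' t - Φ z t - J z t (z' - z)‖ ≤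
        gronwallBound 0 K₀ (K * (L' * ‖z' - z‖) ^ 2) |t| := by
      intro z' hz'
      rcases le_total 0 t with h0 | h0
      · have hsub' : Icc 0 δ ⊆ Icc (-δ) δ := Icc_subset_Icc (by linarith) le_rfl
        rw [abs_of_nonneg h0]
        exact norm_sub_sub_variation_le (T := δ) K.2 hvB hDB
          (fun t ht => (hderiv z hz t (hsub' ht)).mono hsub')
          (fun t ht => (hderiv z' hz' t (hsub' ht)).mono hsub')
          (fun t ht => (hJderiv z hz t (hsub' ht)).mono hsub')
          (fun t ht => hmem z hz t (hsub' ht)) (fun t ht => hmem z' hz' t (hsub' ht))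
          (hJzero z hz) (by rw [hzero z hz, hzero z' hz'])
          (fun t ht => hLip z' hz' z hz t (hsub' ht)) t ⟨h0, ht.2⟩
      · have hmaps : MapsTo (fun s : ℝ => -s) (Icc 0 δ) (Icc (-δ) δ) := fun s hs =>
          ⟨by linarith [hs.2], by linarith [hs.1, hδ]⟩
        have hneg : ∀ s : ℝ, HasDerivWithinAt (fun s : ℝ => -s) (-1) (Icc 0 δ) s := fun s =>
          (hasDerivAt_neg s).hasDerivWithinAt
        rw [abs_of_nonpos h0]
        have := norm_sub_sub_variation_le (T := δ) (v := fun a => -v a)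
          (D := fun a => -fderiv ℝ v a) (x := fun s => Φ z (-s)) (y := fun s => Φ z' (-s))
          (A := fun s => J z (-s)) (h := z' - z) (B := B) (K := K) (K₀ := K₀) (C := L') K.2
          (fun a ha b hb => by
            rw [← norm_neg]
            refine le_of_eq_of_le ?_ (hvB a ha b hb)
            congr 1
            simp only [_root_.neg_apply]
            abel)
          (fun a ha => by rw [norm_neg]; exact hDB a ha)
          (fun s hs => by
            have := (hderiv z hz (-s) (hmaps hs)).scomp s (hneg s) hmaps
            simpa [Function.comp_def] using this)
          (fun s hs => by
            have := (hderiv z' hz' (-s) (hmaps hs)).scomp s (hneg s) hmaps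
            simpa [Function.comp_def] using this)
          (fun s hs => by
            have := (hJderiv z hz (-s) (hmaps hs)).scomp s (hneg s) hmaps
            simpa [Function.comp_def, ContinuousLinearMap.neg_comp] using this)
          (fun s hs => hmem z hz _ (hmaps hs)) (fun s hs => hmem z' hz' _ (hmaps hs))
          (by simp only [neg_zero]; exact hJzero z hz)
          (by simp only [neg_zero]; rw [hzero z hz, hzero z' hz'])
          (fun s hs => hLip z' hz' z hz _ (hmaps hs)) (-t) ⟨by linarith, by linarith [ht.1]⟩
        simpa only [neg_neg] using this
    have hG : ∀ c x : ℝ, gronwallBound 0 K₀ c x = c * gronwallBound 0 K₀ 1 x := by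
      intro c x
      by_cases h : K₀ = 0
      · simp [h, gronwallBound_K0]
      · simp only [gronwallBound_of_K_ne_0 h]; ring
    -- the error is quadratic in `z' - z`, and so `J z t` is the derivative
    rw [hasFDerivAt_iff_isLittleO_nhds_zero, Asymptotics.isLittleO_iff]
    intro c hc
    set M : ℝ := K * L' ^ 2 * gronwallBound 0 K₀ 1 |t| with hM
    have hO' : ∀ᶠ h in 𝓝 (0 : V), z + h ∈ O := by
      have : ContinuousAt (fun h : V => z + h) 0 := by fun_prop
      apply this.eventually
      simp only [add_zero]
      exact Metric.isOpen_ball.mem_nhds hz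
    have hsmall : ∀ᶠ h in 𝓝 (0 : V), M * ‖h‖ < c := by
      have : Filter.Tendsto (fun h : V => M * ‖h‖) (𝓝 0) (𝓝 (M * ‖(0 : V)‖)) :=
        (continuous_const.mul continuous_norm).tendsto 0
      exact this.eventually_lt_const (by simpa using hc)
    filter_upwards [hO', hsmall] with h h1 h2
    have h3 := hquad _ h1
    rw [add_sub_cancel_left, hG] at h3
    refine h3.trans ?_
    calc _ = M * ‖h‖ * ‖h‖ := by rw [hM]; ring
      _ ≤ c * ‖h‖ := by gcongr
  · intro z hz t ht
    have := (convex_Icc (-δ) δ).norm_image_sub_le_of_norm_hasDerivWithin_le (f := Φ z)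
      (f' := fun t => v (Φ z t)) (C := ‖v z₀‖ + 1) (hderiv z hz)
      (fun s hs => (hball (hmem z hz s hs)).2.2.le) (x := 0) (y := t) ⟨by linarith, hδ.le⟩ ht
    rwa [hzero z hz, sub_zero, Real.norm_eq_abs] at this

/-- Uniqueness of solutions: a solution which stays in the open set where `v` is of class `C¹` and
starts in `O` agrees with the local flow, if both stay in a set on which `v` is Lipschitz. -/
theorem IsLocalFlow.eq_of_hasDerivWithinAt {v : V → V} {U O : Set V} {δ : ℝ} {Φ : V → ℝ → V}
    {J : V → ℝ → V →L[ℝ] V} (h : IsLocalFlow v U O δ Φ J) {K : ℝ≥0} (hK : LipschitzOnWith K v U)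
    {c : ℝ → V} {a b : ℝ} (hab : a ≤ b) (hba : b - a ≤ δ) (hcU : ∀ t ∈ Icc a b, c t ∈ U)
    (hc : ∀ t ∈ Icc a b, HasDerivWithinAt c (v (c t)) (Icc a b) t) (hca : c a ∈ O) :
    c b = Φ (c a) (b - a) := by
  have hδ := h.pos
  have hmaps : MapsTo (fun t => t - a) (Icc a b) (Icc (-δ) δ) := fun t ht =>
    ⟨by linarith [ht.1], by linarith [ht.2]⟩
  have hg : ∀ t ∈ Icc a b, HasDerivWithinAt (fun t => Φ (c a) (t - a)) (v (Φ (c a) (t - a)))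
      (Icc a b) t := by
    intro t ht
    have h1 := (h.deriv _ hca (t - a) (hmaps ht)).scomp t
      (((hasDerivAt_id t).sub_const a).hasDerivWithinAt (s := Icc a b)) hmaps
    simpa [Function.comp_def] using h1
  have := ODE_solution_unique_of_mem_Icc_right (v := fun _ => v) (s := fun _ => U) (K := K)
    (a := a) (b := b) (f := c) (g := fun t => Φ (c a) (t - a)) (fun _ _ => hK)
    (fun t ht => (hc t ht).continuousWithinAt)
    (fun t ht => (hc t (Ico_subset_Icc_self ht)).mono_of_mem_nhdsWithin
      (Icc_mem_nhdsGE_of_mem ht))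
    (fun t ht => hcU t (Ico_subset_Icc_self ht))
    (fun t ht => (hg t ht).continuousWithinAt)
    (fun t ht => (hg t (Ico_subset_Icc_self ht)).mono_of_mem_nhdsWithin
      (Icc_mem_nhdsGE_of_mem ht))
    (fun t ht => h.mem _ hca _ (hmaps (Ico_subset_Icc_self ht)))
    (by simp [h.zero _ hca])
  exact this ⟨hab, le_rfl⟩

/-- If the derivative of `v` is infinitesimally symplectic for the bilinear form `B`, then the
derivative of the flow preserves `B`. -/
theorem IsLocalFlow.preserves_form {v : V → V} {U O : Set V} {δ : ℝ} {Φ : V → ℝ → V}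
    {J : V → ℝ → V →L[ℝ] V} (h : IsLocalFlow v U O δ Φ J) (B : V →L[ℝ] V →L[ℝ] ℝ)
    (hB : ∀ a ∈ U, ∀ u w, B (fderiv ℝ v a u) w + B u (fderiv ℝ v a w) = 0)
    {z : V} (hz : z ∈ O) {t : ℝ} (ht : t ∈ Icc (-δ) δ) (u w : V) :
    B (J z t u) (J z t w) = B u w := by
  have hδ := h.pos
  have h0 : (0 : ℝ) ∈ Icc (-δ) δ := ⟨by linarith, hδ.le⟩
  have hd : ∀ s ∈ Icc (-δ) δ, HasDerivWithinAt (fun s => B (J z s u) (J z s w)) 0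
      (Icc (-δ) δ) s := by
    intro s hs
    have hu := (h.jacobian_deriv z hz s hs).clm_apply (hasDerivWithinAt_const s (Icc (-δ) δ) u)
    have hw := (h.jacobian_deriv z hz s hs).clm_apply (hasDerivWithinAt_const s (Icc (-δ) δ) w)
    simp only [map_zero, add_zero, ContinuousLinearMap.comp_apply] at hu hw
    have h1 := B.hasFDerivAt.comp_hasDerivWithinAt s hu
    have h2 := h1.clm_apply hw
    refine h2.congr_deriv ?_
    exact hB _ (h.mem z hz s hs) _ _
  have := (convex_Icc (-δ) δ).norm_image_sub_le_of_norm_hasDerivWithin_le (C := 0) hd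
    (by simp) h0 ht
  rw [zero_mul, norm_le_zero_iff, sub_eq_zero, h.jacobian_zero z hz] at this
  exact this

end LocalFlow

section HamiltonFlow

variable {E : Type*} [NormedAddCommGroup E] [NormedSpace ℝ E] [FiniteDimensional ℝ E]

/-- The Hamilton vector field of a function on `E × E*`. -/
def hamiltonModel (f : E × (E →L[ℝ] ℝ) → ℝ) (z : E × (E →L[ℝ] ℝ)) : E × (E →L[ℝ] ℝ) :=
  sharp E (fderiv ℝ f z)

theorem contDiffAt_clm_comp_fderiv {V W : Type*} [NormedAddCommGroup V]
    [NormedSpace ℝ V] [NormedAddCommGroup W] [NormedSpace ℝ W] (S : (V →L[ℝ] ℝ) →L[ℝ] W)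
    {f : V → ℝ} {z : V} (hf : ContDiffAt ℝ ∞ f z) :
    ContDiffAt ℝ ∞ (fun z => S (fderiv ℝ f z)) z :=
  S.contDiff.contDiffAt.comp z (hf.fderiv_right (m := ∞) (by simp))

theorem fderiv_clm_comp_fderiv {V W : Type*} [NormedAddCommGroup V]
    [NormedSpace ℝ V] [NormedAddCommGroup W] [NormedSpace ℝ W] (S : (V →L[ℝ] ℝ) →L[ℝ] W)
    {f : V → ℝ} {z : V} (hf : ContDiffAt ℝ ∞ f z) (u : V) :
    fderiv ℝ (fun z => S (fderiv ℝ f z)) z u = S (fderiv ℝ (fderiv ℝ f) z u) := by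
  have h1 : DifferentiableAt ℝ (fderiv ℝ f) z :=
    (hf.fderiv_right (m := ∞) (by simp)).differentiableAt (by simp)
  have h3 : HasFDerivAt (fun z => S (fderiv ℝ f z)) (S.comp (fderiv ℝ (fderiv ℝ f) z)) z :=
    S.hasFDerivAt.comp z h1.hasFDerivAt
  rw [h3.fderiv]; rfl

theorem contDiffAt_hamiltonModel {f : E × (E →L[ℝ] ℝ) → ℝ} {z : E × (E →L[ℝ] ℝ)}
    (hf : ContDiffAt ℝ ∞ f z) : ContDiffAt ℝ ∞ (hamiltonModel f) z :=
  contDiffAt_clm_comp_fderiv (V := E × (E →L[ℝ] ℝ)) (sharp E) hf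

/-- The symmetry of the second derivative of `f`, as a property of its Hamilton vector field. -/
theorem hamiltonModel_infinitesimally_symplectic {f : E × (E →L[ℝ] ℝ) → ℝ}
    {z : E × (E →L[ℝ] ℝ)} (hf : ContDiffAt ℝ ∞ f z) (u w : E × (E →L[ℝ] ℝ)) :
    symplecticModel E (fderiv ℝ (hamiltonModel f) z u) w +
      symplecticModel E u (fderiv ℝ (hamiltonModel f) z w) = 0 := by
  have h2 : ∀ u, fderiv ℝ (hamiltonModel f) z u = sharp E (fderiv ℝ (fderiv ℝ f) z u) :=
    fun u => fderiv_clm_comp_fderiv (V := E × (E →L[ℝ] ℝ)) (sharp E) hf u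
  rw [symplecticModel_swap u, h2, h2, symplecticModel_sharp, symplecticModel_sharp]
  have hsym : IsSymmSndFDerivAt ℝ f z := hf.isSymmSndFDerivAt (by simp; norm_cast)
  rw [hsym u w]; ring

end HamiltonFlow

/-! ### The energy as a function of the spatial momentum -/

section Conorm

variable {E : Type*} [NormedAddCommGroup E] [NormedSpace ℝ E] [FiniteDimensional ℝ E]

/-- The norm square of a covector for the inner product `b`. -/
def conormSq (b : E →L[ℝ] E →L[ℝ] ℝ) (η : E →L[ℝ] ℝ) : ℝ := η (b.inverse η)

/-- The energy of a particle of mass `m` with spatial momentum `η`, for the spatial metric `b`, the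
lapse `N` and the shift `β`. -/
def energyOf (b : E →L[ℝ] E →L[ℝ] ℝ) (N : ℝ) (β : E) (m : ℝ) (η : E →L[ℝ] ℝ) : ℝ :=
  η β + N * √(m ^ 2 + conormSq b η)

variable {b : E →L[ℝ] E →L[ℝ] ℝ} (hs : ∀ v w, b v w = b w v) (hp : ∀ v, v ≠ 0 → 0 < b v v)

include hp in
theorem isInvertible_of_pos : b.IsInvertible :=
  isInvertible_of_nondegenerate b fun u hu => by
    by_contra h
    exact (hp u h).ne' (hu u)

include hp in
theorem apply_inverse_of_pos (η : E →L[ℝ] ℝ) : b (b.inverse η) = η :=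
  (isInvertible_of_pos hp).self_apply_inverse η

include hp in
theorem conormSq_eq (η : E →L[ℝ] ℝ) : conormSq b η = b (b.inverse η) (b.inverse η) := by
  rw [conormSq, apply_inverse_of_pos hp]

include hp in
theorem nonneg_of_pos (v : E) : 0 ≤ b v v := by
  rcases eq_or_ne v 0 with rfl | h
  · simp
  · exact (hp v h).le

include hp in
theorem conormSq_nonneg (η : E →L[ℝ] ℝ) : 0 ≤ conormSq b η := by
  rw [conormSq_eq hp]; exact nonneg_of_pos hp _

include hs hp in
/-- The Cauchy-Schwarz inequality. -/
theorem apply_sq_le (v w : E) : b v w ^ 2 ≤ b v v * b w w := by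
  have h0 := nonneg_of_pos hp (b w w • v - b v w • w)
  simp only [map_sub, map_smul, _root_.sub_apply, _root_.smul_apply,
    smul_eq_mul] at h0
  rw [hs w v] at h0
  rcases eq_or_ne w 0 with rfl | hw
  · simp
  · have hw' := hp w hw
    have h1 : 0 ≤ b w w * (b v v * b w w - b v w ^ 2) := by nlinarith
    nlinarith [nonneg_of_mul_nonneg_right h1 hw']

include hs hp in
theorem apply_sq_le_conormSq (η : E →L[ℝ] ℝ) (β : E) : η β ^ 2 ≤ conormSq b η * b β β := by
  have := apply_sq_le hs hp (b.inverse η) β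
  rwa [apply_inverse_of_pos hp, ← conormSq] at this

variable {N : ℝ} (hN : 0 < N) {β : E} (hβ : b β β < N ^ 2)

include hs hp hN hβ in
/-- Since `∂_t` is timelike, the shift term of the energy is dominated by the other one. -/
theorem abs_apply_lt {m : ℝ} (hm : m ≠ 0) (η : E →L[ℝ] ℝ) :
    |η β| < N * √(m ^ 2 + conormSq b η) := by
  have h1 := apply_sq_le_conormSq hs hp η β
  have h2 := conormSq_nonneg hp η
  have h3 := nonneg_of_pos hp β
  have hm2 : 0 < m ^ 2 := by positivity
  apply abs_lt_of_sq_lt_sq _ (by positivity)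
  rw [mul_pow, Real.sq_sqrt (by positivity)]
  nlinarith

include hs hp hN hβ in
theorem energyOf_pos {m : ℝ} (hm : m ≠ 0) (η : E →L[ℝ] ℝ) : 0 < energyOf b N β m η := by
  have := abs_apply_lt hs hp hN hβ hm η
  rw [energyOf]
  linarith [neg_abs_le (η β)]

include hs hp hN hβ in
/-- The positive solution `τ` of the mass shell equation is the energy. -/
theorem eq_energyOf {m τ : ℝ} (hm : m ≠ 0) {η : E →L[ℝ] ℝ} (hτ : 0 < τ)
    (h : (τ - η β) ^ 2 = N ^ 2 * (m ^ 2 + conormSq b η)) : τ = energyOf b N β m η := by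
  have h1 := abs_apply_lt hs hp hN hβ hm η
  have h2 := conormSq_nonneg hp η
  have h3 : (τ - η β) ^ 2 = (N * √(m ^ 2 + conormSq b η)) ^ 2 := by
    rw [mul_pow, Real.sq_sqrt (by positivity), h]
  rw [energyOf]
  rcases sq_eq_sq_iff_eq_or_eq_neg.1 h3 with h4 | h4
  · linarith
  · linarith [le_abs_self (η β)]

theorem conormSq_smul (b : E →L[ℝ] E →L[ℝ] ℝ) (s : ℝ) (η : E →L[ℝ] ℝ) :
    conormSq b (s • η) = s ^ 2 * conormSq b η := by
  simp only [conormSq, map_smul, _root_.smul_apply, smul_eq_mul]; ring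

/-- The energy is homogeneous of degree one in the mass and the momentum together. -/
theorem energyOf_smul (b : E →L[ℝ] E →L[ℝ] ℝ) (N : ℝ) (β : E) {m : ℝ} (hm : 0 < m)
    (η : E →L[ℝ] ℝ) : energyOf b N β m (m • η) = m * energyOf b N β 1 η := by
  have : √(m ^ 2 + m ^ 2 * conormSq b η) = m * √(1 ^ 2 + conormSq b η) := by
    rw [show m ^ 2 + m ^ 2 * conormSq b η = m ^ 2 * (1 ^ 2 + conormSq b η) by ring,
      Real.sqrt_mul (by positivity), Real.sqrt_sq hm.le]
  rw [energyOf, energyOf, conormSq_smul, this]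
  simp only [_root_.smul_apply, smul_eq_mul]; ring

end Conorm

/-! ### Stationary data in coordinates -/

/-- Stationary data `(h, N, β)` on an open subset of a vector space. -/
structure LocalData (E : Type*) [NormedAddCommGroup E] [NormedSpace ℝ E] where
  domain : Set E
  isOpen_domain : IsOpen domain
  h : E → E →L[ℝ] E →L[ℝ] ℝ
  N : E → ℝ
  β : E → E
  smooth_h : ContDiffOn ℝ ∞ h domain
  smooth_N : ContDiffOn ℝ ∞ N domain
  smooth_β : ContDiffOn ℝ ∞ β domain
  symm : ∀ x ∈ domain, ∀ v w, h x v w = h x w v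
  pos : ∀ x ∈ domain, ∀ v, v ≠ 0 → 0 < h x v v
  N_pos : ∀ x ∈ domain, 0 < N x
  timelike : ∀ x ∈ domain, h x (β x) (β x) < N x ^ 2

namespace LocalData

variable {E : Type*} [NormedAddCommGroup E] [NormedSpace ℝ E] [FiniteDimensional ℝ E]
  (A : LocalData E)

/-- The function `N² - |β|²`. -/
def normSq (x : E) : ℝ := A.N x ^ 2 - A.h x (A.β x) (A.β x)

theorem normSq_pos {x : E} (hx : x ∈ A.domain) : 0 < A.normSq x := by
  have := A.timelike x hx
  rw [normSq]; linarith

/-- The energy of a particle of mass `m`, as a function on phase space. -/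
def H (m : ℝ) (w : E × (E →L[ℝ] ℝ)) : ℝ := energyOf (A.h w.1) (A.N w.1) (A.β w.1) m w.2

/-- The geodesic Hamiltonian in coordinates. -/
def K (z : (ℝ × E) × ((ℝ × E) →L[ℝ] ℝ)) : ℝ :=
  (-(z.2 (1, 0) - z.2 (0, A.β z.1.2)) ^ 2 / A.N z.1.2 ^ 2 +
    conormSq (A.h z.1.2) (z.2.comp (ContinuousLinearMap.inr ℝ ℝ E))) / 2

/-- The phase space point below a point of the cotangent bundle of spacetime. -/
def spatial (E : Type*) [NormedAddCommGroup E] [NormedSpace ℝ E] :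
    ((ℝ × E) × ((ℝ × E) →L[ℝ] ℝ)) →L[ℝ] (E × (E →L[ℝ] ℝ)) :=
  ((ContinuousLinearMap.snd ℝ ℝ E).comp (ContinuousLinearMap.fst ℝ _ _)).prod
    (((ContinuousLinearMap.compL ℝ E (ℝ × E) ℝ).flip (ContinuousLinearMap.inr ℝ ℝ E)).comp
      (ContinuousLinearMap.snd ℝ _ _))

theorem spatial_apply (z : (ℝ × E) × ((ℝ × E) →L[ℝ] ℝ)) :
    spatial E z = (z.1.2, z.2.comp (ContinuousLinearMap.inr ℝ ℝ E)) := rfl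

/-- The energy coordinate `τ`. -/
def tauL (E : Type*) [NormedAddCommGroup E] [NormedSpace ℝ E] :
    ((ℝ × E) × ((ℝ × E) →L[ℝ] ℝ)) →L[ℝ] ℝ :=
  (ContinuousLinearMap.apply ℝ ℝ ((1, 0) : ℝ × E)).comp (ContinuousLinearMap.snd ℝ _ _)

theorem tauL_apply (z : (ℝ × E) × ((ℝ × E) →L[ℝ] ℝ)) : tauL E z = z.2 (1, 0) := rfl

theorem contDiffAt_conormSq {w : E × (E →L[ℝ] ℝ)} (hw : w.1 ∈ A.domain) :
    ContDiffAt ℝ ∞ (fun w : E × (E →L[ℝ] ℝ) => conormSq (A.h w.1) w.2) w := by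
  have h1 : ContDiffAt ℝ ∞ (fun w : E × (E →L[ℝ] ℝ) => A.h w.1) w :=
    ContDiffAt.comp (g := A.h) w (A.smooth_h.contDiffAt (A.isOpen_domain.mem_nhds hw))
      contDiffAt_fst
  obtain ⟨e, he⟩ := isInvertible_of_pos (A.pos _ hw)
  have h2 : ContDiffAt ℝ ∞ (fun w : E × (E →L[ℝ] ℝ) => (A.h w.1).inverse) w := by
    refine ContDiffAt.comp (g := ContinuousLinearMap.inverse) w ?_ h1
    rw [← he]
    exact contDiffAt_map_inverse e
  exact contDiffAt_snd.clm_apply (h2.clm_apply contDiffAt_snd)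

theorem contDiffAt_pairing {w : E × (E →L[ℝ] ℝ)} (hw : w.1 ∈ A.domain) :
    ContDiffAt ℝ ∞ (fun w : E × (E →L[ℝ] ℝ) => w.2 (A.β w.1)) w :=
  contDiffAt_snd.clm_apply (ContDiffAt.comp (g := A.β) w
    (A.smooth_β.contDiffAt (A.isOpen_domain.mem_nhds hw)) contDiffAt_fst)

theorem contDiffAt_lapse {w : E × (E →L[ℝ] ℝ)} (hw : w.1 ∈ A.domain) :
    ContDiffAt ℝ ∞ (fun w : E × (E →L[ℝ] ℝ) => A.N w.1) w :=
  ContDiffAt.comp (g := A.N) w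
    (A.smooth_N.contDiffAt (A.isOpen_domain.mem_nhds hw)) contDiffAt_fst

theorem contDiffAt_root {m : ℝ} (hm : m ≠ 0) {w : E × (E →L[ℝ] ℝ)} (hw : w.1 ∈ A.domain) :
    ContDiffAt ℝ ∞ (fun w : E × (E →L[ℝ] ℝ) =>
      A.N w.1 * √(m ^ 2 + conormSq (A.h w.1) w.2)) w := by
  have := conormSq_nonneg (A.pos _ hw) w.2
  exact (A.contDiffAt_lapse hw).mul ((contDiffAt_const.add (A.contDiffAt_conormSq hw)).sqrt
    (by positivity))

theorem contDiffAt_H {m : ℝ} (hm : m ≠ 0) {w : E × (E →L[ℝ] ℝ)} (hw : w.1 ∈ A.domain) :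
    ContDiffAt ℝ ∞ (A.H m) w :=
  (A.contDiffAt_pairing hw).add (A.contDiffAt_root hm hw)

/-- The factor by which the mass shell function differs from `τ - H`. -/
def shellFactor (m : ℝ) (z : (ℝ × E) × ((ℝ × E) →L[ℝ] ℝ)) : ℝ :=
  -(tauL E z - (spatial E z).2 (A.β (spatial E z).1) +
    A.N (spatial E z).1 * √(m ^ 2 + conormSq (A.h (spatial E z).1) (spatial E z).2)) /
      (2 * A.N (spatial E z).1 ^ 2)

/-- The difference of the geodesic Hamiltonian and its value `-m²/2` on the mass shell has the factor
`τ - H`. -/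
theorem K_eq (m : ℝ) {z : (ℝ × E) × ((ℝ × E) →L[ℝ] ℝ)} (hz : z.1.2 ∈ A.domain) :
    A.K z = -m ^ 2 / 2 + (tauL E z - A.H m (spatial E z)) * A.shellFactor m z := by
  have hN := A.N_pos _ hz
  have hq := conormSq_nonneg (A.pos _ hz) (z.2.comp (ContinuousLinearMap.inr ℝ ℝ E))
  have hsq := Real.sq_sqrt (show 0 ≤ m ^ 2 +
    conormSq (A.h z.1.2) (z.2.comp (ContinuousLinearMap.inr ℝ ℝ E)) by positivity)
  have hb : (z.2.comp (ContinuousLinearMap.inr ℝ ℝ E)) (A.β z.1.2) = z.2 (0, A.β z.1.2) := rfl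
  simp only [K, shellFactor, H, energyOf, spatial_apply, tauL_apply, hb]
  set s := √(m ^ 2 + conormSq (A.h z.1.2) (z.2.comp (ContinuousLinearMap.inr ℝ ℝ E)))
  have : conormSq (A.h z.1.2) (z.2.comp (ContinuousLinearMap.inr ℝ ℝ E)) = s ^ 2 - m ^ 2 := by
    linarith
  rw [this]
  field_simp
  ring

theorem contDiffAt_shellFactor {m : ℝ} (hm : m ≠ 0) {z : (ℝ × E) × ((ℝ × E) →L[ℝ] ℝ)}
    (hz : z.1.2 ∈ A.domain) : ContDiffAt ℝ ∞ (A.shellFactor m) z := by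
  have hs : ContDiffAt ℝ ∞ (spatial E) z := (spatial E).contDiff.contDiffAt
  have ht : ContDiffAt ℝ ∞ (tauL E) z := (tauL E).contDiff.contDiffAt
  have h1 := ContDiffAt.comp z (A.contDiffAt_pairing (w := spatial E z) hz) hs
  have h2 := ContDiffAt.comp z (A.contDiffAt_root hm (w := spatial E z) hz) hs
  have h3 := ContDiffAt.comp z (A.contDiffAt_lapse (w := spatial E z) hz) hs
  exact ((ht.sub h1).add h2).neg.div (contDiffAt_const.mul (h3.pow 2))
    (by have := A.N_pos _ hz; simp [spatial_apply]; exact this.ne')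

theorem contDiffAt_K {z : (ℝ × E) × ((ℝ × E) →L[ℝ] ℝ)} (hz : z.1.2 ∈ A.domain) :
    ContDiffAt ℝ ∞ A.K z := by
  have hs : ContDiffAt ℝ ∞ (spatial E) z := (spatial E).contDiff.contDiffAt
  have ht : ContDiffAt ℝ ∞ (tauL E) z := (tauL E).contDiff.contDiffAt
  have h1 := ContDiffAt.comp z (A.contDiffAt_H (m := 1) one_ne_zero (w := spatial E z) hz) hs
  have h2 : ContDiffAt ℝ ∞ (fun z => -1 ^ 2 / 2 + (tauL E z - A.H 1 (spatial E z)) *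
      A.shellFactor 1 z) z :=
    contDiffAt_const.add ((ht.sub h1).mul (A.contDiffAt_shellFactor one_ne_zero hz))
  refine h2.congr_of_eventuallyEq ?_
  have hc : Continuous fun z : (ℝ × E) × ((ℝ × E) →L[ℝ] ℝ) => z.1.2 := by fun_prop
  filter_upwards [hc.continuousAt.preimage_mem_nhds (A.isOpen_domain.mem_nhds hz)] with z' hz'
  exact A.K_eq 1 hz'

/-- On the mass shell, the differential of the geodesic Hamiltonian is a negative multiple of
`dτ - dH`. -/
theorem fderiv_K {m : ℝ} (hm : m ≠ 0) {z : (ℝ × E) × ((ℝ × E) →L[ℝ] ℝ)}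
    (hz : z.1.2 ∈ A.domain) (hτ : tauL E z = A.H m (spatial E z)) :
    A.shellFactor m z < 0 ∧ ∀ u, fderiv ℝ A.K z u =
      A.shellFactor m z * (tauL E u - fderiv ℝ (A.H m) (spatial E z) (spatial E u)) := by
  constructor
  · have hN := A.N_pos _ hz
    have hq := conormSq_nonneg (A.pos _ hz) (z.2.comp (ContinuousLinearMap.inr ℝ ℝ E))
    rw [shellFactor, hτ, H, energyOf]
    apply div_neg_of_neg_of_pos
    · simp only [spatial_apply]
      have : 0 < A.N z.1.2 * √(m ^ 2 +
        conormSq (A.h z.1.2) (z.2.comp (ContinuousLinearMap.inr ℝ ℝ E))) := by positivity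
      linarith
    · simp only [spatial_apply]; positivity
  · intro u
    have h1 : HasFDerivAt (fun z => A.H m (spatial E z))
        ((fderiv ℝ (A.H m) (spatial E z)).comp (spatial E)) z :=
      HasFDerivAt.comp z ((A.contDiffAt_H hm (w := spatial E z) hz).differentiableAt
        (by simp)).hasFDerivAt (spatial E).hasFDerivAt
    have h2 := ((A.contDiffAt_shellFactor hm hz).differentiableAt (by simp)).hasFDerivAt
    have h3 := (((tauL E).hasFDerivAt (x := z)).sub h1).mul h2
    have hc : Continuous fun z : (ℝ × E) × ((ℝ × E) →L[ℝ] ℝ) => z.1.2 := by fun_prop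
    have h4 : HasFDerivAt A.K _ z := (h3.const_add (-m ^ 2 / 2)).congr_of_eventuallyEq (by
      filter_upwards [hc.continuousAt.preimage_mem_nhds (A.isOpen_domain.mem_nhds hz)] with z' hz'
      exact A.K_eq m hz')
    rw [h4.fderiv]
    simp [hτ]

end LocalData

/-! ### The geodesic Hamiltonian in the charts of a stationary spacetime -/

namespace StationaryData

variable {r : ℕ} {Sig : Type*} [TopologicalSpace Sig]
  [ChartedSpace (EuclideanSpace ℝ (Fin r)) Sig] [IsManifold (𝓡 r) ∞ Sig]
  (D : StationaryData r Sig)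

/-- The differential of the inverse of the chart at `a`. -/
def chartFrame (a : Sig) (y : EuclideanSpace ℝ (Fin r)) :
    EuclideanSpace ℝ (Fin r) →L[ℝ] EuclideanSpace ℝ (Fin r) :=
  mfderiv (𝓡 r) (𝓡 r) (chartAt (EuclideanSpace ℝ (Fin r)) a).symm y

theorem chartFrame_eq {a : Sig} {y : EuclideanSpace ℝ (Fin r)}
    (hy : y ∈ (chartAt (EuclideanSpace ℝ (Fin r)) a).target) :
    chartFrame a y = (trivializationAt (EuclideanSpace ℝ (Fin r)) (TangentSpace (𝓡 r)) a).symmL ℝ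
      ((chartAt (EuclideanSpace ℝ (Fin r)) a).symm y) := by
  have hx := (chartAt (EuclideanSpace ℝ (Fin r)) a).map_target hy
  rw [TangentBundle.symmL_trivializationAt hx]
  have h1 : extChartAt (𝓡 r) a ((chartAt (EuclideanSpace ℝ (Fin r)) a).symm y) = y :=
    (chartAt (EuclideanSpace ℝ (Fin r)) a).right_inv hy
  rw [ModelWithCorners.range_eq_univ, mfderivWithin_univ]
  rw [h1]
  rfl

theorem mem_baseSet {a x : Sig} (hx : x ∈ (chartAt (EuclideanSpace ℝ (Fin r)) a).source) :
    x ∈ (trivializationAt (EuclideanSpace ℝ (Fin r)) (TangentSpace (𝓡 r)) a).baseSet := hx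

/-- The differential of the chart at `a`. -/
def chartCoframe (a : Sig) (y : EuclideanSpace ℝ (Fin r)) :
    EuclideanSpace ℝ (Fin r) →L[ℝ] EuclideanSpace ℝ (Fin r) :=
  (trivializationAt (EuclideanSpace ℝ (Fin r)) (TangentSpace (𝓡 r)) a).continuousLinearMapAt ℝ
      ((chartAt (EuclideanSpace ℝ (Fin r)) a).symm y)

theorem chartFrame_chartCoframe {a : Sig} {y : EuclideanSpace ℝ (Fin r)}
    (hy : y ∈ (chartAt (EuclideanSpace ℝ (Fin r)) a).target) (v : EuclideanSpace ℝ (Fin r)) :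
    chartFrame a y (chartCoframe a y v) = v := by
  rw [chartFrame_eq hy]
  exact Bundle.Trivialization.symmL_continuousLinearMapAt _
    (mem_baseSet ((chartAt (EuclideanSpace ℝ (Fin r)) a).map_target hy)) v

theorem chartCoframe_chartFrame {a : Sig} {y : EuclideanSpace ℝ (Fin r)}
    (hy : y ∈ (chartAt (EuclideanSpace ℝ (Fin r)) a).target) (v : EuclideanSpace ℝ (Fin r)) :
    chartCoframe a y (chartFrame a y v) = v := by
  rw [chartFrame_eq hy]
  exact Bundle.Trivialization.continuousLinearMapAt_symmL _
    (mem_baseSet ((chartAt (EuclideanSpace ℝ (Fin r)) a).map_target hy)) v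

theorem chartFrame_ne_zero {a : Sig} {y v : EuclideanSpace ℝ (Fin r)}
    (hy : y ∈ (chartAt (EuclideanSpace ℝ (Fin r)) a).target) (hv : v ≠ 0) :
    chartFrame a y v ≠ 0 := fun h0 => hv (by
  rw [← chartCoframe_chartFrame hy v, h0, map_zero])

theorem chartCoframe_eq {a : Sig} {y : EuclideanSpace ℝ (Fin r)}
    (hy : y ∈ (chartAt (EuclideanSpace ℝ (Fin r)) a).target)
    (v : TangentSpace (𝓡 r) ((chartAt (EuclideanSpace ℝ (Fin r)) a).symm y)) :
    chartCoframe a y v = (trivializationAt (EuclideanSpace ℝ (Fin r)) (TangentSpace (𝓡 r)) a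
      ⟨(chartAt (EuclideanSpace ℝ (Fin r)) a).symm y, v⟩).2 := by
  have := Bundle.Trivialization.coe_linearMapAt_of_mem (R := ℝ)
    (trivializationAt (EuclideanSpace ℝ (Fin r)) (TangentSpace (𝓡 r)) a)
    (mem_baseSet ((chartAt (EuclideanSpace ℝ (Fin r)) a).map_target hy))
  exact congrFun this v

theorem contMDiffOn_chart_symm_top (a : Sig) : ContMDiffOn (𝓡 r) (𝓡 r) ∞
    (chartAt (EuclideanSpace ℝ (Fin r)) a).symm
    (chartAt (EuclideanSpace ℝ (Fin r)) a).target :=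
  contMDiffOn_chart_symm

theorem contMDiffOn_chartFrame (a : Sig) (v : EuclideanSpace ℝ (Fin r)) :
    ContMDiffOn (𝓡 r) (𝓡 r).tangent ∞
      (fun y => (⟨(chartAt (EuclideanSpace ℝ (Fin r)) a).symm y, chartFrame a y v⟩ :
        TangentBundle (𝓡 r) Sig)) (chartAt (EuclideanSpace ℝ (Fin r)) a).target := by
  set e := chartAt (EuclideanSpace ℝ (Fin r)) a
  set τ := trivializationAt (EuclideanSpace ℝ (Fin r)) (TangentSpace (𝓡 r) (M := Sig)) a
  have h1 := Bundle.Trivialization.contMDiffOn_symm (IB := 𝓡 r) (n := ∞) τ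
  have h2 : ContMDiffOn (𝓡 r) ((𝓡 r).prod 𝓘(ℝ, EuclideanSpace ℝ (Fin r))) ∞
      (fun y => (e.symm y, v)) e.target :=
    (contMDiffOn_chart_symm_top a).prodMk contMDiffOn_const
  have h3 := h1.comp h2 (by
    intro y hy
    rw [mem_preimage, τ.mem_target]
    exact mem_baseSet (e.map_target hy))
  refine h3.congr fun y hy => ?_
  have h4 : τ.symm (e.symm y) v = chartFrame a y v :=
    (τ.symmL_apply (R := ℝ) (mem_baseSet (e.map_target hy)) v).symm.trans
      (DFunLike.congr_fun (chartFrame_eq hy) v).symm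
  exact (congrArg (Bundle.TotalSpace.mk (e.symm y)) h4.symm).trans
    (τ.mk_symm (mem_baseSet (e.map_target hy)) v)

/-- The metric `h` in the chart at `a`. -/
def chartMetric (a : Sig) (y : EuclideanSpace ℝ (Fin r)) :
    EuclideanSpace ℝ (Fin r) →L[ℝ] EuclideanSpace ℝ (Fin r) →L[ℝ] ℝ :=
  ContinuousLinearMap.bilinearComp (E := EuclideanSpace ℝ (Fin r))
    (F := EuclideanSpace ℝ (Fin r))
    (D.h.inner ((chartAt (EuclideanSpace ℝ (Fin r)) a).symm y)) (chartFrame a y) (chartFrame a y)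

theorem chartMetric_apply (a : Sig) (y u v : EuclideanSpace ℝ (Fin r)) :
    D.chartMetric a y u v = D.h.inner ((chartAt (EuclideanSpace ℝ (Fin r)) a).symm y)
      (chartFrame a y u) (chartFrame a y v) := rfl

theorem chartMetric_pos {a : Sig} {y v : EuclideanSpace ℝ (Fin r)}
    (hy : y ∈ (chartAt (EuclideanSpace ℝ (Fin r)) a).target) (hv : v ≠ 0) :
    0 < D.chartMetric a y v v :=
  D.h.pos ((chartAt (EuclideanSpace ℝ (Fin r)) a).symm y) (chartFrame a y v)
    (chartFrame_ne_zero hy hv)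

/-- The shift vector field `β` in the chart at `a`. -/
def chartShift (a : Sig) (y : EuclideanSpace ℝ (Fin r)) : EuclideanSpace ℝ (Fin r) :=
  chartCoframe a y (D.β ((chartAt (EuclideanSpace ℝ (Fin r)) a).symm y))

theorem chartFrame_chartShift {a : Sig} {y : EuclideanSpace ℝ (Fin r)}
    (hy : y ∈ (chartAt (EuclideanSpace ℝ (Fin r)) a).target) :
    chartFrame a y (D.chartShift a y) = D.β ((chartAt (EuclideanSpace ℝ (Fin r)) a).symm y) :=
  chartFrame_chartCoframe hy _

theorem chartMetric_chartShift {a : Sig} {y : EuclideanSpace ℝ (Fin r)}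
    (hy : y ∈ (chartAt (EuclideanSpace ℝ (Fin r)) a).target) :
    D.chartMetric a y (D.chartShift a y) (D.chartShift a y) =
      D.h.inner ((chartAt (EuclideanSpace ℝ (Fin r)) a).symm y)
        (D.β ((chartAt (EuclideanSpace ℝ (Fin r)) a).symm y))
        (D.β ((chartAt (EuclideanSpace ℝ (Fin r)) a).symm y)) := by
  rw [chartMetric_apply, D.chartFrame_chartShift hy]

/-- The stationary data in the chart at `a`. -/
def localData (a : Sig) : LocalData (EuclideanSpace ℝ (Fin r)) where
  domain := (chartAt (EuclideanSpace ℝ (Fin r)) a).target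
  isOpen_domain := (chartAt (EuclideanSpace ℝ (Fin r)) a).open_target
  h := D.chartMetric a
  N y := D.N ((chartAt (EuclideanSpace ℝ (Fin r)) a).symm y)
  β := D.chartShift a
  smooth_h := by
    rw [contDiffOn_clm_apply]
    intro v
    rw [contDiffOn_clm_apply]
    intro w
    rw [← contMDiffOn_iff_contDiffOn]
    intro y hy
    have h1 : ContMDiffWithinAt (𝓡 r) ((𝓡 r).prod 𝓘(ℝ, _)) ∞ _ _ _ :=
      (D.h.contMDiff.contMDiffAt (x := (chartAt (EuclideanSpace ℝ (Fin r)) a).symm y)).comp_contMDiffWithinAt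
        y (contMDiffOn_chart_symm_top a y hy)
    have h4 := ContMDiffWithinAt.clm_bundle_apply₂ (E₃ := Bundle.Trivial Sig ℝ)
      (b := (chartAt (EuclideanSpace ℝ (Fin r)) a).symm) (F₁ := EuclideanSpace ℝ (Fin r)) h1
      (contMDiffOn_chartFrame a v y hy)
      (contMDiffOn_chartFrame a w y hy)
    rw [Bundle.contMDiffWithinAt_totalSpace] at h4
    exact h4.2
  smooth_N := by
    rw [← contMDiffOn_iff_contDiffOn]
    exact D.smooth_N.comp_contMDiffOn (contMDiffOn_chart_symm_top a)
  smooth_β := by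
    rw [← contMDiffOn_iff_contDiffOn]
    set e := chartAt (EuclideanSpace ℝ (Fin r)) a
    set τ := trivializationAt (EuclideanSpace ℝ (Fin r)) (TangentSpace (𝓡 r) (M := Sig)) a
    have h1 := Bundle.Trivialization.contMDiffOn (IB := 𝓡 r) (n := ∞) τ
    have h2 := D.smooth_β.comp_contMDiffOn (contMDiffOn_chart_symm_top a)
    have h3 := h1.comp h2 (by
      intro y hy
      rw [mem_preimage, τ.mem_source]
      exact mem_baseSet (e.map_target hy))
    have h4 := contMDiffOn_snd (s := univ) |>.comp h3 (fun _ _ => mem_univ _)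
    refine h4.congr fun y hy => ?_
    exact chartCoframe_eq hy _
  symm y _ v w := D.h.symm _ _ _
  pos _ hy _ hv := D.chartMetric_pos hy hv
  N_pos y _ := D.N_pos _
  timelike y hy := by
    rw [D.chartMetric_chartShift hy]
    exact D.timelike _

theorem localData_normSq {a : Sig} {y : EuclideanSpace ℝ (Fin r)}
    (hy : y ∈ (chartAt (EuclideanSpace ℝ (Fin r)) a).target) :
    (D.localData a).normSq y = D.normSq ((chartAt (EuclideanSpace ℝ (Fin r)) a).symm y) := by
  change _ - D.chartMetric a y (D.chartShift a y) (D.chartShift a y) = _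
  rw [D.chartMetric_chartShift hy]
  rfl

/-- The zero covector at the point `(0, a)`; the charts of the cotangent bundle at these points
cover it. -/
def basePoint (a : Sig) : CotangentBundle (stModel r) (ℝ × Sig) := ⟨(0, a), 0⟩

theorem mem_cot_chart_source {a : Sig} {p : ℝ × Sig} :
    p ∈ (chartAt (ModelProd ℝ (EuclideanSpace ℝ (Fin r))) ((0 : ℝ), a)).source ↔
      p.2 ∈ (chartAt (EuclideanSpace ℝ (Fin r)) a).source := by
  have h : (chartAt (ModelProd ℝ (EuclideanSpace ℝ (Fin r))) ((0 : ℝ), a)).source =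
    (chartAt ℝ (0 : ℝ)).source ×ˢ (chartAt (EuclideanSpace ℝ (Fin r)) a).source := rfl
  rw [h, chartAt_self_eq, mem_prod]
  simp

theorem mem_cot_source {a : Sig} {ζ : CotangentBundle (stModel r) (ℝ × Sig)} :
    ζ ∈ (extChartAt (cotModel (stModel r)) (basePoint (r := r) a)).source ↔
      ζ.proj.2 ∈ (chartAt (EuclideanSpace ℝ (Fin r)) a).source := by
  rw [extChartAt_cot_source]
  exact mem_cot_chart_source

theorem mfderiv_extChartAt_prod_symm {a : Sig} {p : ℝ × EuclideanSpace ℝ (Fin r)}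
    (hp : p.2 ∈ (chartAt (EuclideanSpace ℝ (Fin r)) a).target) :
    mfderiv 𝓘(ℝ, ℝ × EuclideanSpace ℝ (Fin r)) (stModel r)
      (extChartAt (stModel r) ((0 : ℝ), a)).symm p =
    ((ContinuousLinearMap.id ℝ ℝ).prodMap (chartFrame a p.2) :
      (ℝ × EuclideanSpace ℝ (Fin r)) →L[ℝ] (ℝ × EuclideanSpace ℝ (Fin r))) := by
  have h1 : HasMFDerivAt 𝓘(ℝ, ℝ) 𝓘(ℝ, ℝ) (id : ℝ → ℝ) p.1 (ContinuousLinearMap.id ℝ ℝ) :=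
    hasMFDerivAt_id _
  have h2 : HasMFDerivAt (𝓡 r) (𝓡 r) (chartAt (EuclideanSpace ℝ (Fin r)) a).symm p.2 _ :=
    ((contMDiffOn_chart_symm_top a).contMDiffAt
      ((chartAt (EuclideanSpace ℝ (Fin r)) a).open_target.mem_nhds hp)).mdifferentiableAt
        (by simp) |>.hasMFDerivAt
  have h3 := HasMFDerivAt.prodMap (p := p) h1 h2
  have h4 : ((extChartAt (stModel r) ((0 : ℝ), a)).symm : _ → ℝ × Sig) =
      Prod.map id (chartAt (EuclideanSpace ℝ (Fin r)) a).symm := by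
    rfl
  rw [h4]
  rw [modelWithCornersSelf_prod, ← chartedSpaceSelf_prod]
  exact h3.mfderiv.trans
    (congrArg (fun L : ℝ →L[ℝ] ℝ => L.prodMap (chartFrame a p.2)) h1.mfderiv)

theorem cot_apply {a : Sig} {ζ : CotangentBundle (stModel r) (ℝ × Sig)}
    (h : ζ.proj.2 ∈ (chartAt (EuclideanSpace ℝ (Fin r)) a).source) :
    extChartAt (cotModel (stModel r)) (basePoint (r := r) a) ζ =
      ((ζ.proj.1, chartAt (EuclideanSpace ℝ (Fin r)) a ζ.proj.2),
        (covectorModel ζ).comp ((ContinuousLinearMap.id ℝ ℝ).prodMap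
          (chartFrame a (chartAt (EuclideanSpace ℝ (Fin r)) a ζ.proj.2)))) := by
  have hs := mem_cot_chart_source.2 h
  have h1 : extChartAt (stModel r) ((0 : ℝ), a) ζ.proj =
      (ζ.proj.1, chartAt (EuclideanSpace ℝ (Fin r)) a ζ.proj.2) := rfl
  have h2 := mfderiv_extChartAt_prod_symm (a := a)
    (p := (ζ.proj.1, chartAt (EuclideanSpace ℝ (Fin r)) a ζ.proj.2))
    ((chartAt (EuclideanSpace ℝ (Fin r)) a).map_source h)
  have h3 := TangentBundle.symmL_trivializationAt (I := stModel r) hs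
  rw [TangentBundle.symmL_trivializationAt_eq_core hs, ModelWithCorners.range_eq_univ,
    mfderivWithin_univ, h1] at h3
  rw [extChartAt_cot_apply (ζ₀ := basePoint (r := r) a) hs]
  refine Prod.ext h1 ?_
  have h4 : tangentCoordChange (stModel r) (basePoint (r := r) a).proj ζ.proj ζ.proj =
      (ContinuousLinearMap.id ℝ ℝ).prodMap
        (chartFrame a (chartAt (EuclideanSpace ℝ (Fin r)) a ζ.proj.2)) := h3.trans h2
  exact congrArg (fun L => (covectorModel ζ).comp L) h4

/-- The point of the cotangent bundle with given coordinates in the chart at `a`. -/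
def ofChart (a : Sig) (z : (ℝ × EuclideanSpace ℝ (Fin r)) ×
      ((ℝ × EuclideanSpace ℝ (Fin r)) →L[ℝ] ℝ)) : CotangentBundle (stModel r) (ℝ × Sig) :=
  ⟨(z.1.1, (chartAt (EuclideanSpace ℝ (Fin r)) a).symm z.1.2),
    z.2.comp ((ContinuousLinearMap.id ℝ ℝ).prodMap (chartCoframe a z.1.2))⟩

theorem cot_ofChart {a : Sig} {z : (ℝ × EuclideanSpace ℝ (Fin r)) ×
      ((ℝ × EuclideanSpace ℝ (Fin r)) →L[ℝ] ℝ)}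
    (hz : z.1.2 ∈ (chartAt (EuclideanSpace ℝ (Fin r)) a).target) :
    extChartAt (cotModel (stModel r)) (basePoint (r := r) a) (ofChart a z) = z := by
  have hs := (chartAt (EuclideanSpace ℝ (Fin r)) a).map_target hz
  rw [cot_apply (ζ := ofChart a z) hs]
  have h1 : chartAt (EuclideanSpace ℝ (Fin r)) a (ofChart a z).proj.2 = z.1.2 :=
    (chartAt (EuclideanSpace ℝ (Fin r)) a).right_inv hz
  rw [h1]
  refine Prod.ext rfl ?_
  refine ContinuousLinearMap.coe_injective (LinearMap.ext fun q => ?_)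
  change z.2 (q.1, chartCoframe a z.1.2 (chartFrame a z.1.2 q.2)) = z.2 q
  rw [chartCoframe_chartFrame hz]

theorem mem_cot_target {a : Sig} {z : (ℝ × EuclideanSpace ℝ (Fin r)) ×
      ((ℝ × EuclideanSpace ℝ (Fin r)) →L[ℝ] ℝ)} :
    z ∈ (extChartAt (cotModel (stModel r)) (basePoint (r := r) a)).target ↔
      z.1.2 ∈ (chartAt (EuclideanSpace ℝ (Fin r)) a).target := by
  constructor
  · intro h
    have h1 := (extChartAt (cotModel (stModel r)) (basePoint (r := r) a)).map_target h
    rw [mem_cot_source] at h1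
    have h2 := (extChartAt (cotModel (stModel r)) (basePoint (r := r) a)).right_inv h
    rw [cot_apply h1] at h2
    rw [← h2]
    exact (chartAt (EuclideanSpace ℝ (Fin r)) a).map_source h1
  · intro h
    rw [← cot_ofChart h]
    exact (extChartAt (cotModel (stModel r)) (basePoint (r := r) a)).map_source
      (mem_cot_source.2 ((chartAt (EuclideanSpace ℝ (Fin r)) a).map_target h))

theorem cot_symm {a : Sig} {z : (ℝ × EuclideanSpace ℝ (Fin r)) ×
      ((ℝ × EuclideanSpace ℝ (Fin r)) →L[ℝ] ℝ)}
    (hz : z.1.2 ∈ (chartAt (EuclideanSpace ℝ (Fin r)) a).target) :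
    (extChartAt (cotModel (stModel r)) (basePoint (r := r) a)).symm z = ofChart a z := by
  conv_lhs => rw [← cot_ofChart hz]
  exact (extChartAt (cotModel (stModel r)) (basePoint (r := r) a)).left_inv
    (mem_cot_source.2 ((chartAt (EuclideanSpace ℝ (Fin r)) a).map_target hz))

theorem inChart_energy {a : Sig} {z : (ℝ × EuclideanSpace ℝ (Fin r)) ×
      ((ℝ × EuclideanSpace ℝ (Fin r)) →L[ℝ] ℝ)}
    (hz : z.1.2 ∈ (chartAt (EuclideanSpace ℝ (Fin r)) a).target) :
    inChart (basePoint (r := r) a) energy z = LocalData.tauL _ z := by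
  rw [inChart, Function.comp_apply, cot_symm hz]
  change z.2 (1, chartCoframe a z.1.2 0) = z.2 (1, 0)
  rw [map_zero]

/-- The metric at a point, as a bilinear form on the model space. -/
def metricModel (p : ℝ × Sig) : (ℝ × EuclideanSpace ℝ (Fin r)) →L[ℝ]
    (ℝ × EuclideanSpace ℝ (Fin r)) →L[ℝ] ℝ :=
  D.metric p

/-- The metric `h` at a point, as a bilinear form on the model space. -/
def innerModel (x : Sig) : EuclideanSpace ℝ (Fin r) →L[ℝ] EuclideanSpace ℝ (Fin r) →L[ℝ] ℝ :=
  D.h.inner x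

/-- The shift vector at a point, as a vector in the model space. -/
def shiftModel (x : Sig) : EuclideanSpace ℝ (Fin r) := D.β x

theorem metricModel_apply (p : ℝ × Sig) (a b : ℝ) (v w : EuclideanSpace ℝ (Fin r)) :
    D.metricModel p (a, v) (b, w) = -(D.N p.2 ^ 2) * (a * b) +
      D.innerModel p.2 (v + a • D.shiftModel p.2) (w + b • D.shiftModel p.2) :=
  D.metric_apply p a b v w

theorem innerModel_pos (x : Sig) {v : EuclideanSpace ℝ (Fin r)} (hv : v ≠ 0) :
    0 < D.innerModel x v v := D.h.pos x v hv

theorem metricModel_isInvertible (p : ℝ × Sig) : (D.metricModel p).IsInvertible := by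
  refine isInvertible_of_nondegenerate (D.metricModel p) fun u hu => ?_
  obtain ⟨a, v⟩ := u
  have h1 : D.innerModel p.2 (v + a • D.shiftModel p.2) (v + a • D.shiftModel p.2) = 0 := by
    have := hu (0, v + a • D.shiftModel p.2)
    rw [metricModel_apply, zero_smul, add_zero] at this
    linarith
  have h2 : v + a • D.shiftModel p.2 = 0 := by
    by_contra h
    exact (D.innerModel_pos p.2 h).ne' h1
  have h3 : a = 0 := by
    have := hu (1, 0)
    rw [metricModel_apply, h2, map_zero, _root_.zero_apply] at this
    have hN := D.N_pos p.2
    have : a * D.N p.2 ^ 2 = 0 := by linarith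
    exact (mul_eq_zero.1 this).resolve_right (by positivity)
  subst h3
  rw [zero_smul, add_zero] at h2
  exact Prod.ext rfl h2

theorem inChart_geodesicHamiltonian {a : Sig} {z : (ℝ × EuclideanSpace ℝ (Fin r)) ×
      ((ℝ × EuclideanSpace ℝ (Fin r)) →L[ℝ] ℝ)}
    (hz : z.1.2 ∈ (chartAt (EuclideanSpace ℝ (Fin r)) a).target) :
    inChart (basePoint (r := r) a) (geodesicHamiltonian D.metric) z = (D.localData a).K z := by
  rw [inChart, Function.comp_apply, cot_symm hz, geodesicHamiltonian, LocalData.K]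
  congr 1
  set x := (chartAt (EuclideanSpace ℝ (Fin r)) a).symm z.1.2 with hx
  set η := z.2.comp (ContinuousLinearMap.inr ℝ ℝ (EuclideanSpace ℝ (Fin r)))
  set b := D.chartShift a z.1.2
  set s : ℝ := (η b - z.2 (1, 0)) / D.N x ^ 2 with hs
  set u := (D.chartMetric a z.1.2).inverse η
  have hu : D.chartMetric a z.1.2 u = η :=
    apply_inverse_of_pos (fun v hv => D.chartMetric_pos hz hv) η
  have hN := D.N_pos x
  have hz2 : ∀ q : ℝ × EuclideanSpace ℝ (Fin r), z.2 q = q.1 * z.2 (1, 0) + η q.2 := by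
    intro q
    have : q = q.1 • ((1 : ℝ), (0 : EuclideanSpace ℝ (Fin r))) + (0, q.2) := by ext <;> simp
    conv_lhs => rw [this, map_add, map_smul]
    rfl
  let ξ : (ℝ × EuclideanSpace ℝ (Fin r)) →L[ℝ] ℝ :=
    z.2.comp ((ContinuousLinearMap.id ℝ ℝ).prodMap (chartCoframe a z.1.2))
  let G := D.metricModel (z.1.1, x)
  have hinv : G.inverse ξ = (s, chartFrame a z.1.2 (u - s • b)) := by
    rw [(D.metricModel_isInvertible (z.1.1, x)).inverse_apply_eq]
    refine ContinuousLinearMap.coe_injective (LinearMap.ext fun q => ?_)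
    obtain ⟨s', v'⟩ := q
    obtain ⟨w, rfl⟩ : ∃ w, v' = chartFrame a z.1.2 w := ⟨_, (chartFrame_chartCoframe hz v').symm⟩
    have e0 : D.shiftModel x = chartFrame a z.1.2 b := (D.chartFrame_chartShift hz).symm
    have e2 : ∀ (c : ℝ) (v : EuclideanSpace ℝ (Fin r)),
        chartFrame a z.1.2 v + c • D.shiftModel x = chartFrame a z.1.2 (v + c • b) := by
      intro c v
      rw [map_add, map_smul, e0]
    have e3 : D.innerModel x (chartFrame a z.1.2 u) (chartFrame a z.1.2 (w + s' • b)) =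
        η (w + s' • b) := by
      rw [← hu]; rfl
    change z.2 (s', chartCoframe a z.1.2 (chartFrame a z.1.2 w)) = D.metricModel (z.1.1, x)
      (s, chartFrame a z.1.2 (u - s • b)) (s', chartFrame a z.1.2 w)
    rw [metricModel_apply, e2, e2, sub_add_cancel, e3, chartCoframe_chartFrame hz, hz2, map_add,
      map_smul]
    simp only [smul_eq_mul, hs]
    field_simp
    ring
  change ξ (G.inverse ξ) = _
  rw [hinv]
  change z.2 (s, chartCoframe a z.1.2 (chartFrame a z.1.2 (u - s • b))) =
    -(z.2 (1, 0) - η b) ^ 2 / D.N x ^ 2 + η u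
  rw [chartCoframe_chartFrame hz, hz2, map_sub, map_smul]
  simp only [smul_eq_mul, hs]
  field_simp
  ring

end StationaryData

/-! ### Hamiltonian flows on cotangent bundles -/

section Curves

variable {V : Type*} [NormedAddCommGroup V] [NormedSpace ℝ V]
  {V' : Type*} [NormedAddCommGroup V'] [NormedSpace ℝ V']
  {H : Type*} [TopologicalSpace H] {I : ModelWithCorners ℝ V H}
  {X : Type*} [TopologicalSpace X] [ChartedSpace H X]
  {H' : Type*} [TopologicalSpace H'] {I' : ModelWithCorners ℝ V' H'}
  {X' : Type*} [TopologicalSpace X'] [ChartedSpace H' X']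

theorem _root_.HasMFDerivWithinAt.comp_smulRight {γ : ℝ → X} {s : Set ℝ} {t : ℝ}
    {w : TangentSpace I (γ t)}
    (hγ : HasMFDerivWithinAt 𝓘(ℝ, ℝ) I γ s t ((1 : ℝ →L[ℝ] ℝ).smulRight w)) {F : X → X'}
    {L : TangentSpace I (γ t) →L[ℝ] TangentSpace I' (F (γ t))} (hF : HasMFDerivAt I I' F (γ t) L) :
    HasMFDerivWithinAt 𝓘(ℝ, ℝ) I' (F ∘ γ) s t ((1 : ℝ →L[ℝ] ℝ).smulRight (L w)) := by
  refine (HasMFDerivAt.comp_hasMFDerivWithinAt t hF hγ).congr_mfderiv ?_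
  exact ContinuousLinearMap.coe_injective (LinearMap.ext fun x => L.map_smul (x : ℝ) w)

/-- Velocities of curves in a vector space, in the language of manifolds. -/
theorem hasMFDerivWithinAt_smulRight_iff {c : ℝ → V} {s : Set ℝ} {t : ℝ} {w : V} :
    HasMFDerivWithinAt 𝓘(ℝ, ℝ) 𝓘(ℝ, V) c s t
      ((1 : ℝ →L[ℝ] ℝ).smulRight (M₂ := TangentSpace 𝓘(ℝ, V) (c t)) w) ↔
      HasDerivWithinAt c w s t := by
  have : HasDerivWithinAt c w s t ↔ HasFDerivWithinAt c ((1 : ℝ →L[ℝ] ℝ).smulRight w) s t := by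
    rw [hasFDerivWithinAt_iff_hasDerivWithinAt]
    simp
  rw [this]
  exact hasMFDerivWithinAt_iff_hasFDerivWithinAt

end Curves

section HamFlow

variable {E : Type*} [NormedAddCommGroup E] [NormedSpace ℝ E] [FiniteDimensional ℝ E]
  {H : Type*} [TopologicalSpace H] {I : ModelWithCorners ℝ E H} [I.Boundaryless]
  {X : Type*} [TopologicalSpace X] [ChartedSpace H X] [IsManifold I ∞ X]

instance [T2Space X] : T2Space (CotangentBundle I X) := by
  refine ⟨fun ζ ζ' hne => ?_⟩
  by_cases hp : ζ.proj = ζ'.proj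
  · set c := extChartAt (cotModel I) ζ
    have h1 : ζ ∈ c.source := by rw [extChartAt_cot_source]; exact mem_chart_source H ζ.proj
    have h2 : ζ' ∈ c.source := by
      rw [extChartAt_cot_source, mem_ofPred_eq, ← hp]; exact mem_chart_source H ζ.proj
    obtain ⟨U, V, hU, hV, hζU, hζV, hUV⟩ := t2_separation
      (fun h => hne (c.injOn h1 h2 h) : c ζ ≠ c ζ')
    have hc : ContinuousOn c c.source := continuousOn_extChartAt ζ
    have hs : IsOpen c.source := isOpen_extChartAt_source ζ
    exact ⟨c.source ∩ c ⁻¹' U, c.source ∩ c ⁻¹' V, hc.isOpen_inter_preimage hs hU,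
      hc.isOpen_inter_preimage hs hV, ⟨h1, hζU⟩, ⟨h2, hζV⟩,
      (hUV.preimage c).mono inter_subset_right inter_subset_right⟩
  · obtain ⟨U, V, hU, hV, hζU, hζV, hUV⟩ := t2_separation hp
    have hc : Continuous (fun ζ : CotangentBundle I X => ζ.proj) :=
      FiberBundle.continuous_proj _ _
    exact ⟨_, _, hU.preimage hc, hV.preimage hc, hζU, hζV, hUV.preimage _⟩

/-- The Hamiltonian flow of `f` moves `ζ` to `ζ'` in some nonnegative time. -/
def HamFlow (f : CotangentBundle I X → ℝ) (ζ ζ' : CotangentBundle I X) : Prop :=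
  ∃ (γ : ℝ → CotangentBundle I X) (a b : ℝ), a ≤ b ∧ γ a = ζ ∧ γ b = ζ' ∧
    IsMIntegralCurveOn (I := cotModel I) γ (hamiltonField f) (Icc a b)

variable {f : CotangentBundle I X → ℝ}

theorem IsMIntegralCurveOn.shift {γ : ℝ → CotangentBundle I X} {a b : ℝ}
    (h : IsMIntegralCurveOn (I := cotModel I) γ (hamiltonField f) (Icc a b)) (c : ℝ) :
    IsMIntegralCurveOn (I := cotModel I) (γ ∘ (· + c)) (hamiltonField f) (Icc (a - c) (b - c)) := by
  have h1 := h.comp_add c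
  refine h1.mono fun t ht => ?_
  change t + c ∈ Icc a b
  exact ⟨by linarith [ht.1], by linarith [ht.2]⟩

theorem HamFlow.exists_curve {ζ ζ' : CotangentBundle I X} (h : HamFlow f ζ ζ') :
    ∃ (γ : ℝ → CotangentBundle I X) (s : ℝ), 0 ≤ s ∧ γ 0 = ζ ∧ γ s = ζ' ∧
      IsMIntegralCurveOn (I := cotModel I) γ (hamiltonField f) (Icc 0 s) := by
  obtain ⟨γ, a, b, hab, ha, hb, hγ⟩ := h
  refine ⟨γ ∘ (· + a), b - a, by linarith, by simp [ha], by simp [hb], ?_⟩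
  have := IsMIntegralCurveOn.shift hγ a
  rwa [sub_self] at this

theorem HamFlow.refl (ζ : CotangentBundle I X) : HamFlow f ζ ζ := by
  refine ⟨fun _ => ζ, 0, 0, le_rfl, rfl, rfl, fun t ht => ⟨continuousWithinAt_const, ?_⟩⟩
  exact HasFDerivWithinAt.of_finite (E := ℝ) (F := E × (E →L[ℝ] ℝ))
    (((Icc_self (0 : ℝ)) ▸ finite_singleton (0 : ℝ) :
    (Icc (0 : ℝ) 0).Finite).subset inter_subset_left)

theorem HamFlow.trans {ζ ζ' ζ'' : CotangentBundle I X} (h1 : HamFlow f ζ ζ')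
    (h2 : HamFlow f ζ' ζ'') : HamFlow f ζ ζ'' := by
  obtain ⟨γ₁, a, b, hab, ha, hb, hγ₁⟩ := h1
  obtain ⟨γ₂, s, hs, h0, hs', hγ₂⟩ := h2.exists_curve
  have hγ₃ : IsMIntegralCurveOn (I := cotModel I) (γ₂ ∘ (· + -b)) (hamiltonField f)
      (Icc b (b + s)) := by
    have := IsMIntegralCurveOn.shift hγ₂ (-b)
    convert this using 2 <;> ring
  set γ₃ := γ₂ ∘ (· + -b)
  have hb3 : γ₃ b = γ₁ b := by simp [γ₃, h0, hb]
  set γ : ℝ → CotangentBundle I X := fun t => if t ≤ b then γ₁ t else γ₃ t with hγdef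
  have e1 : ∀ t ∈ Icc a b, γ t = γ₁ t := fun t ht => if_pos ht.2
  have e3 : ∀ t ∈ Icc b (b + s), γ t = γ₃ t := by
    intro t ht
    rcases ht.1.eq_or_lt with rfl | h
    · rw [hb3]; exact if_pos le_rfl
    · exact if_neg (not_le.2 h)
  refine ⟨γ, a, b + s, by linarith, by rw [e1 a ⟨le_rfl, hab⟩, ha], ?_, ?_⟩
  · rw [e3 _ ⟨by linarith, le_rfl⟩]; simp [γ₃, hs']
  have hU : Icc a (b + s) = Icc a b ∪ Icc b (b + s) :=
    (Icc_union_Icc_eq_Icc hab (by linarith)).symm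
  have d1 : ∀ t ∈ Icc a b, HasMFDerivWithinAt 𝓘(ℝ, ℝ) (cotModel I) γ (Icc a b) t
      ((1 : ℝ →L[ℝ] ℝ).smulRight (hamiltonField f (γ t))) := by
    intro t ht
    have := (hγ₁ t ht).congr_mono (f₁ := γ) (fun u hu => e1 u hu) (e1 t ht) subset_rfl
    rw [e1 t ht]
    exact this
  have d3 : ∀ t ∈ Icc b (b + s), HasMFDerivWithinAt 𝓘(ℝ, ℝ) (cotModel I) γ (Icc b (b + s)) t
      ((1 : ℝ →L[ℝ] ℝ).smulRight (hamiltonField f (γ t))) := by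
    intro t ht
    have := (hγ₃ t ht).congr_mono (f₁ := γ) (fun u hu => e3 u hu) (e3 t ht) subset_rfl
    rw [e3 t ht]
    exact this
  intro t ht
  rw [hU]
  rcases lt_trichotomy t b with h | h | h
  · have := d1 t ⟨ht.1, h.le⟩
    refine this.mono_of_mem_nhdsWithin ?_
    refine mem_nhdsWithin.2 ⟨Iio b, isOpen_Iio, h, ?_⟩
    rintro u ⟨hu, hu' | hu'⟩
    · exact hu'
    · exact absurd hu'.1 (not_le.2 hu)
  · subst h
    exact (d1 t ⟨hab, le_rfl⟩).union (d3 t ⟨le_rfl, by linarith⟩)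
  · have := d3 t ⟨h.le, ht.2⟩
    refine this.mono_of_mem_nhdsWithin ?_
    refine mem_nhdsWithin.2 ⟨Ioi b, isOpen_Ioi, h, ?_⟩
    rintro u ⟨hu, hu' | hu'⟩
    · exact absurd hu'.2 (not_le.2 hu)
    · exact hu'

/-- Reversing the time turns the flow of `f` into the flow of `-f`. -/
theorem HamFlow.neg {ζ ζ' : CotangentBundle I X} (h : HamFlow f ζ ζ') : HamFlow (-f) ζ' ζ := by
  obtain ⟨γ, a, b, hab, ha, hb, hγ⟩ := h
  refine ⟨γ ∘ (· * (-1)), -b, -a, by linarith, by simp [hb], by simp [ha], ?_⟩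
  have h1 := hγ.comp_mul (-1)
  have h2 : ((-1 : ℝ) • hamiltonField f) = hamiltonField (-f) := by
    funext ζ
    rw [hamiltonField_neg, Pi.smul_apply, neg_one_smul]
  rw [h2] at h1
  refine h1.mono fun t ht => ?_
  change t * (-1) ∈ Icc a b
  exact ⟨by linarith [ht.2], by linarith [ht.1]⟩

theorem hamFlow_neg_iff {ζ ζ' : CotangentBundle I X} :
    HamFlow (-f) ζ ζ' ↔ HamFlow f ζ' ζ :=
  ⟨fun h => by simpa using h.neg, fun h => h.neg⟩

theorem contDiffAt_inChart {ζ₀ ζ : CotangentBundle I X}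
    (hf : ContMDiffAt (cotModel I) 𝓘(ℝ, ℝ) ∞ f ζ)
    (h : ζ.proj ∈ (chartAt H ζ₀.proj).source) :
    ContDiffAt ℝ ∞ (inChart ζ₀ f) (extChartAt (cotModel I) ζ₀ ζ) := by
  have hsrc : ζ ∈ (extChartAt (cotModel I) ζ₀).source := by rw [extChartAt_cot_source]; exact h
  rw [← contMDiffAt_iff_contDiffAt]
  have h1 := (contMDiffOn_extChartAt_symm (I := cotModel I) (n := ∞) ζ₀).contMDiffAt
    ((isOpen_extChartAt_target ζ₀).mem_nhds ((extChartAt (cotModel I) ζ₀).map_source hsrc))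
  refine ContMDiffAt.comp _ ?_ h1
  rw [(extChartAt (cotModel I) ζ₀).left_inv hsrc]
  exact hf

/-- Along the Hamiltonian flow of `f` the rate of change of `q` is `dq(X_f)`. -/
theorem hasDerivWithinAt_comp_curve {q : CotangentBundle I X → ℝ}
    {γ : ℝ → CotangentBundle I X} {s : Set ℝ}
    (hγ : IsMIntegralCurveOn (I := cotModel I) γ (hamiltonField f) s) {t : ℝ} (ht : t ∈ s)
    (hq : MDifferentiableAt (cotModel I) 𝓘(ℝ, ℝ) q (γ t)) :
    HasDerivWithinAt (q ∘ γ) (differential q (γ t) (hamiltonField f (γ t))) s t :=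
  hasMFDerivWithinAt_smulRight_iff.1 ((hγ t ht).comp_smulRight hq.hasMFDerivAt)

/-- A function which Poisson commutes with `f` is constant along the flow of `f`. -/
theorem HamFlow.conserves {q : CotangentBundle I X → ℝ}
    (hq : MDifferentiable (cotModel I) 𝓘(ℝ, ℝ) q)
    (hq0 : ∀ ζ, differential q ζ (hamiltonField f ζ) = 0) {ζ ζ' : CotangentBundle I X}
    (h : HamFlow f ζ ζ') : q ζ' = q ζ := by
  obtain ⟨γ, a, b, hab, rfl, rfl, hγ⟩ := h
  have hd : ∀ t ∈ Icc a b, HasDerivWithinAt (q ∘ γ) 0 (Icc a b) t := fun t ht =>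
    (hasDerivWithinAt_comp_curve hγ ht (hq _)).congr_deriv (hq0 _)
  have := (convex_Icc a b).norm_image_sub_le_of_norm_hasDerivWithin_le (C := 0) hd
    (by simp) (left_mem_Icc.2 hab) (right_mem_Icc.2 hab)
  rw [zero_mul, norm_le_zero_iff, sub_eq_zero] at this
  exact this

theorem differential_hamiltonField_self (ζ : CotangentBundle I X) :
    differential f ζ (hamiltonField f ζ) = 0 := by
  rw [← hamiltonField_spec]
  exact symplecticModel_self (E := E) _

/-- Integral curves of `X_f` are solutions of Hamilton's equations in canonical coordinates. -/
theorem curve_inChart {ζ₀ : CotangentBundle I X} {γ : ℝ → CotangentBundle I X} {s : Set ℝ}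
    (hf : ContMDiff (cotModel I) 𝓘(ℝ, ℝ) ∞ f)
    (hγ : IsMIntegralCurveOn (I := cotModel I) γ (hamiltonField f) s) {t : ℝ} (ht : t ∈ s)
    (h : (γ t).proj ∈ (chartAt H ζ₀.proj).source) :
    HasDerivWithinAt (extChartAt (cotModel I) ζ₀ ∘ γ)
      (hamiltonModel (inChart ζ₀ f) (extChartAt (cotModel I) ζ₀ (γ t))) s t := by
  obtain ⟨L, hL, -, -, hLf⟩ := exists_chart_symplectic h
  have h1 := (hLf f ((contDiffAt_inChart (hf _) h).differentiableAt (by simp))).2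
  rw [hamiltonModel, ← h1]
  exact hasMFDerivWithinAt_smulRight_iff.1 ((hγ t ht).comp_smulRight hL)

/-- Solutions of Hamilton's equations in canonical coordinates are integral curves of `X_f`. -/
theorem curve_ofChart {ζ₀ : CotangentBundle I X} {c : ℝ → E × (E →L[ℝ] ℝ)} {s : Set ℝ}
    (hf : ContMDiff (cotModel I) 𝓘(ℝ, ℝ) ∞ f)
    (hc : ∀ t ∈ s, HasDerivWithinAt c (hamiltonModel (inChart ζ₀ f) (c t)) s t)
    (h : ∀ t ∈ s, c t ∈ (extChartAt (cotModel I) ζ₀).target) :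
    IsMIntegralCurveOn (I := cotModel I) ((extChartAt (cotModel I) ζ₀).symm ∘ c)
      (hamiltonField f) s := by
  intro t ht
  set ζ := (extChartAt (cotModel I) ζ₀).symm (c t) with hζ
  have hcζ : extChartAt (cotModel I) ζ₀ ζ = c t := (extChartAt (cotModel I) ζ₀).right_inv (h t ht)
  have hs : ζ.proj ∈ (chartAt H ζ₀.proj).source := by
    have := (extChartAt (cotModel I) ζ₀).map_target (h t ht)
    rwa [extChartAt_cot_source] at this
  obtain ⟨L, -, hL, -, hLf⟩ := exists_chart_symplectic hs
  have h1 := (hLf f ((contDiffAt_inChart (hf _) hs).differentiableAt (by simp))).2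
  rw [hcζ] at h1 hL
  have h2 : L.symm (hamiltonModel (inChart ζ₀ f) (c t)) = hamiltonField f ζ := by
    rw [hamiltonModel, ← h1]; exact L.symm_apply_apply _
  have h3 := (hasMFDerivWithinAt_smulRight_iff.2 (hc t ht)).comp_smulRight hL
  refine h3.congr_mfderiv ?_
  exact congrArg (fun w => (1 : ℝ →L[ℝ] ℝ).smulRight w) h2

end HamFlow

/-! ### Transport along a Hamiltonian flow -/

section Transport

variable {E : Type*} [NormedAddCommGroup E] [NormedSpace ℝ E] [FiniteDimensional ℝ E]
  {H : Type*} [TopologicalSpace H] {I : ModelWithCorners ℝ E H} [I.Boundaryless]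
  {X : Type*} [TopologicalSpace X] [ChartedSpace H X] [IsManifold I ∞ X]
  {f : CotangentBundle I X → ℝ}

/-- `Ψ` is differentiable at `ζ`, with a symplectic differential. -/
def SymplecticAt (Ψ : CotangentBundle I X → CotangentBundle I X) (ζ : CotangentBundle I X) :
    Prop :=
  ∃ L : TangentSpace (cotModel I) ζ →L[ℝ] TangentSpace (cotModel I) (Ψ ζ),
    HasMFDerivAt (cotModel I) (cotModel I) Ψ ζ L ∧
    ∀ u v, symplecticForm (Ψ ζ) (L u) (L v) = symplecticForm ζ u v

/-- The local flow of a Hamilton vector field. -/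
theorem exists_localTransport (hf : ContMDiff (cotModel I) 𝓘(ℝ, ℝ) ∞ f)
    (ζ₀ : CotangentBundle I X) :
    ∃ (O : Set (CotangentBundle I X)) (δ : ℝ) (Ψ : CotangentBundle I X → ℝ → CotangentBundle I X),
      IsOpen O ∧ ζ₀ ∈ O ∧ 0 < δ ∧
      (∀ ζ ∈ O, Ψ ζ 0 = ζ ∧
        IsMIntegralCurveOn (I := cotModel I) (Ψ ζ) (hamiltonField f) (Icc (-δ) δ)) ∧
      (∀ ζ ∈ O, ∀ t ∈ Icc (-δ) δ, SymplecticAt (fun ζ => Ψ ζ t) ζ) ∧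
      ∀ (γ : ℝ → CotangentBundle I X) (a b : ℝ), a ≤ b → b - a ≤ δ →
        IsMIntegralCurveOn (I := cotModel I) γ (hamiltonField f) (Icc a b) →
        (∀ t ∈ Icc a b, γ t ∈ O) → γ b = Ψ (γ a) (b - a) := by
  have hsm : ∀ ζ ∈ (extChartAt (cotModel I) ζ₀).source, ContDiffAt ℝ ∞ (inChart ζ₀ f)
      (extChartAt (cotModel I) ζ₀ ζ) := fun ζ hζ =>
    contDiffAt_inChart (hf _) (by rwa [extChartAt_cot_source] at hζ)
  set c := extChartAt (cotModel I) ζ₀ with hc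
  have hζ₀ : ζ₀ ∈ c.source := mem_extChartAt_source ζ₀
  have hsm' : ∀ z ∈ c.target, ContDiffAt ℝ ∞ (inChart ζ₀ f) z := fun z hz => by
    have := hsm _ (c.map_target hz)
    rwa [c.right_inv hz] at this
  set v := hamiltonModel (inChart ζ₀ f) with hv
  have hvs : ContDiffAt ℝ ∞ v (c ζ₀) := contDiffAt_hamiltonModel (hsm _ hζ₀)
  obtain ⟨K, s, hs, hK⟩ := (hvs.of_le (m := 1) (by simp)).exists_lipschitzOnWith
  have hU : s ∩ c.target ∈ 𝓝 (c ζ₀) := Filter.inter_mem hs (extChartAt_target_mem_nhds ζ₀)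
  obtain ⟨O, δ, Φ, J, hO, hΦ⟩ := exists_isLocalFlow (hvs.of_le (m := 2) (by norm_cast)) hU
  have hδ := hΦ.pos
  have h0 : (0 : ℝ) ∈ Icc (-δ) δ := ⟨by linarith, hδ.le⟩
  refine ⟨c.source ∩ c ⁻¹' O, δ, fun ζ t => c.symm (Φ (c ζ) t),
    (continuousOn_extChartAt ζ₀).isOpen_inter_preimage (isOpen_extChartAt_source ζ₀) hΦ.isOpen,
    ⟨hζ₀, hO⟩, hδ, ?_, ?_, ?_⟩
  · rintro ζ ⟨hζ, hζO⟩
    refine ⟨by simp only [hΦ.zero _ hζO, c.left_inv hζ], ?_⟩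
    exact curve_ofChart hf (fun t ht => hΦ.deriv _ hζO t ht) fun t ht => (hΦ.mem _ hζO t ht).2
  · rintro ζ ⟨hζ, hζO⟩ t ht
    have htar := (hΦ.mem _ hζO t ht).2
    set ζ' := c.symm (Φ (c ζ) t) with hζ'
    have hcζ' : c ζ' = Φ (c ζ) t := c.right_inv htar
    have hζs : ζ.proj ∈ (chartAt H ζ₀.proj).source := by
      rwa [hc, extChartAt_cot_source] at hζ
    have hζs' : ζ'.proj ∈ (chartAt H ζ₀.proj).source := by
      have := c.map_target htar
      rwa [hc, extChartAt_cot_source] at this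
    obtain ⟨L, hL, -, hLs, -⟩ := exists_chart_symplectic hζs
    obtain ⟨L', -, hL', hLs', -⟩ := exists_chart_symplectic hζs'
    rw [← hc, hcζ'] at hL'
    have hJ := (hΦ.hasFDerivAt _ hζO t ht).hasMFDerivAt
    have h1 := HasMFDerivAt.comp ζ hJ hL
    have h2 := HasMFDerivAt.comp ζ (f := (fun z => Φ z t) ∘ c) hL' h1
    refine ⟨_, h2, fun u w => ?_⟩
    have h3 : ∀ u w, symplecticModel E u w = symplecticForm ζ' (L'.symm u) (L'.symm w) := by
      intro u w
      rw [← hLs', L'.apply_symm_apply, L'.apply_symm_apply]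
    have h4 := hΦ.preserves_form (symplecticModel E) (fun a ha u w =>
      hamiltonModel_infinitesimally_symplectic (hsm' a ha.2) u w) hζO ht (L u) (L w)
    exact (h3 _ _).symm.trans (h4.trans (hLs u w))
  · intro γ a b hab hba hγ hγO
    have hcd : ∀ t ∈ Icc a b, HasDerivWithinAt (c ∘ γ) (v (c (γ t))) (Icc a b) t := fun t ht =>
      curve_inChart hf hγ ht (by
        have := (hγO t ht).1
        rwa [hc, extChartAt_cot_source] at this)
    have := hΦ.eq_of_hasDerivWithinAt (hK.mono inter_subset_left) hab hba
      (fun t ht => hΦ.subset (hγO t ht).2) hcd (hγO a (left_mem_Icc.2 hab)).2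
    change γ b = c.symm (Φ (c (γ a)) (b - a))
    rw [← c.left_inv (hγO b (right_mem_Icc.2 hab)).1]
    exact congrArg c.symm this

/-- There is a map near `ζ` which sends `ζ` to `ζ'`, moves points along the flow of `f`, and has a
symplectic differential at `ζ`. -/
def Transport (f : CotangentBundle I X → ℝ) (ζ ζ' : CotangentBundle I X) : Prop :=
  ∃ Ψ : CotangentBundle I X → CotangentBundle I X, Ψ ζ = ζ' ∧ SymplecticAt Ψ ζ ∧
    ∀ᶠ ζ₁ in 𝓝 ζ, HamFlow f ζ₁ (Ψ ζ₁)

theorem Transport.refl (ζ : CotangentBundle I X) : Transport f ζ ζ :=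
  ⟨id, rfl, ⟨_, hasMFDerivAt_id ζ, fun _ _ => rfl⟩, Filter.Eventually.of_forall HamFlow.refl⟩

theorem Transport.trans {ζ ζ' ζ'' : CotangentBundle I X} (h1 : Transport f ζ ζ')
    (h2 : Transport f ζ' ζ'') : Transport f ζ ζ'' := by
  obtain ⟨Ψ, rfl, ⟨L, hL, hLs⟩, hΨ⟩ := h1
  obtain ⟨Ψ', rfl, ⟨L', hL', hLs'⟩, hΨ'⟩ := h2
  refine ⟨Ψ' ∘ Ψ, rfl, ⟨_, HasMFDerivAt.comp ζ hL' hL, fun u v => ?_⟩, ?_⟩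
  · exact (hLs' _ _).trans (hLs u v)
  · filter_upwards [hΨ, hL.continuousAt.eventually hΨ'] with ζ₁ h1 h2
    exact h1.trans h2

/-- The local transports along a subdivided integral curve are composed. -/
theorem HamFlow.transport (hf : ContMDiff (cotModel I) 𝓘(ℝ, ℝ) ∞ f)
    {ζ ζ' : CotangentBundle I X} (h : HamFlow f ζ ζ') : Transport f ζ ζ' := by
  obtain ⟨γ, s, hs, rfl, rfl, hγ⟩ := h.exists_curve
  choose O δ Ψ hOo hO hδ hΨ hΨs hΨu using fun ζ₀ => exists_localTransport hf ζ₀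
  have hγc : Continuous (fun t : Icc (0 : ℝ) s => γ t) :=
    continuousOn_iff_continuous_domRestrict.1 hγ.continuousOn
  -- a subdivision such that each piece of the curve is in the domain of one local flow, and short
  -- compared to its lifetime
  obtain ⟨τ, hτ0, hτm, ⟨m, hm⟩, hτ⟩ := exists_monotone_Icc_subset_open_cover_Icc hs
    (c := fun i : Icc (0 : ℝ) s => {t | γ t ∈ O (γ i)} ∩ {t | |(t : ℝ) - i| < δ (γ i) / 2})
    (fun i => ((hOo _).preimage hγc).inter
      (isOpen_lt (by fun_prop) continuous_const))
    (fun i _ => mem_iUnion.2 ⟨i, hO _, by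
      change |(i : ℝ) - i| < _
      rw [sub_self, abs_zero]; exact half_pos (hδ _)⟩)
  have key : ∀ n, Transport f (γ 0) (γ (τ n)) := by
    intro n
    induction n with
    | zero => rw [hτ0]; exact Transport.refl _
    | succ n ih =>
      refine ih.trans ?_
      obtain ⟨i, hi⟩ := hτ n
      have hle : τ n ≤ τ (n + 1) := hτm n.le_succ
      have hle' : (τ n : ℝ) ≤ τ (n + 1) := hle
      have ha := hi (left_mem_Icc.2 hle)
      have hb := hi (right_mem_Icc.2 hle)
      have hd : (τ (n + 1) : ℝ) - τ n ≤ δ (γ i) := by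
        have h1 := abs_lt.1 (show |(τ n : ℝ) - i| < δ (γ i) / 2 from ha.2)
        have h2 := abs_lt.1 (show |(τ (n + 1) : ℝ) - i| < δ (γ i) / 2 from hb.2)
        linarith [h1.1, h2.2]
      have h3 : γ (τ (n + 1)) = Ψ (γ i) (γ (τ n)) (τ (n + 1) - τ n) := by
        refine hΨu (γ i) γ _ _ hle' hd (hγ.mono (Icc_subset_Icc (τ n).2.1 (τ (n + 1)).2.2)) ?_
        intro t ht
        exact (hi (a := ⟨t, (τ n).2.1.trans ht.1, ht.2.trans (τ (n + 1)).2.2⟩) ht).1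
      have hmem : (τ (n + 1) : ℝ) - τ n ∈ Icc (-δ (γ i)) (δ (γ i)) :=
        ⟨by linarith [hδ (γ i)], hd⟩
      refine ⟨fun ζ => Ψ (γ i) ζ (τ (n + 1) - τ n), h3.symm, hΨs _ _ ha.1 _ hmem, ?_⟩
      filter_upwards [(hOo (γ i)).mem_nhds ha.1] with ζ hζ
      obtain ⟨e1, e2⟩ := hΨ _ ζ hζ
      exact ⟨Ψ (γ i) ζ, 0, _, by linarith, e1, rfl,
        e2.mono (Icc_subset_Icc (by linarith [hδ (γ i)]) hd)⟩
  have := key m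
  rwa [hm m le_rfl] at this

/-- The set of times at which the curves agree is closed and, by the local uniqueness, open to the
right. -/
theorem curve_unique [T2Space X] (hf : ContMDiff (cotModel I) 𝓘(ℝ, ℝ) ∞ f)
    {γ₁ γ₂ : ℝ → CotangentBundle I X} {s : ℝ}
    (h₁ : IsMIntegralCurveOn (I := cotModel I) γ₁ (hamiltonField f) (Icc 0 s))
    (h₂ : IsMIntegralCurveOn (I := cotModel I) γ₂ (hamiltonField f) (Icc 0 s))
    (h : γ₁ 0 = γ₂ 0) : ∀ t ∈ Icc 0 s, γ₁ t = γ₂ t := by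
  have hcl : IsClosed ({t | γ₁ t = γ₂ t} ∩ Icc 0 s) := by
    have h3 : IsClosed {t : Icc 0 s | γ₁ t = γ₂ t} := isClosed_eq
      (continuousOn_iff_continuous_domRestrict.1 h₁.continuousOn)
      (continuousOn_iff_continuous_domRestrict.1 h₂.continuousOn)
    have h5 := (isClosed_Icc (a := (0 : ℝ)) (b := s)).isClosedEmbedding_subtypeVal.isClosedMap _ h3
    convert h5 using 1
    ext t
    simp [and_comm]
  refine hcl.Icc_subset_of_forall_mem_nhdsWithin h ?_
  rintro x ⟨hx, hx0, hxs⟩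
  have hx : γ₁ x = γ₂ x := hx
  obtain ⟨O, δ, Ψ, hOo, hO, hδ, hΨ, -, hΨu⟩ := exists_localTransport hf (γ₁ x)
  have e1 : ∀ᶠ t in 𝓝[Icc 0 s] x, γ₁ t ∈ O :=
    (h₁.continuousOn x ⟨hx0, hxs.le⟩).eventually (hOo.mem_nhds hO)
  have e2 : ∀ᶠ t in 𝓝[Icc 0 s] x, γ₂ t ∈ O :=
    (h₂.continuousOn x ⟨hx0, hxs.le⟩).eventually (by rw [← hx]; exact hOo.mem_nhds hO)
  obtain ⟨ε, hε, hball⟩ := Metric.mem_nhdsWithin_iff.1 (e1.and e2)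
  have hlt : x < min (min (x + ε) (x + δ)) s := lt_min (lt_min (by linarith) (by linarith)) hxs
  filter_upwards [Ioo_mem_nhdsGT hlt] with t ht
  have ht1 : t < x + ε := ht.2.trans_le ((min_le_left _ _).trans (min_le_left _ _))
  have ht2 : t < x + δ := ht.2.trans_le ((min_le_left _ _).trans (min_le_right _ _))
  have ht3 : t < s := ht.2.trans_le (min_le_right _ _)
  have hin : ∀ u ∈ Icc x t, γ₁ u ∈ O ∧ γ₂ u ∈ O := fun u hu => hball
    ⟨by rw [Metric.mem_ball, Real.dist_eq, abs_lt]; constructor <;> linarith [hu.1, hu.2],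
      hx0.trans hu.1, hu.2.trans ht3.le⟩
  have hsub : Icc x t ⊆ Icc 0 s := Icc_subset_Icc hx0 ht3.le
  have r1 := hΨu γ₁ x t ht.1.le (by linarith) (h₁.mono hsub) fun u hu => (hin u hu).1
  have r2 := hΨu γ₂ x t ht.1.le (by linarith) (h₂.mono hsub) fun u hu => (hin u hu).2
  change γ₁ t = γ₂ t
  rw [r1, r2, hx]

/-- Two points on the orbit of a third one are on one orbit. -/
theorem HamFlow.connected [T2Space X] (hf : ContMDiff (cotModel I) 𝓘(ℝ, ℝ) ∞ f)
    {ζ ζ₁ ζ₂ : CotangentBundle I X} (h₁ : HamFlow f ζ ζ₁) (h₂ : HamFlow f ζ ζ₂) :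
    HamFlow f ζ₁ ζ₂ ∨ HamFlow f ζ₂ ζ₁ := by
  obtain ⟨γ₁, s₁, hs₁, h10, rfl, hγ₁⟩ := h₁.exists_curve
  obtain ⟨γ₂, s₂, hs₂, h20, rfl, hγ₂⟩ := h₂.exists_curve
  rcases le_total s₁ s₂ with h | h
  · left
    have := curve_unique hf hγ₁ (hγ₂.mono (Icc_subset_Icc le_rfl h)) (h10.trans h20.symm) s₁
      ⟨hs₁, le_rfl⟩
    exact ⟨γ₂, s₁, s₂, h, this.symm, rfl, hγ₂.mono (Icc_subset_Icc hs₁ le_rfl)⟩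
  · right
    have := curve_unique hf hγ₂ (hγ₁.mono (Icc_subset_Icc le_rfl h)) (h20.trans h10.symm) s₂
      ⟨hs₂, le_rfl⟩
    exact ⟨γ₁, s₂, s₁, h, this.symm, rfl, hγ₁.mono (Icc_subset_Icc hs₂ le_rfl)⟩

/-- The points `ζ` and `ζ'` are on one orbit of the flow of `f`. -/
def SameOrbit (f : CotangentBundle I X → ℝ) (ζ ζ' : CotangentBundle I X) : Prop :=
  HamFlow f ζ ζ' ∨ HamFlow f ζ' ζ

theorem SameOrbit.trans [T2Space X] (hf : ContMDiff (cotModel I) 𝓘(ℝ, ℝ) ∞ f)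
    {ζ ζ' ζ'' : CotangentBundle I X} (h₁ : SameOrbit f ζ ζ') (h₂ : SameOrbit f ζ' ζ'') :
    SameOrbit f ζ ζ'' := by
  rcases h₁ with h₁ | h₁ <;> rcases h₂ with h₂ | h₂
  · exact Or.inl (h₁.trans h₂)
  · have := HamFlow.connected (f := -f) hf.neg h₁.neg h₂.neg
    rw [hamFlow_neg_iff, hamFlow_neg_iff] at this
    exact this.symm
  · exact HamFlow.connected hf h₁ h₂
  · exact Or.inr (h₂.trans h₁)

end Transport

/-! ### Moving points along a flow to a hypersurface -/

section Return

variable {V : Type*} [NormedAddCommGroup V] [NormedSpace ℝ V]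

/-- The projection along `X` to the kernel of `l`. -/
def projAlong (l : V →L[ℝ] ℝ) (X : V) : V →L[ℝ] V :=
  ContinuousLinearMap.id ℝ V - (l X)⁻¹ • l.smulRight X

theorem projAlong_apply (l : V →L[ℝ] ℝ) (X u : V) :
    projAlong l X u = u - ((l X)⁻¹ * l u) • X := by
  simp [projAlong, smul_smul]

theorem apply_projAlong (B : V →L[ℝ] V →L[ℝ] ℝ) (l : V →L[ℝ] ℝ) {X u w : V} (hX : B X X = 0)
    (hu : B u X = 0) (hw : B X w = 0) : B (projAlong l X u) (projAlong l X w) = B u w := by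
  simp [projAlong_apply, hX, hu, hw]

/-- The motion along a flow is uniformly approximated by the motion with constant velocity. -/
theorem IsLocalFlow.norm_sub_sub_smul_le {v : V → V} {U O : Set V} {δ : ℝ} {Φ : V → ℝ → V}
    {J : V → ℝ → V →L[ℝ] V} (h : IsLocalFlow v U O δ Φ J) {y : V} (hy : y ∈ O)
    (hv : ContinuousAt v y) {ε : ℝ} (hε : 0 < ε) :
    ∃ σ > 0, σ ≤ δ ∧ ∀ᶠ z in 𝓝 y, z ∈ O ∧
      ∀ s, |s| ≤ σ → ‖Φ z s - z - s • v y‖ ≤ ε * |s| := by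
  obtain ⟨M, hM0, hM⟩ := h.speed
  have hδ := h.pos
  obtain ⟨ρ, hρ, hball⟩ := Metric.continuousAt_iff.1 hv ε hε
  set σ := min δ (ρ / 2 / (M + 1)) with hσ
  have hσ0 : 0 < σ := lt_min hδ (by positivity)
  have hMσ : M * σ < ρ / 2 := by
    have h1 : (M + 1) * σ ≤ ρ / 2 := by
      calc (M + 1) * σ ≤ (M + 1) * (ρ / 2 / (M + 1)) := by gcongr; exact min_le_right _ _
        _ = ρ / 2 := by field_simp
    nlinarith
  refine ⟨σ, hσ0, min_le_left _ _, ?_⟩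
  filter_upwards [h.isOpen.mem_nhds hy, Metric.ball_mem_nhds y (half_pos hρ)] with z hzO hz
  refine ⟨hzO, fun s hs => ?_⟩
  have hsub : Icc (-|s|) |s| ⊆ Icc (-δ) δ := by
    have := hs.trans (min_le_left δ _)
    exact Icc_subset_Icc (by linarith) this
  have hd : ∀ u ∈ Icc (-|s|) |s|, HasDerivWithinAt (fun u => Φ z u - u • v y)
      (v (Φ z u) - (1 : ℝ) • v y) (Icc (-|s|) |s|) u := fun u hu =>
    ((h.deriv z hzO u (hsub hu)).mono hsub).sub ((hasDerivWithinAt_id u _).smul_const _)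
  have hb : ∀ u ∈ Icc (-|s|) |s|, ‖v (Φ z u) - (1 : ℝ) • v y‖ ≤ ε := by
    intro u hu
    rw [one_smul, ← dist_eq_norm]
    refine (hball ?_).le
    have h1 := hM z hzO u (hsub hu)
    have h2 : |u| ≤ σ := (abs_le.2 hu).trans hs
    have h3 : dist (Φ z u) z < ρ / 2 := by
      rw [dist_eq_norm]
      calc _ ≤ M * |u| := h1
        _ ≤ M * σ := by gcongr
        _ < _ := hMσ
    calc dist (Φ z u) y ≤ dist (Φ z u) z + dist z y := dist_triangle _ _ _
      _ < ρ / 2 + ρ / 2 := add_lt_add h3 hz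
      _ = ρ := by ring
  have := (convex_Icc (-|s|) |s|).norm_image_sub_le_of_norm_hasDerivWithin_le hd hb
    (x := 0) (y := s) ⟨by simp, by simp⟩ ⟨neg_abs_le s, le_abs_self s⟩
  rw [h.zero z hzO, zero_smul, sub_zero, sub_zero, Real.norm_eq_abs] at this
  rwa [sub_right_comm] at this

/-- Near a point `y` of the hyperplane `ℓ = 0` at which the flow is transversal to it, points can be
moved along the flow to the hyperplane. The time this takes is not constant, and so the differential
of the resulting map at `y` is the projection along the velocity. -/
theorem IsLocalFlow.exists_return {v : V → V} {U O : Set V} {δ : ℝ} {Φ : V → ℝ → V}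
    {J : V → ℝ → V →L[ℝ] V} (h : IsLocalFlow v U O δ Φ J) {y : V} (hy : y ∈ O)
    (hv : ContinuousAt v y) (l : V →L[ℝ] ℝ) (hl : l y = 0) (hlv : l (v y) ≠ 0) :
    ∃ s : V → ℝ, s y = 0 ∧ (∀ᶠ z in 𝓝 y, z ∈ O ∧ |s z| ≤ δ ∧ l (Φ z (s z)) = 0) ∧
      HasFDerivAt (fun z => Φ z (s z))
        (projAlong l (v y)) y := by
  set κ := |l (v y)| with hκ
  have hκ0 : 0 < κ := abs_pos.2 hlv
  have hδ := h.pos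
  have hlin : ∀ (z : V) (s e : ℝ), ‖Φ z s - z - s • v y‖ ≤ e * |s| →
      |l (Φ z s) - l z - s * l (v y)| ≤ ‖l‖ * e * |s| := by
    intro z s e hle
    have h1 := l.le_opNorm (Φ z s - z - s • v y)
    rw [map_sub, map_sub, map_smul, smul_eq_mul, Real.norm_eq_abs] at h1
    calc _ ≤ ‖l‖ * ‖Φ z s - z - s • v y‖ := h1
      _ ≤ ‖l‖ * (e * |s|) := by gcongr
      _ = _ := by ring
  have hex : ∀ᶠ z in 𝓝 y, ∃ s, (z ∈ O ∧ |s| ≤ δ ∧ l (Φ z s) = 0) ∧ |s| ≤ 2 * |l z| / κ := by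
    obtain ⟨σ, hσ0, hσδ, hσ⟩ := h.norm_sub_sub_smul_le hy hv
      (ε := κ / 2 / (‖l‖ + 1)) (by positivity)
    have hlz : ∀ᶠ z in 𝓝 y, |l z| < σ * κ / 2 := by
      have : ContinuousAt (fun z => |l z|) y := by fun_prop
      exact this.eventually_lt_const (by simp only [hl, abs_zero]; positivity)
    filter_upwards [hσ, hlz] with z ⟨hzO, hz⟩ hlz
    -- the linearization predicts the time `-l z / l (v y)`; after twice this time, `l` has changed
    -- its sign
    set s₁ := 2 * l z / l (v y) with hs₁
    have hs₁' : |s₁| = 2 * |l z| / κ := by rw [hs₁, abs_div, abs_mul, abs_two]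
    have hs₁σ : |s₁| ≤ σ := by
      rw [hs₁', div_le_iff₀ hκ0]; linarith
    have h1 := hlin z (-s₁) _ (hz (-s₁) (by rwa [abs_neg]))
    have h2 : |l (Φ z (-s₁)) + l z| ≤ |l z| := by
      have e1 : l (Φ z (-s₁)) - l z - -s₁ * l (v y) = l (Φ z (-s₁)) + l z := by
        rw [hs₁]; field_simp; ring
      rw [e1, abs_neg] at h1
      refine h1.trans ?_
      calc ‖l‖ * (κ / 2 / (‖l‖ + 1)) * |s₁| = (‖l‖ / (‖l‖ + 1)) * (κ / 2 * |s₁|) := by ring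
        _ ≤ 1 * (κ / 2 * |s₁|) := by
            gcongr
            rw [div_le_one (by positivity)]; linarith
        _ = |l z| := by rw [hs₁']; field_simp
    have hcont : ContinuousOn (fun s => l (Φ z s)) (uIcc 0 (-s₁)) := by
      have h3 : ContinuousOn (Φ z) (Icc (-δ) δ) := fun t ht => (h.deriv z hzO t ht).continuousWithinAt
      refine l.continuous.comp_continuousOn (h3.mono ?_)
      intro t ht
      have : |t| ≤ |s₁| := by
        have := abs_sub_left_of_mem_uIcc ht
        simpa using this
      exact abs_le.1 (this.trans (hs₁σ.trans hσδ))
    have hmem : (0 : ℝ) ∈ uIcc (l (Φ z 0)) (l (Φ z (-s₁))) := by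
      rw [h.zero z hzO, mem_uIcc]
      rcases le_total 0 (l z) with h3 | h3
      · rw [abs_of_nonneg h3] at h2
        right; exact ⟨by linarith [(abs_le.1 h2).2], h3⟩
      · rw [abs_of_nonpos h3] at h2
        left; exact ⟨h3, by linarith [(abs_le.1 h2).1]⟩
    obtain ⟨s, hs, hs0⟩ := intermediate_value_uIcc hcont hmem
    have hss : |s| ≤ |s₁| := by
      have := abs_sub_left_of_mem_uIcc hs
      simpa using this
    exact ⟨s, ⟨hzO, hss.trans (hs₁σ.trans hσδ), hs0⟩, hss.trans hs₁'.le⟩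
  classical
  set s : V → ℝ := fun z => if hz : ∃ s, (z ∈ O ∧ |s| ≤ δ ∧ l (Φ z s) = 0) ∧ |s| ≤ 2 * |l z| / κ
    then hz.choose else 0 with hsdef
  have hs : ∀ᶠ z in 𝓝 y, (z ∈ O ∧ |s z| ≤ δ ∧ l (Φ z (s z)) = 0) ∧ |s z| ≤ 2 * |l z| / κ := by
    filter_upwards [hex] with z hz
    have : s z = hz.choose := dif_pos hz
    rw [this]
    exact hz.choose_spec
  have hsy : s y = 0 := by
    have := hs.self_of_nhds.2
    rw [hl, abs_zero, mul_zero, zero_div] at this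
    exact abs_nonpos_iff.1 this
  refine ⟨s, hsy, hs.mono fun z hz => hz.1, ?_⟩
  -- the return time is `-l z / l (v y)` up to an error `o(z - y)`, which gives the derivative
  rw [hasFDerivAt_iff_isLittleO, Asymptotics.isLittleO_iff]
  intro c hc
  set C := (1 + ‖l‖ / κ * ‖v y‖) * (2 * ‖l‖ / κ) with hC
  have hC0 : 0 ≤ C := by positivity
  obtain ⟨σ, hσ0, hσδ, hσ⟩ := h.norm_sub_sub_smul_le hy hv (ε := c / (C + 1)) (by positivity)
  have hsσ : ∀ᶠ z in 𝓝 y, 2 * |l z| / κ < σ := by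
    have : ContinuousAt (fun z => 2 * |l z| / κ) y := by fun_prop
    exact this.eventually_lt_const (by simpa [hl] using hσ0)
  filter_upwards [hσ, hsσ, hs] with z ⟨hzO, hz⟩ hzσ ⟨⟨_, _, hz0⟩, hzs⟩
  set e := c / (C + 1) with he
  have he0 : 0 ≤ e := by positivity
  have h1 := hz (s z) (hzs.trans hzσ.le)
  have h2 := hlin z (s z) _ h1
  rw [hz0] at h2
  have h3 : |s z + l z / l (v y)| ≤ ‖l‖ / κ * (e * |s z|) := by
    have : s z + l z / l (v y) = -((0 - l z - s z * l (v y)) / l (v y)) := by field_simp; ring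
    rw [this, abs_neg, abs_div, ← hκ, div_le_iff₀ hκ0]
    refine h2.trans (le_of_eq ?_)
    field_simp
  have h4 : |s z| ≤ 2 * ‖l‖ / κ * ‖z - y‖ := by
    refine hzs.trans ?_
    have h5 : |l z| ≤ ‖l‖ * ‖z - y‖ := by
      have := l.le_opNorm (z - y)
      rwa [map_sub, hl, sub_zero] at this
    calc 2 * |l z| / κ ≤ 2 * (‖l‖ * ‖z - y‖) / κ := by gcongr
      _ = _ := by ring
  have h6 : Φ z (s z) - Φ y (s y) -
      projAlong l (v y) (z - y) =
      (Φ z (s z) - z - s z • v y) + (s z + l z / l (v y)) • v y := by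
    rw [hsy, h.zero y hy, projAlong_apply, map_sub, hl, sub_zero, add_smul, div_eq_inv_mul]
    abel
  rw [h6]
  calc _ ≤ ‖Φ z (s z) - z - s z • v y‖ + ‖(s z + l z / l (v y)) • v y‖ := norm_add_le _ _
    _ ≤ e * |s z| + ‖l‖ / κ * (e * |s z|) * ‖v y‖ := by
        rw [norm_smul, Real.norm_eq_abs]
        gcongr
    _ = e * (1 + ‖l‖ / κ * ‖v y‖) * |s z| := by ring
    _ ≤ e * (1 + ‖l‖ / κ * ‖v y‖) * (2 * ‖l‖ / κ * ‖z - y‖) := by gcongr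
    _ = (e * C) * ‖z - y‖ := by rw [hC]; ring
    _ ≤ c * ‖z - y‖ := by
        gcongr
        rw [he, div_mul_eq_mul_div, div_le_iff₀ (by positivity)]
        nlinarith

end Return

section Transversal

variable {E : Type*} [NormedAddCommGroup E] [NormedSpace ℝ E] [FiniteDimensional ℝ E]
  {H : Type*} [TopologicalSpace H] {I : ModelWithCorners ℝ E H} [I.Boundaryless]
  {X : Type*} [TopologicalSpace X] [ChartedSpace H X] [IsManifold I ∞ X]
  {f : CotangentBundle I X → ℝ}

/-- `Ψ` is differentiable at `ζ`, and its differential is symplectic on the kernel of `df`. -/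
def ReducedSymplecticAt (f : CotangentBundle I X → ℝ)
    (Ψ : CotangentBundle I X → CotangentBundle I X) (ζ : CotangentBundle I X) : Prop :=
  ∃ L : TangentSpace (cotModel I) ζ →L[ℝ] TangentSpace (cotModel I) (Ψ ζ),
    HasMFDerivAt (cotModel I) (cotModel I) Ψ ζ L ∧
    ∀ u v, differential f ζ u = 0 → differential f ζ v = 0 →
      symplecticForm (Ψ ζ) (L u) (L v) = symplecticForm ζ u v

/-- Near a point of the hypersurface `q = 0`, points can be moved along the flow of `f` to this
hypersurface, if it is transversal to the flow. The function `q` has to be linear in the chart. -/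
theorem exists_return (hf : ContMDiff (cotModel I) 𝓘(ℝ, ℝ) ∞ f) {q : CotangentBundle I X → ℝ}
    {y : CotangentBundle I X} (l : (E × (E →L[ℝ] ℝ)) →L[ℝ] ℝ)
    (hq : ∀ ζ ∈ (extChartAt (cotModel I) y).source, q ζ = l (extChartAt (cotModel I) y ζ))
    (hqy : q y = 0)
    (hqf : differential q y (hamiltonField f y) ≠ 0) :
    ∃ Ψ : CotangentBundle I X → CotangentBundle I X, Ψ y = y ∧ ReducedSymplecticAt f Ψ y ∧
      ∀ᶠ ζ in 𝓝 y, q (Ψ ζ) = 0 ∧ SameOrbit f ζ (Ψ ζ) := by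
  have hys : y.proj ∈ (chartAt H y.proj).source := mem_chart_source H y.proj
  obtain ⟨L, hL, hL', hLs, hLf⟩ := exists_chart_symplectic hys
  have hfc := contDiffAt_inChart (hf y) hys
  have hsm : ∀ z ∈ (extChartAt (cotModel I) y).target, ContDiffAt ℝ ∞ (inChart y f) z :=
    fun z hz => by
      have h1 := (extChartAt (cotModel I) y).map_target hz
      have := contDiffAt_inChart (hf ((extChartAt (cotModel I) y).symm z)) (ζ₀ := y)
        (by rwa [extChartAt_cot_source] at h1)
      rwa [(extChartAt (cotModel I) y).right_inv hz] at this
  set c := extChartAt (cotModel I) y with hc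
  have hcy : y ∈ c.source := mem_extChartAt_source y
  set v := hamiltonModel (inChart y f) with hv
  have hvs : ContDiffAt ℝ ∞ v (c y) := contDiffAt_hamiltonModel hfc
  obtain ⟨O, δ, Φ, J, hO, hΦ⟩ := exists_isLocalFlow (hvs.of_le (m := 2) (by norm_cast))
    (extChartAt_target_mem_nhds (I := cotModel I) y)
  have hLX : L (hamiltonField f y) = v (c y) := (hLf f (hfc.differentiableAt (by simp))).2
  have hql : ∀ u, differential q y u = l (L u) := by
    intro u
    have h1 : HasMFDerivAt (cotModel I) 𝓘(ℝ, ℝ) (l ∘ c) y (l.comp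
      (L : TangentSpace (cotModel I) y →L[ℝ] (E × (E →L[ℝ] ℝ)))) :=
      HasMFDerivAt.comp y l.hasFDerivAt.hasMFDerivAt hL
    have h2 := h1.congr_of_eventuallyEq (f₁ := q) (by
      filter_upwards [(isOpen_extChartAt_source y).mem_nhds hcy] with ζ hζ
      exact hq ζ hζ)
    rw [differential, h2.mfderiv]
    rfl
  rw [hql, hLX] at hqf
  obtain ⟨s, hs0, hs, hds⟩ := hΦ.exists_return hO hvs.continuousAt l (by rw [← hq y hcy, hqy]) hqf
  have hδ := hΦ.pos
  have hΦy : Φ (c y) (s (c y)) = c y := by rw [hs0, hΦ.zero _ hO]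
  have hΨy : c.symm (Φ (c y) (s (c y))) = y := by rw [hΦy, c.left_inv hcy]
  refine ⟨fun ζ => c.symm (Φ (c ζ) (s (c ζ))), hΨy, ?_, ?_⟩
  · have h1 := HasMFDerivAt.comp y hds.hasMFDerivAt hL
    have hL'' := hL'
    have e1 : ((fun z => Φ z (s z)) ∘ c) y = c y := hΦy
    rw [← e1] at hL''
    have h2 := HasMFDerivAt.comp y hL'' h1
    refine ⟨_, h2, fun u w hu hw => ?_⟩
    have h3 : ∀ u w : E × (E →L[ℝ] ℝ), symplecticForm y (L.symm u) (L.symm w) =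
        symplecticModel E u w := by
      intro u w
      rw [← hLs, L.apply_symm_apply, L.apply_symm_apply]
    have h4 : ∀ u, differential f y u = 0 → symplecticModel E (v (c y)) (L u) = 0 := by
      intro u hu
      rw [← hLX, hLs, hamiltonField_spec, hu]
    have h5 : ∀ u, differential f y u = 0 → symplecticModel E (L u) (v (c y)) = 0 := by
      intro u hu
      rw [symplecticModel_swap, h4 u hu, neg_zero]
    -- on `ker df`, the projection along the Hamilton vector field preserves the symplectic form
    have h6 := apply_projAlong (V := E × (E →L[ℝ] ℝ)) (symplecticModel E) l
      (symplecticModel_self _) (h5 u hu) (h4 w hw)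
    exact (h3 _ _).trans (h6.trans (hLs u w))
  · filter_upwards [(isOpen_extChartAt_source y).mem_nhds hcy,
      hL.continuousAt.eventually hs] with ζ hζ hsζ
    obtain ⟨hζO, hsδ, hl0⟩ := hsζ
    have hmem : s (c ζ) ∈ Icc (-δ) δ := abs_le.1 hsδ
    have htar := hΦ.mem _ hζO _ hmem
    constructor
    · rw [hq _ (c.map_target htar), c.right_inv htar, hl0]
    · have hcur : IsMIntegralCurveOn (I := cotModel I) (c.symm ∘ Φ (c ζ)) (hamiltonField f)
          (Icc (-δ) δ) :=
        curve_ofChart hf (fun t ht => hΦ.deriv _ hζO t ht) fun t ht => hΦ.mem _ hζO t ht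
      have h0 : (c.symm ∘ Φ (c ζ)) 0 = ζ := by
        simp only [Function.comp_apply, hΦ.zero _ hζO, c.left_inv hζ]
      rcases le_total 0 (s (c ζ)) with h | h
      · exact Or.inl ⟨_, 0, s (c ζ), h, h0, rfl,
          hcur.mono (Icc_subset_Icc (by linarith) hmem.2)⟩
      · exact Or.inr ⟨_, s (c ζ), 0, h, rfl, h0,
          hcur.mono (Icc_subset_Icc hmem.1 hδ.le)⟩

/-- If the orbit of `ζ` meets the hypersurface `q = 0` transversally at `y`, then the points near `ζ`
can be moved along their orbits to this hypersurface by a map which is symplectic transversally to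
the flow. -/
theorem exists_return_of_sameOrbit [T2Space X] (hf : ContMDiff (cotModel I) 𝓘(ℝ, ℝ) ∞ f)
    {q : CotangentBundle I X → ℝ}
    {ζ y : CotangentBundle I X} (l : (E × (E →L[ℝ] ℝ)) →L[ℝ] ℝ)
    (hq : ∀ ζ ∈ (extChartAt (cotModel I) y).source, q ζ = l (extChartAt (cotModel I) y ζ))
    (hqy : q y = 0) (hqf : differential q y (hamiltonField f y) ≠ 0) (h : SameOrbit f ζ y) :
    ∃ Ψ : CotangentBundle I X → CotangentBundle I X, Ψ ζ = y ∧ ReducedSymplecticAt f Ψ ζ ∧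
      ∀ᶠ ζ₁ in 𝓝 ζ, q (Ψ ζ₁) = 0 ∧ SameOrbit f ζ₁ (Ψ ζ₁) := by
  have h1 : ∃ Ψ : CotangentBundle I X → CotangentBundle I X, Ψ ζ = y ∧ SymplecticAt Ψ ζ ∧
      ∀ᶠ ζ₁ in 𝓝 ζ, SameOrbit f ζ₁ (Ψ ζ₁) := by
    rcases h with h | h
    · obtain ⟨Ψ, h1, h2, h3⟩ := h.transport hf
      exact ⟨Ψ, h1, h2, h3.mono fun _ => Or.inl⟩
    · obtain ⟨Ψ, h1, h2, h3⟩ := h.neg.transport hf.neg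
      exact ⟨Ψ, h1, h2, h3.mono fun _ h => Or.inr (hamFlow_neg_iff.1 h)⟩
  obtain ⟨Ψ, rfl, ⟨L, hL, hLs⟩, hΨ⟩ := h1
  obtain ⟨P, hP, ⟨L', hL', hLs'⟩, hPq⟩ := exists_return hf l hq hqy hqf
  have hfm : MDifferentiable (cotModel I) 𝓘(ℝ, ℝ) f := hf.mdifferentiable (by simp)
  have hcons : ∀ {ζ ζ'}, SameOrbit f ζ ζ' → f ζ' = f ζ := by
    rintro ζ ζ' (h | h)
    · exact h.conserves hfm differential_hamiltonField_self
    · exact (h.conserves hfm differential_hamiltonField_self).symm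
  -- the transport preserves `f`, and so its differential preserves `ker df`
  have hdf : ∀ u, differential f (Ψ ζ) (L u) = differential f ζ u := by
    intro u
    have e1 : HasMFDerivAt (cotModel I) 𝓘(ℝ, ℝ) (f ∘ Ψ) ζ _ :=
      HasMFDerivAt.comp ζ (hfm (Ψ ζ)).hasMFDerivAt hL
    have e2 := e1.congr_of_eventuallyEq (f₁ := f) (hΨ.mono fun ζ₁ h => (hcons h).symm)
    rw [differential, differential, e2.mfderiv]
    rfl
  refine ⟨P ∘ Ψ, hP, ⟨_, HasMFDerivAt.comp ζ hL' hL, fun u v hu hv => ?_⟩, ?_⟩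
  · exact (hLs' _ _ ((hdf u).trans hu) ((hdf v).trans hv)).trans (hLs u v)
  · filter_upwards [hΨ, hL.continuousAt.eventually hPq] with ζ₁ h1 h2
    exact ⟨h2.1, h1.trans hf h2.2⟩

/-- A function which decreases infinitesimally along the flow, in an invariant set, is strictly
decreasing along the flow. -/
theorem strictAntiOn_comp_curve {q : CotangentBundle I X → ℝ}
    (hq : MDifferentiable (cotModel I) 𝓘(ℝ, ℝ) q) {S : Set (CotangentBundle I X)}
    (hS : ∀ ζ ∈ S, ∀ ζ', HamFlow f ζ ζ' → ζ' ∈ S)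
    (hneg : ∀ ζ ∈ S, differential q ζ (hamiltonField f ζ) < 0)
    {γ : ℝ → CotangentBundle I X} {s : ℝ}
    (hγ : IsMIntegralCurveOn (I := cotModel I) γ (hamiltonField f) (Icc 0 s)) (h0 : γ 0 ∈ S) :
    StrictAntiOn (q ∘ γ) (Icc 0 s) := by
  have hd : ∀ t ∈ Icc 0 s, HasDerivWithinAt (q ∘ γ) (differential q (γ t)
      (hamiltonField f (γ t))) (Icc 0 s) t := fun t ht =>
    hasDerivWithinAt_comp_curve hγ ht (hq _)
  refine strictAntiOn_of_deriv_neg (convex_Icc 0 s) (fun t ht => (hd t ht).continuousWithinAt) ?_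
  intro t ht
  rw [interior_Icc] at ht
  have ht' := Ioo_subset_Icc_self ht
  rw [((hd t ht').hasDerivAt (Icc_mem_nhds ht.1 ht.2)).deriv]
  exact hneg _ (hS _ h0 _ ⟨γ, 0, t, ht.1.le, rfl, rfl, hγ.mono (Icc_subset_Icc le_rfl ht.2.le)⟩)

/-- If a function `q ≥ 0` decreases along the flow, and the flow cannot escape to infinity before `q`
becomes zero, then the flow reaches the hypersurface `q = 0`. -/
theorem exists_hamFlow_eq_zero [T2Space X] (hf : ContMDiff (cotModel I) 𝓘(ℝ, ℝ) ∞ f)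
    {q : CotangentBundle I X → ℝ} (hq : MDifferentiable (cotModel I) 𝓘(ℝ, ℝ) q)
    {S : Set (CotangentBundle I X)} (hSc : IsClosed S)
    (hS : ∀ ζ ∈ S, ∀ ζ', HamFlow f ζ ζ' → ζ' ∈ S)
    (hneg : ∀ ζ ∈ S, differential q ζ (hamiltonField f ζ) < 0) {ζ : CotangentBundle I X}
    (hζ : ζ ∈ S) (hqζ : 0 ≤ q ζ) {B : Set (CotangentBundle I X)} (hB : IsCompact B)
    (hSB : ∀ ζ' ∈ S, 0 ≤ q ζ' → q ζ' ≤ q ζ → ζ' ∈ B) :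
    ∃ y, q y = 0 ∧ HamFlow f ζ y := by
  -- From a minimum point of `q` on the closure of the part of the orbit where `q ≥ 0`, the flow still
  -- lowers `q`. So it does for nearby points of the orbit, which therefore gets below `q = 0`.
  set F := {ζ' | HamFlow f ζ ζ' ∧ 0 ≤ q ζ'} with hF
  have hFB : F ⊆ B := by
    rintro ζ' ⟨h, h0⟩
    refine hSB ζ' (hS ζ hζ ζ' h) h0 ?_
    obtain ⟨γ, s, hs, rfl, rfl, hγ⟩ := h.exists_curve
    exact (strictAntiOn_comp_curve hq hS hneg hγ hζ).antitoneOn (left_mem_Icc.2 hs)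
      (right_mem_Icc.2 hs) hs
  have hFc : IsCompact (closure F) :=
    hB.of_isClosed_subset isClosed_closure (closure_minimal hFB hB.isClosed)
  have hFne : (closure F).Nonempty := ⟨ζ, subset_closure ⟨HamFlow.refl ζ, hqζ⟩⟩
  obtain ⟨ζm, hζm, hmin⟩ := hFc.exists_isMinOn hFne hq.continuous.continuousOn
  have hζmS : ζm ∈ S := closure_minimal (fun ζ' h => hS ζ hζ ζ' h.1) hSc hζm
  obtain ⟨O, δ, Ψ, hOo, hO, hδ, hΨ, hΨs, -⟩ := exists_localTransport hf ζm
  have hsub : Icc 0 δ ⊆ Icc (-δ) δ := Icc_subset_Icc (by linarith) le_rfl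
  have hδm : δ ∈ Icc (-δ) δ := hsub (right_mem_Icc.2 hδ.le)
  have hlt : q (Ψ ζm δ) < q ζm := by
    have := strictAntiOn_comp_curve hq hS hneg ((hΨ ζm hO).2.mono hsub)
      (by rw [(hΨ ζm hO).1]; exact hζmS) (left_mem_Icc.2 hδ.le) (right_mem_Icc.2 hδ.le) hδ
    rwa [Function.comp_apply, Function.comp_apply, (hΨ ζm hO).1] at this
  obtain ⟨L, hL, -⟩ := hΨs ζm hO δ hδm
  have hev : ∀ᶠ ζ' in 𝓝 ζm, ζ' ∈ O ∧ q (Ψ ζ' δ) < q ζm :=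
    (hOo.eventually_mem hO).and
      ((ContinuousAt.comp (g := q) hq.continuous.continuousAt hL.continuousAt).eventually_lt_const hlt)
  obtain ⟨ζ', ⟨hζ'O, hζ'lt⟩, hζ'F⟩ := mem_closure_iff_nhds.1 hζm _ hev
  obtain ⟨e0, hcur⟩ := hΨ ζ' hζ'O
  have hflow : ∀ t ∈ Icc 0 δ, HamFlow f ζ (Ψ ζ' t) := fun t ht =>
    hζ'F.1.trans ⟨Ψ ζ', 0, t, ht.1, e0, rfl,
      hcur.mono ((Icc_subset_Icc le_rfl ht.2).trans hsub)⟩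
  have hneg' : q (Ψ ζ' δ) < 0 := by
    by_contra h
    have h1 := hmin (subset_closure ⟨hflow δ (right_mem_Icc.2 hδ.le), not_lt.1 h⟩ : Ψ ζ' δ ∈ closure F)
    exact absurd hζ'lt (not_lt.2 h1)
  obtain ⟨t, ht, ht0⟩ := intermediate_value_Icc' (f := fun t => q (Ψ ζ' t)) hδ.le
    (hq.continuous.comp_continuousOn ((hcur.mono hsub).continuousOn))
    (show (0 : ℝ) ∈ Icc (q (Ψ ζ' δ)) (q (Ψ ζ' 0)) by
      rw [e0]; exact ⟨hneg'.le, hζ'F.2⟩)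
  exact ⟨Ψ ζ' t, ht0, hflow t ht⟩

end Transversal

/-! ### The geodesic flow of a stationary spacetime -/

namespace LocalData

variable {E : Type*} [NormedAddCommGroup E] [NormedSpace ℝ E] [FiniteDimensional ℝ E]
  (A : LocalData E)

/-- Positive energy selects the sheet `τ = H` of the mass shell. -/
theorem tauL_eq_H {m : ℝ} (hm : m ≠ 0) {z : (ℝ × E) × ((ℝ × E) →L[ℝ] ℝ)}
    (hz : z.1.2 ∈ A.domain) (hK : A.K z = -m ^ 2 / 2) (hτ : 0 < tauL E z) :
    tauL E z = A.H m (spatial E z) := by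
  have hN := A.N_pos _ hz
  refine eq_energyOf (A.symm _ hz) (A.pos _ hz) hN (A.timelike _ hz) hm hτ ?_
  rw [K] at hK
  have e : (spatial E z).2 (A.β z.1.2) = z.2 (0, A.β z.1.2) := rfl
  change (tauL E z - (spatial E z).2 (A.β z.1.2)) ^ 2 = A.N z.1.2 ^ 2 * (m ^ 2 +
    conormSq (A.h z.1.2) (z.2.comp (ContinuousLinearMap.inr ℝ ℝ E)))
  rw [e, tauL_apply]
  field_simp at hK
  linarith

theorem K_eq_of_tauL_eq_H {m : ℝ} {z : (ℝ × E) × ((ℝ × E) →L[ℝ] ℝ)}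
    (hz : z.1.2 ∈ A.domain) (h : tauL E z = A.H m (spatial E z)) : A.K z = -m ^ 2 / 2 := by
  rw [A.K_eq m hz, h]; ring

/-- The energy is conserved, since the geodesic Hamiltonian does not depend on the time. -/
theorem tauL_sharp (z : (ℝ × E) × ((ℝ × E) →L[ℝ] ℝ)) (hz : z.1.2 ∈ A.domain) :
    tauL E (sharp (ℝ × E) (fderiv ℝ A.K z)) = 0 := by
  rw [tauL_apply, (sharp_fst_snd (fderiv ℝ A.K z)).2, neg_eq_zero]
  have h1 : HasDerivAt (fun s : ℝ => A.K (z + s • (((1, 0), 0) : (ℝ × E) × ((ℝ × E) →L[ℝ] ℝ))))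
      (fderiv ℝ A.K z ((1, 0), 0)) 0 := by
    have h2 : HasDerivAt (fun s : ℝ => z + s • (((1, 0), 0) : (ℝ × E) × ((ℝ × E) →L[ℝ] ℝ)))
        ((1 : ℝ) • (((1, 0), 0) : (ℝ × E) × ((ℝ × E) →L[ℝ] ℝ))) 0 :=
      ((hasDerivAt_id (0 : ℝ)).smul_const _).const_add z
    rw [one_smul] at h2
    have h4 : HasFDerivAt A.K (fderiv ℝ A.K z)
        (z + (0 : ℝ) • (((1, 0), 0) : (ℝ × E) × ((ℝ × E) →L[ℝ] ℝ))) := by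
      rw [zero_smul, add_zero]
      exact ((A.contDiffAt_K hz).differentiableAt (by simp)).hasFDerivAt
    exact h4.comp_hasDerivAt (0 : ℝ) h2
  have h3 : (fun s : ℝ => A.K (z + s • (((1, 0), 0) : (ℝ × E) × ((ℝ × E) →L[ℝ] ℝ)))) =
      fun _ => A.K z := by
    funext s
    simp [K]
  rw [h3] at h1
  exact h1.unique (hasDerivAt_const _ _)

/-- On the mass shell, the rate of change of the time along the geodesic flow. -/
theorem time_sharp {m : ℝ} (hm : m ≠ 0) {z : (ℝ × E) × ((ℝ × E) →L[ℝ] ℝ)}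
    (hz : z.1.2 ∈ A.domain) (h : tauL E z = A.H m (spatial E z)) :
    (sharp (ℝ × E) (fderiv ℝ A.K z)).1.1 = A.shellFactor m z := by
  have h1 := (sharp_fst_snd (fderiv ℝ A.K z)).1 (ContinuousLinearMap.fst ℝ ℝ E)
  have h2 : spatial E ((0 : ℝ × E), ContinuousLinearMap.fst ℝ ℝ E) = 0 := by
    rw [spatial_apply]
    refine Prod.ext rfl ?_
    ext v
    simp
  rw [(A.fderiv_K hm hz h).2, h2, map_zero] at h1
  simpa [tauL_apply] using h1

end LocalData

namespace StationaryData

variable {r : ℕ} {Sig : Type*} [TopologicalSpace Sig]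
  [ChartedSpace (EuclideanSpace ℝ (Fin r)) Sig] [IsManifold (𝓡 r) ∞ Sig]
  (D : StationaryData r Sig)

/-- The time `t` as a function on the cotangent bundle of spacetime. -/
def time (ζ : CotangentBundle (stModel r) (ℝ × Sig)) : ℝ := ζ.proj.1

/-- The chart of the cotangent bundle of spacetime given by the chart of space at `a`. -/
abbrev cotChart (a : Sig) := extChartAt (cotModel (stModel r)) (basePoint (r := r) a)

theorem eventually_inChart {a : Sig} {ζ : CotangentBundle (stModel r) (ℝ × Sig)}
    (h : ζ.proj.2 ∈ (chartAt (EuclideanSpace ℝ (Fin r)) a).source) :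
    (∀ᶠ z in 𝓝 (cotChart a ζ),
      z.1.2 ∈ (chartAt (EuclideanSpace ℝ (Fin r)) a).target) := by
  have h1 := (cotChart a).map_source (mem_cot_source.2 h)
  filter_upwards [(isOpen_extChartAt_target (basePoint (r := r) a)).mem_nhds h1] with z hz
  exact mem_cot_target.1 hz

theorem cotChart_mem {a : Sig} {ζ : CotangentBundle (stModel r) (ℝ × Sig)}
    (h : ζ.proj.2 ∈ (chartAt (EuclideanSpace ℝ (Fin r)) a).source) :
    (cotChart a ζ).1.2 ∈ (chartAt (EuclideanSpace ℝ (Fin r)) a).target :=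
  (eventually_inChart h).self_of_nhds

theorem inChart_cotChart {a : Sig} {ζ : CotangentBundle (stModel r) (ℝ × Sig)}
    (h : ζ.proj.2 ∈ (chartAt (EuclideanSpace ℝ (Fin r)) a).source)
    (f : CotangentBundle (stModel r) (ℝ × Sig) → ℝ) :
    inChart (basePoint (r := r) a) f (cotChart a ζ) = f ζ := by
  rw [inChart, Function.comp_apply, (cotChart a).left_inv (mem_cot_source.2 h)]

theorem inChart_time {a : Sig} {z : (ℝ × EuclideanSpace ℝ (Fin r)) ×
      ((ℝ × EuclideanSpace ℝ (Fin r)) →L[ℝ] ℝ)}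
    (hz : z.1.2 ∈ (chartAt (EuclideanSpace ℝ (Fin r)) a).target) :
    inChart (basePoint (r := r) a) time z = z.1.1 := by
  rw [inChart, Function.comp_apply, cot_symm hz]
  rfl

theorem contMDiff_of_inChart {f : CotangentBundle (stModel r) (ℝ × Sig) → ℝ}
    (h : ∀ (a : Sig) (z : (ℝ × EuclideanSpace ℝ (Fin r)) ×
      ((ℝ × EuclideanSpace ℝ (Fin r)) →L[ℝ] ℝ)),
      z.1.2 ∈ (chartAt (EuclideanSpace ℝ (Fin r)) a).target →
      ContDiffAt ℝ ∞ (inChart (basePoint (r := r) a) f) z) :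
    ContMDiff (cotModel (stModel r)) 𝓘(ℝ, ℝ) ∞ f := by
  intro ζ
  have hs : ζ.proj.2 ∈ (chartAt (EuclideanSpace ℝ (Fin r)) ζ.proj.2).source := mem_chart_source _ _
  have hs' := mem_cot_source.2 hs
  have h1 := (h _ _ (cotChart_mem hs)).contMDiffAt
  have h2 : ContMDiffAt (cotModel (stModel r))
      𝓘(ℝ, (ℝ × EuclideanSpace ℝ (Fin r)) × ((ℝ × EuclideanSpace ℝ (Fin r)) →L[ℝ] ℝ)) ∞
      (cotChart ζ.proj.2) ζ :=
    contMDiffAt_extChartAt' (by rwa [extChartAt_source] at hs')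
  refine (ContMDiffAt.comp ζ h1 h2).congr_of_eventuallyEq ?_
  filter_upwards [(isOpen_extChartAt_source (basePoint (r := r) ζ.proj.2)).mem_nhds hs'] with ζ' hζ'
  exact (inChart_cotChart (mem_cot_source.1 hζ') f).symm

theorem eventuallyEq_inChart {f : CotangentBundle (stModel r) (ℝ × Sig) → ℝ} {a : Sig}
    {F : (ℝ × EuclideanSpace ℝ (Fin r)) × ((ℝ × EuclideanSpace ℝ (Fin r)) →L[ℝ] ℝ) → ℝ}
    (h : ∀ {z : (ℝ × EuclideanSpace ℝ (Fin r)) × ((ℝ × EuclideanSpace ℝ (Fin r)) →L[ℝ] ℝ)},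
      z.1.2 ∈ (chartAt (EuclideanSpace ℝ (Fin r)) a).target →
      inChart (basePoint (r := r) a) f z = F z)
    {z : (ℝ × EuclideanSpace ℝ (Fin r)) × ((ℝ × EuclideanSpace ℝ (Fin r)) →L[ℝ] ℝ)}
    (hz : z.1.2 ∈ (chartAt (EuclideanSpace ℝ (Fin r)) a).target) :
    inChart (basePoint (r := r) a) f =ᶠ[𝓝 z] F := by
  filter_upwards [(isOpen_extChartAt_target (basePoint (r := r) a)).mem_nhds
    (mem_cot_target.2 hz)] with z' hz'
  exact h (mem_cot_target.1 hz')

theorem contMDiff_geodesicHamiltonian :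
    ContMDiff (cotModel (stModel r)) 𝓘(ℝ, ℝ) ∞ (geodesicHamiltonian D.metric) :=
  contMDiff_of_inChart fun a _ hz => ((D.localData a).contDiffAt_K hz).congr_of_eventuallyEq
    (eventuallyEq_inChart D.inChart_geodesicHamiltonian hz)

theorem contMDiff_energy :
    ContMDiff (cotModel (stModel r)) 𝓘(ℝ, ℝ) ∞ (energy (r := r) (Sig := Sig)) :=
  contMDiff_of_inChart fun _ _ hz =>
    (LocalData.tauL (EuclideanSpace ℝ (Fin r))).contDiff.contDiffAt.congr_of_eventuallyEq
    (eventuallyEq_inChart inChart_energy hz)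

/-- The coordinate `t` of the cotangent bundle of `ℝ × E`. -/
def timeL (E : Type*) [NormedAddCommGroup E] [NormedSpace ℝ E] :
    ((ℝ × E) × ((ℝ × E) →L[ℝ] ℝ)) →L[ℝ] ℝ :=
  (ContinuousLinearMap.fst ℝ ℝ E).comp (ContinuousLinearMap.fst ℝ _ _)

theorem contMDiff_time :
    ContMDiff (cotModel (stModel r)) 𝓘(ℝ, ℝ) ∞ (time (r := r) (Sig := Sig)) :=
  contMDiff_of_inChart fun _ _ hz =>
    (timeL (EuclideanSpace ℝ (Fin r))).contDiff.contDiffAt.congr_of_eventuallyEq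
    (eventuallyEq_inChart inChart_time hz)

/-- The canonical coordinates of the cotangent bundle of spacetime. -/
theorem exists_cotChart {a : Sig} {ζ : CotangentBundle (stModel r) (ℝ × Sig)}
    (h : ζ.proj.2 ∈ (chartAt (EuclideanSpace ℝ (Fin r)) a).source) :
    ∃ L : TangentSpace (cotModel (stModel r)) ζ ≃L[ℝ]
        ((ℝ × EuclideanSpace ℝ (Fin r)) × ((ℝ × EuclideanSpace ℝ (Fin r)) →L[ℝ] ℝ)),
      HasMFDerivAt (cotModel (stModel r))
        𝓘(ℝ, (ℝ × EuclideanSpace ℝ (Fin r)) × ((ℝ × EuclideanSpace ℝ (Fin r)) →L[ℝ] ℝ))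
        (cotChart a) ζ (L : TangentSpace (cotModel (stModel r)) ζ →L[ℝ]
          ((ℝ × EuclideanSpace ℝ (Fin r)) × ((ℝ × EuclideanSpace ℝ (Fin r)) →L[ℝ] ℝ))) ∧
      (∀ u v, symplecticModel (ℝ × EuclideanSpace ℝ (Fin r)) (L u) (L v) =
        symplecticForm ζ u v) ∧
      (∀ u, differential (geodesicHamiltonian D.metric) ζ u =
        fderiv ℝ (D.localData a).K (cotChart a ζ) (L u)) ∧
      L (hamiltonField (geodesicHamiltonian D.metric) ζ) =
        sharp (ℝ × EuclideanSpace ℝ (Fin r)) (fderiv ℝ (D.localData a).K (cotChart a ζ)) ∧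
      (∀ u, differential energy ζ u = LocalData.tauL _ (L u)) ∧
      (∀ u, differential time ζ u = (L u).1.1) := by
  obtain ⟨L, hL, -, hLs, hLf⟩ := exists_chart_symplectic (I := stModel r) (ζ₀ := basePoint (r := r) a)
    (mem_cot_chart_source.2 h)
  have hmem := cotChart_mem h
  have e1 := eventuallyEq_inChart D.inChart_geodesicHamiltonian hmem
  have e2 := eventuallyEq_inChart inChart_energy hmem
  have e3 := eventuallyEq_inChart (F := timeL (EuclideanSpace ℝ (Fin r))) inChart_time hmem
  have d1 := hLf (geodesicHamiltonian D.metric)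
    (((D.localData a).contDiffAt_K hmem).differentiableAt (by simp) |>.congr_of_eventuallyEq e1)
  have d2 := hLf energy
    ((LocalData.tauL (EuclideanSpace ℝ (Fin r))).differentiableAt.congr_of_eventuallyEq e2)
  have d3 := hLf time
    ((timeL (EuclideanSpace ℝ (Fin r))).differentiableAt.congr_of_eventuallyEq e3)
  rw [e1.fderiv_eq] at d1
  rw [e2.fderiv_eq, ContinuousLinearMap.fderiv] at d2
  rw [e3.fderiv_eq, ContinuousLinearMap.fderiv] at d3
  exact ⟨L, hL, hLs, d1.1, d1.2, d2.1, d3.1⟩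

/-- The part of the mass hyperboloid where the energy is positive: one of the two sheets of timelike
covectors. -/
def shell (m : ℝ) : Set (CotangentBundle (stModel r) (ℝ × Sig)) :=
  {ζ | ζ ∈ massHyperboloid D.metric m ∧ 0 < energy ζ}

theorem mem_massHyperboloid_iff {m : ℝ} {ζ : CotangentBundle (stModel r) (ℝ × Sig)} :
    ζ ∈ massHyperboloid D.metric m ↔ geodesicHamiltonian D.metric ζ = -m ^ 2 / 2 := by
  rw [massHyperboloid, mem_ofPred_eq, geodesicHamiltonian]
  constructor <;> intro h <;> linarith

theorem tauL_cotChart {m : ℝ} (hm : m ≠ 0) {a : Sig}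
    {ζ : CotangentBundle (stModel r) (ℝ × Sig)}
    (h : ζ.proj.2 ∈ (chartAt (EuclideanSpace ℝ (Fin r)) a).source) (hζ : ζ ∈ D.shell m) :
    LocalData.tauL _ (cotChart a ζ) = (D.localData a).H m (LocalData.spatial _ (cotChart a ζ)) := by
  have hmem := cotChart_mem h
  refine (D.localData a).tauL_eq_H hm hmem ?_ ?_
  · rw [← D.inChart_geodesicHamiltonian hmem, inChart_cotChart h]
    exact D.mem_massHyperboloid_iff.1 hζ.1
  · rw [← inChart_energy hmem, inChart_cotChart h]
    exact hζ.2

theorem differential_energy (ζ : CotangentBundle (stModel r) (ℝ × Sig)) :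
    differential energy ζ (hamiltonField (geodesicHamiltonian D.metric) ζ) = 0 := by
  have hs : ζ.proj.2 ∈ (chartAt (EuclideanSpace ℝ (Fin r)) ζ.proj.2).source := mem_chart_source _ _
  obtain ⟨L, -, -, -, hX, hτ, -⟩ := D.exists_cotChart hs
  rw [hτ, hX]
  exact (D.localData _).tauL_sharp _ (cotChart_mem hs)

/-- On the mass shell the time is strictly monotone along the geodesic flow. -/
theorem differential_time_neg {m : ℝ} (hm : m ≠ 0) {ζ : CotangentBundle (stModel r) (ℝ × Sig)}
    (hζ : ζ ∈ D.shell m) :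
    differential time ζ (hamiltonField (geodesicHamiltonian D.metric) ζ) < 0 := by
  have hs : ζ.proj.2 ∈ (chartAt (EuclideanSpace ℝ (Fin r)) ζ.proj.2).source := mem_chart_source _ _
  obtain ⟨L, -, -, -, hX, -, ht⟩ := D.exists_cotChart hs
  have h1 := D.tauL_cotChart hm hs hζ
  rw [ht, hX, (D.localData _).time_sharp hm (cotChart_mem hs) h1]
  exact ((D.localData _).fderiv_K hm (cotChart_mem hs) h1).1

theorem SameOrbit.energy_eq {ζ ζ' : CotangentBundle (stModel r) (ℝ × Sig)}
    (h : SameOrbit (geodesicHamiltonian D.metric) ζ ζ') : energy ζ' = energy ζ := by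
  have hm := contMDiff_energy (r := r) (Sig := Sig) |>.mdifferentiable (by simp)
  rcases h with h | h
  · exact h.conserves hm D.differential_energy
  · exact (h.conserves hm D.differential_energy).symm

theorem SameOrbit.hamiltonian_eq {ζ ζ' : CotangentBundle (stModel r) (ℝ × Sig)}
    (h : SameOrbit (geodesicHamiltonian D.metric) ζ ζ') :
    geodesicHamiltonian D.metric ζ' = geodesicHamiltonian D.metric ζ := by
  have hm := D.contMDiff_geodesicHamiltonian.mdifferentiable (by simp)
  rcases h with h | h
  · exact h.conserves hm differential_hamiltonField_self
  · exact (h.conserves hm differential_hamiltonField_self).symm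

theorem SameOrbit.mem_shell {m : ℝ} {ζ ζ' : CotangentBundle (stModel r) (ℝ × Sig)}
    (h : SameOrbit (geodesicHamiltonian D.metric) ζ ζ') (hζ : ζ ∈ D.shell m) : ζ' ∈ D.shell m := by
  refine ⟨?_, by rw [SameOrbit.energy_eq D h]; exact hζ.2⟩
  rw [mem_massHyperboloid_iff, SameOrbit.hamiltonian_eq D h, ← mem_massHyperboloid_iff]
  exact hζ.1

/-- Two points of the hyperboloid bundle are on one geodesic if and only if the geodesic flow moves
one of them to the other. -/
theorem mk_eq_mk_iff [T2Space Sig] {m : ℝ} {ζ ζ' : massHyperboloid D.metric m} :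
    MassiveGeodesics.mk ζ = MassiveGeodesics.mk ζ' ↔
      SameOrbit (geodesicHamiltonian D.metric) ζ.1 ζ'.1 := by
  constructor
  · intro h
    have h1 := Quot.eqvGen_exact h
    clear h
    induction h1 with
    | rel x y h => exact Or.inl h
    | refl x => exact Or.inl (HamFlow.refl _)
    | symm x y _ h => exact h.symm
    | trans x y z _ _ h1 h2 => exact h1.trans D.contMDiff_geodesicHamiltonian h2
  · rintro (h | h)
    · exact Quot.sound h
    · exact (show MassiveGeodesics.mk ζ' = MassiveGeodesics.mk ζ from Quot.sound h).symm

/-- Along the flow, in the shell, the time is strictly decreasing. -/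
theorem strictAntiOn_time {m : ℝ} (hm : m ≠ 0) {γ : ℝ → CotangentBundle (stModel r) (ℝ × Sig)}
    {s : ℝ} (hγ : IsMIntegralCurveOn (I := cotModel (stModel r)) γ
      (hamiltonField (geodesicHamiltonian D.metric)) (Icc 0 s)) (h0 : γ 0 ∈ D.shell m) :
    StrictAntiOn (time ∘ γ) (Icc 0 s) :=
  strictAntiOn_comp_curve (contMDiff_time.mdifferentiable (by simp))
    (fun _ hζ _ h => SameOrbit.mem_shell D (Or.inl h) hζ)
    (fun _ hζ => D.differential_time_neg hm hζ) hγ h0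

/-- An orbit meets each hypersurface of constant time at most once, as the time is strictly monotone. -/
theorem HamFlow.eq_of_time_eq {m : ℝ} (hm : m ≠ 0)
    {ζ ζ' : CotangentBundle (stModel r) (ℝ × Sig)}
    (h : HamFlow (geodesicHamiltonian D.metric) ζ ζ') (hζ : ζ ∈ D.shell m)
    (ht : time ζ = time ζ') : ζ = ζ' := by
  obtain ⟨γ, s, hs, rfl, rfl, hγ⟩ := h.exists_curve
  rcases hs.eq_or_lt with rfl | hs
  · rfl
  · have := D.strictAntiOn_time hm hγ hζ (left_mem_Icc.2 hs.le) (right_mem_Icc.2 hs.le) hs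
    exact absurd ht.symm this.ne

theorem SameOrbit.eq_of_time_eq {m : ℝ} (hm : m ≠ 0)
    {ζ ζ' : CotangentBundle (stModel r) (ℝ × Sig)}
    (h : SameOrbit (geodesicHamiltonian D.metric) ζ ζ') (hζ : ζ ∈ D.shell m)
    (ht : time ζ = time ζ') : ζ = ζ' := by
  rcases id h with h' | h'
  · exact HamFlow.eq_of_time_eq D hm h' hζ ht
  · exact (HamFlow.eq_of_time_eq D hm h' (SameOrbit.mem_shell D h hζ) ht.symm).symm

end StationaryData

/-! ### Properness of the energy and the hypersurface of time zero -/

theorem energyOf_zero_smul {E : Type*} [NormedAddCommGroup E] [NormedSpace ℝ E]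
    [FiniteDimensional ℝ E]
    (b : E →L[ℝ] E →L[ℝ] ℝ) (N : ℝ) (β : E) {s : ℝ} (hs : 0 ≤ s)
    (η : E →L[ℝ] ℝ) : energyOf b N β 0 (s • η) = s * energyOf b N β 0 η := by
  have : √(0 ^ 2 + s ^ 2 * conormSq b η) = s * √(0 ^ 2 + conormSq b η) := by
    rw [show (0 : ℝ) ^ 2 + s ^ 2 * conormSq b η = s ^ 2 * (0 ^ 2 + conormSq b η) by ring,
      Real.sqrt_mul (by positivity), Real.sqrt_sq hs]
  rw [energyOf, energyOf, conormSq_smul, this]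
  simp only [_root_.smul_apply, smul_eq_mul]; ring

namespace LocalData

variable {E : Type*} [NormedAddCommGroup E] [NormedSpace ℝ E] [FiniteDimensional ℝ E]
  (A : LocalData E)

theorem continuousOn_H (m : ℝ) : ContinuousOn (A.H m) {w | w.1 ∈ A.domain} := by
  intro w hw
  have h1 := (A.contDiffAt_pairing hw).continuousAt
  have h2 := (A.contDiffAt_lapse hw).continuousAt
  have h3 := (A.contDiffAt_conormSq hw).continuousAt
  exact (h1.add (h2.mul (Real.continuous_sqrt.continuousAt.comp
    (continuousAt_const.add h3)))).continuousWithinAt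

/-- The positivity of the energy survives in the limit of mass zero, as long as the momentum does not
vanish; with homogeneity this bounds the momentum by the energy. -/
theorem H_zero_pos {w : E × (E →L[ℝ] ℝ)} (hw : w.1 ∈ A.domain) (h0 : w.2 ≠ 0) : 0 < A.H 0 w := by
  have hN := A.N_pos _ hw
  have hp := A.pos _ hw
  have hinv : (A.h w.1).inverse w.2 ≠ 0 := by
    intro h
    have := apply_inverse_of_pos hp w.2
    rw [h, map_zero] at this
    exact h0 this.symm
  have hq : 0 < conormSq (A.h w.1) w.2 := by rw [conormSq_eq hp]; exact hp _ hinv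
  have h1 := apply_sq_le_conormSq (A.symm _ hw) hp w.2 (A.β w.1)
  have h2 := A.timelike _ hw
  have h3 : |w.2 (A.β w.1)| < A.N w.1 * √(0 ^ 2 + conormSq (A.h w.1) w.2) := by
    apply abs_lt_of_sq_lt_sq _ (by positivity)
    rw [mul_pow, Real.sq_sqrt (by positivity)]
    nlinarith
  rw [H, energyOf]
  linarith [neg_abs_le (w.2 (A.β w.1))]

theorem H_zero_le {w : E × (E →L[ℝ] ℝ)} (hw : w.1 ∈ A.domain) (m : ℝ) : A.H 0 w ≤ A.H m w := by
  have hN := A.N_pos _ hw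
  rw [H, H, energyOf, energyOf]
  have h := Real.sqrt_le_sqrt (show (0 : ℝ) ^ 2 + conormSq (A.h w.1) w.2 ≤
    m ^ 2 + conormSq (A.h w.1) w.2 by nlinarith [sq_nonneg m])
  nlinarith

/-- The energy is proper over compact sets. -/
theorem isCompact_sublevel (m : ℝ) {C : Set E} (hC : IsCompact C) (hCd : C ⊆ A.domain) (c : ℝ) :
    IsCompact {w : E × (E →L[ℝ] ℝ) | w.1 ∈ C ∧ A.H m w ≤ c} := by
  have : ProperSpace (E →L[ℝ] ℝ) := FiniteDimensional.proper ℝ _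
  -- `H` of mass zero is homogeneous, and at least `κ` on unit momenta
  obtain ⟨κ, hκ, hκ'⟩ := (hC.prod (isCompact_sphere (0 : E →L[ℝ] ℝ) 1)).exists_forall_le'
    (f := A.H 0) (a := 0) ((A.continuousOn_H 0).mono fun w hw => hCd hw.1) (by
      rintro w ⟨hw, hs⟩
      refine A.H_zero_pos (hCd hw) ?_
      rintro h
      rw [h] at hs
      simp at hs)
  have hbd : ∀ w : E × (E →L[ℝ] ℝ), w.1 ∈ C → A.H m w ≤ c → ‖w.2‖ ≤ |c| / κ := by
    intro w hw hwc
    rcases eq_or_ne w.2 0 with h | h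
    · rw [h, norm_zero]; positivity
    · have hn : 0 < ‖w.2‖ := norm_pos_iff.2 h
      have h1 := hκ' (w.1, ‖w.2‖⁻¹ • w.2) ⟨hw, by
        rw [mem_sphere_zero_iff_norm, norm_smul, norm_inv, norm_norm, inv_mul_cancel₀ hn.ne']⟩
      have h2 : A.H 0 (w.1, ‖w.2‖⁻¹ • w.2) = ‖w.2‖⁻¹ * A.H 0 w :=
        energyOf_zero_smul _ _ _ (by positivity) _
      rw [h2, ← div_eq_inv_mul, le_div_iff₀ hn] at h1
      rw [le_div_iff₀ hκ]
      linarith [A.H_zero_le (hCd hw) m, le_abs_self c]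
  have h1 : IsCompact (C ×ˢ Metric.closedBall (0 : E →L[ℝ] ℝ) (|c| / κ)) :=
    hC.prod (isCompact_closedBall _ _)
  have h2 : IsClosed ((C ×ˢ Metric.closedBall (0 : E →L[ℝ] ℝ) (|c| / κ)) ∩ A.H m ⁻¹' Iic c) :=
    ((A.continuousOn_H m).mono fun w hw => hCd hw.1).preimage_isClosed_of_isClosed
      h1.isClosed isClosed_Iic
  refine (h1.of_isClosed_subset h2 inter_subset_left).of_isClosed_subset ?_ ?_ |> id
  · convert h2 using 1
    ext w
    simp only [mem_ofPred_eq, mem_inter_iff, mem_prod, Metric.mem_closedBall, dist_zero_right,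
      mem_preimage, mem_Iic]
    exact ⟨fun h => ⟨⟨h.1, hbd w h.1 h.2⟩, h.2⟩, fun h => ⟨h.1.1, h.2⟩⟩
  · intro w h
    exact ⟨⟨h.1, by simpa using hbd w h.1 h.2⟩, h.2⟩

/-- The point of the cotangent bundle of spacetime with time `t` and energy `τ` over a point of the
phase space `T*Σ`. -/
def lift (t τ : ℝ) (w : E × (E →L[ℝ] ℝ)) : (ℝ × E) × ((ℝ × E) →L[ℝ] ℝ) :=
  ((t, w.1), τ • ContinuousLinearMap.fst ℝ ℝ E + w.2.comp (ContinuousLinearMap.snd ℝ ℝ E))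

theorem tauL_lift (t τ : ℝ) (w : E × (E →L[ℝ] ℝ)) : tauL E (lift t τ w) = τ := by
  simp [tauL_apply, lift]

theorem spatial_lift (t τ : ℝ) (w : E × (E →L[ℝ] ℝ)) : spatial E (lift t τ w) = w := by
  rw [spatial_apply]
  refine Prod.ext rfl ?_
  ext v
  simp [lift]

theorem lift_eta (z : (ℝ × E) × ((ℝ × E) →L[ℝ] ℝ)) :
    lift z.1.1 (tauL E z) (spatial E z) = z := by
  refine Prod.ext rfl ?_
  refine ContinuousLinearMap.coe_injective (LinearMap.ext fun q => ?_)
  have : q = q.1 • ((1 : ℝ), (0 : E)) + (0, q.2) := by ext <;> simp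
  have h := congrArg z.2 this
  rw [map_add, map_smul] at h
  refine Eq.trans ?_ h.symm
  simp [lift, tauL_apply, spatial_apply, mul_comm]

end LocalData

namespace StationaryData

variable {r : ℕ} {Sig : Type*} [TopologicalSpace Sig]
  [ChartedSpace (EuclideanSpace ℝ (Fin r)) Sig] [IsManifold (𝓡 r) ∞ Sig]
  (D : StationaryData r Sig)

/-- Finitely many compact sets in chart domains cover `Σ`. -/
theorem exists_compact_cover [CompactSpace Sig] [T2Space Sig] :
    ∃ (s : Finset Sig) (C : Sig → Set Sig), (∀ a, IsCompact (C a)) ∧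
      (∀ a, C a ⊆ (chartAt (EuclideanSpace ℝ (Fin r)) a).source) ∧
      ∀ x, ∃ a ∈ s, x ∈ C a := by
  choose C hC hCc hCs using fun a : Sig => exists_mem_nhds_isCompact_mapsTo (X := Sig) (Y := Sig)
    (f := id) continuous_id (x := a)
    ((chartAt (EuclideanSpace ℝ (Fin r)) a).open_source.mem_nhds (mem_chart_source _ a))
  obtain ⟨s, hs⟩ := isCompact_univ.elim_nhds_subcover C fun a _ => hC a
  refine ⟨s, C, hCc, fun a x hx => hCs a hx, fun x => ?_⟩
  have := hs.2 (mem_univ x)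
  simpa using this

/-- A mass shell particle of given energy in a bounded interval of time is confined to a compact set. -/
theorem exists_isCompact_shell [CompactSpace Sig] [T2Space Sig] {m : ℝ} (hm : m ≠ 0) (c T : ℝ) :
    ∃ B : Set (CotangentBundle (stModel r) (ℝ × Sig)), IsCompact B ∧
      ∀ ζ ∈ D.shell m, energy ζ = c → |time ζ| ≤ T → ζ ∈ B := by
  obtain ⟨s, C, hC, hCs, hs⟩ := exists_compact_cover (r := r) (Sig := Sig)
  have hcpt : ∀ a : Sig, IsCompact ((fun p : ℝ × (_ × _) => (cotChart a).symm
      (LocalData.lift p.1 c p.2)) '' (Icc (-T) T ×ˢ {w : EuclideanSpace ℝ (Fin r) × _ | w.1 ∈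
        chartAt (EuclideanSpace ℝ (Fin r)) a '' (C a) ∧ (D.localData a).H m w ≤ c})) := by
    intro a
    have himg : chartAt (EuclideanSpace ℝ (Fin r)) a '' (C a) ⊆ (D.localData a).domain := by
      rintro _ ⟨x, hx, rfl⟩
      exact (chartAt (EuclideanSpace ℝ (Fin r)) a).map_source (hCs a hx)
    have h1 : IsCompact (chartAt (EuclideanSpace ℝ (Fin r)) a '' (C a)) :=
      (hC a).image_of_continuousOn
        ((chartAt (EuclideanSpace ℝ (Fin r)) a).continuousOn.mono (hCs a))
    refine (isCompact_Icc.prod ((D.localData a).isCompact_sublevel m h1 himg c)).image_of_continuousOn ?_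
    refine (continuousOn_extChartAt_symm (I := cotModel (stModel r))
      (basePoint (r := r) a)).comp (t := (cotChart a).target) ?_ ?_
    · unfold LocalData.lift
      fun_prop
    · rintro ⟨t, w⟩ ⟨-, hw, -⟩
      exact mem_cot_target.2 (himg hw)
  refine ⟨_, s.isCompact_biUnion fun a _ => hcpt a, fun ζ hζ hc hT => ?_⟩
  obtain ⟨a, ha, hxa⟩ := hs ζ.proj.2
  have hsrc := hCs a hxa
  refine mem_iUnion₂.2 ⟨a, ha, ⟨(time ζ, LocalData.spatial _ (cotChart a ζ)),
    ⟨abs_le.1 hT, ?_, ?_⟩, ?_⟩⟩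
  · exact ⟨ζ.proj.2, hxa, by rw [cot_apply hsrc]; rfl⟩
  · change (D.localData a).H m (LocalData.spatial _ (cotChart a ζ)) ≤ c
    rw [← D.tauL_cotChart hm hsrc hζ, ← inChart_energy (cotChart_mem hsrc), inChart_cotChart hsrc,
      hc]
  · have h1 : c = LocalData.tauL _ (cotChart a ζ) := by
      rw [← inChart_energy (cotChart_mem hsrc), inChart_cotChart hsrc, hc]
    have h2 : time ζ = (cotChart a ζ).1.1 := by
      rw [← inChart_time (cotChart_mem hsrc), inChart_cotChart hsrc]
    change (cotChart a).symm (LocalData.lift (time ζ) c (LocalData.spatial _ (cotChart a ζ))) = ζ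
    rw [h1, h2, LocalData.lift_eta]
    exact (cotChart a).left_inv (mem_cot_source.2 hsrc)

/-- Every orbit in the mass shell meets the hypersurface `t = 0`: as its energy is conserved and space
is compact, it cannot leave all compact sets before. -/
theorem exists_time_eq_zero [CompactSpace Sig] [T2Space Sig] {m : ℝ} (hm : m ≠ 0)
    {ζ : CotangentBundle (stModel r) (ℝ × Sig)} (hζ : ζ ∈ D.shell m) :
    ∃ y ∈ D.shell m, time y = 0 ∧ SameOrbit (geodesicHamiltonian D.metric) ζ y := by
  suffices h : ∃ y, time y = 0 ∧ SameOrbit (geodesicHamiltonian D.metric) ζ y by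
    obtain ⟨y, h0, h⟩ := h
    exact ⟨y, SameOrbit.mem_shell D h hζ, h0, h⟩
  set S : Set (CotangentBundle (stModel r) (ℝ × Sig)) :=
    {ζ' | geodesicHamiltonian D.metric ζ' = -m ^ 2 / 2 ∧ energy ζ' = energy ζ} with hSdef
  have hSshell : ∀ ζ' ∈ S, ζ' ∈ D.shell m := fun ζ' h =>
    ⟨D.mem_massHyperboloid_iff.2 h.1, by rw [h.2]; exact hζ.2⟩
  have hSc : IsClosed S := (isClosed_eq D.contMDiff_geodesicHamiltonian.continuous
    continuous_const).inter (isClosed_eq contMDiff_energy.continuous continuous_const)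
  have hS : ∀ ζ' ∈ S, ∀ ζ'', SameOrbit (geodesicHamiltonian D.metric) ζ' ζ'' → ζ'' ∈ S :=
    fun ζ' h ζ'' h' => ⟨(SameOrbit.hamiltonian_eq D h').trans h.1,
      (SameOrbit.energy_eq D h').trans h.2⟩
  have hζS : ζ ∈ S := ⟨D.mem_massHyperboloid_iff.1 hζ.1, rfl⟩
  have htime := contMDiff_time (r := r) (Sig := Sig) |>.mdifferentiable (by simp)
  obtain ⟨B, hB, hBS⟩ := D.exists_isCompact_shell hm (energy ζ) |time ζ|
  rcases le_total 0 (time ζ) with h0 | h0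
  · obtain ⟨y, hy, h⟩ := exists_hamFlow_eq_zero D.contMDiff_geodesicHamiltonian htime hSc
      (fun ζ' h ζ'' h' => hS ζ' h ζ'' (Or.inl h'))
      (fun ζ' h => D.differential_time_neg hm (hSshell ζ' h)) hζS h0 hB
      (fun ζ' h h1 h2 => hBS ζ' (hSshell ζ' h) h.2 (by rwa [abs_of_nonneg h1, abs_of_nonneg h0]))
    exact ⟨y, hy, Or.inl h⟩
  · have hdt : ∀ ζ' : CotangentBundle (stModel r) (ℝ × Sig), differential (-time) ζ'
        (hamiltonField (-geodesicHamiltonian D.metric) ζ') =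
        differential time ζ' (hamiltonField (geodesicHamiltonian D.metric) ζ') := by
      intro ζ'
      have h1 : differential (-(time (r := r) (Sig := Sig))) ζ' = -differential time ζ' :=
        mfderiv_neg
      rw [hamiltonField_neg, h1, map_neg]
      exact neg_neg _
    obtain ⟨y, hy, h⟩ := exists_hamFlow_eq_zero (f := -geodesicHamiltonian D.metric)
      (q := -time) D.contMDiff_geodesicHamiltonian.neg htime.neg hSc
      (fun ζ' h ζ'' h' => hS ζ' h ζ'' (Or.inr (hamFlow_neg_iff.1 h')))
      (fun ζ' h => by rw [hdt]; exact D.differential_time_neg hm (hSshell ζ' h)) hζS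
      (by simpa using h0) hB
      (fun ζ' h h1 h2 => hBS ζ' (hSshell ζ' h) h.2 (by
        simp only [Pi.neg_apply] at h1 h2
        rw [abs_of_nonpos (by linarith), abs_of_nonpos h0]; exact h2))
    exact ⟨y, by simpa using hy, Or.inr (hamFlow_neg_iff.1 h)⟩

end StationaryData

/-! ### Linear coordinates on phase space -/

/-- The coordinates of phase space: the first half are the positions, the second half are the
momenta. -/
def phaseIndex (d : ℕ) : Fin (d + 1) ⊕ Fin (d + 1) ≃ Fin (2 * d + 1 + 1) :=
  finSumFinEquiv.trans (finCongr (by omega))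

/-- The position with given coordinates. -/
def position (d : ℕ) : (Fin (2 * d + 1 + 1) → ℝ) →ₗ[ℝ] EuclideanSpace ℝ (Fin (d + 1)) :=
  (EuclideanSpace.equiv (Fin (d + 1)) ℝ).symm.toLinearMap ∘ₗ
    LinearMap.funLeft ℝ ℝ (fun i => phaseIndex d (Sum.inl i))

/-- The momentum with given coordinates, as a vector. -/
def momentum (d : ℕ) : (Fin (2 * d + 1 + 1) → ℝ) →ₗ[ℝ] EuclideanSpace ℝ (Fin (d + 1)) :=
  (EuclideanSpace.equiv (Fin (d + 1)) ℝ).symm.toLinearMap ∘ₗ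
    LinearMap.funLeft ℝ ℝ (fun i => phaseIndex d (Sum.inr i))

theorem position_apply {d : ℕ} (y : Fin (2 * d + 1 + 1) → ℝ) (i : Fin (d + 1)) :
    position d y i = y (phaseIndex d (Sum.inl i)) := rfl

theorem momentum_apply {d : ℕ} (y : Fin (2 * d + 1 + 1) → ℝ) (i : Fin (d + 1)) :
    momentum d y i = y (phaseIndex d (Sum.inr i)) := rfl

/-- The linear coordinates of phase space. -/
def phaseEquiv (d : ℕ) : (Fin (2 * d + 1 + 1) → ℝ) ≃L[ℝ]
    EuclideanSpace ℝ (Fin (d + 1)) × (EuclideanSpace ℝ (Fin (d + 1)) →L[ℝ] ℝ) :=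
  LinearEquiv.toContinuousLinearEquiv <|
    LinearEquiv.ofBijective ((position d).prod
        ((InnerProductSpace.toDual ℝ (EuclideanSpace ℝ (Fin (d + 1)))).toLinearEquiv.toLinearMap ∘ₗ
          momentum d)) (by
      constructor
      · intro y y' h
        obtain ⟨h1, h2⟩ := Prod.mk.inj h
        have h2' : momentum d y = momentum d y' :=
          (InnerProductSpace.toDual ℝ (EuclideanSpace ℝ (Fin (d + 1)))).injective h2
        funext i
        obtain ⟨j | j, rfl⟩ := (phaseIndex d).surjective i
        · exact congrArg (fun x : EuclideanSpace ℝ (Fin (d + 1)) => x j) h1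
        · exact congrArg (fun x : EuclideanSpace ℝ (Fin (d + 1)) => x j) h2'
      · rintro ⟨x, η⟩
        obtain ⟨v, rfl⟩ := (InnerProductSpace.toDual ℝ (EuclideanSpace ℝ (Fin (d + 1)))).surjective η
        refine ⟨fun i => Sum.elim (fun j => x j) (fun j => v j) ((phaseIndex d).symm i),
          Prod.ext ?_ ?_⟩
        · ext j
          simp [position_apply]
        · refine congrArg (InnerProductSpace.toDual ℝ _) ?_
          ext j
          simp [momentum_apply])

theorem phaseEquiv_apply {d : ℕ} (y : Fin (2 * d + 1 + 1) → ℝ) :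
    phaseEquiv d y = (position d y,
      InnerProductSpace.toDual ℝ (EuclideanSpace ℝ (Fin (d + 1))) (momentum d y)) := rfl

/-- The symplectic form in the linear coordinates. -/
theorem symplecticModel_phaseEquiv {d : ℕ} (y y' : Fin (2 * d + 1 + 1) → ℝ) :
    symplecticModel _ (phaseEquiv d y) (phaseEquiv d y') =
      ∑ i, (y (phaseIndex d (Sum.inl i)) * y' (phaseIndex d (Sum.inr i)) -
        y (phaseIndex d (Sum.inr i)) * y' (phaseIndex d (Sum.inl i))) := by
  rw [symplecticModel_apply, phaseEquiv_apply, phaseEquiv_apply, Finset.sum_sub_distrib]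
  simp only [InnerProductSpace.toDual_apply_apply, PiLp.inner_apply]
  simp [position_apply, momentum_apply, mul_comm]

/-- The matrix of the symplectic form has determinant `1` in the linear coordinates, so by pulling it
back by a linear map one gets the square of the determinant of the map. -/
theorem det_symplecticModel_phaseEquiv {d : ℕ}
    (L : (Fin (2 * d + 1 + 1) → ℝ) →L[ℝ] (Fin (2 * d + 1 + 1) → ℝ)) :
    Matrix.det (Matrix.of fun i j : Fin (2 * d + 1 + 1) =>
      symplecticModel _ (phaseEquiv d (L (Pi.single i 1))) (phaseEquiv d (L (Pi.single j 1)))) =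
      L.det ^ 2 := by
  set M : Matrix (Fin (2 * d + 1 + 1)) (Fin (2 * d + 1 + 1)) ℝ :=
    LinearMap.toMatrix' (L : (Fin (2 * d + 1 + 1) → ℝ) →ₗ[ℝ] (Fin (2 * d + 1 + 1) → ℝ)) with hM
  set J := Matrix.reindex (phaseIndex d) (phaseIndex d) (Matrix.J (Fin (d + 1)) ℝ) with hJ
  have hdJ : J.det = 1 := by
    rw [hJ, Matrix.det_reindex_self]
    exact SymplecticGroup.det_eq_one (SymplecticGroup.J_mem _ _)
  have hdM : M.det = L.det := LinearMap.det_toMatrix' _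
  have hMij : ∀ i j, M i j = L (Pi.single j 1) i := by
    intro i j
    rw [hM, LinearMap.toMatrix'_apply]
    simp
  have key : (Matrix.of fun i j : Fin (2 * d + 1 + 1) =>
      symplecticModel _ (phaseEquiv d (L (Pi.single i 1))) (phaseEquiv d (L (Pi.single j 1)))) =
      -(M.transpose * J * M) := by
    ext i j
    rw [Matrix.of_apply, symplecticModel_phaseEquiv, Matrix.neg_apply, Matrix.mul_apply,
      ← (phaseIndex d).sum_comp]
    simp only [Matrix.mul_apply, Matrix.transpose_apply, Fintype.sum_sum_type, hJ,
      Matrix.reindex_apply, Matrix.submatrix_apply, Equiv.symm_apply_apply, Matrix.J]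
    simp only [← (phaseIndex d).sum_comp, Fintype.sum_sum_type, Equiv.symm_apply_apply,
      Matrix.fromBlocks_apply₁₁, Matrix.fromBlocks_apply₁₂, Matrix.fromBlocks_apply₂₁,
      Matrix.fromBlocks_apply₂₂, hMij]
    simp [Matrix.one_apply, Finset.sum_sub_distrib]
    ring
  rw [key, Matrix.det_neg, Matrix.det_mul, Matrix.det_mul, Matrix.det_transpose, hdJ, hdM]
  have : (-1 : ℝ) ^ Fintype.card (Fin (2 * d + 1 + 1)) = 1 := by
    rw [Fintype.card_fin]
    exact Even.neg_one_pow ⟨d + 1, by ring⟩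
  rw [this]; ring

/-- Positions and momenta as independent vectors. -/
def phaseOf (d : ℕ) (p : EuclideanSpace ℝ (Fin (d + 1)) × EuclideanSpace ℝ (Fin (d + 1))) :
    Fin (2 * d + 1 + 1) → ℝ :=
  fun k => Sum.elim (fun j => p.1 j) (fun j => p.2 j) ((phaseIndex d).symm k)

theorem phaseEquiv_phaseOf {d : ℕ}
    (p : EuclideanSpace ℝ (Fin (d + 1)) × EuclideanSpace ℝ (Fin (d + 1))) :
    phaseEquiv d (phaseOf d p) =
      (p.1, InnerProductSpace.toDual ℝ (EuclideanSpace ℝ (Fin (d + 1))) p.2) := by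
  rw [phaseEquiv_apply]
  refine Prod.ext ?_ (congrArg (InnerProductSpace.toDual ℝ _) ?_)
  · ext j
    simp [position_apply, phaseOf]
  · ext j
    simp [momentum_apply, phaseOf]

/-- Listing position and momentum coordinates in one vector preserves the volume. -/
theorem measurePreserving_phaseOf (d : ℕ) : MeasurePreserving (phaseOf d) := by
  have h1 := volume_measurePreserving_piCongrLeft (fun _ : Fin (2 * d + 1 + 1) => ℝ) (phaseIndex d)
  have h2 := volume_measurePreserving_sumPiEquivProdPi_symm
    (fun _ : Fin (d + 1) ⊕ Fin (d + 1) => ℝ)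
  have h3 : MeasurePreserving (fun p : EuclideanSpace ℝ (Fin (d + 1)) ×
      EuclideanSpace ℝ (Fin (d + 1)) => (WithLp.ofLp p.1, WithLp.ofLp p.2)) :=
    (PiLp.volume_preserving_ofLp (Fin (d + 1))).prod (PiLp.volume_preserving_ofLp (Fin (d + 1)))
  have h4 := (h1.comp h2).comp h3
  refine Eq.subst (motive := fun f : EuclideanSpace ℝ (Fin (d + 1)) ×
    EuclideanSpace ℝ (Fin (d + 1)) → Fin (2 * d + 1 + 1) → ℝ => MeasurePreserving f volume volume) ?_ h4
  funext p k
  obtain ⟨j, rfl⟩ := (phaseIndex d).surjective k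
  simp only [Function.comp_apply, phaseOf, Equiv.symm_apply_apply]
  rw [MeasurableEquiv.coe_piCongrLeft, Equiv.piCongrLeft_apply_apply]
  rcases j with j | j <;> rfl

/-- Integration over phase space in the linear coordinates. -/
theorem lintegral_phaseEquiv {d : ℕ}
    {f : EuclideanSpace ℝ (Fin (d + 1)) × (EuclideanSpace ℝ (Fin (d + 1)) →L[ℝ] ℝ) → ℝ≥0∞}
    (hf : Measurable fun y => f (phaseEquiv d y)) :
    ∫⁻ y, f (phaseEquiv d y) = ∫⁻ x : EuclideanSpace ℝ (Fin (d + 1)),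
      ∫⁻ v : EuclideanSpace ℝ (Fin (d + 1)),
        f (x, InnerProductSpace.toDual ℝ (EuclideanSpace ℝ (Fin (d + 1))) v) := by
  have h := measurePreserving_phaseOf d
  rw [← h.lintegral_comp hf, Measure.volume_eq_prod, lintegral_prod]
  · simp only [phaseEquiv_phaseOf]
  · exact (hf.comp h.measurable).aemeasurable

/-! ### Coordinates in which a given function is the first one -/

section Straighten

variable {k : ℕ}

/-- A nonzero linear form on `ℝ^(k+1)` is the first coordinate for a suitable linear automorphism. -/
theorem exists_linearEquiv_apply_zero (φ : (Fin (k + 1) → ℝ) →L[ℝ] ℝ) (hφ : φ ≠ 0) :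
    ∃ A : (Fin (k + 1) → ℝ) ≃L[ℝ] (Fin (k + 1) → ℝ), ∀ w, A w 0 = φ w := by
  obtain ⟨j, hj⟩ : ∃ j, φ (Pi.single j 1) ≠ 0 := by
    by_contra! h
    apply hφ
    refine ContinuousLinearMap.coe_injective (LinearMap.pi_ext' fun j => ?_)
    ext
    simpa using h j
  -- exchange the coordinates `0` and `j`, and then replace the coordinate `0` by `φ`
  let B : (Fin (k + 1) → ℝ) →ₗ[ℝ] (Fin (k + 1) → ℝ) :=
    { toFun := fun w i => if i = 0 then φ w else w (Equiv.swap 0 j i)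
      map_add' := fun v w => by
        funext i
        by_cases h : i = 0 <;> simp [h]
      map_smul' := fun c w => by
        funext i
        by_cases h : i = 0 <;> simp [h] }
  have hB : Function.Injective B := by
    rw [← LinearMap.ker_eq_bot, LinearMap.ker_eq_bot']
    intro w hw
    have h1 : φ w = 0 := by simpa [B] using congrFun hw 0
    have h2 : ∀ i, i ≠ j → w i = 0 := by
      intro i hi
      have hne : Equiv.swap 0 j i ≠ 0 := by
        intro h
        apply hi
        rw [← Equiv.swap_apply_self 0 j i, h, Equiv.swap_apply_left]
      have := congrFun hw (Equiv.swap 0 j i)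
      simpa [B, hne] using this
    have h3 : w = w j • Pi.single j 1 := by
      funext i
      by_cases h : i = j
      · subst h; simp
      · simp [h2 i h, h]
    rw [h3, map_smul, smul_eq_mul, mul_eq_zero] at h1
    rw [h3, h1.resolve_right hj, zero_smul]
  refine ⟨(LinearEquiv.ofInjectiveEndo B hB).toContinuousLinearEquiv, fun w => ?_⟩
  simp [B]

/-- Coordinates in which a given smooth function is the first one. -/
structure Straightening (f : (Fin (k + 1) → ℝ) → ℝ) extends
    OpenPartialHomeomorph (Fin (k + 1) → ℝ) (Fin (k + 1) → ℝ) where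
  apply_zero : ∀ w ∈ source, toFun w 0 = f w
  contDiffOn : ContDiffOn ℝ ∞ toFun source
  contDiffOn_symm : ContDiffOn ℝ ∞ invFun target

/-- Around each point where `df ≠ 0` there are coordinates in which `f` is the first one. -/
theorem exists_straightening {f : (Fin (k + 1) → ℝ) → ℝ} {O : Set (Fin (k + 1) → ℝ)}
    (hO : IsOpen O) (hf : ContDiffOn ℝ ∞ f O) {w₀ : Fin (k + 1) → ℝ} (hw₀ : w₀ ∈ O)
    (hd : fderiv ℝ f w₀ ≠ 0) :
    ∃ q : Straightening f, w₀ ∈ q.source ∧ q.source ⊆ O := by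
  obtain ⟨A, hA⟩ := exists_linearEquiv_apply_zero _ hd
  -- complete `df` to linear coordinates and replace the linear form by `f` itself
  set q₀ : (Fin (k + 1) → ℝ) → (Fin (k + 1) → ℝ) :=
    fun w => A w + (f w - A w 0) • Pi.single 0 1 with hq₀
  have hq0 : ∀ w, q₀ w 0 = f w := fun w => by simp [hq₀]
  have hsm : ContDiffOn ℝ ∞ q₀ O := by
    have h1 : ContDiff ℝ ∞ A := A.contDiff
    have h2 : ContDiff ℝ ∞ (fun w => A w 0) :=
      (ContinuousLinearMap.proj (R := ℝ) (φ := fun _ : Fin (k + 1) => ℝ) 0).contDiff.comp h1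
    exact h1.contDiffOn.add ((hf.sub h2.contDiffOn).smul contDiffOn_const)
  have hder : HasFDerivAt q₀ (A : (Fin (k + 1) → ℝ) →L[ℝ] (Fin (k + 1) → ℝ)) w₀ := by
    have h1 : HasFDerivAt A (A : (Fin (k + 1) → ℝ) →L[ℝ] (Fin (k + 1) → ℝ)) w₀ := A.hasFDerivAt
    have h2 : HasFDerivAt (fun w => A w 0)
        ((ContinuousLinearMap.proj (R := ℝ) (φ := fun _ : Fin (k + 1) => ℝ) 0).comp
          (A : (Fin (k + 1) → ℝ) →L[ℝ] (Fin (k + 1) → ℝ))) w₀ :=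
      ((ContinuousLinearMap.proj (R := ℝ) (φ := fun _ : Fin (k + 1) => ℝ) 0).hasFDerivAt).comp w₀ h1
    have h3 : HasFDerivAt f (fderiv ℝ f w₀) w₀ :=
      ((hf.contDiffAt (hO.mem_nhds hw₀)).differentiableAt (by simp)).hasFDerivAt
    have h4 := h1.add ((h3.sub h2).smul_const (Pi.single 0 1 : Fin (k + 1) → ℝ))
    refine h4.congr_fderiv ?_
    ext w i
    simp [← hA]
  have hat := hsm.contDiffAt (hO.mem_nhds hw₀)
  set e := hat.toOpenPartialHomeomorph q₀ hder (by simp) with he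
  have hecoe : (e : _ → _) = q₀ := rfl
  -- shrink the domain to where the derivative is invertible
  set O' := O ∩ {w | IsUnit (fderiv ℝ q₀ w)} with hO'
  have hO'o : IsOpen O' := by
    have hc : ContinuousOn (fderiv ℝ q₀) O := hsm.continuousOn_fderiv_of_isOpen hO (by simp)
    exact hc.isOpen_inter_preimage hO Units.isOpen
  have hw₀' : w₀ ∈ O' := by
    refine ⟨hw₀, ?_⟩
    rw [mem_ofPred_eq, hder.fderiv]
    exact ⟨ContinuousLinearEquiv.toUnit A, rfl⟩
  set e' := e.restrOpen O' hO'o with he'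
  have hsrc : e'.source ⊆ O' := fun w hw => hw.2
  refine ⟨⟨e', fun w _ => hq0 w, hsm.mono fun w hw => (hsrc hw).1, fun y hy => ?_⟩,
    ⟨hat.mem_toOpenPartialHomeomorph_source hder (by simp), hw₀'⟩, fun w hw => (hsrc hw).1⟩
  have hy' := hsrc (e'.map_target hy)
  obtain ⟨u, hu⟩ := hy'.2
  have hat' := hsm.contDiffAt (hO.mem_nhds hy'.1)
  have hder' : HasFDerivAt e' (ContinuousLinearEquiv.ofUnit u :
      (Fin (k + 1) → ℝ) →L[ℝ] (Fin (k + 1) → ℝ)) (e'.symm y) := by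
    have h1 := (hat'.differentiableAt (by simp)).hasFDerivAt
    rw [← hu] at h1
    exact h1
  exact (e'.contDiffAt_symm hy hder' hat').contDiffWithinAt

namespace Straightening

variable {f : (Fin (k + 1) → ℝ) → ℝ} (q : Straightening f)

/-- The Jacobian of the inverse of the coordinates. -/
def jac (y : Fin (k + 1) → ℝ) : ℝ := |(fderiv ℝ q.symm y).det|

theorem hasFDerivAt {w : Fin (k + 1) → ℝ} (hw : w ∈ q.source) :
    HasFDerivAt q.toOpenPartialHomeomorph (fderiv ℝ q.toOpenPartialHomeomorph w) w :=
  ((q.contDiffOn.contDiffAt (q.open_source.mem_nhds hw)).differentiableAt (by simp)).hasFDerivAt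

theorem hasFDerivAt_symm {y : Fin (k + 1) → ℝ} (hy : y ∈ q.target) :
    HasFDerivAt q.symm (fderiv ℝ q.symm y) y :=
  ((q.contDiffOn_symm.contDiffAt (q.open_target.mem_nhds hy)).differentiableAt
    (by simp)).hasFDerivAt

theorem continuousOn_jac : ContinuousOn q.jac q.target := by
  have h := q.contDiffOn_symm.continuousOn_fderiv_of_isOpen q.open_target (by simp)
  exact continuous_abs.comp_continuousOn (ContinuousLinearMap.continuous_det.comp_continuousOn h)

theorem f_symm {y : Fin (k + 1) → ℝ} (hy : y ∈ q.target) : f (q.symm y) = y 0 := by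
  rw [← q.apply_zero _ (q.map_target hy)]
  exact congrFun (q.right_inv hy) 0

section Pullback

variable {g : (Fin (k + 1) → ℝ) → ℝ} (hg : Continuous g) (hgc : HasCompactSupport g)
  (hgs : tsupport g ⊆ q.source)

/-- The density `g` in the new coordinates, extended by zero. -/
def pullback (g : (Fin (k + 1) → ℝ) → ℝ) : (Fin (k + 1) → ℝ) → ℝ :=
  q.target.indicator fun y => q.jac y * g (q.symm y)

include hgc hgs in
theorem isCompact_image_tsupport : IsCompact (q.toOpenPartialHomeomorph '' tsupport g) :=
  hgc.isCompact.image_of_continuousOn (q.continuousOn.mono hgs)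

theorem pullback_eq_zero {y : Fin (k + 1) → ℝ}
    (hy : y ∉ q.toOpenPartialHomeomorph '' tsupport g) : q.pullback g y = 0 := by
  by_cases hyt : y ∈ q.target
  · rw [pullback, indicator_of_mem hyt]
    have : g (q.symm y) = 0 := by
      by_contra h
      have h' : q.symm y ∈ tsupport g := subset_tsupport g h
      exact hy ⟨q.symm y, h', q.right_inv hyt⟩
    rw [this, mul_zero]
  · rw [pullback, indicator_of_notMem hyt]

include hgc hgs in
theorem hasCompactSupport_pullback : HasCompactSupport (q.pullback g) :=
  HasCompactSupport.intro (q.isCompact_image_tsupport hgc hgs) fun _ hy => q.pullback_eq_zero hy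

include hg hgc hgs in
theorem continuous_pullback : Continuous (q.pullback g) := by
  rw [continuous_iff_continuousAt]
  intro y
  by_cases hyt : y ∈ q.target
  · have h1 : ContinuousOn (fun y => q.jac y * g (q.symm y)) q.target :=
      q.continuousOn_jac.mul (hg.comp_continuousOn q.continuousOn_symm)
    refine (h1.continuousAt (q.open_target.mem_nhds hyt)).congr ?_
    filter_upwards [q.open_target.mem_nhds hyt] with y' hy'
    rw [pullback, indicator_of_mem hy']
  · have h1 : y ∉ q.toOpenPartialHomeomorph '' tsupport g := by
      rintro ⟨w, hw, rfl⟩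
      exact hyt (q.map_source (hgs hw))
    refine (continuousAt_const (y := (0 : ℝ))).congr ?_
    filter_upwards [(q.isCompact_image_tsupport hgc hgs).isClosed.isOpen_compl.mem_nhds h1] with
      y' hy'
    exact (q.pullback_eq_zero hy').symm

theorem continuous_cons_prod :
    Continuous fun p : ℝ × (Fin k → ℝ) => (Fin.cons p.1 p.2 : Fin (k + 1) → ℝ) :=
  continuous_pi fun i => by
    refine Fin.cases ?_ (fun i => ?_) i
    · exact continuous_fst
    · exact (continuous_apply i).comp continuous_snd

theorem measurableSet_slice (c : ℝ) :
    MeasurableSet {y' : Fin k → ℝ | (Fin.cons c y' : Fin (k + 1) → ℝ) ∈ q.target} :=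
  (q.open_target.preimage (continuous_cons_prod.comp (Continuous.prodMk_right c))).measurableSet

include hg hgc hgs in
/-- The integral over the level set is over a compact part of it. -/
theorem integrableOn_slice (c : ℝ) : IntegrableOn
    (fun y' : Fin k → ℝ => q.jac (Fin.cons c y') * g (q.symm (Fin.cons c y')))
    {y' | (Fin.cons c y' : Fin (k + 1) → ℝ) ∈ q.target} := by
  rw [← integrable_indicator_iff (q.measurableSet_slice c)]
  have hcomp : IsCompact ((Fin.tail : (Fin (k + 1) → ℝ) → (Fin k → ℝ)) ''
      (q.toOpenPartialHomeomorph '' tsupport g)) :=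
    (q.isCompact_image_tsupport hgc hgs).image (continuous_pi fun i => continuous_apply i.succ)
  exact ((q.continuous_pullback hg hgc hgs).comp
    (continuous_cons_prod.comp (Continuous.prodMk_right c))).integrable_of_hasCompactSupport
    (HasCompactSupport.intro hcomp fun y' hy' => q.pullback_eq_zero fun h =>
      hy' ⟨_, h, Fin.tail_cons _ _⟩)

include hg hgc hgs in
/-- The average over a thin layer `c - ε < f ≤ c` of a function supported where the coordinates are
defined converges to an integral over the level set. -/
theorem tendsto_layer (c : ℝ) :
    Filter.Tendsto (fun ε => ε⁻¹ * ∫ w in {w | w ∈ q.source ∧ f w ∈ Ioc (c - ε) c}, g w) (𝓝[>] 0)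
      (𝓝 (∫ y' in {y' | (Fin.cons c y' : Fin (k + 1) → ℝ) ∈ q.target},
        q.jac (Fin.cons c y') * g (q.symm (Fin.cons c y')))) := by
  set G := q.pullback g with hG
  have hcomp := q.isCompact_image_tsupport hgc hgs
  have hG0 : ∀ y, y ∉ q.toOpenPartialHomeomorph '' tsupport g → G y = 0 :=
    fun y hy => q.pullback_eq_zero hy
  have hGc : Continuous G := q.continuous_pullback hg hgc hgs
  have hGi : Integrable G :=
    hGc.integrable_of_hasCompactSupport (q.hasCompactSupport_pullback hgc hgs)
  have hcons := continuous_cons_prod (k := k)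
  set Φ : ℝ → ℝ := fun E => ∫ y' : Fin k → ℝ, G (Fin.cons E y') with hΦ
  have hΦc : Continuous Φ := by
    have hcomp' : IsCompact ((Fin.tail : (Fin (k + 1) → ℝ) → (Fin k → ℝ)) ''
        (q.toOpenPartialHomeomorph '' tsupport g)) :=
      hcomp.image (continuous_pi fun i => continuous_apply i.succ)
    have := continuous_parametric_integral_of_continuous (μ := (volume : Measure (Fin k → ℝ)))
      (f := fun E y' => G (Fin.cons E y')) (hGc.comp hcons) hcomp'
    refine this.congr fun E => ?_
    refine setIntegral_eq_integral_of_forall_compl_eq_zero fun y' hy' => hG0 _ fun h => hy' ?_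
    exact ⟨_, h, Fin.tail_cons _ _⟩
  -- the integral over the layer by Fubini in the new coordinates
  have hlayer : ∀ ε > 0, ∫ w in {w | w ∈ q.source ∧ f w ∈ Ioc (c - ε) c}, g w =
      ∫ E in (c - ε)..c, Φ E := by
    intro ε hε
    have himg : q.symm '' (q.target ∩ {y | y 0 ∈ Ioc (c - ε) c}) =
        {w | w ∈ q.source ∧ f w ∈ Ioc (c - ε) c} := by
      ext w
      constructor
      · rintro ⟨y, ⟨hy, hy0⟩, rfl⟩
        exact ⟨q.map_target hy, by rw [q.f_symm hy]; exact hy0⟩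
      · rintro ⟨hw, hfw⟩
        refine ⟨_, ⟨q.map_source hw, ?_⟩, q.left_inv hw⟩
        have := q.apply_zero w hw
        change q.toOpenPartialHomeomorph w 0 = f w at this
        rw [mem_ofPred_eq, this]
        exact hfw
    have hmI : MeasurableSet {y : Fin (k + 1) → ℝ | y 0 ∈ Ioc (c - ε) c} :=
      measurable_pi_apply 0 measurableSet_Ioc
    rw [← himg, integral_image_eq_integral_abs_det_fderiv_smul volume
      (q.open_target.measurableSet.inter hmI)
      (fun y hy => (q.hasFDerivAt_symm hy.1).hasFDerivWithinAt)
      (q.symm.injOn.mono fun y hy => hy.1)]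
    have h1 : ∫ y in q.target ∩ {y | y 0 ∈ Ioc (c - ε) c},
        |(fderiv ℝ q.symm y).det| • g (q.symm y) = ∫ y in {y | y 0 ∈ Ioc (c - ε) c}, G y := by
      rw [hG, pullback, setIntegral_indicator q.open_target.measurableSet, inter_comm]
      rfl
    rw [h1, intervalIntegral.integral_of_le (by linarith)]
    have h2 := (volume_preserving_piFinSuccAbove (fun _ : Fin (k + 1) => ℝ) 0).symm
    rw [← h2.setIntegral_preimage_emb (MeasurableEquiv.measurableEmbedding _)]
    have h3 : (MeasurableEquiv.piFinSuccAbove (fun _ : Fin (k + 1) => ℝ) 0).symm ⁻¹'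
        {y | y 0 ∈ Ioc (c - ε) c} = Ioc (c - ε) c ×ˢ univ := by
      ext p
      simp [MeasurableEquiv.piFinSuccAbove]
    have h4 : ∀ p, (MeasurableEquiv.piFinSuccAbove (fun _ : Fin (k + 1) => ℝ) 0).symm p =
        Fin.cons p.1 p.2 := fun p => by
      simp [MeasurableEquiv.piFinSuccAbove]
      rfl
    simp only [h3, h4]
    rw [Measure.volume_eq_prod, setIntegral_prod]
    · simp only [Measure.restrict_univ]
      rfl
    · have h5 := h2.integrable_comp_emb (MeasurableEquiv.measurableEmbedding _) |>.2 hGi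
      have h6 : G ∘ (MeasurableEquiv.piFinSuccAbove (fun _ : Fin (k + 1) => ℝ) 0).symm =
        fun p => G (Fin.cons p.1 p.2) := funext fun p => congrArg G (h4 p)
      rw [h6] at h5
      exact h5.integrableOn
  -- the fundamental theorem of calculus
  have hlim : Filter.Tendsto (fun ε => ε⁻¹ * ∫ E in (c - ε)..c, Φ E) (𝓝[>] 0) (𝓝 (Φ c)) := by
    have h1 : HasDerivAt (fun u => ∫ E in c..u, Φ E) (Φ c) c :=
      intervalIntegral.integral_hasDerivAt_right (hΦc.intervalIntegrable _ _)
        (hΦc.stronglyMeasurableAtFilter _ _) hΦc.continuousAt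
    have h2 := hasDerivAt_iff_tendsto_slope.1 h1
    have h3 : Filter.Tendsto (fun ε => c - ε) (𝓝[>] (0 : ℝ)) (𝓝[≠] c) := by
      refine tendsto_nhdsWithin_iff.2 ⟨?_, ?_⟩
      · have : Filter.Tendsto (fun ε => c - ε) (𝓝 (0 : ℝ)) (𝓝 (c - 0)) := by
          exact (continuous_const.sub continuous_id).tendsto 0
        rw [sub_zero] at this
        exact this.mono_left nhdsWithin_le_nhds
      · filter_upwards [self_mem_nhdsWithin] with ε hε
        simp only [mem_Ioi] at hε
        simp [hε.ne']
    refine (h2.comp h3).congr fun ε => ?_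
    simp only [Function.comp_apply, slope, vsub_eq_sub, smul_eq_mul,
      intervalIntegral.integral_same, sub_zero]
    rw [intervalIntegral.integral_symm, show c - ε - c = -ε by ring, inv_neg]
    ring
  have hend : Φ c = ∫ y' in {y' | (Fin.cons c y' : Fin (k + 1) → ℝ) ∈ q.target},
      q.jac (Fin.cons c y') * g (q.symm (Fin.cons c y')) := by
    rw [← integral_indicator (q.measurableSet_slice c)]
    rfl
  rw [← hend]
  refine hlim.congr' ?_
  filter_upwards [self_mem_nhdsWithin] with ε hε
  rw [hlayer ε hε]

end Pullback

end Straightening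

end Straighten

/-! ### The points of geodesics at time zero -/

namespace StationaryData

section Rep

variable {r : ℕ} {Sig : Type*} [TopologicalSpace Sig]
  [ChartedSpace (EuclideanSpace ℝ (Fin r)) Sig] [IsManifold (𝓡 r) ∞ Sig]
  (D : StationaryData r Sig) [CompactSpace Sig] [T2Space Sig]

open Classical in
/-- The point at time zero of the geodesic through a point of the mass shell. -/
def rep (m : ℝ) (ζ : CotangentBundle (stModel r) (ℝ × Sig)) :
    CotangentBundle (stModel r) (ℝ × Sig) :=
  if h : m ≠ 0 ∧ ζ ∈ D.shell m then (D.exists_time_eq_zero h.1 h.2).choose else ζ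

variable {m : ℝ} (hm : m ≠ 0) {ζ : CotangentBundle (stModel r) (ℝ × Sig)}

include hm

/-- The defining properties of the point at time zero. -/
theorem rep_spec (hζ : ζ ∈ D.shell m) : D.rep m ζ ∈ D.shell m ∧ time (D.rep m ζ) = 0 ∧
    SameOrbit (geodesicHamiltonian D.metric) ζ (D.rep m ζ) := by
  rw [rep, dif_pos ⟨hm, hζ⟩]
  exact (D.exists_time_eq_zero hm hζ).choose_spec

theorem rep_eq_of_sameOrbit (hζ : ζ ∈ D.shell m) {y : CotangentBundle (stModel r) (ℝ × Sig)}
    (hy : time y = 0) (h : SameOrbit (geodesicHamiltonian D.metric) ζ y) : D.rep m ζ = y := by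
  obtain ⟨h1, h2, h3⟩ := D.rep_spec hm hζ
  exact SameOrbit.eq_of_time_eq D hm (SameOrbit.trans D.contMDiff_geodesicHamiltonian (Or.symm h3) h) h1
    (h2.trans hy.symm)

theorem rep_eq_self (hζ : ζ ∈ D.shell m) (h0 : time ζ = 0) : D.rep m ζ = ζ :=
  D.rep_eq_of_sameOrbit hm hζ h0 (Or.inl (HamFlow.refl _))

/-- The points at time zero label the orbits. -/
theorem rep_eq_rep_iff {ζ' : CotangentBundle (stModel r) (ℝ × Sig)} (hζ : ζ ∈ D.shell m)
    (hζ' : ζ' ∈ D.shell m) : D.rep m ζ = D.rep m ζ' ↔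
      SameOrbit (geodesicHamiltonian D.metric) ζ ζ' := by
  obtain ⟨h1, h2, h3⟩ := D.rep_spec hm hζ
  obtain ⟨h1', h2', h3'⟩ := D.rep_spec hm hζ'
  constructor
  · intro h
    rw [h] at h3
    exact SameOrbit.trans D.contMDiff_geodesicHamiltonian h3 (Or.symm h3')
  · intro h
    exact D.rep_eq_of_sameOrbit hm hζ h2' (SameOrbit.trans D.contMDiff_geodesicHamiltonian h h3')

theorem energy_rep (hζ : ζ ∈ D.shell m) : energy (D.rep m ζ) = energy ζ :=
  SameOrbit.energy_eq D (D.rep_spec hm hζ).2.2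

/-- In the mass shell, passing to the point at time zero is locally the restriction of a map which is
symplectic transversally to the flow. -/
theorem exists_rep_eq (hζ : ζ ∈ D.shell m) :
    ∃ Ψ : CotangentBundle (stModel r) (ℝ × Sig) → CotangentBundle (stModel r) (ℝ × Sig),
      Ψ ζ = D.rep m ζ ∧ ReducedSymplecticAt (geodesicHamiltonian D.metric) Ψ ζ ∧
      ∀ᶠ ζ₁ in 𝓝 ζ, time (Ψ ζ₁) = 0 ∧ (ζ₁ ∈ D.shell m → D.rep m ζ₁ = Ψ ζ₁) := by
  obtain ⟨h1, h2, h3⟩ := D.rep_spec hm hζ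
  obtain ⟨Ψ, hΨ, hΨs, hev⟩ := exists_return_of_sameOrbit D.contMDiff_geodesicHamiltonian
    (q := time) (timeL (EuclideanSpace ℝ (Fin r))) (fun _ _ => rfl) h2
    (D.differential_time_neg hm h1).ne h3
  exact ⟨Ψ, hΨ, hΨs, hev.mono fun ζ₁ h => ⟨h.1, fun hs => D.rep_eq_of_sameOrbit hm hs h.1 h.2⟩⟩

/-- The point at time zero depends continuously on the starting point. -/
theorem continuousWithinAt_rep (hζ : ζ ∈ D.shell m) :
    ContinuousWithinAt (D.rep m) (D.shell m) ζ := by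
  obtain ⟨Ψ, hΨ, ⟨L, hL, -⟩, hev⟩ := D.exists_rep_eq hm hζ
  refine hL.continuousAt.continuousWithinAt.congr_of_eventuallyEq ?_ hΨ.symm
  filter_upwards [self_mem_nhdsWithin, nhdsWithin_le_nhds hev] with ζ₁ h1 h2
  exact h2.2 h1

end Rep

section Phase

variable {d : ℕ} {Sig : Type*} [TopologicalSpace Sig]
  [ChartedSpace (EuclideanSpace ℝ (Fin (d + 1))) Sig] [IsManifold (𝓡 (d + 1)) ∞ Sig]
  (D : StationaryData (d + 1) Sig)

/-- The linear coordinates of the position and the spatial momentum, in a chart of space. -/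
def phase (a : Sig) (ζ : CotangentBundle (stModel (d + 1)) (ℝ × Sig)) :
    Fin (2 * d + 1 + 1) → ℝ :=
  (phaseEquiv d).symm (LocalData.spatial _ (cotChart a ζ))

/-- The energy in the linear coordinates of phase space. -/
def chartEnergy (m : ℝ) (a : Sig) (w : Fin (2 * d + 1 + 1) → ℝ) : ℝ :=
  (D.localData a).H m (phaseEquiv d w)

/-- The domain of the linear coordinates of phase space. -/
def phaseDomain (a : Sig) : Set (Fin (2 * d + 1 + 1) → ℝ) :=
  {w | (phaseEquiv d w).1 ∈ (chartAt (EuclideanSpace ℝ (Fin (d + 1))) a).target}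

theorem isOpen_phaseDomain (a : Sig) : IsOpen (phaseDomain (d := d) a) :=
  (chartAt (EuclideanSpace ℝ (Fin (d + 1))) a).open_target.preimage
    (continuous_fst.comp (phaseEquiv d).continuous)

theorem contDiffOn_chartEnergy {m : ℝ} (hm : m ≠ 0) (a : Sig) :
    ContDiffOn ℝ ∞ (D.chartEnergy m a) (phaseDomain a) := fun w hw =>
  (ContDiffAt.comp w ((D.localData a).contDiffAt_H hm (w := phaseEquiv d w) hw)
    (phaseEquiv d).contDiff.contDiffAt).contDiffWithinAt

theorem chartEnergy_pos {m : ℝ} (hm : m ≠ 0) {a : Sig} {w : Fin (2 * d + 1 + 1) → ℝ}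
    (hw : w ∈ phaseDomain a) : 0 < D.chartEnergy m a w :=
  energyOf_pos ((D.localData a).symm _ hw) ((D.localData a).pos _ hw) ((D.localData a).N_pos _ hw)
    ((D.localData a).timelike _ hw) hm _

theorem chartEnergy_phase {m : ℝ} (hm : m ≠ 0) {a : Sig}
    {ζ : CotangentBundle (stModel (d + 1)) (ℝ × Sig)}
    (h : ζ.proj.2 ∈ (chartAt (EuclideanSpace ℝ (Fin (d + 1))) a).source) (hζ : ζ ∈ D.shell m) :
    D.chartEnergy m a (phase a ζ) = energy ζ := by
  rw [chartEnergy, phase, ContinuousLinearEquiv.apply_symm_apply, ← D.tauL_cotChart hm h hζ,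
    ← inChart_energy (cotChart_mem h), inChart_cotChart h]

/-- The point of the mass shell at time zero with given position and spatial momentum. -/
def ofPhase (m : ℝ) (a : Sig) (w : Fin (2 * d + 1 + 1) → ℝ) :
    CotangentBundle (stModel (d + 1)) (ℝ × Sig) :=
  (cotChart a).symm (LocalData.lift 0 (D.chartEnergy m a w) (phaseEquiv d w))

variable {m : ℝ} (hm : m ≠ 0) {a : Sig} {w : Fin (2 * d + 1 + 1) → ℝ} (hw : w ∈ phaseDomain a)

include hw in
theorem cotChart_ofPhase : cotChart a (D.ofPhase m a w) =
    LocalData.lift 0 (D.chartEnergy m a w) (phaseEquiv d w) :=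
  (cotChart a).right_inv (mem_cot_target.2 hw)

include hw in
theorem ofPhase_mem_source :
    (D.ofPhase m a w).proj.2 ∈ (chartAt (EuclideanSpace ℝ (Fin (d + 1))) a).source :=
  mem_cot_source.1 ((cotChart a).map_target (mem_cot_target.2 hw))

include hw in
theorem phase_ofPhase : phase a (D.ofPhase m a w) = w := by
  rw [phase, D.cotChart_ofPhase hw, LocalData.spatial_lift, ContinuousLinearEquiv.symm_apply_apply]

include hw in
theorem time_ofPhase : time (D.ofPhase m a w) = 0 := by
  have hs := D.ofPhase_mem_source (m := m) hw
  rw [← inChart_cotChart hs time, inChart_time (cotChart_mem hs), D.cotChart_ofPhase hw]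
  rfl

include hw in
theorem energy_ofPhase : energy (D.ofPhase m a w) = D.chartEnergy m a w := by
  have hs := D.ofPhase_mem_source (m := m) hw
  rw [← inChart_cotChart hs energy, inChart_energy (cotChart_mem hs), D.cotChart_ofPhase hw,
    LocalData.tauL_lift]

include hm hw in
theorem ofPhase_mem_shell : D.ofPhase m a w ∈ D.shell m := by
  have hs := D.ofPhase_mem_source (m := m) hw
  refine ⟨D.mem_massHyperboloid_iff.2 ?_, ?_⟩
  · rw [← inChart_cotChart hs (geodesicHamiltonian D.metric), D.inChart_geodesicHamiltonian (cotChart_mem hs),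
      D.cotChart_ofPhase hw, (D.localData a).K_eq_of_tauL_eq_H (m := m)]
    · exact hw
    · rw [LocalData.tauL_lift, LocalData.spatial_lift]
      rfl
  · rw [D.energy_ofPhase hw]
    exact D.chartEnergy_pos hm hw

omit hw in
include hm in
/-- A point of the mass shell at time zero is determined by its phase space coordinates. -/
theorem ofPhase_phase {ζ : CotangentBundle (stModel (d + 1)) (ℝ × Sig)}
    (h : ζ.proj.2 ∈ (chartAt (EuclideanSpace ℝ (Fin (d + 1))) a).source) (hζ : ζ ∈ D.shell m)
    (h0 : time ζ = 0) : D.ofPhase m a (phase a ζ) = ζ := by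
  have h2 : time ζ = (cotChart a ζ).1.1 := by
    rw [← inChart_time (cotChart_mem h), inChart_cotChart h]
  have h3 : D.chartEnergy m a (phase a ζ) = LocalData.tauL _ (cotChart a ζ) := by
    rw [D.chartEnergy_phase hm h hζ, ← inChart_energy (cotChart_mem h), inChart_cotChart h]
  rw [ofPhase, h3, phase, ContinuousLinearEquiv.apply_symm_apply, ← h0, h2, LocalData.lift_eta]
  exact (cotChart a).left_inv (mem_cot_source.2 h)

theorem contMDiffOn_ofPhase (hm : m ≠ 0) (a : Sig) :
    ContMDiffOn 𝓘(ℝ, Fin (2 * d + 1 + 1) → ℝ) (cotModel (stModel (d + 1))) ∞ (D.ofPhase m a)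
      (phaseDomain a) := by
  refine (contMDiffOn_extChartAt_symm (n := ∞) (I := cotModel (stModel (d + 1)))
    (basePoint (r := d + 1) a)).comp (t := (cotChart a).target) ?_ ?_
  · refine ContDiffOn.contMDiffOn ?_
    have h1 := D.contDiffOn_chartEnergy hm a
    unfold LocalData.lift
    fun_prop
  · intro w hw
    exact mem_cot_target.2 hw

theorem continuousOn_phase : ContinuousOn (phase (d := d) a)
    {ζ | ζ.proj.2 ∈ (chartAt (EuclideanSpace ℝ (Fin (d + 1))) a).source} := by
  have h := continuousOn_extChartAt (I := cotModel (stModel (d + 1))) (basePoint (r := d + 1) a)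
  exact (phaseEquiv d).symm.continuous.comp_continuousOn
    ((LocalData.spatial _).continuous.comp_continuousOn
      (h.mono fun ζ hζ => mem_cot_source.2 hζ))

end Phase

section Patch

variable {d : ℕ} {Sig : Type*} [TopologicalSpace Sig]
  [ChartedSpace (EuclideanSpace ℝ (Fin (d + 1))) Sig] [IsManifold (𝓡 (d + 1)) ∞ Sig]
  (D : StationaryData (d + 1) Sig) [CompactSpace Sig] [T2Space Sig]

/-- The transition map from an adapted patch to the linear coordinates of phase space; its Jacobian
is the density of the symplectic volume. -/
theorem exists_hasFDerivAt_phase {m : ℝ} (hm : m ≠ 0)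
    (S : AdaptedPatch D.metric m energy (2 * d + 1)) {y : Fin (2 * d + 1 + 1) → ℝ}
    (hy : y ∈ S.domain) (hy0 : 0 < y 0) {a : Sig}
    (ha : (D.rep m (S.toFun y)).proj.2 ∈ (chartAt (EuclideanSpace ℝ (Fin (d + 1))) a).source) :
    ∃ L : (Fin (2 * d + 1 + 1) → ℝ) →L[ℝ] (Fin (2 * d + 1 + 1) → ℝ),
      HasFDerivAt (fun y => phase a (D.rep m (S.toFun y))) L y ∧
      S.symplecticDensity y = |L.det| := by
  have hdom := S.isOpen_domain.mem_nhds hy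
  have hSm := ((S.smooth.contMDiffAt hdom).mdifferentiableAt (by simp)).hasMFDerivAt
  set L₀ := mfderiv 𝓘(ℝ, Fin (2 * d + 1 + 1) → ℝ) (cotModel (stModel (d + 1))) S.toFun y with hL₀
  have hshell : ∀ y' ∈ S.domain, 0 < y' 0 → S.toFun y' ∈ D.shell m := fun y' h h0 =>
    ⟨S.mem_hyperboloid y' h, by rw [S.coordinate_zero y' h]; exact h0⟩
  obtain ⟨Ψ, hΨ, ⟨L₁, hL₁, hsymp⟩, hev⟩ := D.exists_rep_eq hm (hshell y hy hy0)
  rw [← hΨ] at ha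
  obtain ⟨L₂, hL₂, hsymp₂, -, -, -, htime⟩ := D.exists_cotChart ha
  have hpos : ∀ᶠ y' in 𝓝 y, 0 < y' 0 :=
    (continuous_apply 0).continuousAt.eventually (lt_mem_nhds hy0)
  have hevS : ∀ᶠ y' in 𝓝 y, time (Ψ (S.toFun y')) = 0 ∧
      D.rep m (S.toFun y') = Ψ (S.toFun y') := by
    filter_upwards [hdom, hpos, hSm.continuousAt.eventually hev] with y' h1 h2 h3
    exact ⟨h3.1, h3.2 (hshell y' h1 h2)⟩
  -- The patch is in the mass shell, so its tangent vectors are in the kernel of the differential of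
  -- the Hamiltonian, where the map `Ψ` is symplectic. Its image is in the hypersurface of time zero,
  -- where the symplectic forms of spacetime and of space agree.
  have hK : ∀ u, differential (geodesicHamiltonian D.metric) (S.toFun y) (L₀ u) = 0 := by
    intro u
    have e1 : HasMFDerivAt 𝓘(ℝ, Fin (2 * d + 1 + 1) → ℝ) 𝓘(ℝ, ℝ)
        (geodesicHamiltonian D.metric ∘ S.toFun) y _ :=
      HasMFDerivAt.comp y (D.contMDiff_geodesicHamiltonian.mdifferentiable (by simp)
        (S.toFun y)).hasMFDerivAt hSm
    have e2 : HasMFDerivAt 𝓘(ℝ, Fin (2 * d + 1 + 1) → ℝ) 𝓘(ℝ, ℝ)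
        (geodesicHamiltonian D.metric ∘ S.toFun) y 0 := by
      refine (hasMFDerivAt_const (-m ^ 2 / 2) y).congr_of_eventuallyEq ?_
      filter_upwards [hdom] with y' h1
      exact D.mem_massHyperboloid_iff.1 (S.mem_hyperboloid y' h1)
    exact congrArg (fun l : (Fin (2 * d + 1 + 1) → ℝ) →L[ℝ] ℝ => l u) (e1.mfderiv.symm.trans e2.mfderiv)
  have ht : ∀ u, (L₂ (L₁ (L₀ u))).1.1 = 0 := by
    intro u
    rw [← htime]
    have e1 : HasMFDerivAt 𝓘(ℝ, Fin (2 * d + 1 + 1) → ℝ) 𝓘(ℝ, ℝ)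
        (time ∘ (Ψ ∘ S.toFun)) y _ :=
      HasMFDerivAt.comp y (contMDiff_time.mdifferentiable (by simp)
        (Ψ (S.toFun y))).hasMFDerivAt (HasMFDerivAt.comp y hL₁ hSm)
    have e2 : HasMFDerivAt 𝓘(ℝ, Fin (2 * d + 1 + 1) → ℝ) 𝓘(ℝ, ℝ)
        (time ∘ (Ψ ∘ S.toFun)) y 0 := by
      refine (hasMFDerivAt_const (0 : ℝ) y).congr_of_eventuallyEq ?_
      filter_upwards [hevS] with y' h1
      exact h1.1
    exact congrArg (fun l : (Fin (2 * d + 1 + 1) → ℝ) →L[ℝ] ℝ => l u) (e1.mfderiv.symm.trans e2.mfderiv)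
  have h3 := hasMFDerivAt_iff_hasFDerivAt.1 (HasMFDerivAt.comp y hL₂ (HasMFDerivAt.comp y hL₁ hSm))
  -- the derivative in the linear coordinates, as a map between coordinate spaces
  let L₃ : (Fin (2 * d + 1 + 1) → ℝ) →L[ℝ] ((ℝ × EuclideanSpace ℝ (Fin (d + 1))) ×
      ((ℝ × EuclideanSpace ℝ (Fin (d + 1))) →L[ℝ] ℝ)) := (L₂.toContinuousLinearMap.comp (L₁.comp L₀))
  have h3' : HasFDerivAt (cotChart a ∘ (Ψ ∘ S.toFun)) L₃ y := h3
  have h4 := ((LocalData.spatial (EuclideanSpace ℝ (Fin (d + 1)))).hasFDerivAt).comp y h3'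
  have h5 := ((phaseEquiv d).symm : _ →L[ℝ] (Fin (2 * d + 1 + 1) → ℝ)).hasFDerivAt.comp y h4
  refine ⟨_, h5.congr_of_eventuallyEq ?_, ?_⟩
  · filter_upwards [hevS] with y' h1
    rw [h1.2]
    rfl
  · rw [AdaptedPatch.symplecticDensity, ← Real.sqrt_sq_eq_abs, ← det_symplecticModel_phaseEquiv]
    congr 3
    ext i j
    have hsp : ∀ z z' : (ℝ × EuclideanSpace ℝ (Fin (d + 1))) ×
        ((ℝ × EuclideanSpace ℝ (Fin (d + 1))) →L[ℝ] ℝ), z.1.1 = 0 → z'.1.1 = 0 →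
        symplecticModel _ z z' = symplecticModel _ (LocalData.spatial _ z)
          (LocalData.spatial _ z') := by
      rintro ⟨⟨t, x⟩, η⟩ ⟨⟨t', x'⟩, η'⟩ h h'
      simp only at h h'
      subst h h'
      rfl
    have e1 := hsymp _ _ (hK (Pi.single i 1)) (hK (Pi.single j 1))
    have e2 := hsymp₂ (L₁ (L₀ (Pi.single i 1))) (L₁ (L₀ (Pi.single j 1)))
    have e2 := (hsp _ _ (ht (Pi.single i 1)) (ht (Pi.single j 1))).symm.trans e2
    have e3 : ∀ u : Fin (2 * d + 1 + 1) → ℝ, phaseEquiv d ((((phaseEquiv d).symm :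
        _ →L[ℝ] (Fin (2 * d + 1 + 1) → ℝ)).comp
        ((LocalData.spatial (EuclideanSpace ℝ (Fin (d + 1)))).comp L₃)) u) =
        LocalData.spatial _ (L₂ (L₁ (L₀ u))) := fun u =>
      (phaseEquiv d).apply_symm_apply _
    exact (e1.symm.trans e2.symm).trans (congrArg₂ (fun z z' => symplecticModel _ z z')
      (e3 (Pi.single i 1)).symm (e3 (Pi.single j 1)).symm)

end Patch

end StationaryData

/-! ### Suprema of measures, and slices of linear maps -/

/-- If one of the measures of a family dominates all the others on the subsets of `W`, then the
supremum of the family agrees with it there. -/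
theorem iSup_measure_apply_of_le {ι α : Type*} [MeasurableSpace α] {μ : ι → Measure α} {W : Set α}
    (hW : MeasurableSet W) (i₀ : ι)
    (h : ∀ i, ∀ A, MeasurableSet A → A ⊆ W → μ i A ≤ μ i₀ A) {A : Set α} (hA : MeasurableSet A)
    (hAW : A ⊆ W) : (⨆ i, μ i) A = μ i₀ A := by
  refine le_antisymm ?_ (le_iSup μ i₀ A)
  have key : ⨆ i, μ i ≤ (μ i₀).restrict W + (⨆ i, μ i).restrict Wᶜ := by
    refine iSup_le fun i => Measure.le_iff.2 fun B hB => ?_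
    rw [Measure.add_apply, Measure.restrict_apply hB, Measure.restrict_apply hB,
      ← measure_inter_add_sdiff B hW]
    exact add_le_add (h i _ (hB.inter hW) inter_subset_right) (le_iSup μ i _)
  refine (key A).trans ?_
  rw [Measure.add_apply, Measure.restrict_apply hA, Measure.restrict_apply hA,
    inter_eq_self_of_subset_left hAW, (disjoint_compl_right_iff_subset.2 hAW).inter_eq,
    measure_empty, add_zero]

/-- Forgetting the first coordinate. -/
def tailL (k : ℕ) : (Fin (k + 1) → ℝ) →L[ℝ] (Fin k → ℝ) :=
  ContinuousLinearMap.pi fun i => ContinuousLinearMap.proj i.succ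

/-- The inclusion of the hyperplane of vectors whose first coordinate is zero. -/
def consL (k : ℕ) : (Fin k → ℝ) →L[ℝ] (Fin (k + 1) → ℝ) :=
  ContinuousLinearMap.pi fun i => Fin.cases 0 (fun j => ContinuousLinearMap.proj j) i

theorem consL_apply {k : ℕ} (y : Fin k → ℝ) : consL k y = Fin.cons 0 y := by
  funext i
  refine Fin.cases ?_ (fun j => ?_) i <;> rfl

theorem hasFDerivAt_cons {k : ℕ} (c : ℝ) (y : Fin k → ℝ) :
    HasFDerivAt (fun y : Fin k → ℝ => (Fin.cons c y : Fin (k + 1) → ℝ)) (consL k) y := by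
  have h : (fun y : Fin k → ℝ => (Fin.cons c y : Fin (k + 1) → ℝ)) =
      fun y => Fin.cons c 0 + consL k y := by
    funext y i
    rw [consL_apply]
    refine Fin.cases ?_ (fun j => ?_) i <;> simp
  rw [h]
  exact (consL k).hasFDerivAt.const_add _

/-- A linear map which preserves the first coordinate has the same determinant as its restriction to
the hyperplane on which this coordinate is zero. -/
theorem det_tailL_comp_consL {k : ℕ} (M : (Fin (k + 1) → ℝ) →L[ℝ] (Fin (k + 1) → ℝ))
    (hM : ∀ v, M v 0 = v 0) : ((tailL k).comp (M.comp (consL k))).det = M.det := by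
  have h1 : M.det = (LinearMap.toMatrix'
      (M : (Fin (k + 1) → ℝ) →ₗ[ℝ] (Fin (k + 1) → ℝ))).det := (LinearMap.det_toMatrix' _).symm
  have h2 : ((tailL k).comp (M.comp (consL k))).det = (LinearMap.toMatrix'
      (((tailL k).comp (M.comp (consL k)) : (Fin k → ℝ) →L[ℝ] (Fin k → ℝ)) :
        (Fin k → ℝ) →ₗ[ℝ] (Fin k → ℝ))).det := (LinearMap.det_toMatrix' _).symm
  rw [h1, h2, Matrix.det_succ_row_zero, Finset.sum_eq_single 0]
  · have h3 : (LinearMap.toMatrix' (M : (Fin (k + 1) → ℝ) →ₗ[ℝ] (Fin (k + 1) → ℝ))) 0 0 = 1 := by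
      rw [LinearMap.toMatrix'_apply]
      exact (hM _).trans (by simp)
    rw [h3, Fin.val_zero, pow_zero, one_mul, one_mul]
    congr 1
    ext i j
    rw [Matrix.submatrix_apply, LinearMap.toMatrix'_apply, LinearMap.toMatrix'_apply]
    have h4 : consL k (Pi.single j 1) = Pi.single j.succ 1 := by
      rw [consL_apply]
      funext l
      refine Fin.cases ?_ (fun l => ?_) l
      · simp
      · simp [Pi.single_apply]
    have h5 : ((tailL k).comp (M.comp (consL k))) (Pi.single j 1) i =
        M (consL k (Pi.single j 1)) i.succ := rfl
    refine h5.trans ?_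
    rw [h4]
    simp
  · intro j _ hj
    have h3 : (LinearMap.toMatrix' (M : (Fin (k + 1) → ℝ) →ₗ[ℝ] (Fin (k + 1) → ℝ))) 0 j = 0 := by
      rw [LinearMap.toMatrix'_apply]
      exact (hM _).trans (by simp [hj.symm])
    rw [h3]; simp
  · simp

namespace AdaptedPatch

variable {E : Type*} [NormedAddCommGroup E] [NormedSpace ℝ E]
  {H : Type*} [TopologicalSpace H] {I : ModelWithCorners ℝ E H}
  {X : Type*} [TopologicalSpace X] [ChartedSpace H X] [IsManifold I ∞ X]
  {g : ∀ x : X, TangentSpace I x →L[ℝ] TangentSpace I x →L[ℝ] ℝ} {m : ℝ}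
  {f : CotangentBundle I X → ℝ} {k : ℕ} (S : AdaptedPatch g m f k)

instance : BorelSpace (MassiveGeodesics g m) := ⟨rfl⟩

theorem continuous_cons (c : ℝ) :
    Continuous fun y : Fin k → ℝ => (Fin.cons c y : Fin (k + 1) → ℝ) :=
  continuous_pi fun i => by
    refine Fin.cases ?_ (fun i => ?_) i
    · exact continuous_const
    · exact continuous_apply i

theorem measurableSet_slice (c : ℝ) : MeasurableSet (S.slice c) :=
  (S.isOpen_domain.preimage (continuous_cons c)).measurableSet

theorem continuous_sliceMap (c : ℝ) : Continuous (S.sliceMap c) := by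
  refine continuous_quot_mk.comp (Continuous.subtype_mk ?_ _)
  have h := S.smooth.continuousOn.comp (continuous_cons (k := k) c).continuousOn
    (s := S.slice c) fun y hy => hy
  exact continuousOn_iff_continuous_domRestrict.1 h

/-- The part of the slice which parametrizes points of `A`. -/
def slicePreimage (c : ℝ) (A : Set (MassiveGeodesics g m)) : Set (Fin k → ℝ) :=
  Subtype.val '' (S.sliceMap c ⁻¹' A)

theorem measurableSet_slicePreimage (c : ℝ) {A : Set (MassiveGeodesics g m)}
    (hA : MeasurableSet A) : MeasurableSet (S.slicePreimage c A) :=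
  (S.measurableSet_slice c).subtype_image ((S.continuous_sliceMap c).measurable hA)

/-- The Leray measure of a patch, as an integral over a part of the coordinate space. -/
theorem lerayMeasure_apply (c : ℝ) {A : Set (MassiveGeodesics g m)} (hA : MeasurableSet A) :
    S.lerayMeasure c A = ∫⁻ y' in S.slicePreimage c A,
      ENNReal.ofReal (S.symplecticDensity (Fin.cons c y')) := by
  have hs := S.measurableSet_slice c
  have hm := (S.continuous_sliceMap c).measurable
  rw [lerayMeasure, Measure.map_apply hm hA, withDensity_apply _ (hm hA), slicePreimage]
  have h := (MeasurableEmbedding.subtype_coe hs).lintegral_map (μ := (volume.comap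
    (Subtype.val : S.slice c → Fin k → ℝ)).restrict (S.sliceMap c ⁻¹' A))
    (fun y' => ENNReal.ofReal (S.symplecticDensity (Fin.cons c y')))
  rw [← h]
  congr 1
  have h1 : S.sliceMap c ⁻¹' A = Subtype.val ⁻¹' (Subtype.val '' (S.sliceMap c ⁻¹' A)) :=
    (preimage_image_eq _ Subtype.val_injective).symm
  conv_lhs => rw [h1]
  rw [← (MeasurableEmbedding.subtype_coe hs).restrict_map, map_comap_subtype_coe hs,
    Measure.restrict_restrict (show MeasurableSet (Subtype.val '' (S.sliceMap c ⁻¹' A)) from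
      S.measurableSet_slicePreimage c hA), inter_eq_self_of_subset_left]
  exact Subtype.coe_image_subset _ _

end AdaptedPatch

/-! ### Phase space coordinates on the space of geodesics -/

namespace StationaryData

variable {d : ℕ} {Sig : Type*} [TopologicalSpace Sig]
  [ChartedSpace (EuclideanSpace ℝ (Fin (d + 1))) Sig] [IsManifold (𝓡 (d + 1)) ∞ Sig]
  (D : StationaryData (d + 1) Sig) [CompactSpace Sig] [T2Space Sig]

/-- The point at time zero of a geodesic of positive energy. -/
def pt {m : ℝ} (z : MassiveGeodesics D.metric m) :
    CotangentBundle (stModel (d + 1)) (ℝ × Sig) :=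
  D.rep m (Quot.out z).1

/-- The energy of a geodesic. -/
def geodesicEnergy {m : ℝ} (z : MassiveGeodesics D.metric m) : ℝ := energy (Quot.out z).1

theorem sameOrbit_out {m : ℝ} (ζ : massHyperboloid D.metric m) :
    SameOrbit (geodesicHamiltonian D.metric) (Quot.out (MassiveGeodesics.mk ζ)).1 ζ.1 :=
  D.mk_eq_mk_iff.1 (Quot.out_eq (MassiveGeodesics.mk ζ))

theorem geodesicEnergy_mk {m : ℝ} (ζ : massHyperboloid D.metric m) :
    D.geodesicEnergy (MassiveGeodesics.mk ζ) = energy ζ.1 :=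
  (SameOrbit.energy_eq D (D.sameOrbit_out ζ)).symm

theorem pt_mk {m : ℝ} (hm : m ≠ 0) (ζ : massHyperboloid D.metric m) (h : 0 < energy ζ.1) :
    D.pt (MassiveGeodesics.mk ζ) = D.rep m ζ.1 := by
  have h1 := D.sameOrbit_out ζ
  refine (D.rep_eq_rep_iff hm ⟨(Quot.out (MassiveGeodesics.mk ζ)).2, ?_⟩ ⟨ζ.2, h⟩).2 h1
  rw [← SameOrbit.energy_eq D h1]
  exact h

/-- Membership in the level set of `p_Z` does not depend on the chosen point of the geodesic. -/
theorem mem_levelSet_iff {m c : ℝ} {z : MassiveGeodesics D.metric m} :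
    z ∈ levelSet D.metric m energy c ↔ D.geodesicEnergy z = c := by
  constructor
  · rintro ⟨ζ, rfl, h⟩
    rw [D.geodesicEnergy_mk, h]
  · intro h
    exact ⟨Quot.out z, Quot.out_eq z, h⟩

theorem continuous_geodesicEnergy {m : ℝ} :
    Continuous (D.geodesicEnergy : MassiveGeodesics D.metric m → ℝ) := by
  refine continuous_coinduced_dom.2 ?_
  refine ((contMDiff_energy (r := d + 1) (Sig := Sig)).continuous.comp
    continuous_subtype_val).congr fun ζ => ?_
  exact (D.geodesicEnergy_mk ζ).symm

/-- The geodesics of positive energy which at time zero are in the domain of a chart of space. -/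
def chartSet (m : ℝ) (a : Sig) : Set (MassiveGeodesics D.metric m) :=
  {z | 0 < D.geodesicEnergy z ∧
    (D.pt z).proj.2 ∈ (chartAt (EuclideanSpace ℝ (Fin (d + 1))) a).source}

/-- The coordinates of a geodesic: its position and spatial momentum at time zero. -/
def coord {m : ℝ} (a : Sig) (z : MassiveGeodesics D.metric m) : Fin (2 * d + 1 + 1) → ℝ :=
  phase a (D.pt z)

theorem pt_spec {m : ℝ} (hm : m ≠ 0) {z : MassiveGeodesics D.metric m}
    (hz : 0 < D.geodesicEnergy z) : D.pt z ∈ D.shell m ∧ time (D.pt z) = 0 :=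
  ⟨(D.rep_spec hm ⟨(Quot.out z).2, hz⟩).1, (D.rep_spec hm ⟨(Quot.out z).2, hz⟩).2.1⟩

theorem chartEnergy_coord {m : ℝ} (hm : m ≠ 0) {a : Sig} {z : MassiveGeodesics D.metric m}
    (hz : z ∈ D.chartSet m a) : D.chartEnergy m a (D.coord a z) = D.geodesicEnergy z := by
  rw [coord, D.chartEnergy_phase hm hz.2 (D.pt_spec hm hz.1).1]
  exact D.energy_rep hm ⟨(Quot.out z).2, hz.1⟩

theorem continuousOn_pt {m : ℝ} (hm : m ≠ 0) :
    ContinuousOn (D.pt : MassiveGeodesics D.metric m → _) {z | 0 < D.geodesicEnergy z} := by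
  rw [continuousOn_open_iff (isOpen_lt continuous_const D.continuous_geodesicEnergy)]
  intro U hU
  change IsOpen (MassiveGeodesics.mk (g := D.metric) (m := m) ⁻¹' _)
  have hcont : ContinuousOn (fun ζ : massHyperboloid D.metric m => D.rep m ζ.1)
      {ζ | 0 < energy ζ.1} := by
    intro ζ hζ
    exact (D.continuousWithinAt_rep hm (ζ := ζ.1) ⟨ζ.2, hζ⟩).comp
      continuous_subtype_val.continuousWithinAt fun ζ' hζ' => ⟨ζ'.2, hζ'⟩
  have ho : IsOpen {ζ : massHyperboloid D.metric m | 0 < energy ζ.1} :=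
    isOpen_lt continuous_const
      ((contMDiff_energy (r := d + 1) (Sig := Sig)).continuous.comp continuous_subtype_val)
  convert hcont.isOpen_inter_preimage ho hU using 1
  ext ζ
  simp only [mem_preimage, mem_inter_iff, mem_ofPred_eq, D.geodesicEnergy_mk]
  exact and_congr_right fun h => by rw [D.pt_mk hm ζ h]

theorem isOpen_chartSet {m : ℝ} (hm : m ≠ 0) (a : Sig) : IsOpen (D.chartSet m a) := by
  have h1 : IsOpen {ζ : CotangentBundle (stModel (d + 1)) (ℝ × Sig) |
      ζ.proj.2 ∈ (chartAt (EuclideanSpace ℝ (Fin (d + 1))) a).source} := by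
    have := isOpen_extChartAt_source (I := cotModel (stModel (d + 1))) (basePoint (r := d + 1) a)
    convert this using 1
    ext ζ
    exact mem_cot_source.symm
  exact (D.continuousOn_pt hm).isOpen_inter_preimage
    (isOpen_lt continuous_const D.continuous_geodesicEnergy) h1

theorem continuousOn_coord {m : ℝ} (hm : m ≠ 0) (a : Sig) :
    ContinuousOn (D.coord a) (D.chartSet m a) :=
  continuousOn_phase.comp ((D.continuousOn_pt hm).mono fun _ hz => hz.1) fun _ hz => hz.2

section Patch

variable {m : ℝ} (hm : m ≠ 0) {a : Sig}
  (q : Straightening (D.chartEnergy m a)) (hq : q.source ⊆ phaseDomain a)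

/-- The adapted patch given by phase space coordinates of which the first is the energy. -/
def patch : AdaptedPatch D.metric m energy (2 * d + 1) where
  domain := q.target
  isOpen_domain := q.open_target
  toFun y := D.ofPhase m a (q.symm y)
  smooth := (D.contMDiffOn_ofPhase hm a).comp (t := phaseDomain a) q.contDiffOn_symm.contMDiffOn
    fun y hy => hq (q.map_target hy)
  mem_hyperboloid y hy := (D.ofPhase_mem_shell hm (hq (q.map_target hy))).1
  coordinate_zero y hy := by rw [D.energy_ofPhase (hq (q.map_target hy)), q.f_symm hy]
  injective := by
    rintro ⟨y, hy⟩ ⟨y', hy'⟩ h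
    have h1 := hq (q.map_target hy)
    have h2 := hq (q.map_target hy')
    have h3 := SameOrbit.eq_of_time_eq D hm (D.mk_eq_mk_iff.1 h) (D.ofPhase_mem_shell hm h1)
      ((D.time_ofPhase h1).trans (D.time_ofPhase h2).symm)
    have h4 : q.symm y = q.symm y' := by
      rw [← D.phase_ofPhase (m := m) h1, ← D.phase_ofPhase (m := m) h2]
      exact congrArg (phase a) h3
    exact Subtype.ext (q.symm.injOn hy hy' h4)

/-- Phase space coordinates are canonical, so after straightening the symplectic density is the
Jacobian of the coordinate change. -/
theorem symplecticDensity_patch {y : Fin (2 * d + 1 + 1) → ℝ} (hy : y ∈ q.target) :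
    (D.patch hm q hq).symplecticDensity y = q.jac y := by
  have h1 := hq (q.map_target hy)
  have hrep : ∀ y' ∈ q.target, D.rep m ((D.patch hm q hq).toFun y') = D.ofPhase m a (q.symm y') :=
    fun y' hy' => D.rep_eq_self hm (D.ofPhase_mem_shell hm (hq (q.map_target hy')))
      (D.time_ofPhase (hq (q.map_target hy')))
  obtain ⟨L, hL, hd⟩ := D.exists_hasFDerivAt_phase hm (D.patch hm q hq) hy
    (by rw [← q.f_symm hy]; exact D.chartEnergy_pos hm h1)
    (a := a) (by rw [hrep y hy]; exact D.ofPhase_mem_source h1)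
  have h2 : HasFDerivAt q.symm L y := by
    refine hL.congr_of_eventuallyEq ?_
    filter_upwards [q.open_target.mem_nhds hy] with y' hy'
    rw [hrep y' hy', D.phase_ofPhase (hq (q.map_target hy'))]
  rw [hd, Straightening.jac, h2.fderiv]

theorem geodesicEnergy_sliceMap {m : ℝ} (S : AdaptedPatch D.metric m energy (2 * d + 1)) {c : ℝ}
    (y' : S.slice c) : D.geodesicEnergy (S.sliceMap c y') = c :=
  (D.geodesicEnergy_mk _).trans ((S.coordinate_zero _ y'.2).trans (Fin.cons_zero _ _))

omit hq in
include hm in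
theorem pt_sliceMap (S : AdaptedPatch D.metric m energy (2 * d + 1)) {c : ℝ} (hc : 0 < c)
    (y' : S.slice c) : D.pt (S.sliceMap c y') = D.rep m (S.toFun (Fin.cons c y'.1)) :=
  D.pt_mk hm _ (by rw [S.coordinate_zero _ y'.2]; exact hc)

theorem rep_patch {y : Fin (2 * d + 1 + 1) → ℝ} (hy : y ∈ q.target) :
    D.rep m ((D.patch hm q hq).toFun y) = D.ofPhase m a (q.symm y) :=
  D.rep_eq_self hm (D.ofPhase_mem_shell hm (hq (q.map_target hy)))
    (D.time_ofPhase (hq (q.map_target hy)))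

/-- The geodesics with coordinates in the domain of the straightening. -/
def patchSet (m : ℝ) {a : Sig} (q : Straightening (D.chartEnergy m a)) :
    Set (MassiveGeodesics D.metric m) :=
  {z | z ∈ D.chartSet m a ∧ D.coord a z ∈ q.source}

include hm in
theorem isOpen_patchSet : IsOpen (D.patchSet m q) :=
  (D.continuousOn_coord hm a).isOpen_inter_preimage (D.isOpen_chartSet hm a) q.open_source

/-- The patch parametrizes the geodesics with coordinates in the domain of the straightening. -/
theorem sliceMap_patch {c : ℝ} (y' : (D.patch hm q hq).slice c) :
    (D.patch hm q hq).sliceMap c y' ∈ D.patchSet m q ∧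
      D.coord a ((D.patch hm q hq).sliceMap c y') = q.symm (Fin.cons c y'.1) := by
  have hy' : (Fin.cons c y'.1 : Fin (2 * d + 1 + 1) → ℝ) ∈ q.target := y'.2
  have h1 := hq (q.map_target hy')
  have hc : 0 < c := by
    have := D.chartEnergy_pos hm h1
    rwa [q.f_symm hy', Fin.cons_zero] at this
  have e2 := (D.pt_sliceMap hm (D.patch hm q hq) hc y').trans (D.rep_patch hm q hq hy')
  have e1 := D.geodesicEnergy_sliceMap (D.patch hm q hq) y'
  have e3 : D.coord a ((D.patch hm q hq).sliceMap c y') = q.symm (Fin.cons c y'.1) := by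
    rw [coord, e2, D.phase_ofPhase h1]
  generalize (D.patch hm q hq).sliceMap c y' = z at e1 e2 e3
  refine ⟨⟨⟨by rw [e1]; exact hc, by rw [e2]; exact D.ofPhase_mem_source h1⟩, ?_⟩, e3⟩
  rw [e3]; exact q.map_target hy'

/-- Each adapted patch gives a measure which is at most as large as the one given by straightened
phase space coordinates, where these are defined. -/
theorem lerayMeasure_le_patch (c : ℝ) (S : AdaptedPatch D.metric m energy (2 * d + 1))
    {A : Set (MassiveGeodesics D.metric m)} (hA : MeasurableSet A) (hAq : A ⊆ D.patchSet m q) :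
    S.lerayMeasure c A ≤ (D.patch hm q hq).lerayMeasure c A := by
  rw [S.lerayMeasure_apply c hA, (D.patch hm q hq).lerayMeasure_apply c hA]
  -- the transition map between the slices
  set T : (Fin (2 * d + 1 + 1) → ℝ) → (Fin (2 * d + 1 + 1) → ℝ) :=
    fun y => phase a (D.rep m (S.toFun y)) with hT
  set θ : (Fin (2 * d + 1) → ℝ) → (Fin (2 * d + 1) → ℝ) :=
    fun y' => Fin.tail (q.toOpenPartialHomeomorph (T (Fin.cons c y'))) with hθ
  have hmem : ∀ y' ∈ S.slicePreimage c A, ∃ h : y' ∈ S.slice c, S.sliceMap c ⟨y', h⟩ ∈ A := by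
    rintro _ ⟨⟨y', h⟩, hA, rfl⟩
    exact ⟨h, hA⟩
  have hinfo : ∀ y' ∈ S.slicePreimage c A, (Fin.cons c y' : Fin (2 * d + 1 + 1) → ℝ) ∈ S.domain ∧
      0 < c ∧ (D.rep m (S.toFun (Fin.cons c y'))).proj.2 ∈
        (chartAt (EuclideanSpace ℝ (Fin (d + 1))) a).source ∧ T (Fin.cons c y') ∈ q.source := by
    intro y' hy'
    obtain ⟨h, hzA⟩ := hmem y' hy'
    obtain ⟨⟨h1, h2⟩, h3⟩ := hAq hzA
    rw [D.geodesicEnergy_sliceMap] at h1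
    have hc := h1
    have e2 := D.pt_sliceMap hm S hc ⟨y', h⟩
    rw [e2] at h2
    rw [coord, e2] at h3
    exact ⟨h, hc, h2, h3⟩
  have hshell : ∀ y ∈ S.domain, 0 < y 0 → S.toFun y ∈ D.shell m := fun y h h0 =>
    ⟨S.mem_hyperboloid y h, by rw [S.coordinate_zero y h]; exact h0⟩
  have hT0 : ∀ y ∈ S.domain, 0 < y 0 → (D.rep m (S.toFun y)).proj.2 ∈
      (chartAt (EuclideanSpace ℝ (Fin (d + 1))) a).source → T y ∈ q.source →
      q.toOpenPartialHomeomorph (T y) 0 = y 0 := by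
    intro y hy hy0 ha hTq
    have hs := hshell y hy hy0
    refine (q.apply_zero _ hTq).trans ?_
    rw [hT, D.chartEnergy_phase hm ha (D.rep_spec hm hs).1, D.energy_rep hm hs,
      S.coordinate_zero y hy]
  have hcons : ∀ y' ∈ S.slicePreimage c A,
      Fin.cons c (θ y') = q.toOpenPartialHomeomorph (T (Fin.cons c y')) := by
    intro y' hy'
    obtain ⟨h1, h2, h3, h4⟩ := hinfo y' hy'
    have := hT0 _ h1 (by simpa using h2) h3 h4
    rw [Fin.cons_zero] at this
    conv_rhs => rw [← Fin.cons_self_tail (q.toOpenPartialHomeomorph (T (Fin.cons c y'))), this]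
  -- the densities differ by the Jacobian of the transition map
  have hder : ∀ y' ∈ S.slicePreimage c A, ∃ θ' : (Fin (2 * d + 1) → ℝ) →L[ℝ] (Fin (2 * d + 1) → ℝ),
      HasFDerivAt θ θ' y' ∧ S.symplecticDensity (Fin.cons c y') =
        |θ'.det| * q.jac (Fin.cons c (θ y')) := by
    intro y' hy'
    obtain ⟨h1, h2, h3, h4⟩ := hinfo y' hy'
    have h2' : 0 < (Fin.cons c y' : Fin (2 * d + 1 + 1) → ℝ) 0 := by simpa using h2
    obtain ⟨L, hL, hdens⟩ := D.exists_hasFDerivAt_phase hm S h1 h2' h3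
    have hq' := q.hasFDerivAt h4
    set Q := fderiv ℝ q.toOpenPartialHomeomorph (T (Fin.cons c y')) with hQ
    have hqT : HasFDerivAt (q.toOpenPartialHomeomorph ∘ T) (Q.comp L) (Fin.cons c y') :=
      HasFDerivAt.comp _ hq' hL
    have hev : ∀ᶠ y in 𝓝 (Fin.cons c y' : Fin (2 * d + 1 + 1) → ℝ),
        q.toOpenPartialHomeomorph (T y) 0 = y 0 := by
      have hdom := S.isOpen_domain.mem_nhds h1
      have hpos : ∀ᶠ y in 𝓝 (Fin.cons c y' : Fin (2 * d + 1 + 1) → ℝ), 0 < y 0 :=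
        (continuous_apply 0).continuousAt.eventually (lt_mem_nhds h2')
      have hS : ContinuousAt S.toFun (Fin.cons c y') :=
        S.smooth.continuousOn.continuousAt hdom
      have hrep : ∀ᶠ y in 𝓝 (Fin.cons c y' : Fin (2 * d + 1 + 1) → ℝ),
          (D.rep m (S.toFun y)).proj.2 ∈
            (chartAt (EuclideanSpace ℝ (Fin (d + 1))) a).source := by
        have hc1 : Filter.Tendsto S.toFun (𝓝 (Fin.cons c y'))
            (𝓝[D.shell m] (S.toFun (Fin.cons c y'))) := by
          refine tendsto_nhdsWithin_iff.2 ⟨hS, ?_⟩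
          filter_upwards [hdom, hpos] with y ha hb
          exact hshell y ha hb
        have hc2 := (D.continuousWithinAt_rep hm (hshell _ h1 h2')).tendsto.comp hc1
        have ho := (isOpen_extChartAt_source (I := cotModel (stModel (d + 1)))
          (basePoint (r := d + 1) a)).mem_nhds (mem_cot_source.2 h3)
        filter_upwards [hc2.eventually ho] with y hy
        exact mem_cot_source.1 hy
      filter_upwards [hdom, hpos, hrep, hL.continuousAt.eventually (q.open_source.mem_nhds h4)] with
        y ha hb hc hd
      exact hT0 y ha hb hc hd
    -- both patches have the energy as first coordinate, and so the transition map preserves it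
    have h0 : ∀ v, (Q.comp L) v 0 = v 0 := by
      intro v
      have e1 := hasFDerivAt_pi'.1 hqT 0
      have e2 := (hasFDerivAt_apply (𝕜 := ℝ) (0 : Fin (2 * d + 1 + 1))
        (Fin.cons c y' : Fin (2 * d + 1 + 1) → ℝ)).congr_of_eventuallyEq hev
      exact congrArg (fun l : (Fin (2 * d + 1 + 1) → ℝ) →L[ℝ] ℝ => l v) (e1.unique e2)
    refine ⟨(tailL _).comp ((Q.comp L).comp (consL _)),
      (tailL _).hasFDerivAt.comp y' (hqT.comp y' (hasFDerivAt_cons c y')), ?_⟩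
    rw [det_tailL_comp_consL _ h0, hcons y' hy', hdens, Straightening.jac]
    have hQ' : HasFDerivAt q.symm (fderiv ℝ q.symm (q.toOpenPartialHomeomorph (T (Fin.cons c y'))))
        (q.toOpenPartialHomeomorph (T (Fin.cons c y'))) := q.hasFDerivAt_symm (q.map_source h4)
    have hid : (fderiv ℝ q.symm (q.toOpenPartialHomeomorph (T (Fin.cons c y')))).comp Q =
        ContinuousLinearMap.id ℝ _ := by
      refine (HasFDerivAt.comp _ hQ' hq').unique ?_
      refine (hasFDerivAt_id _).congr_of_eventuallyEq ?_
      filter_upwards [q.open_source.mem_nhds h4] with w hw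
      exact q.left_inv hw
    have hdet : (fderiv ℝ q.symm (q.toOpenPartialHomeomorph (T (Fin.cons c y')))).det * Q.det = 1 := by
      have := congrArg ContinuousLinearMap.det hid
      rw [ContinuousLinearMap.det, ContinuousLinearMap.toLinearMap_comp, LinearMap.det_comp] at this
      exact this.trans LinearMap.det_id
    have hcomp : (Q.comp L).det = Q.det * L.det := by
      rw [ContinuousLinearMap.det, ContinuousLinearMap.toLinearMap_comp, LinearMap.det_comp]
    rw [hcomp, ← abs_mul, mul_right_comm, mul_comm Q.det, hdet, one_mul]
  choose! θ' hθ' hdens using hder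
  have hDm := S.measurableSet_slicePreimage c hA
  have hinj : InjOn θ (S.slicePreimage c A) := by
    intro y₁ hy₁ y₂ hy₂ h
    obtain ⟨h1, h2, h3, h4⟩ := hinfo y₁ hy₁
    obtain ⟨k1, k2, k3, k4⟩ := hinfo y₂ hy₂
    have e1 : q.toOpenPartialHomeomorph (T (Fin.cons c y₁)) =
        q.toOpenPartialHomeomorph (T (Fin.cons c y₂)) := by
      rw [← hcons y₁ hy₁, ← hcons y₂ hy₂, h]
    have e2 : T (Fin.cons c y₁) = T (Fin.cons c y₂) := q.injOn h4 k4 e1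
    have s1 := hshell _ h1 (by simpa using h2)
    have s2 := hshell _ k1 (by simpa using k2)
    have e3 : D.rep m (S.toFun (Fin.cons c y₁)) = D.rep m (S.toFun (Fin.cons c y₂)) := by
      rw [← D.ofPhase_phase hm h3 (D.rep_spec hm s1).1 (D.rep_spec hm s1).2.1,
        ← D.ofPhase_phase hm k3 (D.rep_spec hm s2).1 (D.rep_spec hm s2).2.1]
      exact congrArg _ e2
    have e4 := S.injective (a₁ := ⟨_, h1⟩) (a₂ := ⟨_, k1⟩)
      (D.mk_eq_mk_iff.2 ((D.rep_eq_rep_iff hm s1 s2).1 e3))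
    exact Fin.cons_right_injective (α := fun _ => ℝ) c (congrArg Subtype.val e4)
  have himg : θ '' (S.slicePreimage c A) ⊆ (D.patch hm q hq).slicePreimage c A := by
    rintro _ ⟨y', hy', rfl⟩
    obtain ⟨h1, h2, h3, h4⟩ := hinfo y' hy'
    obtain ⟨h, hzA⟩ := hmem y' hy'
    have htar : (Fin.cons c (θ y') : Fin (2 * d + 1 + 1) → ℝ) ∈ q.target := by
      rw [hcons y' hy']; exact q.map_source h4
    refine ⟨⟨θ y', htar⟩, ?_, rfl⟩
    have s1 := hshell _ h1 (by simpa using h2)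
    have e1 : (D.patch hm q hq).toFun (Fin.cons c (θ y')) = D.rep m (S.toFun (Fin.cons c y')) := by
      change D.ofPhase m a (q.symm (Fin.cons c (θ y'))) = _
      rw [hcons y' hy']
      refine (congrArg (D.ofPhase m a) (q.left_inv h4)).trans ?_
      exact D.ofPhase_phase hm h3 (D.rep_spec hm s1).1 (D.rep_spec hm s1).2.1
    have e2 : (D.patch hm q hq).sliceMap c ⟨θ y', htar⟩ = S.sliceMap c ⟨y', h⟩ := by
      refine (D.mk_eq_mk_iff.2 ?_).symm
      change SameOrbit _ _ ((D.patch hm q hq).toFun (Fin.cons c (θ y')))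
      rw [e1]
      exact (D.rep_spec hm s1).2.2
    rw [mem_preimage, e2]
    exact hzA
  calc ∫⁻ y' in S.slicePreimage c A, ENNReal.ofReal (S.symplecticDensity (Fin.cons c y'))
      = ∫⁻ y' in S.slicePreimage c A, ENNReal.ofReal |(θ' y').det| *
          ENNReal.ofReal (q.jac (Fin.cons c (θ y'))) := by
        refine setLIntegral_congr_fun hDm fun y' hy' => ?_
        rw [hdens y' hy', ENNReal.ofReal_mul (abs_nonneg _)]
    _ = ∫⁻ y' in θ '' (S.slicePreimage c A), ENNReal.ofReal (q.jac (Fin.cons c y')) :=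
        (lintegral_image_eq_lintegral_abs_det_fderiv_mul volume hDm
          (fun y' hy' => (hθ' y' hy').hasFDerivWithinAt) hinj
          fun y' => ENNReal.ofReal (q.jac (Fin.cons c y'))).symm
    _ ≤ ∫⁻ y' in (D.patch hm q hq).slicePreimage c A, ENNReal.ofReal (q.jac (Fin.cons c y')) :=
        lintegral_mono_set himg
    _ = _ := by
        refine setLIntegral_congr_fun ((D.patch hm q hq).measurableSet_slicePreimage c hA)
          fun y' hy' => ?_
        obtain ⟨⟨y', h⟩, -, rfl⟩ := hy'
        rw [D.symplecticDensity_patch hm q hq h]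

include hm hq in
/-- The Liouville measure, where straightened phase space coordinates are defined. -/
theorem lintegral_patchSet (c : ℝ) {G : (Fin (2 * d + 1 + 1) → ℝ) → ℝ≥0∞} (hG : Measurable G) :
    ∫⁻ z in D.patchSet m q, G (D.coord a z) ∂(liouvilleMeasure D.metric m energy (2 * d + 1) c) =
      ∫⁻ y' in {y' | (Fin.cons c y' : Fin (2 * d + 1 + 1) → ℝ) ∈ q.target},
        ENNReal.ofReal (q.jac (Fin.cons c y')) * G (q.symm (Fin.cons c y')) := by
  set P := D.patch hm q hq with hP
  have hWo := D.isOpen_patchSet hm q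
  have hW := hWo.measurableSet
  -- here the supremum over all patches is attained by this patch
  have hrestr : (liouvilleMeasure D.metric m energy (2 * d + 1) c).restrict (D.patchSet m q) =
      P.lerayMeasure c := by
    refine Measure.ext fun A hA => ?_
    rw [Measure.restrict_apply hA, liouvilleMeasure,
      iSup_measure_apply_of_le hW P (fun S B hB hBW => D.lerayMeasure_le_patch hm q hq c S hB hBW)
        (hA.inter hW) inter_subset_right, P.lerayMeasure_apply c hA,
      P.lerayMeasure_apply c (hA.inter hW)]
    have : P.slicePreimage c (A ∩ D.patchSet m q) = P.slicePreimage c A := by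
      refine congrArg (fun B => Subtype.val '' B) ?_
      ext y'
      exact ⟨fun h => h.1, fun h => ⟨h, (D.sliceMap_patch hm q hq y').1⟩⟩
    rw [this]
  set F : MassiveGeodesics D.metric m → ℝ≥0∞ :=
    (D.patchSet m q).indicator fun z => G (D.coord a z) with hF
  have hFm : Measurable F := by
    refine measurable_of_restrict_of_restrict_compl hW ?_ ?_
    · have h1 : Measurable fun z : D.patchSet m q => D.coord a z.1 :=
        (continuousOn_iff_continuous_domRestrict.1
          ((D.continuousOn_coord hm a).mono fun z hz => hz.1)).measurable
      have e : (D.patchSet m q).domRestrict F = fun z => G (D.coord a z.1) :=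
        funext fun z => by rw [domRestrict_apply, hF, indicator_of_mem z.2]
      rw [e]
      exact hG.comp h1
    · have e : (D.patchSet m q)ᶜ.domRestrict F = fun _ => 0 :=
        funext fun z => by rw [domRestrict_apply, hF, indicator_of_notMem z.2]
      rw [e]
      exact measurable_const
  have h1 : ∫⁻ z in D.patchSet m q, G (D.coord a z)
      ∂(liouvilleMeasure D.metric m energy (2 * d + 1) c) =
      ∫⁻ z in D.patchSet m q, F z ∂(liouvilleMeasure D.metric m energy (2 * d + 1) c) :=
    setLIntegral_congr_fun hW fun z hz => by rw [hF, indicator_of_mem hz]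
  have hs := P.measurableSet_slice c
  have hdm : Measurable fun y' : P.slice c =>
      ENNReal.ofReal (P.symplecticDensity (Fin.cons c y'.1)) := by
    have e : (fun y' : P.slice c => ENNReal.ofReal (P.symplecticDensity (Fin.cons c y'.1))) =
        fun y' : P.slice c => ENNReal.ofReal (q.jac (Fin.cons c y'.1)) := by
      funext y'
      rw [D.symplecticDensity_patch hm q hq y'.2]
    rw [e]
    have hc : Continuous fun y' : P.slice c => q.jac (Fin.cons c y'.1) :=
      continuousOn_iff_continuous_domRestrict.1
        (q.continuousOn_jac.comp (AdaptedPatch.continuous_cons (k := 2 * d + 1) c).continuousOn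
          (s := P.slice c) fun y' hy => hy)
    exact ENNReal.measurable_ofReal.comp hc.measurable
  rw [h1, hrestr, AdaptedPatch.lerayMeasure,
    lintegral_map hFm (P.continuous_sliceMap c).measurable]
  refine (lintegral_withDensity_eq_lintegral_mul _ hdm
    (hFm.comp (P.continuous_sliceMap c).measurable)).trans ?_
  have h2 : ∀ y' : P.slice c, ((fun y' : P.slice c =>
      ENNReal.ofReal (P.symplecticDensity (Fin.cons c y'.1))) * fun y' => F (P.sliceMap c y')) y' =
      (fun y' : Fin (2 * d + 1) → ℝ => ENNReal.ofReal (q.jac (Fin.cons c y')) *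
        G (q.symm (Fin.cons c y'))) y'.1 := by
    intro y'
    obtain ⟨h3, h4⟩ := D.sliceMap_patch hm q hq y'
    rw [Pi.mul_apply, D.symplecticDensity_patch hm q hq y'.2, hF, indicator_of_mem h3, h4]
  refine (lintegral_congr h2).trans ?_
  exact lintegral_subtype_comap (μ := volume) hs fun y' : Fin (2 * d + 1) → ℝ =>
    ENNReal.ofReal (q.jac (Fin.cons c y')) * G (q.symm (Fin.cons c y'))

end Patch

end StationaryData

/-! ### Regular values of the energy -/

/-- Rescaling the momentum turns the energy at mass `m` into the one at mass one. -/
theorem LocalData.H_eq_mul {E : Type*} [NormedAddCommGroup E] [NormedSpace ℝ E]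
    [FiniteDimensional ℝ E] (A : LocalData E) {m : ℝ} (hm : 0 < m) (w : E × (E →L[ℝ] ℝ)) :
    A.H m w = m * A.H 1 (w.1, m⁻¹ • w.2) := by
  have h := energyOf_smul (A.h w.1) (A.N w.1) (A.β w.1) hm (m⁻¹ • w.2)
  rw [smul_smul, mul_inv_cancel₀ hm.ne', one_smul] at h
  exact h

namespace StationaryData

variable {d : ℕ} {Sig : Type*} [TopologicalSpace Sig]
  [ChartedSpace (EuclideanSpace ℝ (Fin (d + 1))) Sig] [IsManifold (𝓡 (d + 1)) ∞ Sig]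
  (D : StationaryData (d + 1) Sig)

/-- A regular value of the energy on the space of geodesics of mass one gives, for each mass, a level
of the energy on phase space without critical points. -/
theorem fderiv_chartEnergy_ne_zero {ν : ℝ} (hreg : IsRegularValueOn D.metric 1 energy ν) {m : ℝ}
    (hm : 0 < m) {a : Sig} {w : Fin (2 * d + 1 + 1) → ℝ} (hw : w ∈ phaseDomain a)
    (hE : D.chartEnergy m a w = ν * m) : fderiv ℝ (D.chartEnergy m a) w ≠ 0 := by
  -- on the mass shell the differential of the geodesic Hamiltonian is a multiple of `dτ - dH`, so at a
  -- critical point of `H` its kernel would be in the kernel of `dτ`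
  have hH : ∀ w ∈ phaseDomain (d := d) a, D.chartEnergy 1 a w = ν →
      fderiv ℝ ((D.localData a).H 1) (phaseEquiv d w) ≠ 0 := by
    intro w hw hE
    have hs := D.ofPhase_mem_source (m := 1) hw
    obtain ⟨u, hu, hu'⟩ := hreg _ (D.ofPhase_mem_shell one_ne_zero hw).1
      ((D.energy_ofPhase hw).trans hE)
    obtain ⟨L, -, -, hK, -, hτ, -⟩ := D.exists_cotChart hs
    rw [hK, D.cotChart_ofPhase hw] at hu
    rw [hτ] at hu'
    obtain ⟨h1, h2⟩ := (D.localData a).fderiv_K (m := 1) one_ne_zero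
      (z := LocalData.lift 0 (D.chartEnergy 1 a w) (phaseEquiv d w)) hw
      (by rw [LocalData.tauL_lift, LocalData.spatial_lift]; rfl)
    rw [h2, LocalData.spatial_lift] at hu
    intro h0
    rw [h0] at hu
    rcases mul_eq_zero.1 hu with h | h
    · exact h1.ne h
    · exact hu' (by simpa using h)
  -- scaling of the momentum reduces this to mass one
  let σ : (Fin (2 * d + 1 + 1) → ℝ) → (Fin (2 * d + 1 + 1) → ℝ) := fun w =>
    (phaseEquiv d).symm ((phaseEquiv d w).1, m⁻¹ • (phaseEquiv d w).2)
  have hσ : phaseEquiv d (σ w) = ((phaseEquiv d w).1, m⁻¹ • (phaseEquiv d w).2) :=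
    (phaseEquiv d).apply_symm_apply _
  have hσw : σ w ∈ phaseDomain (d := d) a := by
    rw [phaseDomain, mem_ofPred_eq, hσ]; exact hw
  have h1 : D.chartEnergy 1 a (σ w) = ν := by
    have h := (D.localData a).H_eq_mul hm (phaseEquiv d w)
    rw [← hσ] at h
    have h' : D.chartEnergy m a w = m * D.chartEnergy 1 a (σ w) := h
    rw [hE, mul_comm] at h'
    exact (mul_left_cancel₀ hm.ne' h').symm
  have h2 := hH _ hσw h1
  intro h0
  apply h2
  set M : EuclideanSpace ℝ (Fin (d + 1)) × (EuclideanSpace ℝ (Fin (d + 1)) →L[ℝ] ℝ) →L[ℝ]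
    EuclideanSpace ℝ (Fin (d + 1)) × (EuclideanSpace ℝ (Fin (d + 1)) →L[ℝ] ℝ) :=
    (ContinuousLinearMap.id ℝ (EuclideanSpace ℝ (Fin (d + 1)))).prodMap
      (m • ContinuousLinearMap.id ℝ (EuclideanSpace ℝ (Fin (d + 1)) →L[ℝ] ℝ)) with hM
  have hMσ : M (phaseEquiv d (σ w)) = phaseEquiv d w := by
    rw [hσ, hM]
    refine Prod.ext rfl ?_
    change m • m⁻¹ • (phaseEquiv d w).2 = _
    rw [smul_smul, mul_inv_cancel₀ hm.ne', one_smul]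
  have hd1 : HasFDerivAt (D.chartEnergy m a) (0 : (Fin (2 * d + 1 + 1) → ℝ) →L[ℝ] ℝ)
      ((phaseEquiv d).symm (M (phaseEquiv d (σ w)))) := by
    rw [hMσ, ContinuousLinearEquiv.symm_apply_apply, ← h0]
    exact (((D.contDiffOn_chartEnergy hm.ne' a).contDiffAt
      ((isOpen_phaseDomain a).mem_nhds hw)).differentiableAt (by simp)).hasFDerivAt
  have hd2 := (HasFDerivAt.comp (phaseEquiv d (σ w)) hd1
    ((((phaseEquiv d).symm : _ →L[ℝ] (Fin (2 * d + 1 + 1) → ℝ)).comp M).hasFDerivAt)).const_mul m⁻¹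
  have hd3 : HasFDerivAt ((D.localData a).H 1)
      (0 : EuclideanSpace ℝ (Fin (d + 1)) × (EuclideanSpace ℝ (Fin (d + 1)) →L[ℝ] ℝ) →L[ℝ] ℝ)
      (phaseEquiv d (σ w)) := by
    refine (hd2.congr_fderiv (by simp)).congr_of_eventuallyEq (Filter.Eventually.of_forall ?_)
    intro z
    have h := (D.localData a).H_eq_mul hm (M z)
    have hz : (((M z).1, m⁻¹ • (M z).2) :
        EuclideanSpace ℝ (Fin (d + 1)) × (EuclideanSpace ℝ (Fin (d + 1)) →L[ℝ] ℝ)) = z := by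
      refine Prod.ext rfl ?_
      change m⁻¹ • m • z.2 = z.2
      rw [smul_smul, inv_mul_cancel₀ hm.ne', one_smul]
    rw [hz] at h
    change (D.localData a).H 1 z =
      m⁻¹ * (D.localData a).H m (phaseEquiv d ((phaseEquiv d).symm (M z)))
    rw [ContinuousLinearEquiv.apply_symm_apply, h, ← mul_assoc, inv_mul_cancel₀ hm.ne', one_mul]
  exact hd3.fderiv

end StationaryData

/-! ### The volume of the ellipsoid of momenta of bounded energy -/

section Ellipsoid

open Matrix

variable {r : ℕ}

open scoped MatrixOrder in
/-- A positive semidefinite matrix has a symmetric square root. -/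
theorem exists_isHermitian_mul_self {M : Matrix (Fin r) (Fin r) ℝ} (hM : M.PosSemidef) :
    ∃ X : Matrix (Fin r) (Fin r) ℝ, X.IsHermitian ∧ X * X = M := by
  obtain ⟨X, hX, -, h⟩ := CFC.exists_sqrt_of_isSelfAdjoint_of_quasispectrumRestricts hM.isHermitian
    (QuasispectrumRestricts.nnreal_of_nonneg hM.nonneg)
  exact ⟨X, hX, h⟩

/-- The volume of an ellipsoid with centre at the origin. -/
theorem volume_ellipsoid [NeZero r] {M : Matrix (Fin r) (Fin r) ℝ} (hM : M.PosDef) {ρ : ℝ}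
    (hρ : 0 ≤ ρ) : volume {v : EuclideanSpace ℝ (Fin r) | (v : Fin r → ℝ) ⬝ᵥ (M *ᵥ v) ≤ ρ} =
      ENNReal.ofReal (√ρ ^ r / √M.det) * volume (Metric.ball (0 : EuclideanSpace ℝ (Fin r)) 1) := by
  obtain ⟨X, hX, rfl⟩ := exists_isHermitian_mul_self hM.posSemidef
  have hdet : X.det ≠ 0 := by
    have := hM.det_pos
    rw [Matrix.det_mul] at this
    exact fun h => by simp [h] at this
  set f : EuclideanSpace ℝ (Fin r) →ₗ[ℝ] EuclideanSpace ℝ (Fin r) := Matrix.toEuclideanLin X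
  have hf : LinearMap.det f = X.det :=
    LinearMap.det_toLin (EuclideanSpace.basisFun (Fin r) ℝ).toBasis X
  have hset : {v : EuclideanSpace ℝ (Fin r) | (v : Fin r → ℝ) ⬝ᵥ ((X * X) *ᵥ v) ≤ ρ} =
      f ⁻¹' Metric.closedBall 0 √ρ := by
    ext v
    have h1 : (v : Fin r → ℝ) ⬝ᵥ ((X * X) *ᵥ v) = ‖f v‖ ^ 2 := by
      rw [EuclideanSpace.real_norm_sq_eq, ← Matrix.mulVec_mulVec, Matrix.dotProduct_mulVec,
        ← Matrix.mulVec_transpose]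
      have hXt : Xᵀ = X := hX
      rw [hXt]
      simp only [dotProduct, sq]
      rfl
    rw [mem_ofPred_eq, h1, mem_preimage, mem_closedBall_zero_iff, Real.le_sqrt (norm_nonneg _) hρ]
  have hs : √((X * X).det) = |X.det| := by
    rw [Matrix.det_mul, ← sq, Real.sqrt_sq_eq_abs]
  rw [hset, Measure.addHaar_preimage_linearMap volume (by rw [hf]; exact hdet), hf,
    Measure.addHaar_closedBall volume _ (Real.sqrt_nonneg _), ← mul_assoc, hs,
    ← ENNReal.ofReal_mul (abs_nonneg _), finrank_euclideanSpace_fin, abs_inv]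
  congr 2
  rw [div_eq_inv_mul]

variable (b : EuclideanSpace ℝ (Fin r) →L[ℝ] EuclideanSpace ℝ (Fin r) →L[ℝ] ℝ)

/-- The matrix of a bilinear form. -/
def gram : Matrix (Fin r) (Fin r) ℝ :=
  Matrix.of fun i j => b (EuclideanSpace.single i 1) (EuclideanSpace.single j 1)

theorem apply_eq_gram (v w : EuclideanSpace ℝ (Fin r)) :
    b v w = (v : Fin r → ℝ) ⬝ᵥ (gram b *ᵥ w) := by
  have h : ∀ v : EuclideanSpace ℝ (Fin r), v = ∑ i, v i • EuclideanSpace.single i 1 := fun v => by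
    ext j
    simp [Pi.single_apply]
  conv_lhs => rw [h v, h w]
  simp only [map_sum, map_smul, _root_.sum_apply, _root_.smul_apply,
    smul_eq_mul, dotProduct, Matrix.mulVec, gram, Matrix.of_apply, Finset.mul_sum]
  rw [Finset.sum_comm]
  exact Finset.sum_congr rfl fun i _ => Finset.sum_congr rfl fun j _ => by ring

variable {b} (hs : ∀ v w, b v w = b w v) (hp : ∀ v, v ≠ 0 → 0 < b v v)

include hs hp in
theorem posDef_gram : (gram b).PosDef := by
  refine Matrix.PosDef.of_dotProduct_mulVec_pos ?_ fun x hx => ?_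
  · ext i j
    simp [gram, hs]
  · have h := hp (WithLp.toLp 2 x) (fun h => hx (congrArg WithLp.ofLp h))
    rw [apply_eq_gram] at h
    simpa using h

include hs hp in
/-- The squared norm of a momentum is the quadratic form of the inverse matrix. -/
theorem conormSq_toDual (v : EuclideanSpace ℝ (Fin r)) :
    conormSq b (InnerProductSpace.toDual ℝ _ v) = (v : Fin r → ℝ) ⬝ᵥ ((gram b)⁻¹ *ᵥ v) := by
  have hdet : IsUnit (gram b).det := (posDef_gram hs hp).det_pos.ne'.isUnit
  have h : b.inverse (InnerProductSpace.toDual ℝ _ v) = WithLp.toLp 2 ((gram b)⁻¹ *ᵥ v) := by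
    rw [(isInvertible_of_pos hp).inverse_apply_eq]
    ext w
    rw [hs, apply_eq_gram, Matrix.mulVec_mulVec, Matrix.mul_nonsing_inv _ hdet, Matrix.one_mulVec,
      InnerProductSpace.toDual_apply_apply, PiLp.inner_apply]
    simp [dotProduct, mul_comm]
  rw [conormSq, h, InnerProductSpace.toDual_apply_apply, PiLp.inner_apply]
  simp [dotProduct, mul_comm]

variable {N : ℝ} (hN : 0 < N) {β : EuclideanSpace ℝ (Fin r)} (hβ : b β β < N ^ 2)

/-- The matrix of the quadratic form `N² |η|² - η(β)²` on momenta. -/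
def energyMatrix (b : EuclideanSpace ℝ (Fin r) →L[ℝ] EuclideanSpace ℝ (Fin r) →L[ℝ] ℝ) (N : ℝ)
    (β : EuclideanSpace ℝ (Fin r)) : Matrix (Fin r) (Fin r) ℝ :=
  N ^ 2 • (gram b)⁻¹ - Matrix.vecMulVec β β

include hs hp in
theorem dotProduct_energyMatrix (v : EuclideanSpace ℝ (Fin r)) :
    (v : Fin r → ℝ) ⬝ᵥ (energyMatrix b N β *ᵥ v) =
      N ^ 2 * conormSq b (InnerProductSpace.toDual ℝ _ v) -
        (InnerProductSpace.toDual ℝ _ v β) ^ 2 := by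
  rw [energyMatrix, Matrix.sub_mulVec, Matrix.smul_mulVec, dotProduct_sub, dotProduct_smul,
    ← conormSq_toDual hs hp, InnerProductSpace.toDual_apply_apply, PiLp.inner_apply,
    Matrix.vecMulVec_mulVec]
  have h : (β : Fin r → ℝ) ⬝ᵥ v = ∑ i, inner ℝ (v i) (β i) := by
    simp [dotProduct]
  simp only [smul_eq_mul, dotProduct_smul, op_smul_eq_smul]
  rw [dotProduct_comm (v : Fin r → ℝ) β, h]
  ring

include hs hp hN hβ in
theorem posDef_energyMatrix : (energyMatrix b N β).PosDef := by
  refine Matrix.PosDef.of_dotProduct_mulVec_pos ?_ fun x hx => ?_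
  · refine Matrix.IsHermitian.sub ?_ ?_
    · exact ((posDef_gram hs hp).isHermitian.inv).smul (k := N ^ 2) rfl
    · ext i j
      simp [Matrix.vecMulVec_apply, mul_comm]
  · have h := dotProduct_energyMatrix hs hp (N := N) (β := β) (WithLp.toLp 2 x)
    have h1 := apply_sq_le_conormSq hs hp
      (InnerProductSpace.toDual ℝ (EuclideanSpace ℝ (Fin r)) (WithLp.toLp 2 x)) β
    have h2 : 0 < conormSq b (InnerProductSpace.toDual ℝ _ (WithLp.toLp 2 x)) := by
      rw [conormSq_toDual hs hp]
      simpa using (posDef_gram hs hp).inv.dotProduct_mulVec_pos hx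
    have h3 : 0 < N ^ 2 * conormSq b (InnerProductSpace.toDual ℝ _ (WithLp.toLp 2 x)) -
        (InnerProductSpace.toDual ℝ _ (WithLp.toLp 2 x) β) ^ 2 := by nlinarith
    rw [← h] at h3
    simpa using h3

include hs hp hN in
/-- The energy matrix is a rank one perturbation of `N² h⁻¹`, so its determinant is given by the matrix
determinant lemma. -/
theorem det_energyMatrix [NeZero r] :
    (energyMatrix b N β).det = (N ^ (r - 1)) ^ 2 * (N ^ 2 - b β β) / (gram b).det := by
  have hdet := (posDef_gram hs hp).det_pos
  have hA : (N ^ 2 • (gram b)⁻¹).det = (N ^ 2) ^ r / (gram b).det := by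
    rw [Matrix.det_smul, Fintype.card_fin, Matrix.det_nonsing_inv, Ring.inverse_eq_inv']
    rfl
  have hu : IsUnit (N ^ 2 • (gram b)⁻¹).det := by
    rw [hA]; exact (by positivity : (N ^ 2) ^ r / (gram b).det ≠ 0).isUnit
  have hinv : (N ^ 2 • (gram b)⁻¹)⁻¹ = (N ^ 2)⁻¹ • gram b := by
    refine Matrix.inv_eq_left_inv ?_
    rw [Matrix.smul_mul, Matrix.mul_smul, Matrix.mul_nonsing_inv _ hdet.ne'.isUnit, smul_smul,
      inv_mul_cancel₀ (by positivity), one_smul]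
  have hsum : energyMatrix b N β = N ^ 2 • (gram b)⁻¹ +
      Matrix.replicateCol Unit (-(β : Fin r → ℝ)) * Matrix.replicateRow Unit (β : Fin r → ℝ) := by
    ext i j
    simp [energyMatrix, Matrix.vecMulVec_apply, Matrix.mul_apply, sub_eq_add_neg]
  have hd1 : (1 + Matrix.replicateRow Unit (β : Fin r → ℝ) * ((N ^ 2)⁻¹ • gram b) *
      Matrix.replicateCol Unit (-(β : Fin r → ℝ))).det = 1 - (N ^ 2)⁻¹ * b β β := by
    rw [Matrix.det_unique, apply_eq_gram, Matrix.mul_smul, Matrix.smul_mul, Matrix.mul_assoc]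
    simp [Matrix.mul_apply, dotProduct, Matrix.mulVec]
    ring
  rw [hsum, Matrix.det_add_replicateCol_mul_replicateRow hu, hA, hinv, hd1]
  have hpow : (N ^ 2) ^ r = (N ^ (r - 1)) ^ 2 * N ^ 2 := by
    obtain ⟨k, hk⟩ := Nat.exists_eq_succ_of_ne_zero (NeZero.ne r)
    simp only [hk, Nat.succ_sub_one, pow_succ]
    ring
  rw [hpow]
  field_simp

include hs hp hN hβ in
/-- Squaring turns the bound on the energy into a quadratic inequality for the momentum. No spurious
solutions appear, since `|η(β)|` is less than the root. -/
theorem energyOf_le_iff {m e : ℝ} (hm : m ≠ 0) (he : 0 < e)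
    (η : EuclideanSpace ℝ (Fin r) →L[ℝ] ℝ) : energyOf b N β m η ≤ e ↔
      N ^ 2 * conormSq b η - η β ^ 2 + 2 * e * η β ≤ e ^ 2 - N ^ 2 * m ^ 2 := by
  have h1 := abs_apply_lt hs hp hN hβ hm η
  have h2 := conormSq_nonneg hp η
  have h3 : (N * √(m ^ 2 + conormSq b η)) ^ 2 = N ^ 2 * (m ^ 2 + conormSq b η) := by
    rw [mul_pow, Real.sq_sqrt (by positivity)]
  have h4 : 0 ≤ N * √(m ^ 2 + conormSq b η) := by positivity
  rw [energyOf]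
  constructor
  · intro h
    nlinarith
  · intro h
    have h5 : (N * √(m ^ 2 + conormSq b η)) ^ 2 ≤ (e - η β) ^ 2 := by nlinarith
    have h6 := sq_le_sq.1 h5
    rw [abs_of_nonneg h4] at h6
    rcases le_or_gt 0 (e - η β) with h7 | h7
    · rw [abs_of_nonneg h7] at h6
      linarith
    · rw [abs_of_neg h7] at h6
      linarith [le_abs_self (η β)]

include hs hp in
/-- Expansion of the squared norm around a multiple of the momentum `h(β, ·)`, for completing the
square. -/
theorem conormSq_add_smul (η : EuclideanSpace ℝ (Fin r) →L[ℝ] ℝ) (t : ℝ) :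
    conormSq b (η + t • b β) = conormSq b η + 2 * t * η β + t ^ 2 * b β β := by
  have h1 : b.inverse (b β) = β := by
    rw [(isInvertible_of_pos hp).inverse_apply_eq]
  have h2 : b β (b.inverse η) = η β := by
    rw [hs, apply_inverse_of_pos hp]
  simp only [conormSq, map_add, map_smul, _root_.add_apply,
    _root_.smul_apply, smul_eq_mul, h1, h2]
  ring

include hs hp hN hβ in
/-- The volume of the set of momenta of energy at most `e`. -/
theorem volume_energyOf_le [NeZero r] {m e : ℝ} (hm : m ≠ 0) (he : 0 < e) :
    volume {v : EuclideanSpace ℝ (Fin r) |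
        energyOf b N β m (InnerProductSpace.toDual ℝ _ v) ≤ e} =
      ENNReal.ofReal (N * √(gram b).det / √(N ^ 2 - b β β) ^ (r + 1) *
        √(e ^ 2 - m ^ 2 * (N ^ 2 - b β β)) ^ r) *
        volume (Metric.ball (0 : EuclideanSpace ℝ (Fin r)) 1) := by
  have hF : 0 < N ^ 2 - b β β := by linarith
  set F := N ^ 2 - b β β with hFdef
  set ρ := N ^ 2 * (e ^ 2 - m ^ 2 * F) / F with hρ
  have hM := posDef_energyMatrix hs hp hN hβ
  -- the centre of the ellipsoid
  set v₀ : EuclideanSpace ℝ (Fin r) := (InnerProductSpace.toDual ℝ _).symm ((e / F) • b β) with hv₀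
  have hset : {v : EuclideanSpace ℝ (Fin r) |
      energyOf b N β m (InnerProductSpace.toDual ℝ _ v) ≤ e} =
      (fun v => v + v₀) ⁻¹' {v : EuclideanSpace ℝ (Fin r) |
        (v : Fin r → ℝ) ⬝ᵥ (energyMatrix b N β *ᵥ v) ≤ ρ} := by
    ext v
    rw [mem_preimage, mem_ofPred_eq, mem_ofPred_eq, energyOf_le_iff hs hp hN hβ hm he,
      dotProduct_energyMatrix hs hp, map_add, hv₀, LinearIsometryEquiv.apply_symm_apply,
      conormSq_add_smul hs hp]
    simp only [_root_.add_apply, _root_.smul_apply, smul_eq_mul]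
    set η := InnerProductSpace.toDual ℝ (EuclideanSpace ℝ (Fin r)) v
    have h1 : N ^ 2 * (conormSq b η + 2 * (e / F) * η β + (e / F) ^ 2 * b β β) -
        (η β + e / F * b β β) ^ 2 = N ^ 2 * conormSq b η - η β ^ 2 + 2 * e * η β +
          e ^ 2 * b β β / F := by
      have : b β β = N ^ 2 - F := by rw [hFdef]; ring
      rw [this]
      field_simp
      ring
    have h2 : ρ = e ^ 2 - N ^ 2 * m ^ 2 + e ^ 2 * b β β / F := by
      have : b β β = N ^ 2 - F := by rw [hFdef]; ring
      rw [this, hρ]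
      field_simp
      ring
    rw [h1, h2]
    constructor <;> intro h <;> linarith
  rw [hset, measure_preimage_add_right]
  rcases le_or_gt 0 (e ^ 2 - m ^ 2 * F) with h | h
  · have hρ0 : 0 ≤ ρ := by positivity
    rw [volume_ellipsoid hM hρ0, det_energyMatrix hs hp hN]
    congr 2
    have hG := (posDef_gram hs hp).det_pos
    have e1 : √ρ = N * √(e ^ 2 - m ^ 2 * F) / √F := by
      rw [hρ, Real.sqrt_div (by positivity), Real.sqrt_mul (by positivity), Real.sqrt_sq hN.le]
    have e2 : √((N ^ (r - 1)) ^ 2 * F / (gram b).det) = N ^ (r - 1) * √F / √(gram b).det := by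
      rw [Real.sqrt_div (by positivity), Real.sqrt_mul (by positivity), Real.sqrt_sq (by positivity)]
    have e3 : N ^ r = N ^ (r - 1) * N := by
      obtain ⟨k, hk⟩ := Nat.exists_eq_succ_of_ne_zero (NeZero.ne r)
      simp only [hk, Nat.succ_sub_one, pow_succ]
    have h1 : 0 < √F := Real.sqrt_pos.2 hF
    have h2 : 0 < √(gram b).det := Real.sqrt_pos.2 hG
    rw [e1, e2, div_pow, mul_pow, e3, pow_succ √F]
    field_simp
  -- `m √F` is the minimal energy, and below it there are no momenta
  · have hempty : {v : EuclideanSpace ℝ (Fin r) |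
        (v : Fin r → ℝ) ⬝ᵥ (energyMatrix b N β *ᵥ v) ≤ ρ} = ∅ := by
      ext v
      have hρ0 : ρ < 0 := div_neg_of_neg_of_pos (mul_neg_of_pos_of_neg (by positivity) h) hF
      have h1 : 0 ≤ (v : Fin r → ℝ) ⬝ᵥ (energyMatrix b N β *ᵥ v) := by
        simpa using hM.posSemidef.dotProduct_mulVec_nonneg (v : Fin r → ℝ)
      simp only [mem_ofPred_eq, mem_empty_iff_false, iff_false, not_le]
      linarith
    rw [hempty, measure_empty, Real.sqrt_eq_zero_of_nonpos h.le, zero_pow (NeZero.ne r), mul_zero,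
      ENNReal.ofReal_zero, zero_mul]

end Ellipsoid

/-- The area of the unit sphere and the volume of the unit ball. -/
theorem ofReal_sphereArea (r : ℕ) [NeZero r] : ENNReal.ofReal (sphereArea r) =
    r * volume (Metric.ball (0 : EuclideanSpace ℝ (Fin r)) 1) := by
  rw [sphereArea, Measure.toSphere_apply_univ, finrank_euclideanSpace_fin, ENNReal.ofReal_toReal]
  exact ENNReal.mul_ne_top (ENNReal.natCast_ne_top r) measure_ball_lt_top.ne

theorem sphereArea_pos (r : ℕ) [NeZero r] : 0 < sphereArea r := by
  rw [← ENNReal.ofReal_pos, ofReal_sphereArea]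
  exact ENNReal.mul_pos (Nat.cast_ne_zero.2 (NeZero.ne r)) (Metric.measure_ball_pos _ _ one_pos).ne'

/-! ### Difference quotients -/

/-- The derivative of `e ↦ (e² - a)^(r/2)` at `c`, as a limit of difference quotients from the left.
Where `c² ≤ a`, the quotients vanish, and so does the expression for the limit, since the root in it
is zero. -/
theorem tendsto_quotient_sqrt_pow {r : ℕ} (hr : r ≠ 0) {a c : ℝ} (hc : 0 < c) :
    Filter.Tendsto (fun ε => ε⁻¹ * (√(c ^ 2 - a) ^ r - √((c - ε) ^ 2 - a) ^ r)) (𝓝[>] 0)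
      (𝓝 (r * c * √(c ^ 2 - a) ^ r / (c ^ 2 - a))) := by
  rcases le_or_gt (c ^ 2 - a) 0 with h | h
  · rw [Real.sqrt_eq_zero_of_nonpos h, zero_pow hr, mul_zero, zero_div]
    refine tendsto_const_nhds.congr' ?_
    filter_upwards [Ioo_mem_nhdsGT hc] with ε hε
    have : (c - ε) ^ 2 - a ≤ 0 := by nlinarith [hε.1, hε.2]
    rw [Real.sqrt_eq_zero_of_nonpos this, zero_pow hr, sub_zero, mul_zero]
  · have h1 : HasDerivAt (fun e => √(e ^ 2 - a) ^ r)
        (r * √(c ^ 2 - a) ^ (r - 1) * ((2 * c) / (2 * √(c ^ 2 - a)))) c := by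
      have h2 : HasDerivAt (fun e : ℝ => e ^ 2 - a) (2 * c) c := by
        simpa using (hasDerivAt_pow 2 c).sub_const a
      exact (h2.sqrt h.ne').pow r
    have h2 := hasDerivAt_iff_tendsto_slope.1 h1
    have h3 : Filter.Tendsto (fun ε => c - ε) (𝓝[>] (0 : ℝ)) (𝓝[≠] c) := by
      refine tendsto_nhdsWithin_iff.2 ⟨?_, ?_⟩
      · have : Filter.Tendsto (fun ε => c - ε) (𝓝 (0 : ℝ)) (𝓝 (c - 0)) :=
          (continuous_const.sub continuous_id).tendsto 0
        rw [sub_zero] at this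
        exact this.mono_left nhdsWithin_le_nhds
      · filter_upwards [self_mem_nhdsWithin] with ε hε
        simp only [mem_Ioi] at hε
        simp [hε.ne']
    have h4 : r * √(c ^ 2 - a) ^ (r - 1) * ((2 * c) / (2 * √(c ^ 2 - a))) =
        r * c * √(c ^ 2 - a) ^ r / (c ^ 2 - a) := by
      obtain ⟨k, rfl⟩ := Nat.exists_eq_succ_of_ne_zero hr
      have h5 := Real.sqrt_pos.2 h
      conv_rhs => rw [← Real.sq_sqrt h.le]
      rw [Real.sqrt_sq h5.le, Nat.succ_sub_one, pow_succ]
      field_simp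
      exact (pow_succ _ _).symm
    rw [← h4]
    refine (h2.comp h3).congr fun ε => ?_
    simp only [Function.comp_apply, slope, vsub_eq_sub, smul_eq_mul]
    rw [show c - ε - c = -ε by ring, inv_neg]
    ring

/-- The difference quotients are bounded by twice their limit, uniformly in `a`, even where the limit is
unbounded because `r = 1`. -/
theorem quotient_sqrt_pow_le {r : ℕ} (hr : r ≠ 0) {a c ε : ℝ} (hε : 0 < ε) (hεc : ε < c) :
    ε⁻¹ * (√(c ^ 2 - a) ^ r - √((c - ε) ^ 2 - a) ^ r) ≤
      2 * (r * c * √(c ^ 2 - a) ^ r / (c ^ 2 - a)) := by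
  rcases le_or_gt (c ^ 2 - a) 0 with h | h
  · have : (c - ε) ^ 2 - a ≤ 0 := by nlinarith
    rw [Real.sqrt_eq_zero_of_nonpos h, Real.sqrt_eq_zero_of_nonpos this, zero_pow hr]
    simp
  · obtain ⟨k, rfl⟩ := Nat.exists_eq_succ_of_ne_zero hr
    set S := √(c ^ 2 - a) with hS
    set T := √((c - ε) ^ 2 - a) with hT
    have hS0 : 0 < S := Real.sqrt_pos.2 h
    have hT0 : 0 ≤ T := Real.sqrt_nonneg _
    have hTS : T ≤ S := Real.sqrt_le_sqrt (by nlinarith)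
    have hS2 : S ^ 2 = c ^ 2 - a := Real.sq_sqrt h.le
    have hT2 : (c - ε) ^ 2 - a ≤ T ^ 2 := by
      rcases le_or_gt ((c - ε) ^ 2 - a) 0 with h' | h'
      · exact h'.trans (sq_nonneg T)
      · exact (Real.sq_sqrt h'.le).ge
    have h1 : S ^ (k + 1) - T ^ (k + 1) ≤ (k + 1) * S ^ k * (S - T) := by
      have h := Commute.mul_geom_sum₂ (Commute.all S T) (k + 1)
      rw [← h, mul_comm]
      refine mul_le_mul_of_nonneg_right ?_ (sub_nonneg.2 hTS)
      refine (Finset.sum_le_card_nsmul _ _ (S ^ k) fun i hi => ?_).trans ?_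
      · rw [Finset.mem_range] at hi
        calc S ^ i * T ^ (k + 1 - 1 - i) ≤ S ^ i * S ^ (k + 1 - 1 - i) := by gcongr
          _ = S ^ k := by rw [← pow_add]; congr 1; omega
      · simp
    have h2 : (S - T) * S ≤ 2 * c * ε := by nlinarith
    have h3 : ε⁻¹ * (S ^ (k + 1) - T ^ (k + 1)) ≤ ε⁻¹ * ((k + 1) * S ^ k * (2 * c * ε / S)) := by
      refine mul_le_mul_of_nonneg_left (h1.trans ?_) (by positivity)
      refine mul_le_mul_of_nonneg_left ?_ (by positivity)
      rwa [le_div_iff₀ hS0]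
    refine h3.trans (le_of_eq ?_)
    rw [← hS2]
    rw [Nat.succ_eq_add_one]
    push_cast
    field_simp
    ring

/-! ### The Liouville measure in a chart of space -/

/-- If functions converge pointwise, dominated by a multiple of their limit, and their integrals
converge to a finite number, then this number is the integral of the limit: it is finite by Fatou's
lemma, and then convergence is dominated. -/
theorem lintegral_eq_of_tendsto_of_le_mul {α : Type*} [MeasurableSpace α] {μ : Measure α}
    {Q : ℕ → α → ℝ≥0∞} {γ : α → ℝ≥0∞} {C Γ : ℝ≥0∞} (hQ : ∀ n, AEMeasurable (Q n) μ)
    (hlim : ∀ᵐ x ∂μ, Filter.Tendsto (fun n => Q n x) Filter.atTop (𝓝 (γ x)))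
    (hC : C ≠ ⊤) (hle : ∀ n, ∀ᵐ x ∂μ, Q n x ≤ C * γ x) (hΓ : Γ ≠ ⊤)
    (hint : Filter.Tendsto (fun n => ∫⁻ x, Q n x ∂μ) Filter.atTop (𝓝 Γ)) :
    ∫⁻ x, γ x ∂μ = Γ := by
  have h1 : ∫⁻ x, γ x ∂μ ≤ Γ := by
    calc ∫⁻ x, γ x ∂μ = ∫⁻ x, Filter.liminf (fun n => Q n x) Filter.atTop ∂μ :=
          lintegral_congr_ae (hlim.mono fun x hx => hx.liminf_eq.symm)
      _ ≤ Filter.liminf (fun n => ∫⁻ x, Q n x ∂μ) Filter.atTop := lintegral_liminf_le' hQ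
      _ = Γ := hint.liminf_eq
  have h2 : ∫⁻ x, C * γ x ∂μ ≠ ⊤ := by
    rw [lintegral_const_mul' _ _ hC]
    exact ENNReal.mul_ne_top hC (ne_top_of_le_ne_top hΓ h1)
  exact tendsto_nhds_unique
    (tendsto_lintegral_of_dominated_convergence' _ hQ hle h2 hlim) hint

/-- Points of a compact set where a function is close to its maximal value are close to the points
where it takes this value. -/
theorem exists_pos_forall_mem_of_isCompact {α : Type*} [TopologicalSpace α] {K V : Set α}
    (hK : IsCompact K) (hV : IsOpen V) {f : α → ℝ} (hf : ContinuousOn f K) {c : ℝ}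
    (hle : ∀ w ∈ K, f w ≤ c) (hc : ∀ w ∈ K, f w = c → w ∈ V) :
    ∃ ε > 0, ∀ w ∈ K, c - ε ≤ f w → w ∈ V := by
  rcases (K \ V).eq_empty_or_nonempty with h | h
  · exact ⟨1, one_pos, fun w hw _ => by
      by_contra hV'
      exact (h ▸ (⟨hw, hV'⟩ : w ∈ K \ V) : w ∈ (∅ : Set α))⟩
  · obtain ⟨w₀, hw₀, hmax⟩ := (hK.diff hV).exists_isMaxOn h (hf.mono sdiff_subset)
    have h1 : f w₀ < c := (hle w₀ hw₀.1).lt_of_ne fun h => hw₀.2 (hc w₀ hw₀.1 h)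
    refine ⟨(c - f w₀) / 2, by linarith, fun w hw hwε => ?_⟩
    by_contra hV'
    have := hmax (⟨hw, hV'⟩ : w ∈ K \ V)
    simp only [mem_ofPred_eq] at this
    linarith

theorem setLIntegral_eq_of_subset {α : Type*} [MeasurableSpace α] {μ : Measure α} {s t : Set α}
    {f : α → ℝ≥0∞} (hs : MeasurableSet s)
    (ht : MeasurableSet t) (hts : s ⊆ t) (h : ∀ x ∈ t \ s, f x = 0) :
    ∫⁻ x in s, f x ∂μ = ∫⁻ x in t, f x ∂μ := by
  rw [← lintegral_inter_add_sdiff f t hs, inter_eq_self_of_subset_right hts,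
    setLIntegral_congr_fun (ht.diff hs) h]
  simp

/-- The convergence of layer averages for nonnegative densities, in terms of extended nonnegative
integrals. -/
theorem Straightening.tendsto_lintegral_layer {k : ℕ} {f : (Fin (k + 1) → ℝ) → ℝ}
    (q : Straightening f) {g : (Fin (k + 1) → ℝ) → ℝ} (hg : Continuous g)
    (hgc : HasCompactSupport g) (hgs : tsupport g ⊆ q.source) (hg0 : ∀ w, 0 ≤ g w) (c : ℝ) :
    Filter.Tendsto (fun ε => ENNReal.ofReal ε⁻¹ *
      ∫⁻ w in {w | w ∈ q.source ∧ f w ∈ Ioc (c - ε) c}, ENNReal.ofReal (g w)) (𝓝[>] 0)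
      (𝓝 (∫⁻ y' in {y' | (Fin.cons c y' : Fin (k + 1) → ℝ) ∈ q.target},
        ENNReal.ofReal (q.jac (Fin.cons c y')) * ENNReal.ofReal (g (q.symm (Fin.cons c y'))))) ∧
    ∫⁻ y' in {y' | (Fin.cons c y' : Fin (k + 1) → ℝ) ∈ q.target},
        ENNReal.ofReal (q.jac (Fin.cons c y')) * ENNReal.ofReal (g (q.symm (Fin.cons c y'))) ≠ ⊤ := by
  have hj : ∀ y, 0 ≤ q.jac y := fun y => abs_nonneg _
  have h1 : ∫⁻ y' in {y' | (Fin.cons c y' : Fin (k + 1) → ℝ) ∈ q.target},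
        ENNReal.ofReal (q.jac (Fin.cons c y')) * ENNReal.ofReal (g (q.symm (Fin.cons c y'))) =
      ENNReal.ofReal (∫ y' in {y' | (Fin.cons c y' : Fin (k + 1) → ℝ) ∈ q.target},
        q.jac (Fin.cons c y') * g (q.symm (Fin.cons c y'))) := by
    rw [ofReal_integral_eq_lintegral_ofReal (q.integrableOn_slice hg hgc hgs c)
      (Filter.Eventually.of_forall fun y' => mul_nonneg (hj _) (hg0 _))]
    exact lintegral_congr fun y' => (ENNReal.ofReal_mul (hj _)).symm
  rw [h1]
  refine ⟨?_, ENNReal.ofReal_ne_top⟩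
  refine (ENNReal.tendsto_ofReal (q.tendsto_layer hg hgc hgs c)).congr' ?_
  filter_upwards [self_mem_nhdsWithin] with ε hε
  simp only [mem_Ioi] at hε
  rw [ENNReal.ofReal_mul (by positivity), ofReal_integral_eq_lintegral_ofReal
    (hg.integrable_of_hasCompactSupport hgc).integrableOn (Filter.Eventually.of_forall hg0)]

theorem LocalData.continuousOn_det_gram {r : ℕ} (A : LocalData (EuclideanSpace ℝ (Fin r))) :
    ContinuousOn (fun x => (gram (A.h x)).det) A.domain := by
  refine Continuous.comp_continuousOn (g := Matrix.det) (Continuous.matrix_det continuous_id) ?_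
  refine continuousOn_pi.2 fun i => continuousOn_pi.2 fun j => ?_
  exact (A.smooth_h.continuousOn.clm_apply continuousOn_const).clm_apply continuousOn_const

namespace StationaryData

section ChartLayer

variable {d : ℕ} {Sig : Type*} [TopologicalSpace Sig]
  [ChartedSpace (EuclideanSpace ℝ (Fin (d + 1))) Sig] [IsManifold (𝓡 (d + 1)) ∞ Sig]
  (D : StationaryData (d + 1) Sig)

/-- Near a compact part of a regular level set of the energy, there are finitely many systems of
coordinates in which the energy is a coordinate. -/
theorem exists_straightening_cover {m ν : ℝ} (hm : 0 < m)
    (hreg : IsRegularValueOn D.metric 1 energy ν) {a : Sig} {K : Set (Fin (2 * d + 1 + 1) → ℝ)}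
    (hK : IsCompact K) (hKd : K ⊆ phaseDomain a) (hKE : ∀ w ∈ K, D.chartEnergy m a w = ν * m) :
    ∃ (n : ℕ) (q : Fin n → Straightening (D.chartEnergy m a)),
      (∀ i, (q i).source ⊆ phaseDomain a) ∧ K ⊆ ⋃ i, (q i).source := by
  have h : ∀ w ∈ K, ∃ q : Straightening (D.chartEnergy m a), w ∈ q.source ∧
      q.source ⊆ phaseDomain a := fun w hw =>
    exists_straightening (isOpen_phaseDomain a) (D.contDiffOn_chartEnergy hm.ne' a) (hKd hw)
      (D.fderiv_chartEnergy_ne_zero hreg hm (hKd hw) (hKE w hw))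
  choose q hq1 hq2 using h
  obtain ⟨t, ht⟩ := hK.elim_nhds_subcover' (fun w hw => (q w hw).source)
    fun w hw => (q w hw).open_source.mem_nhds (hq1 w hw)
  refine ⟨t.card, fun i => q _ (t.equivFin.symm i).1.2, fun i => hq2 _ _, fun w hw => ?_⟩
  obtain ⟨w', hw', hww'⟩ := mem_iUnion₂.1 (ht hw)
  refine mem_iUnion.2 ⟨t.equivFin ⟨w', hw'⟩, ?_⟩
  simp only [Equiv.symm_apply_apply]
  exact hww'

theorem isCompact_chartEnergy_le (m : ℝ) (a : Sig) {C : Set (EuclideanSpace ℝ (Fin (d + 1)))}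
    (hC : IsCompact C) (hCs : C ⊆ (chartAt (EuclideanSpace ℝ (Fin (d + 1))) a).target) (c : ℝ) :
    IsCompact {w | (phaseEquiv d w).1 ∈ C ∧ D.chartEnergy m a w ≤ c} := by
  have h := (phaseEquiv d).toHomeomorph.isCompact_preimage.2
    ((D.localData a).isCompact_sublevel m hC hCs c)
  exact h

theorem measurableSet_layer {m : ℝ} (hm : m ≠ 0) (a : Sig) (c₁ c₂ : ℝ) :
    MeasurableSet {w | w ∈ phaseDomain a ∧ D.chartEnergy m a w ∈ Ioc c₁ c₂} := by
  have h := fun c => ((D.contDiffOn_chartEnergy hm a).continuousOn.isOpen_inter_preimage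
    (isOpen_phaseDomain a) (isOpen_Ioi (a := c))).measurableSet
  convert (h c₁).diff (h c₂) using 1
  ext w
  simp only [mem_ofPred_eq, mem_Ioc, mem_sdiff, mem_inter_iff, mem_preimage, mem_Ioi, not_and,
    not_lt]
  tauto

variable [CompactSpace Sig] [T2Space Sig]

theorem measurableSet_levelSet (m c : ℝ) : MeasurableSet (levelSet D.metric m energy c) := by
  have : levelSet D.metric m energy c = D.geodesicEnergy ⁻¹' {c} := by
    ext z
    exact D.mem_levelSet_iff
  rw [this]
  exact (isClosed_singleton.preimage D.continuous_geodesicEnergy).measurableSet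

variable {ψ : EuclideanSpace ℝ (Fin (d + 1)) → ℝ} (hψ : Continuous ψ) (hψc : HasCompactSupport ψ)
  {a : Sig} (hψs : tsupport ψ ⊆ (chartAt (EuclideanSpace ℝ (Fin (d + 1))) a).target)
  (hψ0 : ∀ x, 0 ≤ ψ x)

include hψ hψc hψs hψ0 in
/-- The Liouville measure as a limit of averages over thin layers of phase space. -/
theorem tendsto_lintegral_layer {m ν : ℝ} (hm : 0 < m)
    (hreg : IsRegularValueOn D.metric 1 energy ν) :
    Filter.Tendsto (fun ε => ENNReal.ofReal ε⁻¹ *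
      ∫⁻ w in {w | w ∈ phaseDomain a ∧ D.chartEnergy m a w ∈ Ioc (ν * m - ε) (ν * m)},
        ENNReal.ofReal (ψ (phaseEquiv d w).1)) (𝓝[>] 0)
      (𝓝 (∫⁻ z in D.chartSet m a ∩ levelSet D.metric m energy (ν * m),
        ENNReal.ofReal (ψ (phaseEquiv d (D.coord a z)).1)
          ∂(liouvilleMeasure D.metric m energy (2 * d + 1) (ν * m)))) ∧
    ∫⁻ z in D.chartSet m a ∩ levelSet D.metric m energy (ν * m),
        ENNReal.ofReal (ψ (phaseEquiv d (D.coord a z)).1)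
          ∂(liouvilleMeasure D.metric m energy (2 * d + 1) (ν * m)) ≠ ⊤ := by
  set c := ν * m with hc
  set μ := liouvilleMeasure D.metric m energy (2 * d + 1) c with hμ
  set p : (Fin (2 * d + 1 + 1) → ℝ) → ℝ := fun w => ψ (phaseEquiv d w).1 with hp
  have hpc : Continuous p := hψ.comp (continuous_fst.comp (phaseEquiv d).continuous)
  have hp0 : ∀ w, 0 ≤ p w := fun w => hψ0 _
  have hEc := (D.contDiffOn_chartEnergy hm.ne' a).continuousOn
  set K : Set (Fin (2 * d + 1 + 1) → ℝ) :=
    {w | (phaseEquiv d w).1 ∈ tsupport ψ ∧ D.chartEnergy m a w ≤ c} with hKdef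
  have hK : IsCompact K := D.isCompact_chartEnergy_le m a hψc.isCompact hψs c
  have hKd : K ⊆ phaseDomain a := fun w hw => hψs hw.1
  have hpK : ∀ w, D.chartEnergy m a w ≤ c → w ∉ K → p w = 0 := fun w h1 h2 =>
    image_eq_zero_of_notMem_tsupport (f := ψ) fun h => h2 ⟨h, h1⟩
  have hclosed : ∀ s : Set ℝ, IsClosed s → IsCompact (K ∩ D.chartEnergy m a ⁻¹' s) := fun s hs =>
    hK.of_isClosed_subset ((hEc.mono hKd).preimage_isClosed_of_isClosed hK.isClosed hs)
      inter_subset_left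
  have hKE := hclosed {c} isClosed_singleton
  set KE := K ∩ D.chartEnergy m a ⁻¹' {c} with hKEdef
  obtain ⟨n, q, hq, hcov⟩ := D.exists_straightening_cover hm hreg hKE
    (fun w hw => hKd hw.1) fun w hw => hw.2
  obtain ⟨ε₀, hε₀, hlayer⟩ := exists_pos_forall_mem_of_isCompact hK
    (isOpen_iUnion fun i => (q i).open_source) (hEc.mono hKd) (fun w hw => hw.2)
    fun w hw h => hcov ⟨hw, h⟩
  -- a partition of unity on a whole layer, subordinate to the straightened coordinates
  obtain ⟨χ, hχs, hχ1, hχ01, hχc⟩ := exists_continuous_sum_one_of_isOpen_isCompact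
    (fun i => (q i).open_source) (hclosed _ (isClosed_Ici (a := c - ε₀)))
    fun w hw => hlayer w hw.1 hw.2
  set g : Fin n → (Fin (2 * d + 1 + 1) → ℝ) → ℝ := fun i w => p w * χ i w with hg
  have hgc : ∀ i, Continuous (g i) := fun i => hpc.mul (χ i).continuous
  have hgcs : ∀ i, HasCompactSupport (g i) := fun i => (hχc i).mul_left
  have hgs : ∀ i, tsupport (g i) ⊆ (q i).source := fun i =>
    (tsupport_mul_subset_right).trans (hχs i)
  have hg0 : ∀ i w, 0 ≤ g i w := fun i w => mul_nonneg (hp0 w) (hχ01 i w).1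
  have hgz : ∀ i w, w ∉ (q i).source → g i w = 0 := fun i w hw =>
    image_eq_zero_of_notMem_tsupport fun h => hw (hgs i h)
  have hsum : ∀ w, c - ε₀ ≤ D.chartEnergy m a w → D.chartEnergy m a w ≤ c →
      ∑ i, ENNReal.ofReal (g i w) = ENNReal.ofReal (p w) := by
    intro w h1 h2
    rw [← ENNReal.ofReal_sum_of_nonneg fun i _ => hg0 i w]
    congr 1
    rw [hg, ← Finset.mul_sum]
    by_cases hw : w ∈ K
    · have := hχ1 (⟨hw, h1⟩ : w ∈ K ∩ D.chartEnergy m a ⁻¹' (Ici (c - ε₀)))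
      rw [Finset.sum_apply] at this
      rw [this, Pi.one_apply, mul_one]
    · rw [hpK w h2 hw, zero_mul]
  have hlim := fun i => (q i).tendsto_lintegral_layer (hgc i) (hgcs i) (hgs i) (hg0 i) c
  -- the Liouville measure through the partition of unity
  set G : Fin n → (Fin (2 * d + 1 + 1) → ℝ) → ℝ≥0∞ := fun i =>
    KE.indicator fun w => ENNReal.ofReal (g i w) with hG
  have hGm : ∀ i, Measurable (G i) := fun i =>
    (ENNReal.measurable_ofReal.comp (hgc i).measurable).indicator hKE.measurableSet
  have hGg : ∀ i w, D.chartEnergy m a w = c → G i w = ENNReal.ofReal (g i w) := by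
    intro i w hw
    by_cases h : w ∈ K
    · have : w ∈ KE := ⟨h, hw⟩
      simp only [hG, indicator_of_mem this]
    · have : w ∉ KE := fun h' => h h'.1
      rw [hG]
      simp only [indicator_of_notMem this, hg, hpK w hw.le h, zero_mul, ENNReal.ofReal_zero]
  have hlevel := D.measurableSet_levelSet m c
  have hcs := (D.isOpen_chartSet hm.ne' a).measurableSet
  have h1 : ∀ i, ∫⁻ y' in {y' | (Fin.cons c y' : Fin (2 * d + 1 + 1) → ℝ) ∈ (q i).target},
      ENNReal.ofReal ((q i).jac (Fin.cons c y')) *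
        ENNReal.ofReal (g i ((q i).symm (Fin.cons c y'))) =
      ∫⁻ z in D.chartSet m a, G i (D.coord a z) ∂μ := by
    intro i
    have e1 : ∫⁻ z in D.chartSet m a, G i (D.coord a z) ∂μ =
        ∫⁻ z in D.patchSet m (q i), G i (D.coord a z) ∂μ := by
      refine (setLIntegral_eq_of_subset (D.isOpen_patchSet hm.ne' (q i)).measurableSet hcs
        (fun z hz => hz.1) ?_).symm
      rintro z ⟨hz, hz'⟩
      have : D.coord a z ∉ (q i).source := fun h => hz' ⟨hz, h⟩
      simp only [hG, indicator, hgz i _ this, ENNReal.ofReal_zero, ite_self]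
    rw [e1, D.lintegral_patchSet hm.ne' (q i) (hq i) c (hGm i)]
    refine setLIntegral_congr_fun ((q i).measurableSet_slice c) fun y' hy' => ?_
    rw [hGg i _ (((q i).f_symm hy').trans (Fin.cons_zero _ _))]
  have h2 : ∫⁻ z in D.chartSet m a ∩ levelSet D.metric m energy c,
      ENNReal.ofReal (p (D.coord a z)) ∂μ =
      ∑ i, ∫⁻ z in D.chartSet m a, G i (D.coord a z) ∂μ := by
    rw [← lintegral_finsetSum']
    · rw [inter_comm, ← Measure.restrict_restrict hlevel, ← lintegral_indicator hlevel]
      refine setLIntegral_congr_fun hcs fun z hz => ?_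
      have hE := D.chartEnergy_coord hm.ne' hz
      by_cases hzl : z ∈ levelSet D.metric m energy c
      · rw [D.mem_levelSet_iff.1 hzl] at hE
        simp only [indicator_of_mem hzl, hGg _ _ hE]
        exact (hsum _ (by linarith) hE.le).symm
      · have h3 : D.coord a z ∉ KE := fun h => hzl (D.mem_levelSet_iff.2 (hE ▸ h.2))
        simp only [indicator_of_notMem hzl, hG, indicator_of_notMem h3, Finset.sum_const_zero]
    · exact fun i _ => (hGm i).comp_aemeasurable ((D.continuousOn_coord hm.ne' a).aemeasurable hcs)
  change Filter.Tendsto _ _ (𝓝 (∫⁻ z in D.chartSet m a ∩ levelSet D.metric m energy c,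
      ENNReal.ofReal (p (D.coord a z)) ∂μ)) ∧ ∫⁻ z in D.chartSet m a ∩ levelSet D.metric m energy c,
      ENNReal.ofReal (p (D.coord a z)) ∂μ ≠ ⊤
  rw [h2]
  simp only [← h1]
  refine ⟨?_, (ENNReal.sum_lt_top.2 fun i _ => (hlim i).2.lt_top).ne⟩
  refine (tendsto_finsetSum _ fun i _ => (hlim i).1).congr' ?_
  filter_upwards [Ioo_mem_nhdsGT hε₀] with ε hε
  rw [← Finset.mul_sum]
  congr 1
  have hLm := D.measurableSet_layer hm.ne' a (c - ε) c
  have h3 : ∀ i, ∫⁻ w in {w | w ∈ (q i).source ∧ D.chartEnergy m a w ∈ Ioc (c - ε) c},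
      ENNReal.ofReal (g i w) =
      ∫⁻ w in {w | w ∈ phaseDomain a ∧ D.chartEnergy m a w ∈ Ioc (c - ε) c},
        ENNReal.ofReal (g i w) := by
    intro i
    have hm1 : MeasurableSet {w | w ∈ (q i).source ∧ D.chartEnergy m a w ∈ Ioc (c - ε) c} := by
      convert (q i).open_source.measurableSet.inter hLm using 1
      ext w
      exact ⟨fun h => ⟨h.1, hq i h.1, h.2⟩, fun h => ⟨h.1, h.2.2⟩⟩
    refine setLIntegral_eq_of_subset hm1 hLm
      (fun w hw => ⟨hq i hw.1, hw.2⟩) ?_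
    rintro w ⟨hw, hw'⟩
    rw [hgz i w fun h => hw' ⟨h, hw.2⟩, ENNReal.ofReal_zero]
  simp only [h3]
  rw [← lintegral_finsetSum' _ fun i _ =>
    (hgc i).measurable.ennreal_ofReal.aemeasurable]
  exact setLIntegral_congr_fun hLm fun w hw => hsum w (by linarith [hw.2.1, hε.2]) hw.2.2

/-- The density, in a chart of space and up to the volume of the unit ball, of the measure on the
base induced by the Liouville measure of the level set `{p_Z = c}`. -/
def layerDensity (m : ℝ) (a : Sig) (c : ℝ) (x : EuclideanSpace ℝ (Fin (d + 1))) : ℝ :=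
  (D.localData a).N x * √(gram ((D.localData a).h x)).det /
    √((D.localData a).normSq x) ^ (d + 1 + 1) *
    ((d + 1 : ℕ) * c * √(c ^ 2 - m ^ 2 * (D.localData a).normSq x) ^ (d + 1) /
      (c ^ 2 - m ^ 2 * (D.localData a).normSq x))

omit [CompactSpace Sig] [T2Space Sig] in
include hψ hψs hψ0 in
/-- The integral over a thin layer of phase space, by integrating over the momenta first. -/
theorem lintegral_layer {m : ℝ} (hm : 0 < m) {c ε : ℝ} (hε : 0 < ε) (hεc : ε < c) :
    ENNReal.ofReal ε⁻¹ *
      ∫⁻ w in {w | w ∈ phaseDomain a ∧ D.chartEnergy m a w ∈ Ioc (c - ε) c},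
        ENNReal.ofReal (ψ (phaseEquiv d w).1) =
    ∫⁻ x in (chartAt (EuclideanSpace ℝ (Fin (d + 1))) a).target,
      ENNReal.ofReal (ψ x * ((D.localData a).N x * √(gram ((D.localData a).h x)).det /
          √((D.localData a).normSq x) ^ (d + 1 + 1) *
        (ε⁻¹ * (√(c ^ 2 - m ^ 2 * (D.localData a).normSq x) ^ (d + 1) -
          √((c - ε) ^ 2 - m ^ 2 * (D.localData a).normSq x) ^ (d + 1))))) *
        volume (Metric.ball (0 : EuclideanSpace ℝ (Fin (d + 1))) 1) := by
  set A := D.localData a with hA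
  have hLm := D.measurableSet_layer hm.ne' a (c - ε) c
  set f : EuclideanSpace ℝ (Fin (d + 1)) × (EuclideanSpace ℝ (Fin (d + 1)) →L[ℝ] ℝ) → ℝ≥0∞ :=
    {w | w.1 ∈ A.domain ∧ A.H m w ∈ Ioc (c - ε) c}.indicator fun w => ENNReal.ofReal (ψ w.1) with hf
  have hfe : (fun w => f (phaseEquiv d w)) =
      {w | w ∈ phaseDomain a ∧ D.chartEnergy m a w ∈ Ioc (c - ε) c}.indicator
        fun w => ENNReal.ofReal (ψ (phaseEquiv d w).1) := rfl
  have hpc : Continuous fun w => ψ (phaseEquiv d w).1 :=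
    hψ.comp (continuous_fst.comp (phaseEquiv d).continuous)
  have hfm : Measurable fun w => f (phaseEquiv d w) := by
    rw [hfe]
    exact hpc.measurable.ennreal_ofReal.indicator hLm
  have hdom : MeasurableSet (chartAt (EuclideanSpace ℝ (Fin (d + 1))) a).target :=
    (chartAt (EuclideanSpace ℝ (Fin (d + 1))) a).open_target.measurableSet
  rw [← lintegral_indicator hLm, ← hfe, lintegral_phaseEquiv hfm,
    ← lintegral_const_mul' _ _ ENNReal.ofReal_ne_top, ← lintegral_indicator hdom]
  refine lintegral_congr fun x => ?_
  by_cases hx : x ∈ (chartAt (EuclideanSpace ℝ (Fin (d + 1))) a).target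
  · have hs := A.symm x hx
    have hp := A.pos x hx
    have hN := A.N_pos x hx
    have hβ := A.timelike x hx
    have hF : 0 < A.normSq x := A.normSq_pos hx
    set R : ℝ := A.N x * √(gram (A.h x)).det / √(A.normSq x) ^ (d + 1 + 1) with hR
    have hR0 : 0 ≤ R := by positivity
    have hV := fun e (he : 0 < e) => volume_energyOf_le hs hp hN hβ hm.ne' he
    -- the momenta in the layer over `x` form a difference of two ellipsoids
    have e1 : ∀ v, f (x, InnerProductSpace.toDual ℝ (EuclideanSpace ℝ (Fin (d + 1))) v) =
        ({v | energyOf (A.h x) (A.N x) (A.β x) m (InnerProductSpace.toDual ℝ _ v) ≤ c} \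
          {v | energyOf (A.h x) (A.N x) (A.β x) m (InnerProductSpace.toDual ℝ _ v) ≤ c - ε}
          ).indicator (fun _ => ENNReal.ofReal (ψ x)) v := by
      intro v
      by_cases hv : A.H m (x, InnerProductSpace.toDual ℝ (EuclideanSpace ℝ (Fin (d + 1))) v) ∈
          Ioc (c - ε) c
      · rw [indicator_of_mem, hf, indicator_of_mem]
        · exact ⟨hx, hv⟩
        · exact ⟨hv.2, not_le.2 hv.1⟩
      · rw [indicator_of_notMem, hf, indicator_of_notMem]
        · exact fun h => hv h.2
        · exact fun h => hv ⟨not_le.1 h.2, h.1⟩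
    have hcl : ∀ e, MeasurableSet {v : EuclideanSpace ℝ (Fin (d + 1)) |
        energyOf (A.h x) (A.N x) (A.β x) m (InnerProductSpace.toDual ℝ _ v) ≤ e} := by
      intro e
      have : Continuous fun v : EuclideanSpace ℝ (Fin (d + 1)) =>
          A.H m (x, InnerProductSpace.toDual ℝ _ v) :=
        (A.continuousOn_H m).comp_continuous
          (continuous_const.prodMk (InnerProductSpace.toDual ℝ _).continuous) fun v => hx
      exact (isClosed_le this continuous_const).measurableSet
    have hball : volume (Metric.ball (0 : EuclideanSpace ℝ (Fin (d + 1))) 1) ≠ ⊤ :=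
      measure_ball_lt_top.ne
    have hsub : {v : EuclideanSpace ℝ (Fin (d + 1)) |
        energyOf (A.h x) (A.N x) (A.β x) m (InnerProductSpace.toDual ℝ _ v) ≤ c - ε} ⊆
        {v : EuclideanSpace ℝ (Fin (d + 1)) |
        energyOf (A.h x) (A.N x) (A.β x) m (InnerProductSpace.toDual ℝ _ v) ≤ c} := by
      intro v hv
      rw [mem_ofPred_eq] at hv ⊢
      linarith
    rw [indicator_of_mem hx, lintegral_congr e1,
      lintegral_indicator_const ((hcl c).diff (hcl (c - ε))),
      measure_sdiff hsub (hcl _).nullMeasurableSet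
        (by rw [hV _ (by linarith)]; exact ENNReal.mul_ne_top ENNReal.ofReal_ne_top hball),
      hV c (by linarith), hV (c - ε) (by linarith), ← ENNReal.sub_mul fun _ _ => hball,
      ← ENNReal.ofReal_sub _ (by positivity)]
    rw [← mul_assoc, ← mul_assoc, ← ENNReal.ofReal_mul (by positivity),
      ← ENNReal.ofReal_mul (mul_nonneg (by positivity) (hψ0 x))]
    congr 2
    change ε⁻¹ * ψ x * (R * √(c ^ 2 - m ^ 2 * A.normSq x) ^ (d + 1) -
      R * √((c - ε) ^ 2 - m ^ 2 * A.normSq x) ^ (d + 1)) = _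
    ring
  · rw [indicator_of_notMem hx]
    have : ∀ v, f (x, InnerProductSpace.toDual ℝ _ v) = 0 := fun v =>
      indicator_of_notMem (fun h => hx h.1) _
    simp only [this, lintegral_zero, mul_zero]

include hψ hψc hψs hψ0 in
/-- The Liouville measure of the level set in a chart of space. -/
theorem lintegral_chartSet {m ν : ℝ} (hm : 0 < m) (hν : 0 < ν)
    (hreg : IsRegularValueOn D.metric 1 energy ν) :
    ∫⁻ z in D.chartSet m a ∩ levelSet D.metric m energy (ν * m),
        ENNReal.ofReal (ψ (phaseEquiv d (D.coord a z)).1)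
          ∂(liouvilleMeasure D.metric m energy (2 * d + 1) (ν * m)) =
      ∫⁻ x in (chartAt (EuclideanSpace ℝ (Fin (d + 1))) a).target,
        ENNReal.ofReal (ψ x * D.layerDensity m a (ν * m) x) *
          volume (Metric.ball (0 : EuclideanSpace ℝ (Fin (d + 1))) 1) ∧
    ∫⁻ z in D.chartSet m a ∩ levelSet D.metric m energy (ν * m),
        ENNReal.ofReal (ψ (phaseEquiv d (D.coord a z)).1)
          ∂(liouvilleMeasure D.metric m energy (2 * d + 1) (ν * m)) ≠ ⊤ := by
  obtain ⟨h1, h2⟩ := D.tendsto_lintegral_layer hψ hψc hψs hψ0 hm hreg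
  refine ⟨?_, h2⟩
  have hc : 0 < ν * m := by positivity
  set c := ν * m with hcdef
  set A := D.localData a with hA
  have hdom : MeasurableSet (chartAt (EuclideanSpace ℝ (Fin (d + 1))) a).target :=
    (chartAt (EuclideanSpace ℝ (Fin (d + 1))) a).open_target.measurableSet
  -- a sequence of positive numbers less than `c` which converges to zero
  set u : ℕ → ℝ := fun n => c / (n + 2) with hu
  have hu0 : ∀ n, 0 < u n := fun n => by positivity
  have huc : ∀ n, u n < c := fun n => by
    rw [hu, div_lt_iff₀ (by positivity)]
    nlinarith [(Nat.cast_nonneg n : (0 : ℝ) ≤ n)]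
  have hulim : Filter.Tendsto u Filter.atTop (𝓝[>] 0) := by
    refine tendsto_nhdsWithin_iff.2 ⟨?_, Filter.Eventually.of_forall hu0⟩
    exact tendsto_const_nhds.div_atTop
      (Filter.tendsto_atTop_add_const_right _ 2 tendsto_natCast_atTop_atTop)
  set R : EuclideanSpace ℝ (Fin (d + 1)) → ℝ := fun x =>
    A.N x * √(gram (A.h x)).det / √(A.normSq x) ^ (d + 1 + 1) with hR
  set Q : EuclideanSpace ℝ (Fin (d + 1)) → ℝ → ℝ := fun x ε =>
    ε⁻¹ * (√(c ^ 2 - m ^ 2 * A.normSq x) ^ (d + 1) -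
      √((c - ε) ^ 2 - m ^ 2 * A.normSq x) ^ (d + 1)) with hQ
  have hR0 : ∀ x ∈ A.domain, 0 ≤ R x := by
    intro x hx
    have := A.N_pos x hx
    positivity
  have hNc : ContinuousOn A.N A.domain := A.smooth_N.continuousOn
  have hgc := A.continuousOn_det_gram
  have hFc : ContinuousOn A.normSq A.domain :=
    (hNc.pow 2).sub ((A.smooth_h.continuousOn.clm_apply A.smooth_β.continuousOn).clm_apply
      A.smooth_β.continuousOn)
  have hRc : ContinuousOn R A.domain :=
    (hNc.mul hgc.sqrt).div (hFc.sqrt.pow _) fun x hx =>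
      pow_ne_zero _ (Real.sqrt_pos.2 (A.normSq_pos hx)).ne'
  have hQc : ∀ ε, ContinuousOn (fun x => Q x ε) A.domain := fun ε =>
    continuousOn_const.mul (((continuousOn_const.sub (continuousOn_const.mul hFc)).sqrt.pow _).sub
      ((continuousOn_const.sub (continuousOn_const.mul hFc)).sqrt.pow _))
  refine (lintegral_eq_of_tendsto_of_le_mul (C := 2)
    (Q := fun n x => ENNReal.ofReal (ψ x * (R x * Q x (u n))) *
      volume (Metric.ball (0 : EuclideanSpace ℝ (Fin (d + 1))) 1))
    (fun n => ?_) ?_ ENNReal.ofNat_ne_top (fun n => ?_) h2 ?_).symm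
  · exact (((hψ.continuousOn.mul (hRc.mul (hQc (u n)))).aemeasurable hdom).ennreal_ofReal).mul_const _
  · refine Filter.Eventually.of_forall fun x => ?_
    refine ENNReal.Tendsto.mul_const (ENNReal.tendsto_ofReal ?_) (Or.inr measure_ball_lt_top.ne)
    refine Filter.Tendsto.const_mul _ (Filter.Tendsto.const_mul _ ?_)
    exact (tendsto_quotient_sqrt_pow (Nat.succ_ne_zero d) hc).comp hulim
  · refine (ae_restrict_iff' hdom).2 (Filter.Eventually.of_forall fun x hx => ?_)
    have e2 : (2 : ℝ≥0∞) * (ENNReal.ofReal (ψ x * D.layerDensity m a c x) *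
        volume (Metric.ball (0 : EuclideanSpace ℝ (Fin (d + 1))) 1)) =
        ENNReal.ofReal (2 * (ψ x * D.layerDensity m a c x)) *
          volume (Metric.ball (0 : EuclideanSpace ℝ (Fin (d + 1))) 1) := by
      rw [← mul_assoc, ENNReal.ofReal_mul zero_le_two, ENNReal.ofReal_ofNat]
    rw [e2]
    refine mul_le_mul' (ENNReal.ofReal_le_ofReal ?_) le_rfl
    have h3 : Q x (u n) ≤ _ := quotient_sqrt_pow_le (Nat.succ_ne_zero d) (hu0 n) (huc n)
    calc ψ x * (R x * Q x (u n)) ≤ ψ x * (R x * _) :=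
          mul_le_mul_of_nonneg_left (mul_le_mul_of_nonneg_left h3 (hR0 x hx)) (hψ0 x)
      _ = _ := by
        rw [show D.layerDensity m a c x = R x * ((d + 1 : ℕ) * c *
          √(c ^ 2 - m ^ 2 * A.normSq x) ^ (d + 1) / (c ^ 2 - m ^ 2 * A.normSq x)) from rfl]
        exact (by intros; ring : ∀ u v w : ℝ, u * (v * (2 * w)) = 2 * (u * (v * w))) _ _ _
  · refine (h1.comp hulim).congr fun n => ?_
    exact D.lintegral_layer hψ hψs hψ0 hm (hu0 n) (huc n)

end ChartLayer

end StationaryData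

/-! ### The Riemannian volume in a chart -/

/-- The determinant of a bilinear form under a linear change of variables. -/
theorem det_gram_bilinearComp {r : ℕ}
    (b : EuclideanSpace ℝ (Fin r) →L[ℝ] EuclideanSpace ℝ (Fin r) →L[ℝ] ℝ)
    (T : EuclideanSpace ℝ (Fin r) →L[ℝ] EuclideanSpace ℝ (Fin r)) :
    (gram (b.bilinearComp T T)).det = T.det ^ 2 * (gram b).det := by
  set B := (EuclideanSpace.basisFun (Fin r) ℝ).toBasis with hB
  set M := LinearMap.toMatrix B B (T : EuclideanSpace ℝ (Fin r) →ₗ[ℝ] EuclideanSpace ℝ (Fin r)) with hM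
  have h1 : ∀ i k, M k i = T (EuclideanSpace.single i 1) k := by
    intro i k
    rw [hM, LinearMap.toMatrix_apply]
    simp [hB]
  have h2 : gram (b.bilinearComp T T) = M.transpose * gram b * M := by
    ext i j
    rw [gram, Matrix.of_apply, ContinuousLinearMap.bilinearComp_apply, apply_eq_gram,
      Matrix.mul_assoc, Matrix.mul_apply]
    refine Finset.sum_congr rfl fun k _ => ?_
    rw [Matrix.transpose_apply, h1, Matrix.mul_apply]
    simp only [h1, Matrix.mulVec, dotProduct]
  rw [h2, Matrix.det_mul, Matrix.det_mul, Matrix.det_transpose, hM, LinearMap.det_toMatrix,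
    ContinuousLinearMap.det]
  ring

namespace StationaryData

section RiemannianVolume

variable {r : ℕ} {Sig : Type*} [TopologicalSpace Sig]
  [ChartedSpace (EuclideanSpace ℝ (Fin r)) Sig] [IsManifold (𝓡 r) ∞ Sig]
  (D : StationaryData r Sig)

/-- The change of the density of the Riemannian volume under a change of charts. -/
theorem chartDensity_transition {e e' : OpenPartialHomeomorph Sig (EuclideanSpace ℝ (Fin r))}
    (he : e ∈ atlas (EuclideanSpace ℝ (Fin r)) Sig)
    (he' : e' ∈ atlas (EuclideanSpace ℝ (Fin r)) Sig) {y : EuclideanSpace ℝ (Fin r)}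
    (hy : y ∈ e.target) (hy' : e.symm y ∈ e'.source) :
    ∃ L : EuclideanSpace ℝ (Fin r) →L[ℝ] EuclideanSpace ℝ (Fin r),
      HasFDerivAt (e' ∘ e.symm) L y ∧
        D.chartDensity e y = |L.det| * D.chartDensity e' (e' (e.symm y)) := by
  have hmax := IsManifold.subset_maximalAtlas (I := 𝓡 r) (n := ∞) he
  have hmax' := IsManifold.subset_maximalAtlas (I := 𝓡 r) (n := ∞) he'
  have h1 : MDifferentiableAt (𝓡 r) (𝓡 r) e.symm y :=
    ((contMDiffOn_symm_of_mem_maximalAtlas hmax).contMDiffAt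
      (e.open_target.mem_nhds hy)).mdifferentiableAt (by simp)
  have h2 : MDifferentiableAt (𝓡 r) (𝓡 r) e' (e.symm y) :=
    ((contMDiffOn_of_mem_maximalAtlas hmax').contMDiffAt
      (e'.open_source.mem_nhds hy')).mdifferentiableAt (by simp)
  have h3 : MDifferentiableAt (𝓡 r) (𝓡 r) e'.symm (e' (e.symm y)) :=
    ((contMDiffOn_symm_of_mem_maximalAtlas hmax').contMDiffAt
      (e'.open_target.mem_nhds (e'.map_source hy'))).mdifferentiableAt (by simp)
  have h4 := HasMFDerivAt.comp y h2.hasMFDerivAt h1.hasMFDerivAt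
  set L : EuclideanSpace ℝ (Fin r) →L[ℝ] EuclideanSpace ℝ (Fin r) :=
    (mfderiv (𝓡 r) (𝓡 r) e' (e.symm y)).comp (mfderiv (𝓡 r) (𝓡 r) e.symm y) with hL
  refine ⟨L, hasMFDerivAt_iff_hasFDerivAt.1 h4, ?_⟩
  -- the frames of the two charts differ by the derivative of the transition map
  have h5 : mfderiv (𝓡 r) (𝓡 r) e.symm y =
      (mfderiv (𝓡 r) (𝓡 r) e'.symm (e' (e.symm y))).comp L := by
    have h6 := HasMFDerivAt.comp y h3.hasMFDerivAt h4
    refine (HasMFDerivAt.congr_of_eventuallyEq h6 ?_).mfderiv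
    filter_upwards [(e.continuousAt_symm hy).eventually (e'.open_source.mem_nhds hy')] with y' h
    exact (e'.left_inv h).symm
  set b : EuclideanSpace ℝ (Fin r) →L[ℝ] EuclideanSpace ℝ (Fin r) →L[ℝ] ℝ :=
    ContinuousLinearMap.bilinearComp (E := EuclideanSpace ℝ (Fin r))
      (F := EuclideanSpace ℝ (Fin r)) (D.h.inner (e.symm y))
      (mfderiv (𝓡 r) (𝓡 r) e'.symm (e' (e.symm y)))
      (mfderiv (𝓡 r) (𝓡 r) e'.symm (e' (e.symm y))) with hb
  have h7 : D.chartDensity e y = √(gram (b.bilinearComp L L)).det := by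
    rw [chartDensity, h5]
    rfl
  have h8 : D.chartDensity e' (e' (e.symm y)) = √(gram b).det := by
    rw [chartDensity, e'.left_inv hy']
    rfl
  rw [h7, h8, det_gram_bilinearComp, Real.sqrt_mul (sq_nonneg _), Real.sqrt_sq_eq_abs]

variable [MeasurableSpace Sig] [BorelSpace Sig]

/-- The measure with density `√(det h_ij)` in a chart, as a measure on the manifold. -/
def chartVolume (e : OpenPartialHomeomorph Sig (EuclideanSpace ℝ (Fin r))) : Measure Sig :=
  (((volume : Measure (EuclideanSpace ℝ (Fin r))).restrict e.target).withDensity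
      (fun y => ENNReal.ofReal (D.chartDensity e y))).map e.symm

theorem aemeasurable_symm (e : OpenPartialHomeomorph Sig (EuclideanSpace ℝ (Fin r))) :
    AEMeasurable e.symm (((volume : Measure (EuclideanSpace ℝ (Fin r))).restrict
      e.target).withDensity (fun y => ENNReal.ofReal (D.chartDensity e y))) :=
  (e.continuousOn_symm.aemeasurable e.open_target.measurableSet).mono_ac
    (withDensity_absolutelyContinuous _ _)

theorem chartVolume_apply (e : OpenPartialHomeomorph Sig (EuclideanSpace ℝ (Fin r)))
    {B : Set Sig} (hB : MeasurableSet B) : D.chartVolume e B =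
      ∫⁻ y in e.symm ⁻¹' B ∩ e.target, ENNReal.ofReal (D.chartDensity e y) := by
  rw [chartVolume, Measure.map_apply_of_aemeasurable (D.aemeasurable_symm e) hB,
    withDensity_apply', Measure.restrict_restrict' e.open_target.measurableSet]

omit [IsManifold (𝓡 r) ∞ Sig] in
theorem measurableSet_preimage_symm (e : OpenPartialHomeomorph Sig (EuclideanSpace ℝ (Fin r)))
    {B : Set Sig} (hB : MeasurableSet B) : MeasurableSet (e.symm ⁻¹' B ∩ e.target) := by
  have h1 : Measurable (e.target.domRestrict e.symm) :=
    (continuousOn_iff_continuous_domRestrict.1 e.continuousOn_symm).measurable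
  have h2 := e.open_target.measurableSet.subtype_image (h1 hB)
  convert h2 using 1
  ext y
  constructor
  · rintro ⟨h, h'⟩
    exact ⟨⟨y, h'⟩, h, rfl⟩
  · rintro ⟨⟨y, h'⟩, h, rfl⟩
    exact ⟨h, h'⟩

/-- On the domain of a chart, no other chart sees more volume than this chart. -/
theorem chartVolume_le {e e' : OpenPartialHomeomorph Sig (EuclideanSpace ℝ (Fin r))}
    (he : e ∈ atlas (EuclideanSpace ℝ (Fin r)) Sig)
    (he' : e' ∈ atlas (EuclideanSpace ℝ (Fin r)) Sig) {B : Set Sig} (hB : MeasurableSet B)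
    (hBe : B ⊆ e.source) : D.chartVolume e' B ≤ D.chartVolume e B := by
  rw [D.chartVolume_apply e hB, D.chartVolume_apply e' hB]
  set W := e.symm ⁻¹' (B ∩ e'.source) ∩ e.target with hW
  have hWm : MeasurableSet W :=
    measurableSet_preimage_symm e (hB.inter e'.open_source.measurableSet)
  have hder : ∀ y ∈ W, ∃ L : EuclideanSpace ℝ (Fin r) →L[ℝ] EuclideanSpace ℝ (Fin r),
      HasFDerivAt (e' ∘ e.symm) L y ∧
        D.chartDensity e y = |L.det| * D.chartDensity e' (e' (e.symm y)) := fun y hy =>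
    D.chartDensity_transition he he' hy.2 hy.1.2
  choose! L hL hdens using hder
  have hinj : InjOn (e' ∘ e.symm) W := fun y hy y' hy' h =>
    e.symm.injOn hy.2 hy'.2 (e'.injOn hy.1.2 hy'.1.2 h)
  have himg : (e' ∘ e.symm) '' W = e'.symm ⁻¹' B ∩ e'.target := by
    ext y'
    constructor
    · rintro ⟨y, ⟨⟨h1, h2⟩, h3⟩, rfl⟩
      refine ⟨?_, e'.map_source h2⟩
      rw [mem_preimage, Function.comp_apply, e'.left_inv h2]
      exact h1
    · rintro ⟨h1, h2⟩
      have h3 := hBe h1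
      refine ⟨e (e'.symm y'), ⟨?_, e.map_source h3⟩, ?_⟩
      · rw [mem_preimage, e.left_inv h3]
        exact ⟨h1, e'.map_target h2⟩
      · rw [Function.comp_apply, e.left_inv h3, e'.right_inv h2]
  calc ∫⁻ y in e'.symm ⁻¹' B ∩ e'.target, ENNReal.ofReal (D.chartDensity e' y)
      = ∫⁻ y in W, ENNReal.ofReal |(L y).det| *
          ENNReal.ofReal (D.chartDensity e' ((e' ∘ e.symm) y)) := by
        rw [← himg]
        exact lintegral_image_eq_lintegral_abs_det_fderiv_mul volume hWm
          (fun y hy => (hL y hy).hasFDerivWithinAt) hinj _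
    _ = ∫⁻ y in W, ENNReal.ofReal (D.chartDensity e y) := by
        refine setLIntegral_congr_fun hWm fun y hy => ?_
        rw [hdens y hy, ENNReal.ofReal_mul (abs_nonneg _)]
        rfl
    _ ≤ ∫⁻ y in e.symm ⁻¹' B ∩ e.target, ENNReal.ofReal (D.chartDensity e y) :=
        lintegral_mono_set fun y hy => ⟨hy.1.1, hy.2⟩

/-- On the domain of a chart, the supremum over all charts which defines the Riemannian volume is
attained by this chart. -/
theorem riemannianVolume_restrict {e : OpenPartialHomeomorph Sig (EuclideanSpace ℝ (Fin r))}
    (he : e ∈ atlas (EuclideanSpace ℝ (Fin r)) Sig) :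
    D.riemannianVolume.restrict e.source = D.chartVolume e := by
  have hW := e.open_source.measurableSet
  refine Measure.ext fun B hB => ?_
  have h1 : D.riemannianVolume = ⨆ e : atlas (EuclideanSpace ℝ (Fin r)) Sig, D.chartVolume e.1 := by
    rw [riemannianVolume, iSup_subtype']
    rfl
  rw [Measure.restrict_apply hB, h1, iSup_measure_apply_of_le hW (⟨e, he⟩ :
    atlas (EuclideanSpace ℝ (Fin r)) Sig) (fun e' A hA hAW => D.chartVolume_le he e'.2 hA hAW)
      (hB.inter hW) inter_subset_right, D.chartVolume_apply e hB,
    D.chartVolume_apply e (hB.inter hW)]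
  congr 2
  ext y
  exact ⟨fun h => ⟨h.1.1, h.2⟩, fun h => ⟨⟨h.1, e.map_target h.2⟩, h.2⟩⟩

/-- Integration with respect to the Riemannian volume in the domain of a chart. -/
theorem lintegral_riemannianVolume (a : Sig) {f : Sig → ℝ≥0∞} (hf : Measurable f) :
    ∫⁻ x in (chartAt (EuclideanSpace ℝ (Fin r)) a).source, f x ∂D.riemannianVolume =
      ∫⁻ y in (chartAt (EuclideanSpace ℝ (Fin r)) a).target,
        ENNReal.ofReal (√(gram ((D.localData a).h y)).det) *
          f ((chartAt (EuclideanSpace ℝ (Fin r)) a).symm y) := by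
  set e := chartAt (EuclideanSpace ℝ (Fin r)) a with he
  have hd : AEMeasurable (fun y => ENNReal.ofReal (D.chartDensity e y))
      ((volume : Measure (EuclideanSpace ℝ (Fin r))).restrict e.target) :=
    (((D.localData a).continuousOn_det_gram).sqrt.aemeasurable e.open_target.measurableSet).ennreal_ofReal
  rw [D.riemannianVolume_restrict (chart_mem_atlas _ a), chartVolume,
    lintegral_map' hf.aemeasurable (D.aemeasurable_symm e)]
  refine (lintegral_withDensity_eq_lintegral_mul₀' hd
    (hf.comp_aemeasurable (D.aemeasurable_symm e))).trans ?_
  rfl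

end RiemannianVolume

end StationaryData

/-! ### Integration over the base -/

section Transport

variable {X Y : Type*} [TopologicalSpace X] [TopologicalSpace Y] [T2Space Y]
  (e : OpenPartialHomeomorph X Y) {χ : X → ℝ} (hχ : Continuous χ) (hχc : HasCompactSupport χ)
  (hχs : tsupport χ ⊆ e.source)

/-- The function `χ` in the coordinates `e`, extended by zero. -/
def transport (χ : X → ℝ) : Y → ℝ := e.target.indicator fun y => χ (e.symm y)

include hχc hχs in
theorem isCompact_image_tsupport : IsCompact (e '' tsupport χ) :=
  hχc.isCompact.image_of_continuousOn (e.continuousOn.mono hχs)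

include hχc hχs in
theorem tsupport_transport_subset : tsupport (transport e χ) ⊆ e '' tsupport χ := by
  refine closure_minimal (fun y hy => ?_) (isCompact_image_tsupport e hχc hχs).isClosed
  have hyt : y ∈ e.target := by
    by_contra h
    exact hy (indicator_of_notMem h _)
  refine ⟨e.symm y, subset_tsupport χ fun h => hy ?_, e.right_inv hyt⟩
  rw [transport, indicator_of_mem hyt, h]

include hχc hχs in
theorem tsupport_transport_subset_target : tsupport (transport e χ) ⊆ e.target := by
  refine (tsupport_transport_subset e hχc hχs).trans ?_
  rintro _ ⟨x, hx, rfl⟩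
  exact e.map_source (hχs hx)

include hχc hχs in
theorem hasCompactSupport_transport : HasCompactSupport (transport e χ) :=
  (isCompact_image_tsupport e hχc hχs).of_isClosed_subset (isClosed_tsupport _)
    (tsupport_transport_subset e hχc hχs)

include hχ hχc hχs in
theorem continuous_transport : Continuous (transport e χ) := by
  refine continuous_of_tsupport fun y hy => ?_
  have hyt := tsupport_transport_subset_target e hχc hχs hy
  refine ((hχ.continuousAt.comp (e.continuousAt_symm hyt))).congr ?_
  filter_upwards [e.open_target.mem_nhds hyt] with y' hy'
  rw [transport, indicator_of_mem hy', Function.comp_apply]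

end Transport

namespace StationaryData

section Base

variable {d : ℕ} {Sig : Type*} [TopologicalSpace Sig]
  [ChartedSpace (EuclideanSpace ℝ (Fin (d + 1))) Sig] [IsManifold (𝓡 (d + 1)) ∞ Sig]
  (D : StationaryData (d + 1) Sig)

/-- The density with respect to the Riemannian volume, up to the volume of the unit ball, of the
measure on the base induced by the Liouville measure of the level set `{p_Z = c}`. -/
def baseDensity (m c : ℝ) (x : Sig) : ℝ :=
  D.N x / √(D.normSq x) ^ (d + 1 + 1) *
    ((d + 1 : ℕ) * c * √(c ^ 2 - m ^ 2 * D.normSq x) ^ (d + 1) / (c ^ 2 - m ^ 2 * D.normSq x))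

theorem layerDensity_eq (m : ℝ) {a : Sig} (c : ℝ) {y : EuclideanSpace ℝ (Fin (d + 1))}
    (hy : y ∈ (chartAt (EuclideanSpace ℝ (Fin (d + 1))) a).target) :
    D.layerDensity m a c y = √(gram ((D.localData a).h y)).det *
      D.baseDensity m c ((chartAt (EuclideanSpace ℝ (Fin (d + 1))) a).symm y) := by
  rw [layerDensity, baseDensity, D.localData_normSq hy]
  change D.N ((chartAt (EuclideanSpace ℝ (Fin (d + 1))) a).symm y) * _ / _ * _ = _
  ring

theorem normSq_pos (x : Sig) : 0 < D.normSq x := by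
  have := D.timelike x
  rw [normSq]
  linarith

theorem continuous_normSq : Continuous D.normSq := by
  rw [continuous_iff_continuousAt]
  intro a
  set e := chartAt (EuclideanSpace ℝ (Fin (d + 1))) a with he
  have ha : a ∈ e.source := mem_chart_source _ a
  set A := D.localData a with hA
  have hc : ContinuousOn A.normSq A.domain :=
    (A.smooth_N.continuousOn.pow 2).sub
      ((A.smooth_h.continuousOn.clm_apply A.smooth_β.continuousOn).clm_apply
        A.smooth_β.continuousOn)
  have h1 : ContinuousAt (A.normSq ∘ e) a :=
    ContinuousAt.comp (hc.continuousAt (e.open_target.mem_nhds (e.map_source ha)))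
      (e.continuousAt ha)
  refine h1.congr ?_
  filter_upwards [e.open_source.mem_nhds ha] with x hx
  rw [Function.comp_apply, D.localData_normSq (e.map_source hx), e.left_inv hx]

/-- The integrand of the volume formula. -/
def volumeDensity (ν : ℝ) (x : Sig) : ℝ :=
  D.N x * ν / D.normSq x ^ (((d : ℝ) + 2) / 2) * (ν ^ 2 - D.normSq x) ^ (((d : ℝ) - 1) / 2)

/-- In the classically allowed region, the density depends on the mass only through a power. -/
theorem baseDensity_of_lt {m ν : ℝ} (hm : 0 < m) {x : Sig} (hx : 0 < ν ^ 2 - D.normSq x) :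
    D.baseDensity m (ν * m) x = (d + 1 : ℕ) * m ^ d * D.volumeDensity ν x := by
  have hF := D.normSq_pos x
  set G := ν ^ 2 - D.normSq x with hG
  have e1 : (ν * m) ^ 2 - m ^ 2 * D.normSq x = m ^ 2 * G := by rw [hG]; ring
  have e2 : √(m ^ 2 * G) = m * √G := by
    rw [Real.sqrt_mul (sq_nonneg m), Real.sqrt_sq hm.le]
  have e3 : ∀ (y : ℝ) (k : ℕ), 0 ≤ y → √y ^ k = y ^ ((k : ℝ) / 2) := by
    intro y k hy
    rw [Real.sqrt_eq_rpow, ← Real.rpow_natCast, ← Real.rpow_mul hy]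
    congr 1
    ring
  have e4 : G ^ (((d : ℝ) - 1) / 2) = √G ^ (d + 1) / G := by
    rw [e3 _ _ hx.le, ← Real.rpow_sub_one hx.ne']
    congr 1
    push_cast
    ring
  have e5 : D.normSq x ^ (((d : ℝ) + 2) / 2) = √(D.normSq x) ^ (d + 1 + 1) := by
    rw [e3 _ _ hF.le]
    congr 1
    push_cast
    ring
  rw [baseDensity, volumeDensity, e1, e2, ← hG, e4, e5, mul_pow]
  have h6 : √(D.normSq x) ^ (d + 1 + 1) ≠ 0 := pow_ne_zero _ (Real.sqrt_pos.2 hF).ne'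
  field_simp
  ring

/-- In the classically forbidden region, the root in the density is that of a nonpositive number. -/
theorem baseDensity_of_le {m ν : ℝ} {x : Sig} (hx : ν ^ 2 - D.normSq x ≤ 0) :
    D.baseDensity m (ν * m) x = 0 := by
  have e1 : (ν * m) ^ 2 - m ^ 2 * D.normSq x = m ^ 2 * (ν ^ 2 - D.normSq x) := by ring
  rw [baseDensity, e1, Real.sqrt_eq_zero_of_nonpos
    (mul_nonpos_of_nonneg_of_nonpos (sq_nonneg m) hx), zero_pow d.succ_ne_zero]
  simp

theorem volumeDensity_nonneg {ν : ℝ} (hν : 0 < ν) {x : Sig} (hx : 0 < ν ^ 2 - D.normSq x) :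
    0 ≤ D.volumeDensity ν x := by
  have := D.normSq_pos x
  have := D.N_pos x
  rw [volumeDensity]
  positivity

theorem isOpen_volumeDomain (ν : ℝ) : IsOpen {x | 0 < ν ^ 2 - D.normSq x} :=
  isOpen_lt continuous_const (continuous_const.sub D.continuous_normSq)

theorem continuousOn_volumeDensity (ν : ℝ) :
    ContinuousOn (D.volumeDensity ν) {x | 0 < ν ^ 2 - D.normSq x} :=
  ((D.smooth_N.continuous.continuousOn.mul continuousOn_const).div
    (D.continuous_normSq.continuousOn.rpow_const fun x _ => Or.inl (D.normSq_pos x).ne')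
      fun x _ => (Real.rpow_pos_of_pos (D.normSq_pos x) _).ne').mul
    ((continuous_const.sub D.continuous_normSq).continuousOn.rpow_const fun _ hx =>
      Or.inl (ne_of_gt hx))

variable [CompactSpace Sig] [T2Space Sig]

theorem position_coord {m : ℝ} {a : Sig} {z : MassiveGeodesics D.metric m}
    (hz : z ∈ D.chartSet m a) : (phaseEquiv d (D.coord a z)).1 =
      chartAt (EuclideanSpace ℝ (Fin (d + 1))) a (D.pt z).proj.2 := by
  rw [coord, phase, ContinuousLinearEquiv.apply_symm_apply, cot_apply hz.2]
  rfl

variable [MeasurableSpace Sig] [BorelSpace Sig]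

theorem measurable_baseDensity (m c : ℝ) : Measurable (D.baseDensity m c) := by
  have h1 := D.continuous_normSq.measurable
  have h2 := D.smooth_N.continuous.measurable
  unfold baseDensity
  fun_prop

/-- The Liouville measure of a part of the level set which is cut out by a function on the base
supported in a chart. -/
theorem lintegral_levelSet {m ν : ℝ} (hm : 0 < m) (hν : 0 < ν)
    (hreg : IsRegularValueOn D.metric 1 energy ν) {a : Sig} {χ : Sig → ℝ} (hχ : Continuous χ)
    (hχ0 : ∀ x, 0 ≤ χ x)
    (hχs : tsupport χ ⊆ (chartAt (EuclideanSpace ℝ (Fin (d + 1))) a).source) :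
    ∫⁻ z in levelSet D.metric m energy (ν * m), ENNReal.ofReal (χ (D.pt z).proj.2)
        ∂(liouvilleMeasure D.metric m energy (2 * d + 1) (ν * m)) =
      ∫⁻ x, ENNReal.ofReal (χ x) * (ENNReal.ofReal (D.baseDensity m (ν * m) x) *
        volume (Metric.ball (0 : EuclideanSpace ℝ (Fin (d + 1))) 1)) ∂D.riemannianVolume ∧
    ∫⁻ z in levelSet D.metric m energy (ν * m), ENNReal.ofReal (χ (D.pt z).proj.2)
        ∂(liouvilleMeasure D.metric m energy (2 * d + 1) (ν * m)) ≠ ⊤ := by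
  set e := chartAt (EuclideanSpace ℝ (Fin (d + 1))) a with he
  have hχc : HasCompactSupport χ := HasCompactSupport.of_compactSpace χ
  have hψ0 : ∀ y, 0 ≤ transport e χ y := fun y => indicator_nonneg (fun y _ => hχ0 _) y
  have hχz : ∀ x, x ∉ e.source → χ x = 0 := fun x hx =>
    image_eq_zero_of_notMem_tsupport fun h => hx (hχs h)
  obtain ⟨h1, h2⟩ := D.lintegral_chartSet (continuous_transport e hχ hχc hχs)
    (hasCompactSupport_transport e hχc hχs) (tsupport_transport_subset_target e hχc hχs) hψ0 hm hν
    hreg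
  have hlevel := D.measurableSet_levelSet m (ν * m)
  have hset := (D.isOpen_chartSet hm.ne' a).measurableSet.inter hlevel
  have h3 : ∫⁻ z in levelSet D.metric m energy (ν * m), ENNReal.ofReal (χ (D.pt z).proj.2)
        ∂(liouvilleMeasure D.metric m energy (2 * d + 1) (ν * m)) =
      ∫⁻ z in D.chartSet m a ∩ levelSet D.metric m energy (ν * m),
        ENNReal.ofReal (transport e χ (phaseEquiv d (D.coord a z)).1)
          ∂(liouvilleMeasure D.metric m energy (2 * d + 1) (ν * m)) := by
    rw [← setLIntegral_eq_of_subset hset hlevel inter_subset_right]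
    · refine setLIntegral_congr_fun hset fun z hz => ?_
      rw [D.position_coord hz.1, transport, indicator_of_mem (e.map_source hz.1.2),
        e.left_inv hz.1.2]
    · rintro z ⟨hz, hz'⟩
      have h : (D.pt z).proj.2 ∉ e.source := fun h => hz' ⟨⟨by
        rw [D.mem_levelSet_iff.1 hz]; positivity, h⟩, hz⟩
      rw [hχz _ h, ENNReal.ofReal_zero]
  rw [h3]
  refine ⟨h1.trans ?_, h2⟩
  have hmeas : Measurable fun x => ENNReal.ofReal (χ x) *
      (ENNReal.ofReal (D.baseDensity m (ν * m) x) *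
        volume (Metric.ball (0 : EuclideanSpace ℝ (Fin (d + 1))) 1)) :=
    hχ.measurable.ennreal_ofReal.mul
      ((D.measurable_baseDensity m (ν * m)).ennreal_ofReal.mul_const _)
  rw [← setLIntegral_univ (μ := D.riemannianVolume), ← setLIntegral_eq_of_subset
    e.open_source.measurableSet MeasurableSet.univ (subset_univ _), D.lintegral_riemannianVolume a hmeas]
  · refine setLIntegral_congr_fun e.open_target.measurableSet fun y hy => ?_
    rw [D.layerDensity_eq m _ hy, transport, indicator_of_mem hy, ENNReal.ofReal_mul (hχ0 _),
      ENNReal.ofReal_mul (Real.sqrt_nonneg _)]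
    ring
  · rintro x ⟨-, hx⟩
    rw [hχz x hx, ENNReal.ofReal_zero, zero_mul]

/-- The volume of the level set, and its finiteness, by summing the contributions of charts over a
partition of unity. -/
theorem liouvilleMeasure_levelSet {m ν : ℝ} (hm : 0 < m) (hν : 0 < ν)
    (hreg : IsRegularValueOn D.metric 1 energy ν) :
    liouvilleMeasure D.metric m energy (2 * d + 1) (ν * m) (levelSet D.metric m energy (ν * m)) =
      ENNReal.ofReal (m ^ d) * (ENNReal.ofReal (sphereArea (d + 1)) *
        ∫⁻ x in {x | 0 < ν ^ 2 - D.normSq x}, ENNReal.ofReal (D.volumeDensity ν x)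
          ∂D.riemannianVolume) ∧
    liouvilleMeasure D.metric m energy (2 * d + 1) (ν * m)
      (levelSet D.metric m energy (ν * m)) ≠ ⊤ := by
  -- a finite partition of unity subordinate to charts
  obtain ⟨t, ht⟩ := isCompact_univ.elim_nhds_subcover
    (fun a : Sig => (chartAt (EuclideanSpace ℝ (Fin (d + 1))) a).source)
    fun a _ => (chartAt _ a).open_source.mem_nhds (mem_chart_source _ a)
  have hcov : (univ : Set Sig) ⊆ ⋃ i : Fin t.card,
      (chartAt (EuclideanSpace ℝ (Fin (d + 1))) (t.equivFin.symm i).1).source := by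
    intro x hx
    obtain ⟨a, ha, hxa⟩ := mem_iUnion₂.1 (ht.2 hx)
    refine mem_iUnion.2 ⟨t.equivFin ⟨a, ha⟩, ?_⟩
    rw [Equiv.symm_apply_apply]
    exact hxa
  obtain ⟨χ, hχs, hχ1, hχ01, -⟩ := exists_continuous_sum_one_of_isOpen_isCompact
    (fun i : Fin t.card =>
      (chartAt (EuclideanSpace ℝ (Fin (d + 1))) (t.equivFin.symm i).1).open_source)
    isCompact_univ hcov
  have hsum : ∀ x : Sig, ∑ i, ENNReal.ofReal (χ i x) = 1 := by
    intro x
    rw [← ENNReal.ofReal_sum_of_nonneg fun i _ => (hχ01 i x).1, ← Finset.sum_apply, hχ1 (mem_univ x)]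
    exact ENNReal.ofReal_one
  have hloc := fun i => D.lintegral_levelSet hm hν hreg (χ i).continuous (fun x => (hχ01 i x).1)
    (hχs i)
  set μ := liouvilleMeasure D.metric m energy (2 * d + 1) (ν * m) with hμ
  have hlevel := D.measurableSet_levelSet m (ν * m)
  -- all of the level set consists of geodesics of positive energy, which meet time zero
  have hpos : levelSet D.metric m energy (ν * m) ⊆ {z | 0 < D.geodesicEnergy z} := by
    intro z hz
    rw [mem_ofPred_eq, D.mem_levelSet_iff.1 hz]
    positivity
  have h1 : μ (levelSet D.metric m energy (ν * m)) =
      ∑ i, ∫⁻ z in levelSet D.metric m energy (ν * m),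
        ENNReal.ofReal (χ i (D.pt z).proj.2) ∂μ := by
    rw [← lintegral_finsetSum' _ fun i _ => ?_]
    · simp only [hsum, setLIntegral_one]
    · have hc : ContinuousOn (fun z => χ i (D.pt z).proj.2) (levelSet D.metric m energy (ν * m)) :=
        (χ i).continuous.comp_continuousOn (continuous_snd.comp_continuousOn
          ((FiberBundle.continuous_proj _ _).comp_continuousOn
            ((D.continuousOn_pt hm.ne').mono hpos)))
      exact (hc.aemeasurable hlevel).ennreal_ofReal
  refine ⟨?_, by rw [h1]; exact (ENNReal.sum_lt_top.2 fun i _ => (hloc i).2.lt_top).ne⟩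
  set b := volume (Metric.ball (0 : EuclideanSpace ℝ (Fin (d + 1))) 1) with hb
  have hbm : Measurable fun x => ENNReal.ofReal (D.baseDensity m (ν * m) x) * b :=
    (D.measurable_baseDensity m (ν * m)).ennreal_ofReal.mul_const _
  have hS := (D.isOpen_volumeDomain ν).measurableSet
  rw [h1, Finset.sum_congr rfl fun i _ => (hloc i).1, ← lintegral_finsetSum]
  · simp only [← Finset.sum_mul, hsum, one_mul]
    rw [← setLIntegral_univ (μ := D.riemannianVolume), ← setLIntegral_eq_of_subset hS
      MeasurableSet.univ (subset_univ _), ← mul_assoc, ← lintegral_const_mul']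
    · refine setLIntegral_congr_fun hS fun x hx => ?_
      rw [D.baseDensity_of_lt hm hx, ofReal_sphereArea, ENNReal.ofReal_mul (by positivity),
        ENNReal.ofReal_mul (by positivity), ENNReal.ofReal_natCast]
      ring
    · exact ENNReal.mul_ne_top ENNReal.ofReal_ne_top ENNReal.ofReal_ne_top
    · rintro x ⟨-, hx⟩
      rw [D.baseDensity_of_le (not_lt.1 hx), ENNReal.ofReal_zero, zero_mul]
  · exact fun i _ => (χ i).continuous.measurable.ennreal_ofReal.mul hbm

/-- The volume integral is finite because the Liouville measure of the level set is. -/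
theorem integrableOn_volumeDensity {ν : ℝ} (hν : 0 < ν)
    (hreg : IsRegularValueOn D.metric 1 energy ν) :
    IntegrableOn (D.volumeDensity ν) {x | 0 < ν ^ 2 - D.normSq x} D.riemannianVolume := by
  have hS := (D.isOpen_volumeDomain ν).measurableSet
  obtain ⟨h1, h2⟩ := D.liouvilleMeasure_levelSet one_pos hν hreg
  refine ⟨(D.continuousOn_volumeDensity ν).aestronglyMeasurable hS, ?_⟩
  rw [hasFiniteIntegral_iff_ofReal ((ae_restrict_iff' hS).2
    (Filter.Eventually.of_forall fun x hx => D.volumeDensity_nonneg hν hx)), lt_top_iff_ne_top]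
  intro h
  refine h2 ?_
  rw [h1, h, one_pow, ENNReal.ofReal_one, one_mul, ENNReal.mul_top]
  exact (ENNReal.ofReal_pos.2 (sphereArea_pos (d + 1))).ne'

end Base

end StationaryData

end StationaryLadder

end

open StationaryLadder
theorem mainTheorem7 (d : ℕ) (Sig : Type*) [TopologicalSpace Sig]
    [ChartedSpace (EuclideanSpace ℝ (Fin (d + 1))) Sig] [IsManifold (𝓡 (d + 1)) ∞ Sig]
    [CompactSpace Sig] [T2Space Sig] [MeasurableSpace Sig] [BorelSpace Sig]
    (D : StationaryData (d + 1) Sig) (m ν : ℝ) (hm : 0 < m) (hν : 0 < ν)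
    (hreg : IsRegularValueOn D.metric 1 StationaryData.energy ν) :
    IntegrableOn (fun x => D.N x * ν / D.normSq x ^ (((d : ℝ) + 2) / 2) *
      (ν ^ 2 - D.normSq x) ^ (((d : ℝ) - 1) / 2)) {x | 0 < ν ^ 2 - D.normSq x}
      D.riemannianVolume ∧
    liouvilleMeasure D.metric m StationaryData.energy (2 * d + 1) (ν * m)
        (levelSet D.metric m StationaryData.energy (ν * m)) =
      ENNReal.ofReal (m ^ d) *
        liouvilleMeasure D.metric 1 StationaryData.energy (2 * d + 1) ν
          (levelSet D.metric 1 StationaryData.energy ν) ∧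
    liouvilleMeasure D.metric 1 StationaryData.energy (2 * d + 1) ν
        (levelSet D.metric 1 StationaryData.energy ν) =
      ENNReal.ofReal (sphereArea (d + 1) *
        ∫ x in {x | 0 < ν ^ 2 - D.normSq x},
          D.N x * ν / D.normSq x ^ (((d : ℝ) + 2) / 2) *
            (ν ^ 2 - D.normSq x) ^ (((d : ℝ) - 1) / 2) ∂D.riemannianVolume) := by
  have hint := D.integrableOn_volumeDensity hν hreg
  have h1 := (D.liouvilleMeasure_levelSet one_pos hν hreg).1
  rw [mul_one, one_pow, ENNReal.ofReal_one, one_mul] at h1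
  have hS := (D.isOpen_volumeDomain ν).measurableSet
  refine ⟨hint, ?_, ?_⟩
  · rw [h1]
    exact (D.liouvilleMeasure_levelSet hm hν hreg).1
  · rw [h1, ENNReal.ofReal_mul (sphereArea_pos (d + 1)).le,
      ← ofReal_integral_eq_lintegral_ofReal hint ((ae_restrict_iff' hS).2
        (Filter.Eventually.of_forall fun x hx => D.volumeDensity_nonneg hν hx))]
    rfl
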